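/- Let $(M,F)$ be a connected $n$-dimensional Finsler manifold: $F:TM\to\mathbb R$ is continuous, $C^\infty$ off the zero section, positive there, absolutely homogeneous ($F(x,\lambda y)=|\lambda|F(x,y)$ for $\lambda\in\mathbb R$), and $g_{ij}(x,y)=\frac12\,\partial^2F^2/\partial y^i\partial y^j$ is positive definite for $y\neq0$. For vector fields along a curve $c$ put $g(X,Y)=g_{ij}(c,\dot c)X^iY^j$, and let $\nabla/dt$ be the covariant derivative along $c$ of the Cartan connection $(L^i_{jk},N^i_j,C^i_{jk})$. Let $x_0,x_1\in M$, let $\Omega$ be the set of piecewise $C^\infty$ regular curves $c:[0,1]\to M$ with $c(0)=x_0$, $c(1)=x_1$, and for $p\in\mathbb R\setminus\{0\}$ let $E_p(c)=\int_0^1 g(\dot c,\dot c)^{p/2}\,dt$. Let $c\in\Omega$ be a geodesic (smooth, $\nabla\dot c/dt=0$). Let $T_c\Omega$ be the space of continuous, piecewise $C^\infty$ vector fields $X$ along $c$ with $X(0)=X(1)=0$, and $T_c^\perp\Omega=\{X\in T_c\Omega: g(X,\dot c)=0\}$. For $X,Y\in T_c\Omega$ let $$I_p(X,Y)=\frac{\partial^2E_p(c_{s_1s_2})}{\partial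 s_1\partial s_2}(0,0),$$ where $(c_{s_1s_2})\subset\Omega$ is a two-parameter variation of $c$ with $\partial c_{s_1s_2}/\partial s_1=X$ and $\partial c_{s_1s_2}/\partial s_2=Y$ at $s_1=s_2=0$; such variations exist, the derivative exists, and it does not depend on the variation. Write $I_p(X)=I_p(X,X)$. A Jacobi field along $c$ is a smooth field $J$ on $[0,1]$ with $\frac{\nabla}{dt}\frac{\nabla J}{dt}+R^2(J,\dot c)\dot c=0$, where $R^2(J,\dot c)\dot c$ has the components $R^i_{jk}(c,\dot c)\dot c^jJ^k$, $R^i_{jk}=\delta N^i_j/\delta x^k-\delta N^i_k/\delta x^j$, $\delta/\delta x^i=\partial/\partial x^i-N^j_i\,\partial/\partial y^j$. For $t\in(0,1]$ say that $c(t)$ is conjugate to $c(0)$ along $c$ if there is a Jacobi field $J\not\equiv0$ with $J(0)=J(t)=0$. **Proposition 2.** Let $p\in\mathbb R\setminus\{0,1\}$. i) If no $c(t)$ with $t\in(0,1)$ is conjugate to $c(0)$ along $c$, then for all $X\in T_c^\perp\Omega$: $I_p(X)\ge0$ if $p\in(0,1)\cup(1,\infty)$, and $I_p(X)\le0$ if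 $p\in(-\infty,0)$. If moreover $c(1)$ is not conjugate to $c(0)$ along $c$, then in both cases, for $X\in T_c^\perp\Omega$, $I_p(X)=0\Leftrightarrow X=0$; that is, $I_p$ restricted to $T_c^\perp\Omega$ is positive definite, respectively negative definite. ii) If some $c(t)$ with $t\in(0,1)$ is conjugate to $c(0)$ along $c$, then there is $X\in T_c^\perp\Omega$ with $I_p(X)<0$ if $p\in(0,1)\cup(1,\infty)$, and there is $X\in T_c^\perp\Omega$ with $I_p(X)>0$ if $p\in(-\infty,0)$. -/

import Mathlib

open scoped Manifold ContDiff Topology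

noncomputable section

namespace Finsler

/-! ### Local formulas on `ℝⁿ`

Below `L : ℝⁿ → ℝⁿ → ℝ` is the coordinate expression `(x, y) ↦ L x y` of a fundamental function. -/

section Local

variable {n : ℕ}

/-- `∂f/∂xⁱ`. -/
def dx (f : EuclideanSpace ℝ (Fin n) → EuclideanSpace ℝ (Fin n) → ℝ) (i : Fin n)
    (x y : EuclideanSpace ℝ (Fin n)) : ℝ :=
  fderiv ℝ (fun z => f z y) x (EuclideanSpace.single i 1)

/-- `∂f/∂yⁱ`. -/
def dy (f : EuclideanSpace ℝ (Fin n) → EuclideanSpace ℝ (Fin n) → ℝ) (i : Fin n)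
    (x y : EuclideanSpace ℝ (Fin n)) : ℝ :=
  fderiv ℝ (fun z => f x z) y (EuclideanSpace.single i 1)

variable (L : EuclideanSpace ℝ (Fin n) → EuclideanSpace ℝ (Fin n) → ℝ)

/-- The fundamental tensor `g_ij = ½ ∂²L²/∂yⁱ∂yʲ`. -/
def gLow (i j : Fin n) (x y : EuclideanSpace ℝ (Fin n)) : ℝ :=
  (1 / 2) * dy (dy (fun x y => L x y ^ 2) j) i x y

/-- The inverse matrix `gⁱʲ`. -/
def gUp (i j : Fin n) (x y : EuclideanSpace ℝ (Fin n)) : ℝ :=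
  (Matrix.of fun a b => gLow L a b x y)⁻¹ i j

/-- The formal Christoffel symbols `Γⁱ_jk = ½ gⁱᵐ (∂g_mk/∂xʲ + ∂g_jm/∂xᵏ - ∂g_jk/∂xᵐ)`. -/
def christoffel (i j k : Fin n) (x y : EuclideanSpace ℝ (Fin n)) : ℝ :=
  (1 / 2) * ∑ m, gUp L i m x y *
    (dx (gLow L m k) j x y + dx (gLow L j m) k x y - dx (gLow L j k) m x y)

/-- The nonlinear connection `Nⁱ_j = ½ ∂(Γⁱ_kl yᵏ yˡ)/∂yʲ`. -/
def nonlinConn (i j : Fin n) (x y : EuclideanSpace ℝ (Fin n)) : ℝ :=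
  (1 / 2) * dy (fun x y => ∑ k, ∑ l, christoffel L i k l x y * y k * y l) j x y

/-- The horizontal derivative `δf/δxⁱ = ∂f/∂xⁱ - Nʲ_i ∂f/∂yʲ`. -/
def horiz (f : EuclideanSpace ℝ (Fin n) → EuclideanSpace ℝ (Fin n) → ℝ) (i : Fin n)
    (x y : EuclideanSpace ℝ (Fin n)) : ℝ :=
  dx f i x y - ∑ j, nonlinConn L j i x y * dy f j x y

/-- Horizontal coefficients of the Cartan connection,
`Lⁱ_jk = ½ gⁱᵐ (δg_mk/δxʲ + δg_jm/δxᵏ - δg_jk/δxᵐ)`. -/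
def cartanH (i j k : Fin n) (x y : EuclideanSpace ℝ (Fin n)) : ℝ :=
  (1 / 2) * ∑ m, gUp L i m x y *
    (horiz L (gLow L m k) j x y + horiz L (gLow L j m) k x y - horiz L (gLow L j k) m x y)

/-- Vertical coefficients of the Cartan connection,
`Cⁱ_jk = ½ gⁱᵐ (∂g_mk/∂yʲ + ∂g_jm/∂yᵏ - ∂g_jk/∂yᵐ)`. -/
def cartanV (i j k : Fin n) (x y : EuclideanSpace ℝ (Fin n)) : ℝ :=
  (1 / 2) * ∑ m, gUp L i m x y *
    (dy (gLow L m k) j x y + dy (gLow L j m) k x y - dy (gLow L j k) m x y)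

/-- The curvature of the nonlinear connection, `Rⁱ_jk = δNⁱ_j/δxᵏ - δNⁱ_k/δxʲ`. It is the
contraction `Rⁱ_mjk yᵐ` of the `h`-curvature of the Cartan connection. -/
def curv (i j k : Fin n) (x y : EuclideanSpace ℝ (Fin n)) : ℝ :=
  horiz L (nonlinConn L i j) k x y - horiz L (nonlinConn L i k) j x y

/-- The derivative on `[0,1]` (one-sided at the end points) of a curve in `ℝⁿ`. -/
def timeDeriv (ξ : ℝ → EuclideanSpace ℝ (Fin n)) (t : ℝ) : EuclideanSpace ℝ (Fin n) :=
  derivWithin ξ (Set.Icc 0 1) t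

/-- The covariant derivative along the curve `x` of the field with components `ξ`:
`dξⁱ/dt + ξᵐ (Lⁱ_mk(x,ẋ) dxᵏ/dt + Cⁱ_mk(x,ẋ) (d²xᵏ/dt² + Nᵏ_l(x,ẋ) dxˡ/dt))`. -/
def covDeriv (x ξ : ℝ → EuclideanSpace ℝ (Fin n)) (t : ℝ) : EuclideanSpace ℝ (Fin n) :=
  WithLp.toLp 2 fun i => timeDeriv ξ t i + ∑ m, ξ t m * ∑ k,
    (cartanH L i m k (x t) (timeDeriv x t) * timeDeriv x t k
      + cartanV L i m k (x t) (timeDeriv x t) *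
        (timeDeriv (timeDeriv x) t k
          + ∑ l, nonlinConn L k l (x t) (timeDeriv x t) * timeDeriv x t l))

/-- The curvature term `R²(ξ,ẋ)ẋ`, with components `Rⁱ_jk(x,ẋ) ẋʲ ξᵏ`. -/
def curvTerm (x ξ : ℝ → EuclideanSpace ℝ (Fin n)) (t : ℝ) : EuclideanSpace ℝ (Fin n) :=
  WithLp.toLp 2 fun i => ∑ j, ∑ k,
    curv L i j k (x t) (timeDeriv x t) * timeDeriv x t j * ξ t k

end Local

/-! ### Finsler manifolds -/

section Global

variable {n : ℕ} {M : Type*} [TopologicalSpace M] [ChartedSpace (EuclideanSpace ℝ (Fin n)) M]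

/-- The fundamental tensor `g_(x,y)(u,v) = ½ D²(F²(x,·))(y)(u,v)` on `T_xM`, for `y ∈ T_xM`. -/
def fundTensor (F : TangentBundle (𝓡 n) M → ℝ) (x : M) (y u v : TangentSpace (𝓡 n) x) : ℝ :=
  (1 / 2) * fderiv ℝ (fun w : EuclideanSpace ℝ (Fin n) =>
    fderiv ℝ (fun z : EuclideanSpace ℝ (Fin n) =>
      F (⟨x, z⟩ : TangentBundle (𝓡 n) M) ^ 2) w v) y u

/-- `F : TM → ℝ` is the fundamental function of an (absolutely homogeneous) Finsler manifold. -/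
structure IsFinsler [IsManifold (𝓡 n) ∞ M] (F : TangentBundle (𝓡 n) M → ℝ) : Prop where
  pos : ∀ (x : M) (y : TangentSpace (𝓡 n) x), y ≠ 0 → 0 < F ⟨x, y⟩
  homogeneous : ∀ (x : M) (y : TangentSpace (𝓡 n) x) (a : ℝ), F ⟨x, a • y⟩ = |a| * F ⟨x, y⟩
  posDef : ∀ (x : M) (y u : TangentSpace (𝓡 n) x), y ≠ 0 → u ≠ 0 → 0 < fundTensor F x y u u
  smooth : ContMDiffOn (𝓡 n).tangent 𝓘(ℝ, ℝ) ∞ F {v | v.snd ≠ 0}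
  continuous : Continuous F

/-- A partition `0 = τ 0 < τ 1 < ⋯ < τ k = 1` of `[0,1]`. -/
structure IsPartition (k : ℕ) (τ : ℕ → ℝ) : Prop where
  zero : τ 0 = 0
  last : τ k = 1
  lt : ∀ i < k, τ i < τ (i + 1)

/-- The velocity `ċ(t)` of a curve `c : [0,1] → M`. Curves on `[0,1]` are functions on `ℝ` of which
only the values on `[0,1]` matter. -/
def velocity (c : ℝ → M) (t : ℝ) : TangentSpace (𝓡 n) (c t) :=
  mfderivWithin 𝓘(ℝ, ℝ) (𝓡 n) c (Set.Icc 0 1) t (1 : ℝ)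

/-- The set `Ω` of the piecewise `C^∞` regular curves `c : [0,1] → M` with `c(0) = x₀` and
`c(1) = x₁`: there is a partition such that `c` is smooth with non-vanishing velocity on each of its
closed intervals (so `c` is continuous). -/
def pathSpace (n : ℕ) {M : Type*} [TopologicalSpace M]
    [ChartedSpace (EuclideanSpace ℝ (Fin n)) M] (x₀ x₁ : M) : Set (ℝ → M) :=
  {c | c 0 = x₀ ∧ c 1 = x₁ ∧ ∃ (k : ℕ) (τ : ℕ → ℝ), IsPartition k τ ∧ ∀ i < k,
    ContMDiffOn 𝓘(ℝ, ℝ) (𝓡 n) ∞ c (Set.Icc (τ i) (τ (i + 1))) ∧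
    ∀ t ∈ Set.Icc (τ i) (τ (i + 1)),
      mfderivWithin 𝓘(ℝ, ℝ) (𝓡 n) c (Set.Icc (τ i) (τ (i + 1))) t (1 : ℝ) ≠ 0}

/-- The `p`-energy `E_p(c) = ∫₀¹ g(ċ,ċ)^(p/2) dt`. -/
def energy (F : TangentBundle (𝓡 n) M → ℝ) (p : ℝ) (c : ℝ → M) : ℝ :=
  ∫ t in (0 : ℝ)..1, fundTensor F (c t) (velocity c t) (velocity c t) (velocity c t) ^ (p / 2)

/-- The coordinate expression of `F` in the chart at `a`. -/
def localF (F : TangentBundle (𝓡 n) M → ℝ) (a : M) (x y : EuclideanSpace ℝ (Fin n)) : ℝ :=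
  F (tangentMap (𝓡 n) (𝓡 n) (chartAt (EuclideanSpace ℝ (Fin n)) a).symm ⟨x, y⟩)

/-- The coordinate expression of the curve `c` in the chart at `a`. -/
def localCurve (a : M) (c : ℝ → M) (t : ℝ) : EuclideanSpace ℝ (Fin n) :=
  chartAt (EuclideanSpace ℝ (Fin n)) a (c t)

/-- The components, in the chart at `a`, of a vector field along `c`. -/
def localField (a : M) (c : ℝ → M) (X : (t : ℝ) → TangentSpace (𝓡 n) (c t)) (t : ℝ) :
    EuclideanSpace ℝ (Fin n) :=
  mfderiv (𝓡 n) (𝓡 n) (chartAt (EuclideanSpace ℝ (Fin n)) a) (c t) (X t)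

/-- `c` is a geodesic: `c` is smooth on `[0,1]` and `∇ċ/dt = 0` in all charts. -/
def IsGeodesic (F : TangentBundle (𝓡 n) M → ℝ) (c : ℝ → M) : Prop :=
  ContMDiffOn 𝓘(ℝ, ℝ) (𝓡 n) ∞ c (Set.Icc 0 1) ∧
  ∀ (a : M), ∀ t ∈ Set.Icc (0 : ℝ) 1, c t ∈ (chartAt (EuclideanSpace ℝ (Fin n)) a).source →
    covDeriv (localF F a) (localCurve a c) (timeDeriv (localCurve a c)) t = 0

/-- `J` is a Jacobi field along `c`: a smooth field on `[0,1]` with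
`∇/dt ∇J/dt + R²(J,ċ)ċ = 0` in all charts. -/
def IsJacobi [IsManifold (𝓡 n) ∞ M] (F : TangentBundle (𝓡 n) M → ℝ) (c : ℝ → M)
    (J : (t : ℝ) → TangentSpace (𝓡 n) (c t)) : Prop :=
  ContMDiffOn 𝓘(ℝ, ℝ) (𝓡 n).tangent ∞ (fun t => (⟨c t, J t⟩ : TangentBundle (𝓡 n) M))
    (Set.Icc 0 1) ∧
  ∀ (a : M), ∀ t ∈ Set.Icc (0 : ℝ) 1, c t ∈ (chartAt (EuclideanSpace ℝ (Fin n)) a).source →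
    covDeriv (localF F a) (localCurve a c)
        (covDeriv (localF F a) (localCurve a c) (localField a c J)) t
      + curvTerm (localF F a) (localCurve a c) (localField a c J) t = 0

/-- `c(b)` is conjugate to `c(a)` along `c`: some Jacobi field along `c` that is not identically
zero vanishes at `a` and at `b`. -/
def IsConjugate [IsManifold (𝓡 n) ∞ M] (F : TangentBundle (𝓡 n) M → ℝ) (c : ℝ → M)
    (a b : ℝ) : Prop :=
  ∃ J : (t : ℝ) → TangentSpace (𝓡 n) (c t), IsJacobi F c J ∧
    (∃ t ∈ Set.Icc (0 : ℝ) 1, J t ≠ 0) ∧ J a = 0 ∧ J b = 0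

/-- `T_cΩ`: the continuous, piecewise `C^∞` fields along `c` that vanish at `0` and `1`. -/
def tangentOmega [IsManifold (𝓡 n) ∞ M] (c : ℝ → M) :
    Set ((t : ℝ) → TangentSpace (𝓡 n) (c t)) :=
  {X | X 0 = 0 ∧ X 1 = 0 ∧ ∃ (k : ℕ) (τ : ℕ → ℝ), IsPartition k τ ∧ ∀ i < k,
    ContMDiffOn 𝓘(ℝ, ℝ) (𝓡 n).tangent ∞ (fun t => (⟨c t, X t⟩ : TangentBundle (𝓡 n) M))
      (Set.Icc (τ i) (τ (i + 1)))}

/-- `T_c^⊥Ω`: the fields `X ∈ T_cΩ` with `g(X,ċ) = 0`. -/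
def perpOmega [IsManifold (𝓡 n) ∞ M] (F : TangentBundle (𝓡 n) M → ℝ) (c : ℝ → M) :
    Set ((t : ℝ) → TangentSpace (𝓡 n) (c t)) :=
  {X | X ∈ tangentOmega c ∧
    ∀ t ∈ Set.Icc (0 : ℝ) 1, fundTensor F (c t) (velocity c t) (X t) (velocity c t) = 0}

/-- `V`, with `V s₁ s₂ t = c_{s₁s₂}(t)` for `s₁, s₂ ∈ (-ε,ε)`, is a two-parameter variation of `c`
in `Ω` (smooth in `(s₁,s₂,t)` on the closed intervals of a partition) with
`∂V/∂s₁(0,0,t) = X(t)` and `∂V/∂s₂(0,0,t) = Y(t)`. -/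
structure IsVariation (c : ℝ → M) (X Y : (t : ℝ) → TangentSpace (𝓡 n) (c t)) (ε : ℝ)
    (V : ℝ → ℝ → ℝ → M) : Prop where
  eps_pos : 0 < ε
  mem : ∀ s₁ ∈ Set.Ioo (-ε) ε, ∀ s₂ ∈ Set.Ioo (-ε) ε, V s₁ s₂ ∈ pathSpace n (c 0) (c 1)
  base : ∀ t ∈ Set.Icc (0 : ℝ) 1, V 0 0 t = c t
  smooth : ∃ (k : ℕ) (τ : ℕ → ℝ), IsPartition k τ ∧ ∀ i < k,
    ContMDiffOn 𝓘(ℝ, ℝ × ℝ × ℝ) (𝓡 n) ∞ (fun q : ℝ × ℝ × ℝ => V q.1 q.2.1 q.2.2)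
      (Set.Ioo (-ε) ε ×ˢ Set.Ioo (-ε) ε ×ˢ Set.Icc (τ i) (τ (i + 1)))
  field_fst : ∀ t ∈ Set.Icc (0 : ℝ) 1,
    (⟨V 0 0 t, mfderiv 𝓘(ℝ, ℝ) (𝓡 n) (fun s => V s 0 t) 0 (1 : ℝ)⟩ : TangentBundle (𝓡 n) M)
      = ⟨c t, X t⟩
  field_snd : ∀ t ∈ Set.Icc (0 : ℝ) 1,
    (⟨V 0 0 t, mfderiv 𝓘(ℝ, ℝ) (𝓡 n) (fun s => V 0 s t) 0 (1 : ℝ)⟩ : TangentBundle (𝓡 n) M)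
      = ⟨c t, Y t⟩

/-- `I` is the Hessian `I_p` of the `p`-energy at `c`: all `X, Y ∈ T_cΩ` are the variation fields of
a two-parameter variation `c_{s₁s₂}` of `c`, and for each such variation the derivative
`∂²E_p(c_{s₁s₂})/∂s₁∂s₂ (0,0)` exists and equals `I X Y`. These conditions determine `I` on
`T_cΩ × T_cΩ`. -/
def IsHessian [IsManifold (𝓡 n) ∞ M] (F : TangentBundle (𝓡 n) M → ℝ) (p : ℝ) (c : ℝ → M)
    (I : ((t : ℝ) → TangentSpace (𝓡 n) (c t)) → ((t : ℝ) → TangentSpace (𝓡 n) (c t)) → ℝ) :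
    Prop :=
  ∀ X ∈ tangentOmega c, ∀ Y ∈ tangentOmega c,
    (∃ ε V, IsVariation c X Y ε V) ∧
    ∀ ε V, IsVariation c X Y ε V →
      (∀ᶠ s₁ in 𝓝 (0 : ℝ), DifferentiableAt ℝ (fun s₂ => energy (n := n) F p (V s₁ s₂)) 0) ∧
      HasDerivAt (fun s₁ => deriv (fun s₂ => energy (n := n) F p (V s₁ s₂)) 0) (I X Y) 0

end Global

end Finsler

end

/-! Along the geodesic `c` the number F²(ċ) is a constant r > 0 (`speedSq`,
`IsGeodesicTube.speedSq_eq`), and the integrand of E_p is (F²)^(p/2). Its second derivative along a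
variation is (p/2) r^(p/2-1) times the second derivative of F² plus (p/2)(p/2-1) r^(p/2-2) times a
product of two first derivatives of F². By the Euler–Lagrange equation of F² the first derivative in
the direction X is d/dt of 2g(X,ċ), so it vanishes when X is orthogonal to ċ. Hence I_p(X) = (p/2)
r^(p/2-1) I(X) on orthogonal fields, with I the second variation of ∫F²
(`IsGeodesicTube.tubeHessian_of_perp`). The factor has the sign of p, and what remains is Jacobi's
theorem for I.

To reach a variational problem in a vector space, `exists_tube` builds a smooth family Φ(t,·) of
parametrizations around the points c(t). A field X along c becomes a map ξ from [0,1] to ℝⁿ, and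
I(X) becomes the integral of Q_t((ξ,ξ'),(ξ,ξ')), where Q = `tubeQuad` is the second derivative of F²
in the tube; on pairs (0,w) it is 2g, hence positive definite. Q depends on the tube, but this is
harmless: two families with the same variation fields have second derivatives that differ by a
tangent vector D(t), and their integrands then differ by d/dt of 2g(D,ċ)
(`IsFamilyOn.hasDerivWithinAt_defect`), while D = 0 at the fixed end points. This yields the Hessian
for every variation (`IsGeodesicTube.isHessian`). The Jacobi equation, written with the Cartan
connection, is the linearized geodesic equation (`IsLocalFinsler.jacobi_operator_apply`, by the
homogeneity identities for g, N, L and C), and therefore the Euler–Lagrange equation of Q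
(`IsGeodesicTube.jacobi_iff_tube`).

Jacobi's theorem for Q: let A(t) collect the solutions that vanish at 0. Where A is invertible, put
f = A⁻¹ξ and w = ξ' - A'f; the integrand equals a total derivative plus Q(0,w)(0,w)
(`hasDerivAt_boundary_term`). So the integral is nonnegative, and if it is zero then w = 0, f is
constant, and ξ = 0. If only interior conjugate points are excluded, A may degenerate at 1; the
estimate is then made on [0,T] and T tends to 1 (`IsQuadLagrangian.tendsto_scaled`).

Conversely, let ξ solve the equation and vanish at 0 and at an interior t₀. Stopped at t₀ it has
second variation 0 and a corner there, and adding a small multiple of a field ζ with ζ(t₀)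
proportional to ξ'(t₀) makes the second variation negative (`exists_integral_neg`). The new field
must be orthogonal to ċ: for ξ this holds because g(ξ,ċ) is affine in t and vanishes twice
(`IsGeodesicTube.tubeLin_eq_zero_of_isQJacobi`), and ζ is chosen in the kernel of g(·,ċ). -/

noncomputable section

namespace Finsler

open Set MeasureTheory Filter

set_option linter.unusedSectionVars false

/-! ### Linear differential equations on [0,1]. -/

section LinearODE

variable {B : Type*} [NormedAddCommGroup B] [NormedSpace ℝ B]

/-- On a union, each of the two derivatives is either the given one or vacuous, since a point
outside a closed interval is not in its closure. Sharing one `f'` makes the two one-sided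
derivatives agree at `b`. -/
theorem hasDerivWithinAt_Icc_glue {a b c : ℝ} (hab : a ≤ b) (hbc : b ≤ c) {f g : ℝ → B}
    {f' : ℝ → B} (hfg : f b = g b)
    (hf : ∀ t ∈ Icc a b, HasDerivWithinAt f (f' t) (Icc a b) t)
    (hg : ∀ t ∈ Icc b c, HasDerivWithinAt g (f' t) (Icc b c) t) :
    ∀ t ∈ Icc a c, HasDerivWithinAt (fun t => if t ≤ b then f t else g t) (f' t) (Icc a c) t := by
  intro t ht
  rw [← Icc_union_Icc_eq_Icc hab hbc]
  have e1 : EqOn (fun t => if t ≤ b then f t else g t) f (Icc a b) := fun x hx => by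
    simp [hx.2]
  have e2 : EqOn (fun t => if t ≤ b then f t else g t) g (Icc b c) := fun x hx => by
    rcases hx.1.eq_or_lt with h | h
    · subst h; simp [hfg]
    · simp [not_le.2 h]
  refine HasDerivWithinAt.union ?_ ?_
  · by_cases h : t ≤ b
    · exact (hf t ⟨ht.1, h⟩).congr e1 (e1 ⟨ht.1, h⟩)
    · refine HasFDerivWithinAt.of_notMem_closure ?_
      rw [isClosed_Icc.closure_eq]
      exact fun h' => h h'.2
  · by_cases h : b ≤ t
    · exact (hg t ⟨h, ht.2⟩).congr e2 (e2 ⟨h, ht.2⟩)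
    · refine HasFDerivWithinAt.of_notMem_closure ?_
      rw [isClosed_Icc.closure_eq]
      exact fun h' => h h'.1

/-- For a linear field Picard–Lindelöf works on intervals whose length δ depends only on a bound for
`L`, not on the initial value; finitely many such steps, glued together, cover [0,1]. -/
theorem exists_linearODE_solution [CompleteSpace B] {L : ℝ → B →L[ℝ] B} (hL : ContinuousOn L (Icc 0 1)) (y₀ : B) :
    ∃ Y : ℝ → B, Y 0 = y₀ ∧
      ∀ t ∈ Icc (0 : ℝ) 1, HasDerivWithinAt Y (L t (Y t)) (Icc 0 1) t := by
  obtain ⟨K, hK⟩ := isCompact_Icc.exists_bound_of_continuousOn hL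
  -- The maximum with 1 serves only to make `K'` positive, since δ is a reciprocal.
  set K' : NNReal := ⟨max K 1, by positivity⟩
  have hK' : ∀ t ∈ Icc (0 : ℝ) 1, ‖L t‖ ≤ K' := fun t ht => (hK t ht).trans (le_max_left _ _)
  have hK1 : (1 : ℝ) ≤ K' := le_max_right _ _
  have hKpos : (0 : ℝ) < K' := by linarith
  set δ : ℝ := 1 / (2 * K')
  have hδ : 0 < δ := by positivity
  have hδK : K' * δ = 1 / 2 := by simp only [δ]; field_simp
  have local_sol : ∀ a b : ℝ, 0 ≤ a → b ≤ 1 → a ≤ b → b - a ≤ δ → ∀ x : B,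
      ∃ Y : ℝ → B, Y a = x ∧ ∀ t ∈ Icc a b, HasDerivWithinAt Y (L t (Y t)) (Icc a b) t := by
    intro a b ha hb hab hd x
    have hsub : Icc a b ⊆ Icc (0 : ℝ) 1 := Icc_subset_Icc ha hb
    -- In the ball of radius ‖x‖ + 1 around x one has ‖y‖ ≤ 2‖x‖ + 1, so within time δ = 1/(2K') the
    -- solution moves by at most (2‖x‖ + 1)/2 and stays in the ball.
    have : IsPicardLindelof (fun t y => L t y) (tmin := a) (tmax := b) ⟨a, left_mem_Icc.2 hab⟩ x
        (‖x‖₊ + 1) 0 (K' * (2 * ‖x‖₊ + 1)) K' := by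
      refine ⟨fun t ht => ?_, fun y _ => (hL.mono hsub).clm_apply continuousOn_const, ?_, ?_⟩
      · refine ((L t).lipschitz.weaken ?_).lipschitzOnWith
        exact hK' t (hsub ht)
      · intro t ht y hy
        have h1 : ‖y‖ ≤ 2 * ‖x‖ + 1 := by
          have : ‖y - x‖ ≤ ‖x‖ + 1 := by simpa [dist_eq_norm] using hy
          have h2 : ‖y‖ ≤ ‖y - x‖ + ‖x‖ := by simpa using norm_add_le (y - x) x
          linarith
        calc ‖L t y‖ ≤ ‖L t‖ * ‖y‖ := (L t).le_opNorm y
          _ ≤ K' * (2 * ‖x‖ + 1) := by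
            have := hK' t (hsub ht)
            gcongr
          _ = _ := by push_cast; rfl
      · have : max (b - a) (a - a) = b - a := by rw [max_eq_left]; linarith
        simp only [this]
        push_cast
        have h0 := norm_nonneg x
        calc (K' : ℝ) * (2 * ‖x‖ + 1) * (b - a) ≤ K' * (2 * ‖x‖ + 1) * δ := by gcongr
          _ = (K' * δ) * (2 * ‖x‖ + 1) := by ring
          _ ≤ ‖x‖ + 1 - 0 := by rw [hδK]; linarith
    obtain ⟨Y, hY, hY'⟩ := this.exists_eq_forall_mem_Icc_hasDerivWithinAt₀
    exact ⟨Y, hY, hY'⟩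
  have key : ∀ k : ℕ, ∃ Y : ℝ → B, Y 0 = y₀ ∧ ∀ t ∈ Icc (0 : ℝ) (min 1 (k * δ)),
      HasDerivWithinAt Y (L t (Y t)) (Icc 0 (min 1 (k * δ))) t := by
    intro k
    induction k with
    | zero =>
      obtain ⟨Y, h1, h2⟩ := local_sol 0 0 le_rfl zero_le_one le_rfl (by simpa using hδ.le) y₀
      exact ⟨Y, h1, by simpa using h2⟩
    | succ k ih =>
      obtain ⟨Y, h1, h2⟩ := ih
      have ha : (0 : ℝ) ≤ min 1 (k * δ) := by positivity
      have hab : min 1 (k * δ) ≤ min 1 ((k + 1 : ℕ) * δ) := by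
        push_cast; gcongr; linarith
      obtain ⟨Z, h3, h4⟩ := local_sol (min 1 (k * δ)) (min 1 ((k + 1 : ℕ) * δ)) ha
        (min_le_left _ _) hab (by
          push_cast
          rcases le_total 1 (k * δ) with h | h
          · rw [min_eq_left h, min_eq_left (by linarith)]; simpa using hδ.le
          · rw [min_eq_right h]; have := min_le_right 1 ((k + 1) * δ); linarith) (Y (min 1 (k * δ)))
      refine ⟨fun t => if t ≤ min 1 (k * δ) then Y t else Z t, by simp [ha, h1], ?_⟩
      have := hasDerivWithinAt_Icc_glue (f := Y) (g := Z)
        (f' := fun t => L t (if t ≤ min 1 (k * δ) then Y t else Z t)) ha hab h3.symm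
        (fun t ht => by simpa [ht.2] using h2 t ht) (fun t ht => by
          rcases ht.1.eq_or_lt with h | h
          · have := h4 t ht
            subst h
            rw [h3] at this
            simpa using this
          · simpa only [not_le.2 h, if_false] using h4 t ht)
      exact this
  obtain ⟨k, hk⟩ := exists_nat_ge (1 / δ)
  obtain ⟨Y, h1, h2⟩ := key k
  rw [min_eq_left (by rwa [div_le_iff₀ hδ] at hk)] at h2
  exact ⟨Y, h1, h2⟩

/-- The Lipschitz uniqueness theorem is one-sided, so `Y` is compared with the zero solution to the
right and to the left of `t₀` separately. -/
theorem linearODE_solution_unique {L : ℝ → B →L[ℝ] B} (hL : ContinuousOn L (Icc 0 1))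
    {Y : ℝ → B} (hY : ∀ t ∈ Icc (0 : ℝ) 1, HasDerivWithinAt Y (L t (Y t)) (Icc 0 1) t)
    {t₀ : ℝ} (ht₀ : t₀ ∈ Icc (0 : ℝ) 1) (h0 : Y t₀ = 0) : ∀ t ∈ Icc (0 : ℝ) 1, Y t = 0 := by
  obtain ⟨K, hK⟩ := isCompact_Icc.exists_bound_of_continuousOn hL
  set K' : NNReal := ⟨max K 1, by positivity⟩
  have hK' : ∀ t ∈ Icc (0 : ℝ) 1, ‖L t‖ ≤ K' := fun t ht => (hK t ht).trans (le_max_left _ _)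
  have hlip : ∀ t ∈ Icc (0 : ℝ) 1, LipschitzOnWith K' (fun y => L t y) univ := fun t ht =>
    ((L t).lipschitz.weaken (hK' t ht)).lipschitzOnWith
  have hcont : ContinuousOn Y (Icc 0 1) := fun t ht => (hY t ht).continuousWithinAt
  have hz : ∀ t : ℝ, ∀ s : Set ℝ, HasDerivWithinAt (fun _ : ℝ => (0 : B)) (L t 0) s t := fun t s => by
    simpa using hasDerivWithinAt_const t s (0 : B)
  have right : EqOn Y (fun _ => 0) (Icc t₀ 1) := by
    refine ODE_solution_unique_of_mem_Icc_right (v := fun t y => L t y) (s := fun _ => univ)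
      (fun t ht => hlip t ⟨ht₀.1.trans ht.1, ht.2.le⟩) (hcont.mono (Icc_subset_Icc_left ht₀.1))
      (fun t ht => ?_) (fun _ _ => mem_univ _) continuousOn_const (fun t _ => hz t _)
      (fun _ _ => mem_univ _) h0
    have ht' : t ∈ Icc (0 : ℝ) 1 := ⟨ht₀.1.trans ht.1, ht.2.le⟩
    refine (hY t ht').mono_of_mem_nhdsWithin ?_
    exact mem_of_superset (Icc_mem_nhdsGE ht.2) (Icc_subset_Icc_left ht'.1)
  have left : EqOn Y (fun _ => 0) (Icc 0 t₀) := by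
    refine ODE_solution_unique_of_mem_Icc_left (v := fun t y => L t y) (s := fun _ => univ)
      (fun t ht => hlip t ⟨ht.1.le, ht.2.trans ht₀.2⟩) (hcont.mono (Icc_subset_Icc_right ht₀.2))
      (fun t ht => ?_) (fun _ _ => mem_univ _) continuousOn_const (fun t _ => hz t _)
      (fun _ _ => mem_univ _) h0
    have ht' : t ∈ Icc (0 : ℝ) 1 := ⟨ht.1.le, ht.2.trans ht₀.2⟩
    refine (hY t ht').mono_of_mem_nhdsWithin ?_
    exact mem_of_superset (Icc_mem_nhdsLE ht.1) (Icc_subset_Icc_right ht'.2)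
  intro t ht
  rcases le_total t t₀ with h | h
  · exact left ⟨ht.1, h⟩
  · exact right ⟨h, ht.2⟩

theorem linearODE_solution_contDiffOn [CompleteSpace B] {L : ℝ → B →L[ℝ] B} (hL : ContDiffOn ℝ ∞ L (Icc 0 1))
    {Y : ℝ → B} (hY : ∀ t ∈ Icc (0 : ℝ) 1, HasDerivWithinAt Y (L t (Y t)) (Icc 0 1) t) :
    ContDiffOn ℝ ∞ Y (Icc 0 1) := by
  refine ODE.contDiffOn_enat_Icc_of_hasDerivWithinAt (n := ⊤) (f := fun t y => L t y) (u := univ)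
    ?_ hY (fun _ _ => mem_univ _)
  exact (hL.comp contDiffOn_fst fun q hq => hq.1).clm_apply contDiffOn_snd

/-- Left composition with `L t` is a linear field on the space of endomorphisms, so the existence
theorem applies there with the identity as initial value. -/
theorem exists_fundamentalSolution [CompleteSpace B] {L : ℝ → B →L[ℝ] B}
    (hL : ContDiffOn ℝ ∞ L (Icc 0 1)) : ∃ U : ℝ → B →L[ℝ] B, U 0 = ContinuousLinearMap.id ℝ B ∧
      ContDiffOn ℝ ∞ U (Icc 0 1) ∧
      ∀ t ∈ Icc (0 : ℝ) 1, HasDerivWithinAt U (L t ∘L U t) (Icc 0 1) t := by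
  have hL' : ContDiffOn ℝ ∞ (fun t => ContinuousLinearMap.compL ℝ B B B (L t)) (Icc 0 1) :=
    contDiffOn_const.clm_apply hL
  obtain ⟨U, hU0, hU⟩ := exists_linearODE_solution hL'.continuousOn (ContinuousLinearMap.id ℝ B)
  exact ⟨U, hU0, linearODE_solution_contDiffOn hL' hU, hU⟩

end LinearODE

/-! ### Quadratic Lagrangians: Legendre transformation, Hamiltonian form, Jacobi tensor. -/

section QuadraticLagrangian

variable {H : Type*} [NormedAddCommGroup H] [NormedSpace ℝ H]

/-- A smooth family of symmetric bilinear forms on `H × H`, positive definite on the second factor: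
the second derivative along a solution of a regular Lagrangian `ℒ(t, v, v')`. -/
structure IsQuadLagrangian (Q : ℝ → (H × H) →L[ℝ] (H × H) →L[ℝ] ℝ) : Prop where
  smooth : ContDiffOn ℝ ∞ Q (Icc 0 1)
  symm : ∀ t ∈ Icc (0 : ℝ) 1, ∀ u v, Q t u v = Q t v u
  pos : ∀ t ∈ Icc (0 : ℝ) 1, ∀ w, w ≠ 0 → 0 < Q t (0, w) (0, w)

/-- The solutions of the Euler-Lagrange equation of the quadratic Lagrangian `Q`. -/
structure IsQJacobi (Q : ℝ → (H × H) →L[ℝ] (H × H) →L[ℝ] ℝ) (ξ : ℝ → H) : Prop where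
  smooth : ContDiffOn ℝ ∞ ξ (Icc 0 1)
  eqn : ∀ t ∈ Icc (0 : ℝ) 1, ∀ η, HasDerivWithinAt
    (fun t => Q t (ξ t, derivWithin ξ (Icc 0 1) t) (0, η))
    (Q t (ξ t, derivWithin ξ (Icc 0 1) t) (η, 0)) (Icc 0 1) t

theorem hasDerivWithinAt_clm_apply_const {E F : Type*} [NormedAddCommGroup E] [NormedSpace ℝ E]
    [NormedAddCommGroup F] [NormedSpace ℝ F] {c : ℝ → E →L[ℝ] F} {c' : E →L[ℝ] F} {s : Set ℝ}
    {t : ℝ} (h : HasDerivWithinAt c c' s t) (v : E) :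
    HasDerivWithinAt (fun t => c t v) (c' v) s t := by
  simpa using h.clm_apply (hasDerivWithinAt_const t s v)

/-- Precomposition with a continuous linear map, on dual spaces. -/
def dualPre {E F : Type*} [NormedAddCommGroup E] [NormedSpace ℝ E] [NormedAddCommGroup F]
    [NormedSpace ℝ F] (l : E →L[ℝ] F) : (F →L[ℝ] ℝ) →L[ℝ] (E →L[ℝ] ℝ) :=
  (ContinuousLinearMap.compL ℝ E F ℝ).flip l

@[simp] theorem dualPre_apply {E F : Type*} [NormedAddCommGroup E] [NormedSpace ℝ E]
    [NormedAddCommGroup F] [NormedSpace ℝ F] (l : E →L[ℝ] F) (α : F →L[ℝ] ℝ) (u : E) :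
    dualPre l α u = α (l u) := rfl

variable {Q : ℝ → (H × H) →L[ℝ] (H × H) →L[ℝ] ℝ}

/-- The form `ℒ_{v'v'}`. -/
def legendre (Q : ℝ → (H × H) →L[ℝ] (H × H) →L[ℝ] ℝ) (t : ℝ) : H →L[ℝ] (H →L[ℝ] ℝ) :=
  (dualPre (ContinuousLinearMap.inr ℝ H H) ∘L Q t) ∘L ContinuousLinearMap.inr ℝ H H

theorem legendre_apply (t : ℝ) (v w : H) : legendre Q t v w = Q t (0, v) (0, w) := by
  simp [legendre]

/-- The form `ℒ_{vv'}`. -/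
def mixedForm (Q : ℝ → (H × H) →L[ℝ] (H × H) →L[ℝ] ℝ) (t : ℝ) : H →L[ℝ] (H →L[ℝ] ℝ) :=
  (dualPre (ContinuousLinearMap.inr ℝ H H) ∘L Q t) ∘L ContinuousLinearMap.inl ℝ H H

theorem mixedForm_apply (t : ℝ) (v w : H) : mixedForm Q t v w = Q t (v, 0) (0, w) := by
  simp [mixedForm]

theorem momentum_eq (t : ℝ) (v w z : H) :
    Q t (v, w) (0, z) = legendre Q t w z + mixedForm Q t v z := by
  rw [legendre_apply, mixedForm_apply, ← add_apply, ← map_add]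
  simp

theorem exists_equiv_of_injective {E F : Type*} [NormedAddCommGroup E] [NormedSpace ℝ E]
    [NormedAddCommGroup F] [NormedSpace ℝ F] [FiniteDimensional ℝ E] [FiniteDimensional ℝ F]
    (f : E →L[ℝ] F) (hf : Function.Injective f)
    (hn : Module.finrank ℝ E = Module.finrank ℝ F) : ∃ e : E ≃L[ℝ] F, (e : E →L[ℝ] F) = f :=
  ⟨(LinearMap.linearEquivOfInjective (f : E →ₗ[ℝ] F) hf hn).toContinuousLinearEquiv, by ext; rfl⟩

theorem finrank_dual (H : Type*) [NormedAddCommGroup H] [NormedSpace ℝ H] [FiniteDimensional ℝ H] :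
    Module.finrank ℝ (H →L[ℝ] ℝ) = Module.finrank ℝ H := by
  rw [← LinearMap.toContinuousLinearMap.finrank_eq, Subspace.dual_finrank_eq]

variable [FiniteDimensional ℝ H]

/-- A vector in the kernel would have `Q t (0, w) (0, w) = 0`, against positivity; equality of
dimensions does the rest. -/
theorem IsQuadLagrangian.exists_legendre_equiv (hQ : IsQuadLagrangian Q) {t : ℝ}
    (ht : t ∈ Icc (0 : ℝ) 1) : ∃ e : H ≃L[ℝ] (H →L[ℝ] ℝ), (e : H →L[ℝ] _) = legendre Q t := by
  refine exists_equiv_of_injective _ ?_ (finrank_dual H).symm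
  rw [injective_iff_map_eq_zero]
  intro w hw
  by_contra h
  have := hQ.pos t ht w h
  rw [← legendre_apply, hw] at this
  simp at this

/-- The velocity of the solution of the Euler-Lagrange equation with given position and momentum. -/
def hamVel (Q : ℝ → (H × H) →L[ℝ] (H × H) →L[ℝ] ℝ) (t : ℝ) : H × (H →L[ℝ] ℝ) →L[ℝ] H :=
  ContinuousLinearMap.inverse (legendre Q t) ∘L
    (ContinuousLinearMap.snd ℝ H _ - mixedForm Q t ∘L ContinuousLinearMap.fst ℝ H _)

/-- The Hamiltonian form of the Euler-Lagrange equation. -/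
def hamField (Q : ℝ → (H × H) →L[ℝ] (H × H) →L[ℝ] ℝ) (t : ℝ) :
    H × (H →L[ℝ] ℝ) →L[ℝ] H × (H →L[ℝ] ℝ) :=
  ContinuousLinearMap.inl ℝ H _ ∘L hamVel Q t +
    ContinuousLinearMap.inr ℝ H _ ∘L (dualPre (ContinuousLinearMap.inl ℝ H H) ∘L Q t) ∘L
      (ContinuousLinearMap.inl ℝ H H ∘L ContinuousLinearMap.fst ℝ H _ +
        ContinuousLinearMap.inr ℝ H H ∘L hamVel Q t)

theorem hamField_apply (t : ℝ) (y : H × (H →L[ℝ] ℝ)) : hamField Q t y =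
    (hamVel Q t y, dualPre (ContinuousLinearMap.inl ℝ H H) (Q t (y.1, hamVel Q t y))) := by
  simp only [hamField, add_apply, ContinuousLinearMap.comp_apply,
    ContinuousLinearMap.inl_apply, ContinuousLinearMap.inr_apply, ContinuousLinearMap.coe_fst',
    Prod.mk_add_mk, add_zero, zero_add]

/-- `hamVel` inverts the Legendre transformation: the velocity it returns has the prescribed
momentum. `hamVel_eq` is the other composition. -/
theorem IsQuadLagrangian.legendre_hamVel (hQ : IsQuadLagrangian Q) {t : ℝ}
    (ht : t ∈ Icc (0 : ℝ) 1) (y : H × (H →L[ℝ] ℝ)) (w : H) :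
    Q t (y.1, hamVel Q t y) (0, w) = y.2 w := by
  obtain ⟨e, he⟩ := hQ.exists_legendre_equiv ht
  rw [momentum_eq, hamVel, ← he, ContinuousLinearMap.inverse_equiv]
  simp

theorem IsQuadLagrangian.hamVel_eq (hQ : IsQuadLagrangian Q) {t : ℝ}
    (ht : t ∈ Icc (0 : ℝ) 1) (v w : H) :
    hamVel Q t (v, dualPre (ContinuousLinearMap.inr ℝ H H) (Q t (v, w))) = w := by
  obtain ⟨e, he⟩ := hQ.exists_legendre_equiv ht
  have : dualPre (ContinuousLinearMap.inr ℝ H H) (Q t (v, w)) = e w + mixedForm Q t v := by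
    ext z
    have h : e w = legendre Q t w := by rw [← he]; rfl
    rw [dualPre_apply, ContinuousLinearMap.inr_apply, momentum_eq, h]; rfl
  rw [hamVel, this, ← he, ContinuousLinearMap.inverse_equiv]
  simp

theorem IsQuadLagrangian.legendre_smooth (hQ : IsQuadLagrangian Q) :
    ContDiffOn ℝ ∞ (legendre Q) (Icc 0 1) :=
  (contDiffOn_const.clm_comp hQ.smooth).clm_comp contDiffOn_const

theorem IsQuadLagrangian.legendre_inverse_smooth (hQ : IsQuadLagrangian Q) :
    ContDiffOn ℝ ∞ (fun t => ContinuousLinearMap.inverse (legendre Q t)) (Icc 0 1) := by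
  intro t ht
  obtain ⟨e, he⟩ := hQ.exists_legendre_equiv ht
  have := contDiffAt_map_inverse (n := ∞) e
  rw [he] at this
  exact this.comp_contDiffWithinAt t (hQ.legendre_smooth t ht)

theorem IsQuadLagrangian.hamVel_smooth (hQ : IsQuadLagrangian Q) :
    ContDiffOn ℝ ∞ (hamVel Q) (Icc 0 1) :=
  hQ.legendre_inverse_smooth.clm_comp (contDiffOn_const.sub
    (((contDiffOn_const.clm_comp hQ.smooth).clm_comp contDiffOn_const).clm_comp contDiffOn_const))

theorem IsQuadLagrangian.hamField_smooth (hQ : IsQuadLagrangian Q) :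
    ContDiffOn ℝ ∞ (hamField Q) (Icc 0 1) :=
  (contDiffOn_const.clm_comp hQ.hamVel_smooth).add (contDiffOn_const.clm_comp
    ((contDiffOn_const.clm_comp hQ.smooth).clm_comp
      (contDiffOn_const.add (contDiffOn_const.clm_comp hQ.hamVel_smooth))))

/-- `eqn` differentiates the momentum only against each fixed vector. The momentum is known to be
smooth as a curve in the dual space, so its derivative there is identified by evaluation. -/
theorem IsQJacobi.hasDerivWithinAt_momentum {ξ : ℝ → H} (hQ : IsQuadLagrangian Q)
    (hξ : IsQJacobi Q ξ) {t : ℝ} (ht : t ∈ Icc (0 : ℝ) 1) :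
    HasDerivWithinAt (fun t => dualPre (ContinuousLinearMap.inr ℝ H H)
        (Q t (ξ t, derivWithin ξ (Icc 0 1) t)))
      (dualPre (ContinuousLinearMap.inl ℝ H H) (Q t (ξ t, derivWithin ξ (Icc 0 1) t)))
      (Icc 0 1) t := by
  have hu := uniqueDiffOn_Icc (zero_lt_one' ℝ)
  have hd : ContDiffOn ℝ ∞ (derivWithin ξ (Icc 0 1)) (Icc 0 1) := fun t ht =>
    (hξ.smooth t ht).derivWithin hu (by simp) ht
  have hsm : ContDiffWithinAt ℝ ∞ (fun t => dualPre (ContinuousLinearMap.inr ℝ H H)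
      (Q t (ξ t, derivWithin ξ (Icc 0 1) t))) (Icc 0 1) t :=
    contDiffWithinAt_const.clm_apply ((hQ.smooth t ht).clm_apply
      ((hξ.smooth t ht).prodMk (hd t ht)))
  have h3 := (hsm.differentiableWithinAt (by simp)).hasDerivWithinAt
  refine h3.congr_deriv ?_
  ext η
  have h4 := hasDerivWithinAt_clm_apply_const h3 η
  have h5 := (hξ.eqn t ht η).derivWithin (hu t ht)
  have h6 := h4.derivWithin (hu t ht)
  simp only [dualPre_apply, ContinuousLinearMap.inr_apply] at h6
  rw [h5] at h6
  exact h6.symm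

/-- Position and momentum solve the linear system `hamField`. Zero position and velocity at `t₀`
give zero momentum, so uniqueness applies. -/
theorem IsQJacobi.eq_zero {ξ : ℝ → H} (hQ : IsQuadLagrangian Q) (hξ : IsQJacobi Q ξ) {t₀ : ℝ}
    (ht₀ : t₀ ∈ Icc (0 : ℝ) 1) (h0 : ξ t₀ = 0) (h1 : derivWithin ξ (Icc 0 1) t₀ = 0) :
    ∀ t ∈ Icc (0 : ℝ) 1, ξ t = 0 := by
  set Y : ℝ → H × (H →L[ℝ] ℝ) := fun t => (ξ t,
    dualPre (ContinuousLinearMap.inr ℝ H H) (Q t (ξ t, derivWithin ξ (Icc 0 1) t)))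
  have hv : ∀ t ∈ Icc (0 : ℝ) 1, hamVel Q t (Y t) = derivWithin ξ (Icc 0 1) t := fun t ht =>
    hQ.hamVel_eq ht _ _
  have hY : ∀ t ∈ Icc (0 : ℝ) 1, HasDerivWithinAt Y (hamField Q t (Y t)) (Icc 0 1) t := by
    intro t ht
    rw [hamField_apply, hv t ht]
    refine HasDerivWithinAt.prodMk ?_ ?_
    · exact ((hξ.smooth t ht).differentiableWithinAt (by simp)).hasDerivWithinAt
    · exact hξ.hasDerivWithinAt_momentum hQ ht
  intro t ht
  have := linearODE_solution_unique hQ.hamField_smooth.continuousOn hY ht₀ (by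
    simp only [Y, h0, h1, Prod.mk_zero_zero, map_zero]) t ht
  exact congrArg Prod.fst this

/-- `A` is the matrix of the solutions of the Euler-Lagrange equation of `Q` that vanish at `0`,
parametrized by their initial momentum; `Z` is its derivative and `M` its momentum. -/
structure IsJacobiTensor (Q : ℝ → (H × H) →L[ℝ] (H × H) →L[ℝ] ℝ)
    (A Z : ℝ → (H →L[ℝ] ℝ) →L[ℝ] H) (M : ℝ → (H →L[ℝ] ℝ) →L[ℝ] (H →L[ℝ] ℝ)) : Prop where
  A_zero : A 0 = 0
  M_zero : M 0 = ContinuousLinearMap.id ℝ _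
  A_smooth : ContDiffOn ℝ ∞ A (Icc 0 1)
  Z_smooth : ContDiffOn ℝ ∞ Z (Icc 0 1)
  A_deriv : ∀ t ∈ Icc (0 : ℝ) 1, HasDerivWithinAt A (Z t) (Icc 0 1) t
  M_deriv : ∀ t ∈ Icc (0 : ℝ) 1, ∃ M' : (H →L[ℝ] ℝ) →L[ℝ] (H →L[ℝ] ℝ),
    HasDerivWithinAt M M' (Icc 0 1) t ∧ ∀ α η, M' α η = Q t (A t α, Z t α) (η, 0)
  M_eq : ∀ t ∈ Icc (0 : ℝ) 1, ∀ α η, M t α η = Q t (A t α, Z t α) (0, η)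

/-- The Hamiltonian fundamental solution restricted to initial data (0, α): its position part is `A`
and its momentum part is `M`. -/
theorem IsQuadLagrangian.exists_jacobiTensor (hQ : IsQuadLagrangian Q) :
    ∃ A Z M, IsJacobiTensor Q A Z M := by
  obtain ⟨U, hU0, hUs, hU⟩ := exists_fundamentalSolution hQ.hamField_smooth
  set i : (H →L[ℝ] ℝ) →L[ℝ] H × (H →L[ℝ] ℝ) := ContinuousLinearMap.inr ℝ H _
  refine ⟨fun t => ContinuousLinearMap.fst ℝ H _ ∘L U t ∘L i, fun t => hamVel Q t ∘L U t ∘L i,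
    fun t => ContinuousLinearMap.snd ℝ H _ ∘L U t ∘L i, ?_, ?_, ?_, ?_, ?_, ?_, ?_⟩
  · rw [hU0]; ext; simp [i]
  · rw [hU0]; ext; simp [i]
  · exact contDiffOn_const.clm_comp (hUs.clm_comp contDiffOn_const)
  · exact hQ.hamVel_smooth.clm_comp (hUs.clm_comp contDiffOn_const)
  · intro t ht
    have := (hasDerivWithinAt_const t (Icc 0 1) (ContinuousLinearMap.fst ℝ H (H →L[ℝ] ℝ))).clm_comp
      ((hU t ht).clm_comp (hasDerivWithinAt_const t (Icc 0 1) i))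
    convert this using 1
    ext α
    simp [hamField_apply]
  · intro t ht
    refine ⟨_, (hasDerivWithinAt_const t (Icc 0 1)
      (ContinuousLinearMap.snd ℝ H (H →L[ℝ] ℝ))).clm_comp
      ((hU t ht).clm_comp (hasDerivWithinAt_const t (Icc 0 1) i)), fun α η => ?_⟩
    simp [hamField_apply]
  · intro t ht α η
    simpa using (hQ.legendre_hamVel ht (U t (i α)) η).symm

variable {A Z : ℝ → (H →L[ℝ] ℝ) →L[ℝ] H} {M : ℝ → (H →L[ℝ] ℝ) →L[ℝ] (H →L[ℝ] ℝ)}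

theorem IsJacobiTensor.isQJacobi (h : IsJacobiTensor Q A Z M) (α : H →L[ℝ] ℝ) :
    IsQJacobi Q (fun t => A t α) := by
  have hd : ∀ t ∈ Icc (0 : ℝ) 1, derivWithin (fun t => A t α) (Icc 0 1) t = Z t α := fun t ht => by
    have := (h.A_deriv t ht).clm_apply (hasDerivWithinAt_const t (Icc 0 1) α)
    simpa using this.derivWithin (uniqueDiffOn_Icc (zero_lt_one' ℝ) t ht)
  refine ⟨h.A_smooth.clm_apply contDiffOn_const, fun t ht η => ?_⟩
  obtain ⟨M', h1, h2⟩ := h.M_deriv t ht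
  have h3 := (h1.clm_apply (hasDerivWithinAt_const t (Icc 0 1) α)).clm_apply
    (hasDerivWithinAt_const t (Icc 0 1) η)
  rw [hd t ht, ← h2]
  refine (h3.congr_deriv (by simp)).congr_of_mem (fun s hs => ?_) ht
  rw [hd s hs, h.M_eq s hs]

/-- The derivative of `M t α (A t β)` is `Q t (A t α, Z t α) (A t β, Z t β)`, symmetric in α and β,
so the difference of the two sides is constant; it is zero at 0 because `A 0 = 0`. In symplectic
terms, the solutions vanishing at 0 form an isotropic space. -/
theorem IsJacobiTensor.symm (hQ : IsQuadLagrangian Q) (h : IsJacobiTensor Q A Z M) (α β : H →L[ℝ] ℝ) :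
    ∀ t ∈ Icc (0 : ℝ) 1, M t α (A t β) = M t β (A t α) := by
  have hd : ∀ α β : H →L[ℝ] ℝ, ∀ t ∈ Icc (0 : ℝ) 1, HasDerivWithinAt (fun t => M t α (A t β))
      (Q t (A t α, Z t α) (A t β, Z t β)) (Icc 0 1) t := by
    intro α β t ht
    obtain ⟨M', h1, h2⟩ := h.M_deriv t ht
    have h3 := (h1.clm_apply (hasDerivWithinAt_const t (Icc 0 1) α)).clm_apply
      ((h.A_deriv t ht).clm_apply (hasDerivWithinAt_const t (Icc 0 1) β))
    refine h3.congr_deriv ?_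
    simp only [map_zero, add_zero]
    rw [h2, h.M_eq t ht, ← map_add]
    simp
  intro t ht
  have h0 : ∀ t ∈ Icc (0 : ℝ) 1, HasDerivWithinAt
      (fun t => M t α (A t β) - M t β (A t α)) 0 (Icc 0 1) t := fun t ht => by
    refine ((hd α β t ht).sub (hd β α t ht)).congr_deriv ?_
    rw [hQ.symm t ht]; simp
  have := constant_of_has_deriv_right_zero (fun t ht => (h0 t ht).continuousWithinAt)
    (fun t ht => (h0 t ⟨ht.1, ht.2.le⟩).mono_of_mem_nhdsWithin
      (mem_of_superset (Icc_mem_nhdsGE ht.2) (Icc_subset_Icc_left ht.1))) t ht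
  simp only [h.A_zero] at this
  simpa [sub_eq_zero] using this

end QuadraticLagrangian

/-! ### Piecewise differentiable fields and integrability. -/

section Index

variable {H : Type*} [NormedAddCommGroup H] [NormedSpace ℝ H]

/-- Continuous functions on `[0,1]` that are differentiable with bounded derivative off a finite
set. -/
structure IsPiecewiseDiff (ξ : ℝ → H) : Prop where
  cont : ContinuousOn ξ (Icc 0 1)
  diff : ∃ s : Set ℝ, s.Finite ∧ ∃ C : ℝ, ∀ t ∈ Ioo (0 : ℝ) 1 \ s,
    DifferentiableAt ℝ ξ t ∧ ‖deriv ξ t‖ ≤ C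

variable [FiniteDimensional ℝ H]

theorem aestronglyMeasurable_deriv_restrict (ξ : ℝ → H) (μ : Measure ℝ) :
    AEStronglyMeasurable (deriv ξ) μ :=
  have := FiniteDimensional.complete ℝ H
  (stronglyMeasurable_deriv ξ).aestronglyMeasurable

theorem intervalIntegrable_of_bounded_off_finite {E : Type*} [NormedAddCommGroup E] {f : ℝ → E}
    {a b : ℝ} (hab : a ≤ b)
    (hm : AEStronglyMeasurable f (volume.restrict (Ioc a b))) {s : Set ℝ} (hs : s.Finite) {C : ℝ}
    (hC : ∀ t ∈ Ioo a b \ s, ‖f t‖ ≤ C) : IntervalIntegrable f volume a b := by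
  rw [intervalIntegrable_iff_integrableOn_Ioc_of_le hab]
  refine Integrable.of_bound hm C ?_
  have h1 : ∀ᵐ t ∂(volume.restrict (Ioc a b)), t ∉ s ∪ {b} :=
    ae_restrict_of_ae ((hs.union (finite_singleton b)).countable.ae_notMem _)
  filter_upwards [h1, ae_restrict_mem measurableSet_Ioc] with t h2 h3
  simp only [mem_union, mem_singleton_iff, not_or] at h2
  exact hC t ⟨⟨h3.1, lt_of_le_of_ne h3.2 h2.2⟩, h2.1⟩

theorem IsPiecewiseDiff.deriv_integrable {ξ : ℝ → H} (h : IsPiecewiseDiff ξ) {a b : ℝ}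
    (hab : a ≤ b) (ha : 0 ≤ a) (hb : b ≤ 1) : IntervalIntegrable (deriv ξ) volume a b := by
  obtain ⟨s, hs, C, hC⟩ := h.diff
  exact intervalIntegrable_of_bounded_off_finite hab (aestronglyMeasurable_deriv_restrict _ _) hs
    fun t ht => (hC t ⟨⟨ha.trans_lt ht.1.1, ht.1.2.trans_le hb⟩, ht.2⟩).2

/-- Integrating the bounded derivative gives linear growth from 0. For fields with ξ 0 = 0 this
balances the linear vanishing of the Jacobi tensor in `tendsto_boundary_term`. -/
theorem IsPiecewiseDiff.norm_sub_le {ξ : ℝ → H} (h : IsPiecewiseDiff ξ) :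
    ∃ C, ∀ t ∈ Icc (0 : ℝ) 1, ‖ξ t - ξ 0‖ ≤ C * t := by
  have := FiniteDimensional.complete ℝ H
  obtain ⟨s, hs, C, hC⟩ := h.diff
  refine ⟨C, fun t ht => ?_⟩
  rw [← integral_eq_of_hasDerivAt_off_countable_of_le ξ (deriv ξ) ht.1 hs.countable
    (h.cont.mono (Icc_subset_Icc_right ht.2))
    (fun x hx => (hC x ⟨⟨hx.1.1, hx.1.2.trans_le ht.2⟩, hx.2⟩).1.hasDerivAt)
    (h.deriv_integrable ht.1 le_rfl ht.2)]
  have := intervalIntegral.norm_integral_le_of_norm_le_const_ae (a := 0) (b := t) (C := C)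
    (f := deriv ξ) (by
      have h1 : ∀ᵐ x : ℝ, x ∉ s ∪ {1} := (hs.union (finite_singleton 1)).countable.ae_notMem _
      filter_upwards [h1] with x hx hx'
      rw [uIoc_of_le ht.1] at hx'
      simp only [mem_union, mem_singleton_iff, not_or] at hx
      exact (hC x ⟨⟨hx'.1, lt_of_le_of_ne (hx'.2.trans ht.2) hx.2⟩, hx.1⟩).2)
  simpa [abs_of_nonneg ht.1] using this

theorem _root_.ContinuousOn.aestronglyMeasurable_restrict_Ioc {E : Type*} [NormedAddCommGroup E]
    {R : ℝ → E} {a b : ℝ} (hR : ContinuousOn R (Icc a b)) :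
    AEStronglyMeasurable R (volume.restrict (Ioc a b)) :=
  (hR.aestronglyMeasurable_of_isCompact isCompact_Icc measurableSet_Icc).mono_measure
    (Measure.restrict_mono Ioc_subset_Icc_self le_rfl)

/-- A bounded measurable bilinear expression is integrable. -/
theorem intervalIntegrable_bilin {X : Type*} [NormedAddCommGroup X] [NormedSpace ℝ X]
    {R : ℝ → X →L[ℝ] X →L[ℝ] ℝ} {a b : ℝ} (hab : a ≤ b) (hR : ContinuousOn R (Icc a b))
    {u v : ℝ → X} (hu : AEStronglyMeasurable u (volume.restrict (Ioc a b)))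
    (hv : AEStronglyMeasurable v (volume.restrict (Ioc a b))) {s : Set ℝ} (hs : s.Finite)
    {C D : ℝ} (hC : ∀ t ∈ Ioo a b \ s, ‖u t‖ ≤ C) (hD : ∀ t ∈ Ioo a b \ s, ‖v t‖ ≤ D) :
    IntervalIntegrable (fun t => R t (u t) (v t)) volume a b := by
  obtain ⟨K, hK⟩ := IsCompact.exists_bound_of_continuousOn (E := X →L[ℝ] X →L[ℝ] ℝ)
    isCompact_Icc hR
  have hRm : AEStronglyMeasurable R (volume.restrict (Ioc a b)) :=
    ContinuousOn.aestronglyMeasurable_restrict_Ioc (E := X →L[ℝ] X →L[ℝ] ℝ) hR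
  have hc : Continuous fun p : (X →L[ℝ] X →L[ℝ] ℝ) × X × X => p.1 p.2.1 p.2.2 := by fun_prop
  refine intervalIntegrable_of_bounded_off_finite hab
    (hc.comp_aestronglyMeasurable (hRm.prodMk (hu.prodMk hv))) hs (C := K * C * D) fun t ht => ?_
  have hK0 := hK t (Ioo_subset_Icc_self ht.1)
  have h0 : 0 ≤ K := (norm_nonneg _).trans hK0
  have h1 : 0 ≤ C := (norm_nonneg _).trans (hC t ht)
  calc ‖R t (u t) (v t)‖ ≤ ‖R t‖ * ‖u t‖ * ‖v t‖ := (R t).le_opNorm₂ _ _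
    _ ≤ K * C * D := by
      have := hC t ht
      have := hD t ht
      gcongr

theorem IsPiecewiseDiff.jet {ξ : ℝ → H} (h : IsPiecewiseDiff ξ) (T : ℝ) :
    AEStronglyMeasurable (fun t => (T • ξ t, deriv ξ t)) (volume.restrict (Ioc 0 1)) ∧
    ∃ s : Set ℝ, s.Finite ∧ ∃ C : ℝ, ∀ t ∈ Ioo (0 : ℝ) 1 \ s, ‖(T • ξ t, deriv ξ t)‖ ≤ C := by
  constructor
  · refine AEStronglyMeasurable.prodMk ?_ (aestronglyMeasurable_deriv_restrict _ _)
    exact (h.cont.const_smul T).aestronglyMeasurable_restrict_Ioc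
  · obtain ⟨s, hs, C, hC⟩ := h.diff
    obtain ⟨K, hK⟩ := isCompact_Icc.exists_bound_of_continuousOn (h.cont.const_smul T)
    refine ⟨s, hs, max K C, fun t ht => ?_⟩
    rw [Prod.norm_mk]
    exact max_le_max (hK t (Ioo_subset_Icc_self ht.1)) (hC t ht).2

theorem IsPiecewiseDiff.integrable_bilin {ξ η : ℝ → H} (h : IsPiecewiseDiff ξ)
    (h' : IsPiecewiseDiff η) (T S : ℝ)
    {R : ℝ → (H × H) →L[ℝ] (H × H) →L[ℝ] ℝ} (hR : ContinuousOn R (Icc 0 1)) {a b : ℝ}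
    (hab : a ≤ b) (ha : 0 ≤ a) (hb : b ≤ 1) :
    IntervalIntegrable (fun t => R t (T • ξ t, deriv ξ t) (S • η t, deriv η t)) volume a b := by
  obtain ⟨h1, s, hs, C, hC⟩ := h.jet T
  obtain ⟨h1', s', hs', C', hC'⟩ := h'.jet S
  have hsub : Ioo a b ⊆ Ioo 0 1 := Ioo_subset_Ioo ha hb
  have hsub' : Ioc a b ⊆ Ioc 0 1 := Ioc_subset_Ioc ha hb
  refine intervalIntegrable_bilin hab (hR.mono (Icc_subset_Icc ha hb))
    (h1.mono_measure (Measure.restrict_mono hsub' le_rfl))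
    (h1'.mono_measure (Measure.restrict_mono hsub' le_rfl)) (hs.union hs') (C := C) (D := C')
    (fun t ht => hC t ⟨hsub ht.1, fun h => ht.2 (Or.inl h)⟩)
    (fun t ht => hC' t ⟨hsub ht.1, fun h => ht.2 (Or.inr h)⟩)

variable {Q : ℝ → (H × H) →L[ℝ] (H × H) →L[ℝ] ℝ}
  {A Z : ℝ → (H →L[ℝ] ℝ) →L[ℝ] H} {M : ℝ → (H →L[ℝ] ℝ) →L[ℝ] (H →L[ℝ] ℝ)}

/-- The integrand of the second variation. -/
def quadIntegrand (Q : ℝ → (H × H) →L[ℝ] (H × H) →L[ℝ] ℝ) (ξ η : ℝ → H) (t : ℝ) : ℝ :=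
  Q t (ξ t, deriv ξ t) (η t, deriv η t)

/-- The integrand of the second variation on `[0, T]`, with time rescaled to `[0, 1]`. -/
def scaledIntegrand (Q : ℝ → (H × H) →L[ℝ] (H × H) →L[ℝ] ℝ) (ξ : ℝ → H) (T t : ℝ) : ℝ :=
  Q (T * t) (T • ξ t, deriv ξ t) (T • ξ t, deriv ξ t)

/-- A t = t A' + o(t), and the injective A' is bounded below by 1/K in finite dimension. Half of
this bound absorbs the remainder, which explains the constant 1/(2K). -/
theorem exists_lower_bound_of_deriv {E F : Type*} [NormedAddCommGroup E] [NormedSpace ℝ E]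
    [NormedAddCommGroup F] [NormedSpace ℝ F] [FiniteDimensional ℝ E] {A : ℝ → E →L[ℝ] F}
    {A' : E →L[ℝ] F} (h0 : A 0 = 0) (hA : HasDerivWithinAt A A' (Icc 0 1) 0)
    (hinj : Function.Injective A') :
    ∃ c > 0, ∀ᶠ t in 𝓝[Icc 0 1] (0 : ℝ), ∀ α, c * t * ‖α‖ ≤ ‖A t α‖ := by
  obtain ⟨K, hK0, hK'⟩ := LinearMap.exists_antilipschitzWith (A' : E →ₗ[ℝ] F)
    (LinearMap.ker_eq_bot.2 hinj)
  have hK : ∀ α, ‖α‖ ≤ K * ‖A' α‖ := fun α => by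
    simpa using hK'.le_mul_dist α 0
  have hK0 : (0 : ℝ) < K := hK0
  refine ⟨1 / (2 * K), by positivity, ?_⟩
  have := (hasDerivWithinAt_iff_isLittleO.1 hA).def (c := 1 / (2 * K)) (by positivity)
  filter_upwards [this, self_mem_nhdsWithin] with t ht ht1 α
  simp only [h0, sub_zero] at ht
  have h1 : ‖(A t - t • A') α‖ ≤ 1 / (2 * K) * t * ‖α‖ := by
    refine ((A t - t • A').le_opNorm α).trans ?_
    rw [Real.norm_of_nonneg ht1.1] at ht
    gcongr
  have h2 : t * ‖A' α‖ ≤ ‖A t α‖ + ‖(A t - t • A') α‖ := by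
    have h3 : t • A' α = A t α - (A t - t • A') α := by
      simp
    have h4 : t * ‖A' α‖ = ‖t • A' α‖ := by rw [norm_smul, Real.norm_of_nonneg ht1.1]
    rw [h4, h3]
    exact _root_.norm_sub_le _ _
  have h3 : t * ‖α‖ ≤ t * (K * ‖A' α‖) := mul_le_mul_of_nonneg_left (hK α) ht1.1
  have h4 : 1 / (2 * K) * (t * ‖α‖) ≤ 1 / (2 * K) * (t * (K * ‖A' α‖)) := by gcongr
  have h5 : 1 / (2 * K) * (t * (K * ‖A' α‖)) = t * ‖A' α‖ / 2 := by field_simp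
  have h8 : 1 / (2 * K) * t * ‖α‖ = 1 / (2 * K) * (t * ‖α‖) := by ring
  rw [h8] at h1 ⊢
  linarith

/-- Near `0` the Jacobi tensor grows linearly. -/
theorem IsJacobiTensor.exists_lower_bound (h : IsJacobiTensor Q A Z M) :
    ∃ c > 0, ∀ᶠ t in 𝓝[Icc 0 1] (0 : ℝ), ∀ α, c * t * ‖α‖ ≤ ‖A t α‖ := by
  have h0 : (0 : ℝ) ∈ Icc (0 : ℝ) 1 := by simp
  refine exists_lower_bound_of_deriv h.A_zero (h.A_deriv 0 h0) ?_
  -- At time 0 the position vanishes, so `Z 0 α = 0` makes the momentum vanish as well, and `M 0` is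
  -- the identity.
  rw [injective_iff_map_eq_zero]
  intro α hα
  ext η
  have := h.M_eq 0 h0 α η
  rw [hα, h.A_zero, h.M_zero, zero_apply, Prod.mk_zero_zero, map_zero] at this
  simpa using this

end Index

/-! ### Completing the square with a Jacobi tensor. -/

section IndexForm

variable {H : Type*} [NormedAddCommGroup H] [NormedSpace ℝ H] [FiniteDimensional ℝ H]
  {Q : ℝ → (H × H) →L[ℝ] (H × H) →L[ℝ] ℝ}
  {A Z : ℝ → (H →L[ℝ] ℝ) →L[ℝ] H} {M : ℝ → (H →L[ℝ] ℝ) →L[ℝ] (H →L[ℝ] ℝ)}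

/-- The coefficients of a field with respect to a Jacobi tensor, on the rescaled interval. -/
def jacobiCoeff (A : ℝ → (H →L[ℝ] ℝ) →L[ℝ] H) (ξ : ℝ → H) (T u : ℝ) : H →L[ℝ] ℝ :=
  ContinuousLinearMap.inverse (A (T * u)) (ξ u)

/-- The defect `ξ' - A'A⁻¹ξ` of a field with respect to a Jacobi tensor. -/
def jacobiDefect (A Z : ℝ → (H →L[ℝ] ℝ) →L[ℝ] H) (ξ : ℝ → H) (T u : ℝ) : H :=
  deriv ξ u - T • Z (T * u) (jacobiCoeff A ξ T u)

theorem IsJacobiTensor.equiv (hinj : Function.Injective (A t)) :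
    ∃ e : (H →L[ℝ] ℝ) ≃L[ℝ] H, (e : _ →L[ℝ] H) = A t :=
  exists_equiv_of_injective (A t) hinj (finrank_dual H)

theorem apply_jacobiCoeff {ξ : ℝ → H} {T u : ℝ} (hinj : Function.Injective (A (T * u))) :
    A (T * u) (jacobiCoeff A ξ T u) = ξ u := by
  obtain ⟨e, he⟩ := IsJacobiTensor.equiv hinj
  rw [jacobiCoeff, ← he, ContinuousLinearMap.inverse_equiv]
  simp

theorem IsJacobiTensor.M_continuousOn (h : IsJacobiTensor Q A Z M) : ContinuousOn M (Icc 0 1) :=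
  fun t ht => by
    obtain ⟨M', h1, -⟩ := h.M_deriv t ht
    exact HasDerivWithinAt.continuousWithinAt (F := (H →L[ℝ] ℝ) →L[ℝ] (H →L[ℝ] ℝ)) h1

theorem mul_mem_Icc {T u : ℝ} (hT : T ∈ Ioc (0 : ℝ) 1) (hu : u ∈ Icc (0 : ℝ) 1) :
    T * u ∈ Icc (0 : ℝ) 1 :=
  ⟨mul_nonneg hT.1.le hu.1, mul_le_one₀ hT.2 hu.1 hu.2⟩

theorem mul_mem_Ioo {T u : ℝ} (hT : T ∈ Ioc (0 : ℝ) 1) (hu : u ∈ Ioo (0 : ℝ) 1) :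
    T * u ∈ Ioo (0 : ℝ) 1 :=
  ⟨mul_pos hT.1 hu.1, by nlinarith [hT.1, hT.2, hu.1, hu.2]⟩

theorem hasDerivAt_comp_mul {E : Type*} [NormedAddCommGroup E] [NormedSpace ℝ E] {f : ℝ → E}
    {f' : E} {T u : ℝ} (hT : T ∈ Ioc (0 : ℝ) 1) (hu : u ∈ Ioo (0 : ℝ) 1)
    (hf : HasDerivWithinAt f f' (Icc 0 1) (T * u)) :
    HasDerivAt (fun u => f (T * u)) (T • f') u := by
  have hm := mul_mem_Ioo hT hu
  have hd : HasDerivAt (fun u => T * u) T u := by simpa using (hasDerivAt_id u).const_mul T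
  exact HasDerivAt.scomp u (hf.hasDerivAt (Icc_mem_nhds hm.1 hm.2)) hd

theorem exists_hasDerivAt_inverse {E F : Type*} [NormedAddCommGroup E] [NormedSpace ℝ E]
    [NormedAddCommGroup F] [NormedSpace ℝ F] [CompleteSpace E] {a : ℝ → E →L[ℝ] F} {a' : E →L[ℝ] F}
    {u : ℝ} (ha : HasDerivAt a a' u) (e : E ≃L[ℝ] F) (he : (e : E →L[ℝ] F) = a u) :
    ∃ b', HasDerivAt (fun u => ContinuousLinearMap.inverse (a u)) b' u := by
  have h1 := (contDiffAt_map_inverse (n := 1) e).differentiableAt (by simp)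
  rw [he] at h1
  exact ⟨_, (DifferentiableAt.comp u h1 ha.differentiableAt).hasDerivAt⟩

theorem continuousWithinAt_inverse {E F : Type*} [NormedAddCommGroup E] [NormedSpace ℝ E]
    [NormedAddCommGroup F] [NormedSpace ℝ F] [CompleteSpace E] {a : ℝ → E →L[ℝ] F}
    {u : ℝ} {s : Set ℝ} (ha : ContinuousWithinAt a s u) (e : E ≃L[ℝ] F)
    (he : (e : E →L[ℝ] F) = a u) :
    ContinuousWithinAt (fun u => ContinuousLinearMap.inverse (a u)) s u := by
  have h1 := (contDiffAt_map_inverse (n := 0) e).continuousAt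
  rw [he] at h1
  exact h1.comp_continuousWithinAt ha

theorem continuousWithinAt_comp_mul {E : Type*} [TopologicalSpace E] {f : ℝ → E}
    {T u : ℝ} (hT : T ∈ Ioc (0 : ℝ) 1) (hu : u ∈ Icc (0 : ℝ) 1)
    (hf : ContinuousOn f (Icc 0 1)) : ContinuousWithinAt (fun u => f (T * u)) (Icc 0 1) u :=
  (hf _ (mul_mem_Icc hT hu)).comp (f := fun u => T * u) (by fun_prop)
    (fun _ hv => mul_mem_Icc hT hv)

theorem continuousWithinAt_jacobiCoeff (h : IsJacobiTensor Q A Z M) {ξ : ℝ → H} {T u : ℝ}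
    (hT : T ∈ Ioc (0 : ℝ) 1) (hu : u ∈ Icc (0 : ℝ) 1) (hinj : Function.Injective (A (T * u)))
    (hξ : ContinuousWithinAt ξ (Icc 0 1) u) :
    ContinuousWithinAt (jacobiCoeff A ξ T) (Icc 0 1) u := by
  obtain ⟨e, he⟩ := IsJacobiTensor.equiv hinj
  exact (continuousWithinAt_inverse (continuousWithinAt_comp_mul hT hu h.A_smooth.continuousOn) e
    he).clm_apply hξ

/-- Differentiating A(Tu) f(u) = ξ(u) gives T Z f + A f' = ξ'; solving for A f' leaves the defect.
-/
theorem hasDerivAt_jacobiCoeff (h : IsJacobiTensor Q A Z M) {ξ : ℝ → H} {T u : ℝ}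
    (hT : T ∈ Ioc (0 : ℝ) 1) (hu : u ∈ Ioo (0 : ℝ) 1)
    (hinj : ∀ v ∈ Ioc (0 : ℝ) 1, Function.Injective (A (T * v)))
    (hξ : DifferentiableAt ℝ ξ u) :
    ∃ f', HasDerivAt (jacobiCoeff A ξ T) f' u ∧ A (T * u) f' = jacobiDefect A Z ξ T u := by
  obtain ⟨e, he⟩ := IsJacobiTensor.equiv (hinj u (Ioo_subset_Ioc_self hu))
  have hA := hasDerivAt_comp_mul (E := (H →L[ℝ] ℝ) →L[ℝ] H) hT hu
    (h.A_deriv _ (Ioo_subset_Icc_self (mul_mem_Ioo hT hu)))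
  obtain ⟨b', h2⟩ := exists_hasDerivAt_inverse hA e he
  have h3 := h2.clm_apply hξ.hasDerivAt
  refine ⟨_, h3, ?_⟩
  have h4 := hA.clm_apply h3
  have h5 : (fun u => A (T * u) (ContinuousLinearMap.inverse (A (T * u)) (ξ u))) =ᶠ[𝓝 u] ξ := by
    filter_upwards [Ioo_mem_nhds hu.1 hu.2] with v hv
    exact apply_jacobiCoeff (hinj v (Ioo_subset_Ioc_self hv))
  have h6 := (h4.congr_of_eventuallyEq h5.symm).deriv
  exact eq_sub_of_add_eq' h6.symm

/-- This is the Legendre–Jacobi identity. With ξ = A f and ξ' = T Z f + w, the terms of the second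
variation that contain f alone or f together with w form a total derivative, and only the square of
w in the velocity slot is left. -/
theorem hasDerivAt_boundary_term (hQ : IsQuadLagrangian Q) (h : IsJacobiTensor Q A Z M)
    {ξ : ℝ → H} {T u : ℝ}
    (hT : T ∈ Ioc (0 : ℝ) 1) (hu : u ∈ Ioo (0 : ℝ) 1)
    (hinj : ∀ v ∈ Ioc (0 : ℝ) 1, Function.Injective (A (T * v)))
    (hξ : DifferentiableAt ℝ ξ u) :
    HasDerivAt (fun u => T * M (T * u) (jacobiCoeff A ξ T u) (ξ u))
      (scaledIntegrand Q ξ T u -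
        Q (T * u) (0, jacobiDefect A Z ξ T u) (0, jacobiDefect A Z ξ T u)) u := by
  have hm := Ioo_subset_Icc_self (mul_mem_Ioo hT hu)
  obtain ⟨f', hf, hf'⟩ := hasDerivAt_jacobiCoeff h hT hu hinj hξ
  obtain ⟨M', hM₀, hM'⟩ := h.M_deriv _ hm
  have hM := hasDerivAt_comp_mul (E := (H →L[ℝ] ℝ) →L[ℝ] (H →L[ℝ] ℝ)) hT hu hM₀
  have hAf := apply_jacobiCoeff (ξ := ξ) (hinj u (Ioo_subset_Ioc_self hu))
  refine (((hM.clm_apply hf).clm_apply hξ.hasDerivAt).const_mul T).congr_deriv ?_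
  set f := jacobiCoeff A ξ T u
  set w := jacobiDefect A Z ξ T u
  have hw : deriv ξ u = w + T • Z (T * u) f := by simp [w, jacobiDefect, f]
  -- The symmetry of the Jacobi tensor exchanges f' and f, so that f' enters only through A f' = w.
  have e1 : M (T * u) f' (ξ u) = Q (T * u) (ξ u, Z (T * u) f) (0, w) := by
    rw [← hAf, h.symm hQ f' f _ hm, hf', h.M_eq _ hm, hAf]
  have e2 : M (T * u) f (deriv ξ u) = Q (T * u) (ξ u, Z (T * u) f) (0, deriv ξ u) := by
    rw [h.M_eq _ hm, hAf]
  have e3 : M' f (ξ u) = Q (T * u) (ξ u, Z (T * u) f) (ξ u, 0) := by rw [hM', hAf]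
  set x : H × H := (ξ u, Z (T * u) f)
  set y : H × H := (0, w)
  have e4 : (T • ξ u, deriv ξ u) = T • x + y := by simp [x, y, hw, add_comm]
  have e5 : ((0 : H), deriv ξ u) = y + T • (0, Z (T * u) f) := by simp [y, hw]
  have e6 : ((ξ u, 0) : H × H) = x - (0, Z (T * u) f) := by simp [x]
  rw [scaledIntegrand, e4]
  simp only [add_apply, smul_apply, smul_eq_mul, e1, e2, e3, e5, e6, map_add, map_sub, map_smul]
  rw [hQ.symm _ hm y x]
  ring

theorem continuousOn_comp_mul {E : Type*} [TopologicalSpace E] {f : ℝ → E} {T : ℝ}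
    (hT : T ∈ Ioc (0 : ℝ) 1) (hf : ContinuousOn f (Icc 0 1)) :
    ContinuousOn (fun u => f (T * u)) (Icc 0 1) := fun _ hu =>
  continuousWithinAt_comp_mul hT hu hf

theorem scaledIntegrand_integrable (hQ : IsQuadLagrangian Q) {ξ : ℝ → H} (hξ : IsPiecewiseDiff ξ)
    {T : ℝ} (hT : T ∈ Ioc (0 : ℝ) 1) {a b : ℝ} (hab : a ≤ b) (ha : 0 ≤ a) (hb : b ≤ 1) :
    IntervalIntegrable (scaledIntegrand Q ξ T) volume a b :=
  hξ.integrable_bilin hξ T T (continuousOn_comp_mul hT hQ.smooth.continuousOn) hab ha hb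

/-- The coefficient A⁻¹ξ is continuous wherever A is invertible; A vanishes at 0, so boundedness is
obtained only on [ε,1]. -/
theorem defect_integrable (hQ : IsQuadLagrangian Q) (h : IsJacobiTensor Q A Z M) {ξ : ℝ → H}
    (hξ : IsPiecewiseDiff ξ) {T : ℝ} (hT : T ∈ Ioc (0 : ℝ) 1)
    (hinj : ∀ v ∈ Ioc (0 : ℝ) 1, Function.Injective (A (T * v))) {ε : ℝ} (hε : ε ∈ Ioc (0 : ℝ) 1) :
    IntervalIntegrable (fun u => Q (T * u) (0, jacobiDefect A Z ξ T u)
      (0, jacobiDefect A Z ξ T u)) volume ε 1 := by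
  have hsub : Icc ε 1 ⊆ Icc (0 : ℝ) 1 := Icc_subset_Icc_left hε.1.le
  have hc : ContinuousOn (fun u => T • Z (T * u) (jacobiCoeff A ξ T u)) (Icc ε 1) := by
    refine ContinuousOn.const_smul ?_ T
    refine ((continuousOn_comp_mul hT h.Z_smooth.continuousOn).mono hsub).clm_apply fun u hu => ?_
    exact (continuousWithinAt_jacobiCoeff h hT (hsub hu) (hinj u ⟨hε.1.trans_le hu.1, hu.2⟩)
      (hξ.cont u (hsub hu))).mono hsub
  obtain ⟨s, hs, C, hC⟩ := hξ.diff
  obtain ⟨K, hK⟩ := IsCompact.exists_bound_of_continuousOn isCompact_Icc hc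
  have hm : AEStronglyMeasurable (fun u => ((0 : H), jacobiDefect A Z ξ T u))
      (volume.restrict (Ioc ε 1)) :=
    aestronglyMeasurable_const.prodMk ((aestronglyMeasurable_deriv_restrict _ _).sub
      hc.aestronglyMeasurable_restrict_Ioc)
  have hb : ∀ t ∈ Ioo ε 1 \ s, ‖((0 : H), jacobiDefect A Z ξ T t)‖ ≤ C + K := by
    intro t ht
    rw [Prod.norm_mk, norm_zero, max_eq_right (norm_nonneg _)]
    refine (_root_.norm_sub_le _ _).trans (add_le_add (hC t ⟨⟨hε.1.trans ht.1.1, ht.1.2⟩, ht.2⟩).2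
      (hK t (Ioo_subset_Icc_self ht.1)))
  exact intervalIntegrable_bilin hε.2
    ((continuousOn_comp_mul hT hQ.smooth.continuousOn).mono hsub) hm hm hs hb hb

/-- The fundamental theorem of calculus off the corners of ξ. The boundary term at 1 drops out since
ξ 1 = 0; the one at ε is dealt with in `tendsto_boundary_term`. -/
theorem integral_scaled_eq (hQ : IsQuadLagrangian Q) (h : IsJacobiTensor Q A Z M) {ξ : ℝ → H}
    (hξ : IsPiecewiseDiff ξ) (hξ1 : ξ 1 = 0) {T : ℝ} (hT : T ∈ Ioc (0 : ℝ) 1)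
    (hinj : ∀ v ∈ Ioc (0 : ℝ) 1, Function.Injective (A (T * v))) {ε : ℝ} (hε : ε ∈ Ioc (0 : ℝ) 1) :
    ∫ u in ε..1, Q (T * u) (0, jacobiDefect A Z ξ T u) (0, jacobiDefect A Z ξ T u) =
      (∫ u in ε..1, scaledIntegrand Q ξ T u) +
        T * M (T * ε) (jacobiCoeff A ξ T ε) (ξ ε) := by
  obtain ⟨s, hs, C, hC⟩ := hξ.diff
  have hsub : Icc ε 1 ⊆ Icc (0 : ℝ) 1 := Icc_subset_Icc_left hε.1.le
  have i1 := scaledIntegrand_integrable hQ hξ hT hε.2 hε.1.le le_rfl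
  have i2 := defect_integrable hQ h hξ hT hinj hε
  have hMc : ContinuousOn (fun u => M (T * u)) (Icc 0 1) :=
    continuousOn_comp_mul hT h.M_continuousOn
  have hc : ContinuousOn (fun u => T * M (T * u) (jacobiCoeff A ξ T u) (ξ u)) (Icc ε 1) := by
    intro u hu
    refine ContinuousWithinAt.mul continuousWithinAt_const ?_
    refine ContinuousWithinAt.clm_apply (ContinuousWithinAt.clm_apply
      ((hMc u (hsub hu)).mono hsub) ?_) ((hξ.cont u (hsub hu)).mono hsub)
    exact (continuousWithinAt_jacobiCoeff h hT (hsub hu) (hinj u ⟨hε.1.trans_le hu.1, hu.2⟩)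
      (hξ.cont u (hsub hu))).mono hsub
  have := integral_eq_of_hasDerivAt_off_countable_of_le _ _ hε.2 hs.countable hc
    (fun u hu => hasDerivAt_boundary_term hQ h hT ⟨hε.1.trans hu.1.1, hu.1.2⟩ hinj
      (hC u ⟨⟨hε.1.trans hu.1.1, hu.1.2⟩, hu.2⟩).1) (i1.sub i2)
  rw [intervalIntegral.integral_sub i1 i2, hξ1, map_zero] at this
  linarith

/-- Since ‖ξ(ε)‖ ≤ Cε while A(Tε) expands by at least cTε, the coefficient A⁻¹ξ stays bounded by
C/(cT). M is bounded too, and the remaining factor ξ(ε) tends to 0. -/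
theorem tendsto_boundary_term (h : IsJacobiTensor Q A Z M) {ξ : ℝ → H}
    (hξ : IsPiecewiseDiff ξ) (hξ0 : ξ 0 = 0) {T : ℝ} (hT : T ∈ Ioc (0 : ℝ) 1)
    (hinj : ∀ v ∈ Ioc (0 : ℝ) 1, Function.Injective (A (T * v))) :
    Tendsto (fun ε => T * M (T * ε) (jacobiCoeff A ξ T ε) (ξ ε)) (𝓝[>] 0) (𝓝 0) := by
  obtain ⟨C, hC⟩ := hξ.norm_sub_le
  obtain ⟨c, hc, hlow⟩ := h.exists_lower_bound
  have hMc := h.M_continuousOn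
  obtain ⟨K, hK⟩ := IsCompact.exists_bound_of_continuousOn
    (E := (H →L[ℝ] ℝ) →L[ℝ] (H →L[ℝ] ℝ)) isCompact_Icc hMc
  have hmem : ∀ᶠ ε in 𝓝[>] (0 : ℝ), ε ∈ Ioc (0 : ℝ) 1 := Ioc_mem_nhdsGT one_pos
  have hT0 : Tendsto (fun ε => T * ε) (𝓝[>] 0) (𝓝[Icc 0 1] 0) := by
    refine tendsto_nhdsWithin_iff.2 ⟨?_, hmem.mono fun ε hε =>
      mul_mem_Icc hT (Ioc_subset_Icc_self hε)⟩
    have : Tendsto (fun ε : ℝ => T * ε) (𝓝 0) (𝓝 (T * 0)) := (continuous_const_mul T).tendsto 0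
    rw [mul_zero] at this
    exact this.mono_left nhdsWithin_le_nhds
  refine squeeze_zero_norm' (a := fun ε => T * (K * (C / (c * T))) * (C * ε)) ?_ ?_
  · filter_upwards [hmem, hT0.eventually hlow] with ε hε hl
    have hξε : ‖ξ ε‖ ≤ C * ε := by simpa [hξ0] using hC ε (Ioc_subset_Icc_self hε)
    have h1 := hl (jacobiCoeff A ξ T ε)
    rw [apply_jacobiCoeff (hinj ε hε)] at h1
    have hcT : 0 < c * T := mul_pos hc hT.1
    have h2 : ‖jacobiCoeff A ξ T ε‖ ≤ C / (c * T) := by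
      rw [le_div_iff₀ hcT]
      have h3 : (‖jacobiCoeff A ξ T ε‖ * (c * T)) * ε ≤ C * ε := by linarith
      exact le_of_mul_le_mul_right h3 hε.1
    have h4 := hK _ (mul_mem_Icc hT (Ioc_subset_Icc_self hε))
    have h5 : 0 ≤ K := (norm_nonneg _).trans h4
    rw [norm_mul, Real.norm_of_nonneg hT.1.le, mul_assoc]
    refine mul_le_mul_of_nonneg_left ?_ hT.1.le
    refine ((M (T * ε)).le_opNorm₂ _ _).trans ?_
    have h6 : 0 ≤ C / (c * T) := (norm_nonneg _).trans h2
    gcongr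
  · have : Tendsto (fun ε : ℝ => T * (K * (C / (c * T))) * (C * ε)) (𝓝 0)
        (𝓝 (T * (K * (C / (c * T))) * (C * 0))) := by
      apply Continuous.tendsto
      fun_prop
    rw [mul_zero, mul_zero] at this
    exact this.mono_left nhdsWithin_le_nhds

theorem tendsto_integral_lower {f : ℝ → ℝ} (hf : IntervalIntegrable f volume 0 1) :
    Tendsto (fun ε => ∫ u in ε..1, f u) (𝓝[>] 0) (𝓝 (∫ u in (0 : ℝ)..1, f u)) := by
  have h1 := intervalIntegral.continuousOn_primitive_interval' hf (a := 1) right_mem_uIcc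
  rw [uIcc_of_le (zero_le_one' ℝ)] at h1
  have h2 : Tendsto (fun ε => ∫ u in (1 : ℝ)..ε, f u) (𝓝[Icc 0 1] 0)
      (𝓝 (∫ u in (1 : ℝ)..0, f u)) := h1 0 (left_mem_Icc.2 zero_le_one)
  have h3 : 𝓝[>] (0 : ℝ) ≤ 𝓝[Icc 0 1] 0 := nhdsWithin_le_of_mem
    (mem_of_superset (Ioc_mem_nhdsGT (zero_lt_one' ℝ)) Ioc_subset_Icc_self)
  have h4 := (h2.mono_left h3).neg
  rw [← intervalIntegral.integral_symm] at h4
  exact h4.congr fun ε => (intervalIntegral.integral_symm _ _).symm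

theorem tendsto_integral_defect (hQ : IsQuadLagrangian Q) (h : IsJacobiTensor Q A Z M) {ξ : ℝ → H}
    (hξ : IsPiecewiseDiff ξ) (hξ0 : ξ 0 = 0) (hξ1 : ξ 1 = 0) {T : ℝ} (hT : T ∈ Ioc (0 : ℝ) 1)
    (hinj : ∀ v ∈ Ioc (0 : ℝ) 1, Function.Injective (A (T * v))) :
    Tendsto (fun ε => ∫ u in ε..1, Q (T * u) (0, jacobiDefect A Z ξ T u)
      (0, jacobiDefect A Z ξ T u)) (𝓝[>] 0) (𝓝 (∫ u in (0 : ℝ)..1, scaledIntegrand Q ξ T u)) := by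
  have h1 : Tendsto (fun ε => ∫ u in ε..1, scaledIntegrand Q ξ T u) (𝓝[>] 0)
      (𝓝 (∫ u in (0 : ℝ)..1, scaledIntegrand Q ξ T u)) := by
    exact tendsto_integral_lower (scaledIntegrand_integrable hQ hξ hT zero_le_one le_rfl le_rfl)
  have h2 := h1.add (tendsto_boundary_term h hξ hξ0 hT hinj)
  rw [add_zero] at h2
  refine h2.congr' ?_
  filter_upwards [Ioc_mem_nhdsGT (zero_lt_one' ℝ)] with ε hε
  exact (integral_scaled_eq hQ h hξ hξ1 hT hinj hε).symm

theorem IsQuadLagrangian.nonneg (hQ : IsQuadLagrangian Q) {t : ℝ} (ht : t ∈ Icc (0 : ℝ) 1) (w : H) :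
    0 ≤ Q t (0, w) (0, w) := by
  by_cases hw : w = 0
  · rw [hw, Prod.mk_zero_zero, map_zero]
  · exact (hQ.pos t ht w hw).le

theorem integral_defect_nonneg (hQ : IsQuadLagrangian Q) {ξ : ℝ → H} {T : ℝ}
    (hT : T ∈ Ioc (0 : ℝ) 1) {ε ε' : ℝ} (hε : 0 ≤ ε) (h : ε ≤ ε') (h1 : ε' ≤ 1) :
    0 ≤ ∫ u in ε..ε', Q (T * u) (0, jacobiDefect A Z ξ T u) (0, jacobiDefect A Z ξ T u) :=
  intervalIntegral.integral_nonneg h fun _ hu =>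
    hQ.nonneg (mul_mem_Icc hT ⟨hε.trans hu.1, hu.2.trans h1⟩) _

theorem scaled_integral_nonneg (hQ : IsQuadLagrangian Q) (h : IsJacobiTensor Q A Z M) {ξ : ℝ → H}
    (hξ : IsPiecewiseDiff ξ) (hξ0 : ξ 0 = 0) (hξ1 : ξ 1 = 0) {T : ℝ} (hT : T ∈ Ioc (0 : ℝ) 1)
    (hinj : ∀ v ∈ Ioc (0 : ℝ) 1, Function.Injective (A (T * v))) :
    0 ≤ ∫ u in (0 : ℝ)..1, scaledIntegrand Q ξ T u := by
  refine ge_of_tendsto (tendsto_integral_defect hQ h hξ hξ0 hξ1 hT hinj) ?_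
  filter_upwards [Ioc_mem_nhdsGT (zero_lt_one' ℝ)] with ε hε
  exact integral_defect_nonneg hQ hT hε.1.le hε.2 le_rfl

theorem scaledIntegrand_one (ξ : ℝ → H) : scaledIntegrand Q ξ 1 = quadIntegrand Q ξ ξ := by
  ext u; simp [scaledIntegrand, quadIntegrand]

/-- A zero integral forces the defect w to vanish almost everywhere. The coefficient f has
derivative A⁻¹w off a finite set, so it is constant on [u,1]; it vanishes at 1, and hence ξ(u) =
A(u) f(u) = 0. -/
theorem eq_zero_of_integral_eq_zero (hQ : IsQuadLagrangian Q) (h : IsJacobiTensor Q A Z M)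
    {ξ : ℝ → H} (hξ : IsPiecewiseDiff ξ) (hξ0 : ξ 0 = 0) (hξ1 : ξ 1 = 0)
    (hinj : ∀ v ∈ Ioc (0 : ℝ) 1, Function.Injective (A v))
    (hz : ∫ u in (0 : ℝ)..1, quadIntegrand Q ξ ξ u = 0) : ∀ u ∈ Icc (0 : ℝ) 1, ξ u = 0 := by
  have hT : (1 : ℝ) ∈ Ioc (0 : ℝ) 1 := by simp
  have hinj' : ∀ v ∈ Ioc (0 : ℝ) 1, Function.Injective (A (1 * v)) := by simpa using hinj
  have hlim := tendsto_integral_defect hQ h hξ hξ0 hξ1 hT hinj'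
  rw [scaledIntegrand_one, hz] at hlim
  obtain ⟨s, hs, C, hC⟩ := hξ.diff
  intro u hu
  rcases hu.1.eq_or_lt with h0 | h0
  · rw [← h0, hξ0]
  have huI : u ∈ Ioc (0 : ℝ) 1 := ⟨h0, hu.2⟩
  set N : ℝ → ℝ := fun u => Q (1 * u) (0, jacobiDefect A Z ξ 1 u) (0, jacobiDefect A Z ξ 1 u)
  have hNi : IntervalIntegrable N volume u 1 := defect_integrable hQ h hξ hT hinj' huI
  -- The integrand is nonnegative, so the integral over [u,1] is at most those over [ε,1] with ε <
  -- u, which tend to 0.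
  have hJ0 : ∫ v in u..1, N v = 0 := by
    refine le_antisymm (ge_of_tendsto hlim ?_) (integral_defect_nonneg hQ hT h0.le hu.2 le_rfl)
    filter_upwards [Ioo_mem_nhdsGT h0] with ε hε
    have hεI : ε ∈ Ioc (0 : ℝ) 1 := ⟨hε.1, hε.2.le.trans hu.2⟩
    have i1 : IntervalIntegrable N volume ε 1 := defect_integrable hQ h hξ hT hinj' hεI
    have i2 : IntervalIntegrable N volume ε u := i1.mono_set (by
      rw [uIcc_of_le hε.2.le, uIcc_of_le hεI.2]; exact Icc_subset_Icc_right hu.2)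
    rw [← intervalIntegral.integral_add_adjacent_intervals i2 hNi]
    have := integral_defect_nonneg (A := A) (Z := Z) (ξ := ξ) hQ hT hε.1.le hε.2.le hu.2
    linarith
  have hNz : N =ᵐ[volume.restrict (Ioc u 1)] 0 := by
    rw [intervalIntegral.integral_of_le hu.2] at hJ0
    refine (setIntegral_eq_zero_iff_of_nonneg_ae ?_ hNi.1).1 hJ0
    filter_upwards [ae_restrict_mem measurableSet_Ioc] with v hv
    exact hQ.nonneg (mul_mem_Icc hT ⟨h0.le.trans hv.1.le, hv.2⟩) _
  have hwz : ∀ᵐ v ∂(volume.restrict (Ioc u 1)),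
      ContinuousLinearMap.inverse (A v) (jacobiDefect A Z ξ 1 v) = 0 := by
    filter_upwards [hNz, ae_restrict_mem measurableSet_Ioc] with v hv hv1
    have : jacobiDefect A Z ξ 1 v = 0 := by
      by_contra hne
      exact (hQ.pos (1 * v) (mul_mem_Icc hT ⟨h0.le.trans hv1.1.le, hv1.2⟩) _ hne).ne' hv
    rw [this, map_zero]
  have hint : IntervalIntegrable (fun v => ContinuousLinearMap.inverse (A v)
      (jacobiDefect A Z ξ 1 v)) volume u 1 := by
    rw [intervalIntegrable_iff_integrableOn_Ioc_of_le hu.2]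
    exact (integrable_zero _ _ _).congr (hwz.mono fun v hv => hv.symm)
  have hftc := integral_eq_of_hasDerivAt_off_countable_of_le (jacobiCoeff A ξ 1) _ hu.2
    hs.countable (fun v hv => (continuousWithinAt_jacobiCoeff h hT ⟨h0.le.trans hv.1, hv.2⟩
      (hinj' v ⟨h0.trans_le hv.1, hv.2⟩) (hξ.cont v ⟨h0.le.trans hv.1, hv.2⟩)).mono
      (Icc_subset_Icc_left h0.le)) (fun v hv => by
        have hv' : v ∈ Ioo (0 : ℝ) 1 := ⟨h0.trans hv.1.1, hv.1.2⟩
        obtain ⟨f', h1, h2⟩ := hasDerivAt_jacobiCoeff h hT hv' hinj' (hC v ⟨hv', hv.2⟩).1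
        obtain ⟨e, he⟩ := IsJacobiTensor.equiv (hinj v (Ioo_subset_Ioc_self hv'))
        have : f' = ContinuousLinearMap.inverse (A v) (jacobiDefect A Z ξ 1 v) := by
          rw [← h2, one_mul, ← he, ContinuousLinearMap.inverse_equiv]
          simp
        rwa [← this]) hint
  rw [intervalIntegral.integral_of_le hu.2, integral_eq_zero_of_ae hwz] at hftc
  have h1 : jacobiCoeff A ξ 1 1 = 0 := by simp [jacobiCoeff, hξ1]
  rw [h1, zero_sub, eq_comm, neg_eq_zero] at hftc
  rw [← apply_jacobiCoeff (ξ := ξ) (hinj' u huI), hftc, map_zero]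

end IndexForm

/-! ### Jacobi's theorem for quadratic Lagrangians. -/

section IndexForm

variable {H : Type*} [NormedAddCommGroup H] [NormedSpace ℝ H] [FiniteDimensional ℝ H]
  {Q : ℝ → (H × H) →L[ℝ] (H × H) →L[ℝ] ℝ}

/-- The rescaled integrand belongs to the field s ↦ T ξ(s/T) on [0,T], which vanishes at both ends
whenever ξ does. So intervals shorter than [0,1] can be used with one fixed ξ, and the limit T → 1
follows by dominated convergence. -/
theorem IsQuadLagrangian.tendsto_scaled (hQ : IsQuadLagrangian Q) {ξ : ℝ → H}
    (hξ : IsPiecewiseDiff ξ) : Tendsto (fun T => ∫ u in (0 : ℝ)..1, scaledIntegrand Q ξ T u)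
      (𝓝[<] 1) (𝓝 (∫ u in (0 : ℝ)..1, quadIntegrand Q ξ ξ u)) := by
  have hmem : ∀ᶠ T in 𝓝[<] (1 : ℝ), T ∈ Ioo (0 : ℝ) 1 := Ioo_mem_nhdsLT zero_lt_one
  obtain ⟨K, hK⟩ := IsCompact.exists_bound_of_continuousOn
    (E := (H × H) →L[ℝ] (H × H) →L[ℝ] ℝ) isCompact_Icc hQ.smooth.continuousOn
  obtain ⟨-, s, hs, C, hC⟩ := hξ.jet 1
  have hae : ∀ᵐ u : ℝ, u ∉ s ∪ {1} := (hs.union (finite_singleton 1)).countable.ae_notMem _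
  refine intervalIntegral.tendsto_integral_filter_of_dominated_convergence (fun _ => K * C * C)
    ?_ ?_ intervalIntegrable_const ?_
  · filter_upwards [hmem] with T hT
    rw [uIoc_of_le zero_le_one]
    exact (scaledIntegrand_integrable hQ hξ ⟨hT.1, hT.2.le⟩ zero_le_one le_rfl
      le_rfl).1.aestronglyMeasurable
  · filter_upwards [hmem] with T hT
    filter_upwards [hae] with u hu hu'
    rw [uIoc_of_le zero_le_one] at hu'
    simp only [mem_union, mem_singleton_iff, not_or] at hu
    have hu1 : u ∈ Ioo (0 : ℝ) 1 := ⟨hu'.1, lt_of_le_of_ne hu'.2 hu.2⟩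
    have h1 := hK _ (mul_mem_Icc ⟨hT.1, hT.2.le⟩ (Ioo_subset_Icc_self hu1))
    have h0 : 0 ≤ K := (norm_nonneg _).trans h1
    have h2 : ‖(T • ξ u, deriv ξ u)‖ ≤ C := by
      refine le_trans ?_ (hC u ⟨hu1, hu.1⟩)
      rw [Prod.norm_mk, Prod.norm_mk, one_smul, norm_smul, Real.norm_of_nonneg hT.1.le]
      exact max_le_max_right _ (mul_le_of_le_one_left (norm_nonneg _) hT.2.le)
    have h3 : 0 ≤ C := (norm_nonneg _).trans h2
    refine ((Q (T * u)).le_opNorm₂ _ _).trans ?_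
    gcongr
  · refine Eventually.of_forall fun u hu => ?_
    rw [uIoc_of_le zero_le_one] at hu
    have hu' := Ioc_subset_Icc_self hu
    have h1 : Tendsto (fun T => Q (T * u)) (𝓝[<] 1) (𝓝 (Q u)) := by
      refine (hQ.smooth.continuousOn u hu').tendsto.comp (tendsto_nhdsWithin_iff.2 ⟨?_, ?_⟩)
      · have : Tendsto (fun T : ℝ => T * u) (𝓝 1) (𝓝 (1 * u)) :=
          (continuous_mul_const u).tendsto 1
        rw [one_mul] at this
        exact this.mono_left nhdsWithin_le_nhds
      · exact hmem.mono fun T hT => mul_mem_Icc ⟨hT.1, hT.2.le⟩ hu'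
    have h2 : Tendsto (fun T : ℝ => (T • ξ u, deriv ξ u)) (𝓝[<] 1) (𝓝 (ξ u, deriv ξ u)) := by
      refine Tendsto.prodMk_nhds ?_ tendsto_const_nhds
      have : Tendsto (fun T : ℝ => T • ξ u) (𝓝 1) (𝓝 ((1 : ℝ) • ξ u)) :=
        (continuous_id.smul continuous_const).tendsto 1
      rw [one_smul] at this
      exact this.mono_left nhdsWithin_le_nhds
    have hc : Continuous fun p : ((H × H) →L[ℝ] (H × H) →L[ℝ] ℝ) × (H × H) =>
        p.1 p.2 p.2 := by fun_prop
    exact (hc.tendsto (Q u, (ξ u, deriv ξ u))).comp (h1.prodMk_nhds h2)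

/-- A kernel vector α gives a solution that vanishes at 0 and at t, hence everywhere. Then its
velocity at 0 is zero, and so is its initial momentum, which is α. -/
theorem IsJacobiTensor.injective_of_not_conjugate {A Z : ℝ → (H →L[ℝ] ℝ) →L[ℝ] H}
    {M : ℝ → (H →L[ℝ] ℝ) →L[ℝ] (H →L[ℝ] ℝ)} (h : IsJacobiTensor Q A Z M) {t : ℝ}
    (hconj : ∀ J, IsQJacobi Q J → J 0 = 0 → J t = 0 → ∀ s ∈ Icc (0 : ℝ) 1, J s = 0) :
    Function.Injective (A t) := by
  rw [injective_iff_map_eq_zero]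
  intro α hα
  have h0 : (0 : ℝ) ∈ Icc (0 : ℝ) 1 := by simp
  have hz := hconj _ (h.isQJacobi α) (by simp [h.A_zero]) hα
  have hu := uniqueDiffOn_Icc (zero_lt_one' ℝ)
  have hZ : Z 0 α = 0 := by
    have h1 := (h.A_deriv 0 h0).clm_apply (hasDerivWithinAt_const 0 (Icc 0 1) α)
    have h2 := (hasDerivWithinAt_const (0 : ℝ) (Icc 0 1) (0 : H)).congr_of_mem
      (fun s hs => hz s hs) h0
    have := (h1.derivWithin (hu 0 h0)).symm.trans (h2.derivWithin (hu 0 h0))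
    simpa using this
  ext η
  have := h.M_eq 0 h0 α η
  rw [h.M_zero, hZ, h.A_zero, zero_apply, Prod.mk_zero_zero, map_zero] at this
  simpa using this

/-- Jacobi's condition, first part: without interior conjugate points the second variation is
nonnegative. -/
theorem IsQuadLagrangian.integral_nonneg (hQ : IsQuadLagrangian Q)
    (hconj : ∀ t ∈ Ioo (0 : ℝ) 1, ∀ J, IsQJacobi Q J → J 0 = 0 → J t = 0 →
      ∀ s ∈ Icc (0 : ℝ) 1, J s = 0)
    {ξ : ℝ → H} (hξ : IsPiecewiseDiff ξ) (hξ0 : ξ 0 = 0) (hξ1 : ξ 1 = 0) :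
    0 ≤ ∫ u in (0 : ℝ)..1, quadIntegrand Q ξ ξ u := by
  obtain ⟨A, Z, M, h⟩ := hQ.exists_jacobiTensor
  refine ge_of_tendsto (hQ.tendsto_scaled hξ) ?_
  filter_upwards [Ioo_mem_nhdsLT (zero_lt_one' ℝ)] with T hT
  refine scaled_integral_nonneg hQ h hξ hξ0 hξ1 ⟨hT.1, hT.2.le⟩ fun v hv => ?_
  -- Here T < 1 is essential: `T * v` never reaches 1, where a conjugate point is still allowed.
  have hv' : T * v ∈ Ioo (0 : ℝ) 1 := ⟨mul_pos hT.1 hv.1, by nlinarith [hT.1, hT.2, hv.1, hv.2]⟩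
  exact h.injective_of_not_conjugate (hconj _ hv')

/-- Jacobi's condition, second part: if moreover the end points are not conjugate, the second
variation is positive definite. -/
theorem IsQuadLagrangian.eq_zero_of_integral (hQ : IsQuadLagrangian Q)
    (hconj : ∀ t ∈ Ioc (0 : ℝ) 1, ∀ J, IsQJacobi Q J → J 0 = 0 → J t = 0 →
      ∀ s ∈ Icc (0 : ℝ) 1, J s = 0)
    {ξ : ℝ → H} (hξ : IsPiecewiseDiff ξ) (hξ0 : ξ 0 = 0) (hξ1 : ξ 1 = 0)
    (hz : ∫ u in (0 : ℝ)..1, quadIntegrand Q ξ ξ u = 0) : ∀ u ∈ Icc (0 : ℝ) 1, ξ u = 0 := by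
  obtain ⟨A, Z, M, h⟩ := hQ.exists_jacobiTensor
  exact eq_zero_of_integral_eq_zero hQ h hξ hξ0 hξ1 (fun v hv =>
    h.injective_of_not_conjugate (hconj v hv)) hz

theorem IsPiecewiseDiff.add {ξ ζ : ℝ → H} (h : IsPiecewiseDiff ξ) (h' : IsPiecewiseDiff ζ) :
    IsPiecewiseDiff (fun t => ξ t + ζ t) := by
  obtain ⟨s, hs, C, hC⟩ := h.diff
  obtain ⟨s', hs', C', hC'⟩ := h'.diff
  refine ⟨h.cont.add h'.cont, s ∪ s', hs.union hs', C + C', fun t ht => ?_⟩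
  obtain ⟨h1, h2⟩ := hC t ⟨ht.1, fun h => ht.2 (Or.inl h)⟩
  obtain ⟨h3, h4⟩ := hC' t ⟨ht.1, fun h => ht.2 (Or.inr h)⟩
  refine ⟨h1.add h3, ?_⟩
  rw [show (fun t => ξ t + ζ t) = ξ + ζ from rfl, deriv_add h1 h3]
  exact norm_add_le_of_le h2 h4

theorem IsPiecewiseDiff.const_smul {ξ : ℝ → H} (h : IsPiecewiseDiff ξ) (a : ℝ) :
    IsPiecewiseDiff (fun t => a • ξ t) := by
  obtain ⟨s, hs, C, hC⟩ := h.diff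
  refine ⟨h.cont.const_smul a, s, hs, |a| * C, fun t ht => ?_⟩
  obtain ⟨h1, h2⟩ := hC t ht
  refine ⟨h1.const_smul a, ?_⟩
  rw [show (fun t => a • ξ t) = a • ξ from rfl, deriv_const_smul a h1, norm_smul, Real.norm_eq_abs]
  gcongr

theorem IsPiecewiseDiff.of_contDiffOn {ξ : ℝ → H} (h : ContDiffOn ℝ ∞ ξ (Icc 0 1)) :
    IsPiecewiseDiff ξ := by
  have hd : ContinuousOn (derivWithin ξ (Icc 0 1)) (Icc 0 1) :=
    h.continuousOn_derivWithin (uniqueDiffOn_Icc zero_lt_one) (by simp)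
  obtain ⟨C, hC⟩ := isCompact_Icc.exists_bound_of_continuousOn hd
  refine ⟨h.continuousOn, ∅, finite_empty, C, fun t ht => ?_⟩
  have hn := Icc_mem_nhds ht.1.1 ht.1.2
  have ht' := Ioo_subset_Icc_self ht.1
  refine ⟨((h t ht').differentiableWithinAt (by simp)).differentiableAt hn, ?_⟩
  rw [← derivWithin_of_mem_nhds hn]
  exact hC t ht'

theorem deriv_truncate_lt {ξ : ℝ → H} {t₀ t : ℝ} (ht : t < t₀) :
    (fun t => ξ (min t t₀)) =ᶠ[𝓝 t] ξ := by
  filter_upwards [Iio_mem_nhds ht] with s hs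
  rw [min_eq_left (le_of_lt hs)]

theorem deriv_truncate_gt {ξ : ℝ → H} {t₀ t : ℝ} (ht : t₀ < t) :
    (fun t => ξ (min t t₀)) =ᶠ[𝓝 t] fun _ => ξ t₀ := by
  filter_upwards [Ioi_mem_nhds ht] with s hs
  rw [min_eq_right (le_of_lt hs)]

theorem IsPiecewiseDiff.truncate {ξ : ℝ → H} (h : IsPiecewiseDiff ξ) {t₀ : ℝ}
    (ht₀ : t₀ ∈ Ioo (0 : ℝ) 1) : IsPiecewiseDiff (fun t => ξ (min t t₀)) := by
  obtain ⟨s, hs, C, hC⟩ := h.diff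
  -- Stopping at `t₀` may create a corner there, and `max C 0` also bounds the zero derivative of
  -- the constant part.
  refine ⟨h.cont.comp (by fun_prop) (fun t ht => ⟨le_min ht.1 ht₀.1.le, (min_le_left _ _).trans
    ht.2⟩), s ∪ {t₀}, hs.union (finite_singleton _), max C 0, fun t ht => ?_⟩
  simp only [Set.mem_sdiff, mem_union, mem_singleton_iff, not_or] at ht
  rcases lt_or_gt_of_ne ht.2.2 with h1 | h1
  · have := hC t ⟨ht.1, ht.2.1⟩
    rw [(deriv_truncate_lt h1).deriv_eq, (deriv_truncate_lt h1).differentiableAt_iff]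
    exact ⟨this.1, this.2.trans (le_max_left _ _)⟩
  · rw [(deriv_truncate_gt h1).deriv_eq, (deriv_truncate_gt h1).differentiableAt_iff]
    simp

/-- Integration by parts. Before `t₀`, since ξ solves the Euler–Lagrange equation, every term except
the pure ζ-term is the derivative of the momentum of ξ paired with ξ + 2εζ. After `t₀` the stopped
field is identically zero. What survives is the boundary value at `t₀`, where ξ vanishes but its
momentum need not. -/
theorem integral_truncated_add (hQ : IsQuadLagrangian Q) {ξ ζ : ℝ → H} (hξ : IsQJacobi Q ξ)
    (hζ : IsPiecewiseDiff ζ) (hζ0 : ζ 0 = 0) {t₀ : ℝ} (ht₀ : t₀ ∈ Ioo (0 : ℝ) 1)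
    (hξ0 : ξ 0 = 0) (hξt : ξ t₀ = 0) (ε : ℝ) :
    ∫ t in (0 : ℝ)..1, quadIntegrand Q (fun t => ξ (min t t₀) + ε • ζ t)
        (fun t => ξ (min t t₀) + ε • ζ t) t =
      2 * ε * Q t₀ (0, derivWithin ξ (Icc 0 1) t₀) (0, ζ t₀) +
        ε ^ 2 * ∫ t in (0 : ℝ)..1, quadIntegrand Q ζ ζ t := by
  set X : ℝ → H := fun t => ξ (min t t₀) + ε • ζ t
  have hξp := IsPiecewiseDiff.of_contDiffOn hξ.smooth
  have hX : IsPiecewiseDiff X := (hξp.truncate ht₀).add (hζ.const_smul ε)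
  have hQc := hQ.smooth.continuousOn
  have iX : ∀ a b : ℝ, a ≤ b → 0 ≤ a → b ≤ 1 →
      IntervalIntegrable (quadIntegrand Q X X) volume a b := fun a b h1 h2 h3 => by
    have := hX.integrable_bilin hX 1 1 hQc h1 h2 h3
    simp only [one_smul] at this
    exact this
  have iζ : ∀ a b : ℝ, a ≤ b → 0 ≤ a → b ≤ 1 →
      IntervalIntegrable (quadIntegrand Q ζ ζ) volume a b := fun a b h1 h2 h3 => by
    have := hζ.integrable_bilin hζ 1 1 hQc h1 h2 h3
    simp only [one_smul] at this
    exact this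
  obtain ⟨s, hs, C, hC⟩ := hζ.diff
  have hfirst : ∫ t in (0 : ℝ)..t₀, (quadIntegrand Q X X t - ε ^ 2 * quadIntegrand Q ζ ζ t) =
      2 * ε * Q t₀ (0, derivWithin ξ (Icc 0 1) t₀) (0, ζ t₀) := by
    have hsub : Icc 0 t₀ ⊆ Icc (0 : ℝ) 1 := Icc_subset_Icc_right ht₀.2.le
    -- The factor 2ε occurs because, Q being symmetric, the mixed term in ξ and ζ appears twice.
    have hcont : ContinuousOn (fun t => dualPre (ContinuousLinearMap.inr ℝ H H)
        (Q t (ξ t, derivWithin ξ (Icc 0 1) t)) (ξ t + (2 * ε) • ζ t)) (Icc 0 t₀) := by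
      refine ContinuousOn.clm_apply (fun t ht => ?_) ?_
      · exact ((hξ.hasDerivWithinAt_momentum hQ (hsub ht)).continuousWithinAt).mono hsub
      · exact (hξp.cont.add (hζ.cont.const_smul _)).mono hsub
    have := integral_eq_of_hasDerivAt_off_countable_of_le _
      (fun t => quadIntegrand Q X X t - ε ^ 2 * quadIntegrand Q ζ ζ t) ht₀.1.le hs.countable hcont
      (fun t ht => by
        have ht1 : t ∈ Ioo (0 : ℝ) 1 := ⟨ht.1.1, ht.1.2.trans ht₀.2⟩
        have hn := Icc_mem_nhds ht1.1 ht1.2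
        have hξd : HasDerivAt ξ (derivWithin ξ (Icc 0 1) t) t :=
          ((hξ.smooth t (Ioo_subset_Icc_self ht1)).differentiableWithinAt
            (by simp)).hasDerivWithinAt.hasDerivAt hn
        have hζd := (hC t ⟨ht1, ht.2⟩).1.hasDerivAt
        have h1 := ((hξ.hasDerivWithinAt_momentum hQ (Ioo_subset_Icc_self ht1)).hasDerivAt
          hn).clm_apply (hξd.add (hζd.const_smul (2 * ε)))
        refine h1.congr_deriv ?_
        have hXd : deriv X t = derivWithin ξ (Icc 0 1) t + ε • deriv ζ t := by
          refine HasDerivAt.deriv ?_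
          exact (hξd.congr_of_eventuallyEq (deriv_truncate_lt ht.1.2)).add (hζd.const_smul ε)
        have hXt : X t = ξ t + ε • ζ t := by simp only [X, min_eq_left ht.1.2.le]
        simp only [quadIntegrand, hXd, hXt]
        set p : H × H := (ξ t, derivWithin ξ (Icc 0 1) t)
        set q : H × H := (ζ t, deriv ζ t)
        have e1 : (ξ t + ε • ζ t, derivWithin ξ (Icc 0 1) t + ε • deriv ζ t) = p + ε • q := rfl
        simp only [e1, dualPre_apply, ContinuousLinearMap.inl_apply, ContinuousLinearMap.inr_apply,
          Pi.add_apply, Pi.smul_apply]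
        rw [← map_add, show ((ξ t + (2 * ε) • ζ t, 0) : H × H) +
          (0, derivWithin ξ (Icc 0 1) t + (2 * ε) • deriv ζ t) = p + (2 * ε) • q by
            simp [p, q]]
        simp only [map_add, map_smul, add_apply, smul_apply, smul_eq_mul]
        rw [hQ.symm t (Ioo_subset_Icc_self ht1) q p]
        ring)
      ((iX _ _ ht₀.1.le le_rfl ht₀.2.le).sub ((iζ _ _ ht₀.1.le le_rfl ht₀.2.le).const_mul _))
    rw [this, hξ0, hξt, hζ0, smul_zero, add_zero, zero_add, map_zero, sub_zero, map_smul,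
      smul_eq_mul, dualPre_apply, ContinuousLinearMap.inr_apply]
  have hsecond : ∫ t in t₀..1, quadIntegrand Q X X t =
      ∫ t in t₀..1, ε ^ 2 * quadIntegrand Q ζ ζ t := by
    refine intervalIntegral.integral_congr_ae ?_
    have h1 : ∀ᵐ x : ℝ, x ∉ s ∪ {1} := (hs.union (finite_singleton 1)).countable.ae_notMem _
    filter_upwards [h1] with t ht ht'
    rw [uIoc_of_le ht₀.2.le] at ht'
    simp only [mem_union, mem_singleton_iff, not_or] at ht
    have ht1 : t ∈ Ioo (0 : ℝ) 1 := ⟨ht₀.1.trans ht'.1, lt_of_le_of_ne ht'.2 ht.2⟩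
    have hζd := (hC t ⟨ht1, ht.1⟩).1.hasDerivAt
    have hXd : deriv X t = ε • deriv ζ t := by
      refine HasDerivAt.deriv ?_
      exact (((hasDerivAt_const t (ξ t₀)).congr_of_eventuallyEq
        (deriv_truncate_gt ht'.1)).add (hζd.const_smul ε)).congr_deriv (zero_add _)
    have hXt : X t = ε • ζ t := by simp only [X, min_eq_right ht'.1.le, hξt, zero_add]
    have e1 : (ε • ζ t, ε • deriv ζ t) = ε • (ζ t, deriv ζ t) := rfl
    simp only [quadIntegrand, hXd, hXt, e1, map_smul, smul_apply, smul_eq_mul]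
    ring
  rw [← intervalIntegral.integral_add_adjacent_intervals (iX 0 t₀ ht₀.1.le le_rfl ht₀.2.le)
    (iX t₀ 1 ht₀.2.le ht₀.1.le le_rfl), ← intervalIntegral.integral_add_adjacent_intervals
    (iζ 0 t₀ ht₀.1.le le_rfl ht₀.2.le) (iζ t₀ 1 ht₀.2.le ht₀.1.le le_rfl), hsecond,
    intervalIntegral.integral_const_mul]
  rw [intervalIntegral.integral_sub (iX 0 t₀ ht₀.1.le le_rfl ht₀.2.le)
    ((iζ _ _ ht₀.1.le le_rfl ht₀.2.le).const_mul _), intervalIntegral.integral_const_mul] at hfirst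
  linarith

/-- Jacobi's necessary condition: past a conjugate point the second variation takes negative
values. -/
theorem exists_integral_neg (hQ : IsQuadLagrangian Q) {ξ ζ : ℝ → H} (hξ : IsQJacobi Q ξ)
    (hζ : IsPiecewiseDiff ζ) (hζ0 : ζ 0 = 0) {t₀ : ℝ} (ht₀ : t₀ ∈ Ioo (0 : ℝ) 1)
    (hξ0 : ξ 0 = 0) (hξt : ξ t₀ = 0)
    (hne : 0 < Q t₀ (0, derivWithin ξ (Icc 0 1) t₀) (0, ζ t₀)) :
    ∃ ε : ℝ, ∫ t in (0 : ℝ)..1, quadIntegrand Q (fun t => ξ (min t t₀) + ε • ζ t)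
        (fun t => ξ (min t t₀) + ε • ζ t) t < 0 := by
  set m := Q t₀ (0, derivWithin ξ (Icc 0 1) t₀) (0, ζ t₀)
  set K := ∫ t in (0 : ℝ)..1, quadIntegrand Q ζ ζ t
  -- With this ε the linear term is -2m²/(|K| + 1), while the quadratic term is at most m²/(|K| +
  -- 1).
  refine ⟨-m / (|K| + 1), ?_⟩
  rw [integral_truncated_add hQ hξ hζ hζ0 ht₀ hξ0 hξt]
  have hk : 0 < |K| + 1 := by positivity
  have h1 : (-m / (|K| + 1)) ^ 2 * K ≤ m ^ 2 / (|K| + 1) := by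
    rw [div_pow, neg_sq, div_mul_eq_mul_div, div_le_div_iff₀ (by positivity) hk]
    have : K ≤ |K| + 1 := (le_abs_self K).trans (by linarith)
    have h2 : m ^ 2 * K ≤ m ^ 2 * (|K| + 1) := by gcongr
    nlinarith
  have h2 : 2 * (-m / (|K| + 1)) * m = -2 * (m ^ 2 / (|K| + 1)) := by ring
  have h3 : 0 < m ^ 2 / (|K| + 1) := by positivity
  change 2 * (-m / (|K| + 1)) * m + (-m / (|K| + 1)) ^ 2 * K < 0
  linarith

end IndexForm

/-! ### Calculus of functions of (x, y) with y ≠ 0. -/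

section Coordinates

variable {n : ℕ}

/-- The points `(x, y)` with `x ∈ U` and `y ≠ 0`. -/
def slit (U : Set (EuclideanSpace ℝ (Fin n))) :
    Set (EuclideanSpace ℝ (Fin n) × EuclideanSpace ℝ (Fin n)) := U ×ˢ {0}ᶜ

theorem isOpen_slit {U : Set (EuclideanSpace ℝ (Fin n))} (hU : IsOpen U) : IsOpen (slit U) :=
  hU.prod isOpen_compl_singleton

/-- `f` is smooth as a function of `x ∈ U` and `y ≠ 0`. -/
def SmoothOff (U : Set (EuclideanSpace ℝ (Fin n)))
    (f : EuclideanSpace ℝ (Fin n) → EuclideanSpace ℝ (Fin n) → ℝ) : Prop :=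
  ContDiffOn ℝ ∞ (Function.uncurry f) (slit U)

variable {U : Set (EuclideanSpace ℝ (Fin n))}
  {f g : EuclideanSpace ℝ (Fin n) → EuclideanSpace ℝ (Fin n) → ℝ}
  {x y : EuclideanSpace ℝ (Fin n)}

theorem SmoothOff.contDiffAt (hU : IsOpen U) (hf : SmoothOff U f) (h : (x, y) ∈ slit U) :
    ContDiffAt ℝ ∞ (Function.uncurry f) (x, y) :=
  ContDiffOn.contDiffAt hf ((isOpen_slit hU).mem_nhds h)

theorem SmoothOff.differentiableAt (hU : IsOpen U) (hf : SmoothOff U f) (h : (x, y) ∈ slit U) :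
    DifferentiableAt ℝ (Function.uncurry f) (x, y) :=
  (hf.contDiffAt hU h).differentiableAt (by simp)

theorem SmoothOff.hasFDerivAt_fst (hU : IsOpen U) (hf : SmoothOff U f) (h : (x, y) ∈ slit U) :
    HasFDerivAt (fun z => f z y) (fderiv ℝ (Function.uncurry f) (x, y) ∘L
      ContinuousLinearMap.inl ℝ _ _) x :=
  HasFDerivAt.comp (g := Function.uncurry f) (f := fun z => (z, y)) x (hf.differentiableAt hU h).hasFDerivAt (hasFDerivAt_prodMk_left x y)

theorem SmoothOff.hasFDerivAt_snd (hU : IsOpen U) (hf : SmoothOff U f) (h : (x, y) ∈ slit U) :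
    HasFDerivAt (fun z => f x z) (fderiv ℝ (Function.uncurry f) (x, y) ∘L
      ContinuousLinearMap.inr ℝ _ _) y :=
  HasFDerivAt.comp (g := Function.uncurry f) (f := fun z => (x, z)) y (hf.differentiableAt hU h).hasFDerivAt (hasFDerivAt_prodMk_right x y)

theorem SmoothOff.dx_eq (hU : IsOpen U) (hf : SmoothOff U f) (h : (x, y) ∈ slit U) (i : Fin n) :
    dx f i x y = fderiv ℝ (Function.uncurry f) (x, y) (EuclideanSpace.single i 1, 0) := by
  rw [dx, (hf.hasFDerivAt_fst hU h).fderiv]; rfl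

theorem SmoothOff.dy_eq (hU : IsOpen U) (hf : SmoothOff U f) (h : (x, y) ∈ slit U) (i : Fin n) :
    dy f i x y = fderiv ℝ (Function.uncurry f) (x, y) (0, EuclideanSpace.single i 1) := by
  rw [dy, (hf.hasFDerivAt_snd hU h).fderiv]; rfl

theorem SmoothOff.fderiv_uncurry (hU : IsOpen U) (hf : SmoothOff U f) :
    ContDiffOn ℝ ∞ (fderiv ℝ (Function.uncurry f)) (slit U) :=
  hf.fderiv_of_isOpen (isOpen_slit hU) (by simp)

theorem SmoothOff.dx (hU : IsOpen U) (hf : SmoothOff U f) (i : Fin n) : SmoothOff U (dx f i) := by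
  refine ((hf.fderiv_uncurry hU).clm_apply (contDiffOn_const
    (c := (EuclideanSpace.single i 1, 0)))).congr fun q hq => ?_
  exact hf.dx_eq hU hq i

theorem SmoothOff.dy (hU : IsOpen U) (hf : SmoothOff U f) (i : Fin n) : SmoothOff U (dy f i) := by
  refine ((hf.fderiv_uncurry hU).clm_apply (contDiffOn_const
    (c := (0, EuclideanSpace.single i 1)))).congr fun q hq => ?_
  exact hf.dy_eq hU hq i

theorem SmoothOff.congr (hf : SmoothOff U f) (h : ∀ x y, (x, y) ∈ slit U → g x y = f x y) :
    SmoothOff U g := ContDiffOn.congr hf fun q hq => h q.1 q.2 hq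

theorem SmoothOff.add (hf : SmoothOff U f) (hg : SmoothOff U g) :
    SmoothOff U (fun x y => f x y + g x y) := ContDiffOn.add hf hg

theorem SmoothOff.sub (hf : SmoothOff U f) (hg : SmoothOff U g) :
    SmoothOff U (fun x y => f x y - g x y) := ContDiffOn.sub hf hg

theorem SmoothOff.mul (hf : SmoothOff U f) (hg : SmoothOff U g) :
    SmoothOff U (fun x y => f x y * g x y) := ContDiffOn.mul hf hg

theorem SmoothOff.const (c : ℝ) : SmoothOff U (fun _ _ => c) := contDiffOn_const

theorem SmoothOff.sum {ι : Type*} {s : Finset ι}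
    {F : ι → EuclideanSpace ℝ (Fin n) → EuclideanSpace ℝ (Fin n) → ℝ}
    (h : ∀ k ∈ s, SmoothOff U (F k)) : SmoothOff U (fun x y => ∑ k ∈ s, F k x y) :=
  ContDiffOn.sum (f := fun k => Function.uncurry (F k)) h

theorem SmoothOff.prod {ι : Type*} {s : Finset ι}
    {F : ι → EuclideanSpace ℝ (Fin n) → EuclideanSpace ℝ (Fin n) → ℝ}
    (h : ∀ k ∈ s, SmoothOff U (F k)) : SmoothOff U (fun x y => ∏ k ∈ s, F k x y) :=
  contDiffOn_prod (f := fun k => Function.uncurry (F k)) h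

theorem SmoothOff.coord (k : Fin n) : SmoothOff U (fun _ y => y k) := by
  have : ContDiff ℝ ∞ fun q : EuclideanSpace ℝ (Fin n) × EuclideanSpace ℝ (Fin n) => q.2 k :=
    (EuclideanSpace.proj (𝕜 := ℝ) k).contDiff.comp contDiff_snd
  exact this.contDiffOn

theorem eventually_snd (hU : IsOpen U) (h : (x, y) ∈ slit U) : ∀ᶠ z in 𝓝 y, (x, z) ∈ slit U :=
  (Continuous.prodMk_right x).continuousAt.eventually ((isOpen_slit hU).mem_nhds h)

theorem eventually_fst (hU : IsOpen U) (h : (x, y) ∈ slit U) : ∀ᶠ z in 𝓝 x, (z, y) ∈ slit U :=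
  (Continuous.prodMk_left y).continuousAt.eventually ((isOpen_slit hU).mem_nhds h)

theorem dx_congr (hU : IsOpen U) (hfg : ∀ x y, (x, y) ∈ slit U → f x y = g x y)
    (h : (x, y) ∈ slit U) (i : Fin n) : dx f i x y = dx g i x y := by
  have : (fun z => f z y) =ᶠ[𝓝 x] fun z => g z y :=
    (eventually_fst hU h).mono fun z hz => hfg z y hz
  rw [dx, dx, this.fderiv_eq]

theorem dy_congr (hU : IsOpen U) (hfg : ∀ x y, (x, y) ∈ slit U → f x y = g x y)
    (h : (x, y) ∈ slit U) (i : Fin n) : dy f i x y = dy g i x y := by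
  have : (fun z => f x z) =ᶠ[𝓝 y] fun z => g x z :=
    (eventually_snd hU h).mono fun z hz => hfg x z hz
  rw [dy, dy, this.fderiv_eq]

theorem dy_sub (hU : IsOpen U) (hf : SmoothOff U f) (hg : SmoothOff U g) (h : (x, y) ∈ slit U)
    (i : Fin n) : dy (fun x y => f x y - g x y) i x y = dy f i x y - dy g i x y := by
  rw [dy, ((hf.hasFDerivAt_snd hU h).fun_sub (hg.hasFDerivAt_snd hU h)).fderiv, hf.dy_eq hU h,
    hg.dy_eq hU h]; rfl

theorem dx_mul (hU : IsOpen U) (hf : SmoothOff U f) (hg : SmoothOff U g) (h : (x, y) ∈ slit U)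
    (i : Fin n) :
    dx (fun x y => f x y * g x y) i x y = dx f i x y * g x y + f x y * dx g i x y := by
  rw [dx, ((hf.hasFDerivAt_fst hU h).fun_mul (hg.hasFDerivAt_fst hU h)).fderiv, hf.dx_eq hU h,
    hg.dx_eq hU h]
  simp; ring

theorem dy_mul (hU : IsOpen U) (hf : SmoothOff U f) (hg : SmoothOff U g) (h : (x, y) ∈ slit U)
    (i : Fin n) :
    dy (fun x y => f x y * g x y) i x y = dy f i x y * g x y + f x y * dy g i x y := by
  rw [dy, ((hf.hasFDerivAt_snd hU h).fun_mul (hg.hasFDerivAt_snd hU h)).fderiv, hf.dy_eq hU h,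
    hg.dy_eq hU h]
  simp; ring

theorem dx_const_mul (hU : IsOpen U) (hf : SmoothOff U f) (c : ℝ) (h : (x, y) ∈ slit U)
    (i : Fin n) : dx (fun x y => c * f x y) i x y = c * dx f i x y := by
  rw [dx, ((hf.hasFDerivAt_fst hU h).const_mul c).fderiv, hf.dx_eq hU h]; rfl

theorem dy_const_mul (hU : IsOpen U) (hf : SmoothOff U f) (c : ℝ) (h : (x, y) ∈ slit U)
    (i : Fin n) : dy (fun x y => c * f x y) i x y = c * dy f i x y := by
  rw [dy, ((hf.hasFDerivAt_snd hU h).const_mul c).fderiv, hf.dy_eq hU h]; rfl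

theorem dx_sum (hU : IsOpen U) {ι : Type*} {s : Finset ι}
    {F : ι → EuclideanSpace ℝ (Fin n) → EuclideanSpace ℝ (Fin n) → ℝ}
    (hF : ∀ k ∈ s, SmoothOff U (F k)) (h : (x, y) ∈ slit U) (i : Fin n) :
    dx (fun x y => ∑ k ∈ s, F k x y) i x y = ∑ k ∈ s, dx (F k) i x y := by
  rw [dx, (HasFDerivAt.fun_sum fun k hk => (hF k hk).hasFDerivAt_fst hU h).fderiv]
  rw [sum_apply]
  exact Finset.sum_congr rfl fun k hk => ((hF k hk).dx_eq hU h i).symm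

theorem dy_sum (hU : IsOpen U) {ι : Type*} {s : Finset ι}
    {F : ι → EuclideanSpace ℝ (Fin n) → EuclideanSpace ℝ (Fin n) → ℝ}
    (hF : ∀ k ∈ s, SmoothOff U (F k)) (h : (x, y) ∈ slit U) (i : Fin n) :
    dy (fun x y => ∑ k ∈ s, F k x y) i x y = ∑ k ∈ s, dy (F k) i x y := by
  rw [dy, (HasFDerivAt.fun_sum fun k hk => (hF k hk).hasFDerivAt_snd hU h).fderiv]
  rw [sum_apply]
  exact Finset.sum_congr rfl fun k hk => ((hF k hk).dy_eq hU h i).symm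

theorem dy_coord (k i : Fin n) (x y : EuclideanSpace ℝ (Fin n)) :
    dy (fun _ y => y k) i x y = if k = i then 1 else 0 := by
  have : HasFDerivAt (fun z : EuclideanSpace ℝ (Fin n) => z k) (EuclideanSpace.proj (𝕜 := ℝ) k) y :=
    (EuclideanSpace.proj (𝕜 := ℝ) k).hasFDerivAt
  rw [dy, this.fderiv]
  simp

theorem dx_coord (k i : Fin n) (x y : EuclideanSpace ℝ (Fin n)) :
    dx (fun _ y => y k) i x y = 0 := by
  rw [dx, fderiv_fun_const]; simp

/-- `∂(yᵏ f_k)/∂yⁱ = f_i + yᵏ ∂f_k/∂yⁱ`. -/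
theorem dy_contract (hU : IsOpen U)
    {F : Fin n → EuclideanSpace ℝ (Fin n) → EuclideanSpace ℝ (Fin n) → ℝ}
    (hF : ∀ k, SmoothOff U (F k)) (h : (x, y) ∈ slit U) (i : Fin n) :
    dy (fun x y => ∑ k, y k * F k x y) i x y = F i x y + ∑ k, y k * dy (F k) i x y := by
  rw [dy_sum hU (fun k _ => (SmoothOff.coord k).mul (hF k)) h]
  simp only [dy_mul hU (SmoothOff.coord _) (hF _) h, dy_coord, Finset.sum_add_distrib]
  simp

theorem dx_contract (hU : IsOpen U)
    {F : Fin n → EuclideanSpace ℝ (Fin n) → EuclideanSpace ℝ (Fin n) → ℝ}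
    (hF : ∀ k, SmoothOff U (F k)) (h : (x, y) ∈ slit U) (i : Fin n) :
    dx (fun x y => ∑ k, y k * F k x y) i x y = ∑ k, y k * dx (F k) i x y := by
  rw [dx_sum hU (fun k _ => (SmoothOff.coord k).mul (hF k)) h]
  simp only [dx_mul hU (SmoothOff.coord _) (hF _) h, dx_coord]
  simp

theorem SmoothOff.isSymm (hU : IsOpen U) (hf : SmoothOff U f) (h : (x, y) ∈ slit U) :
    IsSymmSndFDerivAt ℝ (Function.uncurry f) (x, y) :=
  (hf.contDiffAt hU h).isSymmSndFDerivAt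
    (by simp; exact WithTop.coe_le_coe.2 (le_top (a := (2 : ℕ∞))))

theorem fderiv_clm_apply_const {E F G : Type*} [NormedAddCommGroup E] [NormedSpace ℝ E]
    [NormedAddCommGroup F] [NormedSpace ℝ F] [NormedAddCommGroup G] [NormedSpace ℝ G]
    {c : E → F →L[ℝ] G} {z : E} (hc : DifferentiableAt ℝ c z) (v : F) (w : E) :
    fderiv ℝ (fun z => c z v) z w = fderiv ℝ c z w v := by
  rw [fderiv_clm_apply hc (differentiableAt_const v)]
  simp

theorem SmoothOff.differentiableAt_fderiv (hU : IsOpen U) (hf : SmoothOff U f)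
    (h : (x, y) ∈ slit U) : DifferentiableAt ℝ (fderiv ℝ (Function.uncurry f)) (x, y) :=
  ((hf.fderiv_uncurry hU).contDiffAt ((isOpen_slit hU).mem_nhds h)).differentiableAt (by simp)

theorem SmoothOff.fderiv_dx (hU : IsOpen U) (hf : SmoothOff U f) (h : (x, y) ∈ slit U)
    (i : Fin n) (w : EuclideanSpace ℝ (Fin n) × EuclideanSpace ℝ (Fin n)) :
    fderiv ℝ (Function.uncurry (Finsler.dx f i)) (x, y) w =
      fderiv ℝ (fderiv ℝ (Function.uncurry f)) (x, y) w (EuclideanSpace.single i 1, 0) := by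
  have : Function.uncurry (Finsler.dx f i) =ᶠ[𝓝 (x, y)]
      fun q => fderiv ℝ (Function.uncurry f) q (EuclideanSpace.single i 1, 0) := by
    filter_upwards [(isOpen_slit hU).mem_nhds h] with q hq
    exact hf.dx_eq hU hq i
  rw [this.fderiv_eq, fderiv_clm_apply_const (hf.differentiableAt_fderiv hU h)]

theorem SmoothOff.fderiv_dy (hU : IsOpen U) (hf : SmoothOff U f) (h : (x, y) ∈ slit U)
    (i : Fin n) (w : EuclideanSpace ℝ (Fin n) × EuclideanSpace ℝ (Fin n)) :
    fderiv ℝ (Function.uncurry (Finsler.dy f i)) (x, y) w =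
      fderiv ℝ (fderiv ℝ (Function.uncurry f)) (x, y) w (0, EuclideanSpace.single i 1) := by
  have : Function.uncurry (Finsler.dy f i) =ᶠ[𝓝 (x, y)]
      fun q => fderiv ℝ (Function.uncurry f) q (0, EuclideanSpace.single i 1) := by
    filter_upwards [(isOpen_slit hU).mem_nhds h] with q hq
    exact hf.dy_eq hU hq i
  rw [this.fderiv_eq, fderiv_clm_apply_const (hf.differentiableAt_fderiv hU h)]

theorem dy_dx_comm (hU : IsOpen U) (hf : SmoothOff U f) (h : (x, y) ∈ slit U) (i j : Fin n) :
    dy (dx f i) j x y = dx (dy f j) i x y := by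
  rw [(hf.dx hU i).dy_eq hU h, (hf.dy hU j).dx_eq hU h, hf.fderiv_dx hU h, hf.fderiv_dy hU h]
  exact hf.isSymm hU h _ _

theorem dy_dy_comm (hU : IsOpen U) (hf : SmoothOff U f) (h : (x, y) ∈ slit U) (i j : Fin n) :
    dy (dy f i) j x y = dy (dy f j) i x y := by
  rw [(hf.dy hU i).dy_eq hU h, (hf.dy hU j).dy_eq hU h, hf.fderiv_dy hU h, hf.fderiv_dy hU h]
  exact hf.isSymm hU h _ _

theorem euclidean_eq_sum (v : EuclideanSpace ℝ (Fin n)) :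
    v = ∑ i, v i • EuclideanSpace.single i (1 : ℝ) := by
  ext j
  simp [Pi.single_apply]

theorem SmoothOff.fderiv_apply (hU : IsOpen U) (hf : SmoothOff U f) (h : (x, y) ∈ slit U)
    (v w : EuclideanSpace ℝ (Fin n)) :
    fderiv ℝ (Function.uncurry f) (x, y) (v, w) =
      ∑ i, v i * Finsler.dx f i x y + ∑ i, w i * Finsler.dy f i x y := by
  have h1 : (v, w) = ∑ i, v i • ((EuclideanSpace.single i (1 : ℝ), 0) :
      EuclideanSpace ℝ (Fin n) × EuclideanSpace ℝ (Fin n)) +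
      ∑ i, w i • ((0, EuclideanSpace.single i (1 : ℝ)) :
      EuclideanSpace ℝ (Fin n) × EuclideanSpace ℝ (Fin n)) := by
    refine Prod.ext ?_ ?_
    · simp only [Prod.fst_add, Prod.fst_sum, Prod.smul_fst, smul_zero, Finset.sum_const_zero,
        add_zero]
      exact euclidean_eq_sum v
    · simp only [Prod.snd_add, Prod.snd_sum, Prod.smul_snd, smul_zero, Finset.sum_const_zero,
        zero_add]
      exact euclidean_eq_sum w
  rw [h1, map_add, map_sum, map_sum]
  simp only [map_smul, smul_eq_mul, hf.dx_eq hU h, hf.dy_eq hU h]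

end Coordinates

/-! ### Identities for the fundamental tensor and the Cartan connection in coordinates. -/

section LocalFinsler

variable {n : ℕ}

/-- The coordinate expression of `F²`. -/
def sqr (L : EuclideanSpace ℝ (Fin n) → EuclideanSpace ℝ (Fin n) → ℝ)
    (x y : EuclideanSpace ℝ (Fin n)) : ℝ := L x y ^ 2

/-- `L` is the coordinate expression of a Finsler function over the open set `U`. -/
structure IsLocalFinsler (L : EuclideanSpace ℝ (Fin n) → EuclideanSpace ℝ (Fin n) → ℝ)
    (U : Set (EuclideanSpace ℝ (Fin n))) : Prop where
  isOpen : IsOpen U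
  smooth : SmoothOff U L
  homogeneous : ∀ x ∈ U, ∀ (y : EuclideanSpace ℝ (Fin n)) (a : ℝ), L x (a • y) = |a| * L x y
  posDef : ∀ x ∈ U, ∀ y u : EuclideanSpace ℝ (Fin n), y ≠ 0 → u ≠ 0 →
    0 < fderiv ℝ (fderiv ℝ (Function.uncurry (sqr L))) (x, y) (0, u) (0, u)

/-- The spray coefficients `Γⁱ_kl yᵏ yˡ`. -/
def spray (L : EuclideanSpace ℝ (Fin n) → EuclideanSpace ℝ (Fin n) → ℝ) (i : Fin n)
    (x y : EuclideanSpace ℝ (Fin n)) : ℝ :=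
  ∑ k, ∑ l, christoffel L i k l x y * y k * y l

variable {L : EuclideanSpace ℝ (Fin n) → EuclideanSpace ℝ (Fin n) → ℝ}
  {U : Set (EuclideanSpace ℝ (Fin n))} {x y : EuclideanSpace ℝ (Fin n)}

theorem gLow_def (i j : Fin n) : gLow L i j = fun x y => (1 / 2) * dy (dy (sqr L) j) i x y := rfl

theorem nonlinConn_def (i j : Fin n) :
    nonlinConn L i j = fun x y => (1 / 2) * dy (spray L i) j x y := rfl

theorem SmoothOff.det {A : Fin n → Fin n →
    EuclideanSpace ℝ (Fin n) → EuclideanSpace ℝ (Fin n) → ℝ}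
    (hA : ∀ i j, SmoothOff U (A i j)) :
    SmoothOff U (fun x y => (Matrix.of fun i j => A i j x y).det) := by
  simp only [Matrix.det_apply', Matrix.of_apply]
  exact SmoothOff.sum fun σ _ => (SmoothOff.const _).mul (SmoothOff.prod fun i _ => hA _ _)

namespace IsLocalFinsler

variable (hL : IsLocalFinsler L U)
include hL

theorem smooth_sqr : SmoothOff U (sqr L) :=
  (hL.smooth.mul hL.smooth).congr fun x y _ => by simp [sqr, sq]

theorem smooth_gLow (i j : Fin n) : SmoothOff U (gLow L i j) :=
  (SmoothOff.const (1 / 2)).mul ((hL.smooth_sqr.dy hL.isOpen j).dy hL.isOpen i)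

theorem gLow_comm (h : (x, y) ∈ slit U) (i j : Fin n) : gLow L i j x y = gLow L j i x y := by
  simp only [gLow_def, dy_dy_comm hL.isOpen hL.smooth_sqr h i j]

theorem dy_dy_sqr (i j : Fin n) : dy (dy (sqr L) j) i x y = 2 * gLow L i j x y := by
  simp [gLow_def]

theorem dy_gLow_comm (h : (x, y) ∈ slit U) (i j k : Fin n) :
    dy (gLow L i j) k x y = dy (gLow L j i) k x y :=
  dy_congr hL.isOpen (fun _ _ h => hL.gLow_comm h i j) h k

theorem dx_gLow_comm (h : (x, y) ∈ slit U) (i j k : Fin n) :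
    dx (gLow L i j) k x y = dx (gLow L j i) k x y :=
  dx_congr hL.isOpen (fun _ _ h => hL.gLow_comm h i j) h k

theorem dy_gLow_swap (h : (x, y) ∈ slit U) (i j k : Fin n) :
    dy (gLow L i j) k x y = dy (gLow L k j) i x y := by
  have h1 := hL.smooth_sqr.dy hL.isOpen j
  rw [gLow_def, gLow_def, dy_const_mul hL.isOpen (h1.dy hL.isOpen _) _ h,
    dy_const_mul hL.isOpen (h1.dy hL.isOpen _) _ h, dy_dy_comm hL.isOpen h1 h]

theorem fderiv_fderiv_sqr (h : (x, y) ∈ slit U) (a : EuclideanSpace ℝ (Fin n) ×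
      EuclideanSpace ℝ (Fin n)) (u : EuclideanSpace ℝ (Fin n)) :
    fderiv ℝ (fderiv ℝ (Function.uncurry (sqr L))) (x, y) a (0, u) =
      ∑ i, u i * (∑ k, a.1 k * dx (dy (sqr L) i) k x y + ∑ k, a.2 k * (2 * gLow L k i x y)) := by
  have h1 : ((0, u) : EuclideanSpace ℝ (Fin n) × EuclideanSpace ℝ (Fin n)) =
      ∑ i, u i • ((0, EuclideanSpace.single i (1 : ℝ)) :
      EuclideanSpace ℝ (Fin n) × EuclideanSpace ℝ (Fin n)) := by
    refine Prod.ext ?_ ?_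
    · simp only [Prod.fst_sum, Prod.smul_fst, smul_zero, Finset.sum_const_zero]
    · simp only [Prod.snd_sum, Prod.smul_snd]
      exact euclidean_eq_sum u
  rw [h1, map_sum]
  refine Finset.sum_congr rfl fun i _ => ?_
  rw [map_smul, smul_eq_mul, ← hL.smooth_sqr.fderiv_dy hL.isOpen h,
    show a = (a.1, a.2) from rfl, (hL.smooth_sqr.dy hL.isOpen i).fderiv_apply hL.isOpen h]
  simp only [hL.dy_dy_sqr]

/-- A kernel vector v of the matrix g would satisfy g(v,v) = 0. -/
theorem det_ne_zero (h : (x, y) ∈ slit U) : (Matrix.of fun a b => gLow L a b x y).det ≠ 0 := by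
  intro h0
  obtain ⟨v, hv, hv0⟩ := Matrix.exists_mulVec_eq_zero_iff.2 h0
  have hpos := hL.posDef x h.1 y (WithLp.toLp 2 v) h.2 (by simpa using hv)
  rw [hL.fderiv_fderiv_sqr h] at hpos
  refine hpos.ne' (Finset.sum_eq_zero fun i _ => ?_)
  have h1 := congrFun hv0 i
  simp only [Matrix.mulVec, dotProduct, Matrix.of_apply, Pi.zero_apply] at h1
  have h2 : ∑ k, v k * (2 * gLow L k i x y) = 2 * ∑ k, gLow L i k x y * v k := by
    rw [Finset.mul_sum]
    exact Finset.sum_congr rfl fun k _ => by rw [hL.gLow_comm h i k]; ring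
  simp only [PiLp.zero_apply, zero_mul, Finset.sum_const_zero, zero_add]
  rw [h2, h1]; simp

/-- By Cramer's rule the inverse is the adjugate divided by the determinant, and both are
polynomials in the g_ij. -/
theorem smooth_gUp (i j : Fin n) : SmoothOff U (gUp L i j) := by
  have hdet := SmoothOff.det hL.smooth_gLow
  have hadj : SmoothOff U fun x y => (Matrix.of fun a b => gLow L a b x y).adjugate i j := by
    have h1 : ∀ a b, SmoothOff U fun x y =>
        (Matrix.of fun a b => gLow L a b x y).updateRow j (Pi.single i 1) a b := by
      intro a b
      by_cases haj : a = j
      · subst haj; simp only [Matrix.updateRow_self]; exact SmoothOff.const _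
      · simp only [Matrix.updateRow_ne haj]; exact hL.smooth_gLow a b
    refine (SmoothOff.det h1).congr fun x y _ => ?_
    rw [Matrix.adjugate_apply]; rfl
  have hinv : SmoothOff U fun x y => ((Matrix.of fun a b => gLow L a b x y).det)⁻¹ :=
    ContDiffOn.inv hdet fun q hq => hL.det_ne_zero hq
  refine (hinv.mul hadj).congr fun x y h => ?_
  rw [gUp, Matrix.inv_def, Matrix.smul_apply, Ring.inverse_eq_inv', smul_eq_mul]

theorem sum_gLow_gUp (h : (x, y) ∈ slit U) (i j : Fin n) :
    ∑ s, gLow L i s x y * gUp L s j x y = if i = j then 1 else 0 := by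
  have h1 := Matrix.mul_nonsing_inv _ (isUnit_iff_ne_zero.2 (hL.det_ne_zero h))
  have h2 := congrFun (congrFun h1 i) j
  rwa [Matrix.mul_apply, Matrix.one_apply] at h2

/-- Identities between quantities with an upper index are proved below after lowering that index,
where the factors gⁱᵐ in the definitions cancel. -/
theorem eq_of_sum_gLow (h : (x, y) ∈ slit U) {v w : Fin n → ℝ}
    (hvw : ∀ i, ∑ s, gLow L i s x y * v s = ∑ s, gLow L i s x y * w s) (i : Fin n) :
    v i = w i := by
  have h1 := Matrix.mulVec_injective_iff_isUnit.2
    ((Matrix.isUnit_iff_isUnit_det _).2 (isUnit_iff_ne_zero.2 (hL.det_ne_zero h)))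
  exact congrFun (h1 (funext hvw)) i

/-- Lowering an index that was raised with `½ gⁱᵐ`. -/
theorem lower_half_raise (h : (x, y) ∈ slit U) (i : Fin n) (B : Fin n → ℝ) :
    ∑ s, gLow L i s x y * ((1 / 2) * ∑ m, gUp L s m x y * B m) = (1 / 2) * B i := by
  simp only [Finset.mul_sum]
  rw [Finset.sum_comm]
  have : ∀ m, ∑ s, gLow L i s x y * (1 / 2 * (gUp L s m x y * B m)) =
      (if i = m then 1 else 0) * ((1 / 2) * B m) := by
    intro m
    rw [← hL.sum_gLow_gUp h i m, Finset.sum_mul]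
    exact Finset.sum_congr rfl fun s _ => by ring
  simp only [this]
  simp

theorem smooth_christoffel (i j k : Fin n) : SmoothOff U (christoffel L i j k) := by
  have hU := hL.isOpen
  refine (SmoothOff.const (1 / 2)).mul (SmoothOff.sum fun m _ => (hL.smooth_gUp i m).mul ?_)
  exact (((hL.smooth_gLow m k).dx hU j).add ((hL.smooth_gLow j m).dx hU k)).sub
    ((hL.smooth_gLow j k).dx hU m)

theorem smooth_spray (i : Fin n) : SmoothOff U (spray L i) :=
  SmoothOff.sum fun k _ => SmoothOff.sum fun l _ =>
    ((hL.smooth_christoffel i k l).mul (SmoothOff.coord k)).mul (SmoothOff.coord l)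

theorem smooth_nonlinConn (i j : Fin n) : SmoothOff U (nonlinConn L i j) :=
  (SmoothOff.const (1 / 2)).mul ((hL.smooth_spray i).dy hL.isOpen j)

theorem dy_spray (i j : Fin n) : dy (spray L i) j x y = 2 * nonlinConn L i j x y := by
  simp [nonlinConn_def]

/-- Euler's relation in degree 2: differentiate L²(x, ay) = a² L²(x, y) at a = 1. -/
theorem fderiv_sqr_vertical (h : (x, y) ∈ slit U) :
    fderiv ℝ (Function.uncurry (sqr L)) (x, y) (0, y) = 2 * sqr L x y := by
  have h1 := hL.smooth_sqr.hasFDerivAt_snd hL.isOpen h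
  have h2 : HasDerivAt (fun a : ℝ => a • y) y 1 := by
    simpa using (hasDerivAt_id (1 : ℝ)).smul_const y
  have h3 : HasDerivAt (fun a : ℝ => sqr L x (a • y))
      (fderiv ℝ (Function.uncurry (sqr L)) (x, y) (0, y)) 1 := by
    have h4 : HasFDerivAt (fun z => sqr L x z) (fderiv ℝ (Function.uncurry (sqr L)) (x, y) ∘L
      ContinuousLinearMap.inr ℝ _ _) ((1 : ℝ) • y) := by rwa [one_smul]
    exact h4.comp_hasDerivAt (1 : ℝ) h2
  have h5 : HasDerivAt (fun a : ℝ => a ^ 2 * sqr L x y) (2 * sqr L x y) 1 := by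
    simpa using ((hasDerivAt_id (1 : ℝ)).pow 2).mul_const (sqr L x y)
  refine h3.unique (h5.congr_of_eventuallyEq (Eventually.of_forall fun a => ?_))
  simp only [sqr, hL.homogeneous x h.1, mul_pow, sq_abs]

theorem contract_dy_sqr (h : (x, y) ∈ slit U) : ∑ k, y k * dy (sqr L) k x y = 2 * sqr L x y := by
  rw [← hL.fderiv_sqr_vertical h, hL.smooth_sqr.fderiv_apply hL.isOpen h]
  simp

/-- Euler's relation differentiated in yⁱ. The other contraction identities for g come in the same
way, by differentiating in x or in y. -/
theorem contract_gLow (h : (x, y) ∈ slit U) (i : Fin n) :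
    ∑ k, y k * gLow L i k x y = (1 / 2) * dy (sqr L) i x y := by
  have hU := hL.isOpen
  have h1 := dy_congr hU (fun x y h => hL.contract_dy_sqr h) h i
  rw [dy_contract hU (fun k => hL.smooth_sqr.dy hU k) h, dy_const_mul hU hL.smooth_sqr _ h] at h1
  simp only [hL.dy_dy_sqr] at h1
  have h2 : ∑ k, y k * (2 * gLow L i k x y) = 2 * ∑ k, y k * gLow L i k x y := by
    rw [Finset.mul_sum]; exact Finset.sum_congr rfl fun k _ => by ring
  linarith

/-- Differentiating `contract_gLow` in yʲ produces g_ij on both sides; after cancellation the Cartan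
tensor annihilates y. Its total symmetry gives the same for the other two slots. -/
theorem contract_dy_gLow (h : (x, y) ∈ slit U) (i j : Fin n) :
    ∑ k, y k * dy (gLow L i k) j x y = 0 := by
  have hU := hL.isOpen
  have h1 := dy_congr hU (fun x y h => hL.contract_gLow h i) h j
  rw [dy_contract hU (fun k => hL.smooth_gLow i k) h,
    dy_const_mul hU (hL.smooth_sqr.dy hU i) _ h, hL.dy_dy_sqr, hL.gLow_comm h j i] at h1
  linarith

theorem contract_dy_gLow_fst (h : (x, y) ∈ slit U) (i j : Fin n) :
    ∑ k, y k * dy (gLow L k i) j x y = 0 := by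
  rw [← hL.contract_dy_gLow h i j]
  exact Finset.sum_congr rfl fun k _ => by rw [hL.dy_gLow_comm h]

theorem contract_dy_gLow_deriv (h : (x, y) ∈ slit U) (i j : Fin n) :
    ∑ k, y k * dy (gLow L i j) k x y = 0 := by
  rw [← hL.contract_dy_gLow_fst h j i]
  exact Finset.sum_congr rfl fun k _ => by rw [hL.dy_gLow_swap h]

theorem contract_dx_gLow (h : (x, y) ∈ slit U) (i m : Fin n) :
    ∑ k, y k * dx (gLow L i k) m x y = (1 / 2) * dx (dy (sqr L) i) m x y := by
  have hU := hL.isOpen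
  have h1 := dx_congr hU (fun x y h => hL.contract_gLow h i) h m
  rwa [dx_contract hU (fun k => hL.smooth_gLow i k) h,
    dx_const_mul hU (hL.smooth_sqr.dy hU i) _ h] at h1

theorem contract_dx_gLow_fst (h : (x, y) ∈ slit U) (i m : Fin n) :
    ∑ k, y k * dx (gLow L k i) m x y = (1 / 2) * dx (dy (sqr L) i) m x y := by
  rw [← hL.contract_dx_gLow h i m]
  exact Finset.sum_congr rfl fun k _ => by rw [hL.dx_gLow_comm h]

theorem contract_dx_dy_sqr (h : (x, y) ∈ slit U) (m : Fin n) :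
    ∑ k, y k * dx (dy (sqr L) k) m x y = 2 * dx (sqr L) m x y := by
  have hU := hL.isOpen
  have h1 := dx_congr hU (fun x y h => hL.contract_dy_sqr h) h m
  rwa [dx_contract hU (fun k => hL.smooth_sqr.dy hU k) h, dx_const_mul hU hL.smooth_sqr _ h] at h1

/-- `g_is Γˢ_kl yᵏ yˡ = ½ (yᵏ ∂²L²/∂xᵏ∂yⁱ - ∂L²/∂xⁱ)`. -/
theorem sum_gLow_spray (h : (x, y) ∈ slit U) (i : Fin n) :
    ∑ s, gLow L i s x y * spray L s x y =
      (1 / 2) * (∑ k, y k * dx (dy (sqr L) i) k x y - dx (sqr L) i x y) := by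
  have h1 : ∑ s, gLow L i s x y * spray L s x y =
      ∑ k, ∑ l, (y k * y l) * ∑ s, gLow L i s x y * christoffel L s k l x y := by
    simp only [spray, Finset.mul_sum]
    rw [Finset.sum_comm]
    refine Finset.sum_congr rfl fun k _ => ?_
    rw [Finset.sum_comm]
    exact Finset.sum_congr rfl fun l _ => Finset.sum_congr rfl fun s _ => by ring
  have h2 : ∀ k l, ∑ s, gLow L i s x y * christoffel L s k l x y =
      (1 / 2) * (dx (gLow L i l) k x y + dx (gLow L k i) l x y - dx (gLow L k l) i x y) :=
    fun k l => hL.lower_half_raise h i fun m =>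
      dx (gLow L m l) k x y + dx (gLow L k m) l x y - dx (gLow L k l) m x y
  have h3 : ∑ k, ∑ l, (y k * y l) * ((1 / 2) *
      (dx (gLow L i l) k x y + dx (gLow L k i) l x y - dx (gLow L k l) i x y)) =
      (1 / 2) * (∑ k, y k * ∑ l, y l * dx (gLow L i l) k x y
        + ∑ l, y l * ∑ k, y k * dx (gLow L k i) l x y
        - ∑ k, y k * ∑ l, y l * dx (gLow L k l) i x y) := by
    have h4 : ∑ l, y l * ∑ k, y k * dx (gLow L k i) l x y =
        ∑ k, ∑ l, y l * (y k * dx (gLow L k i) l x y) := by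
      rw [Finset.sum_comm]; simp only [Finset.mul_sum]
    rw [h4]
    simp only [Finset.mul_sum, ← Finset.sum_add_distrib, ← Finset.sum_sub_distrib]
    exact Finset.sum_congr rfl fun k _ => Finset.sum_congr rfl fun l _ => by ring
  rw [h1]
  simp only [h2]
  rw [h3]
  simp only [hL.contract_dx_gLow h, hL.contract_dx_gLow_fst h]
  have h5 : ∑ k, y k * (1 / 2 * dx (dy (sqr L) k) i x y) = dx (sqr L) i x y := by
    have := hL.contract_dx_dy_sqr h i
    have h6 : ∑ k, y k * (1 / 2 * dx (dy (sqr L) k) i x y) =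
      (1 / 2) * ∑ k, y k * dx (dy (sqr L) k) i x y := by
      rw [Finset.mul_sum]; exact Finset.sum_congr rfl fun k _ => by ring
    rw [h6, this]; ring
  have h6 : ∑ k, y k * (1 / 2 * dx (dy (sqr L) i) k x y) =
      (1 / 2) * ∑ k, y k * dx (dy (sqr L) i) k x y := by
    rw [Finset.mul_sum]; exact Finset.sum_congr rfl fun k _ => by ring
  rw [h5, h6]; ring

theorem dx_dy_dy_sqr (h : (x, y) ∈ slit U) (i m k : Fin n) :
    dy (dx (dy (sqr L) i) k) m x y = 2 * dx (gLow L m i) k x y := by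
  have hU := hL.isOpen
  rw [dy_dx_comm hU (hL.smooth_sqr.dy hU i) h, dx_congr hU (fun x y _ => hL.dy_dy_sqr m i) h,
    dx_const_mul hU (hL.smooth_gLow m i) _ h]

/-- The derivative of `sum_gLow_spray` along the fibre. -/
theorem dy_sum_gLow_spray (h : (x, y) ∈ slit U) (i m : Fin n) :
    ∑ s, dy (gLow L i s) m x y * spray L s x y
      + ∑ s, gLow L i s x y * (2 * nonlinConn L s m x y) =
    (1 / 2) * (dx (dy (sqr L) i) m x y + ∑ k, y k * (2 * dx (gLow L m i) k x y)
      - dx (dy (sqr L) m) i x y) := by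
  have hU := hL.isOpen
  have h1 := dy_congr hU (fun x y h => hL.sum_gLow_spray h i) h m
  have h2 : ∀ k, SmoothOff U (dx (dy (sqr L) i) k) := fun k => (hL.smooth_sqr.dy hU i).dx hU k
  rw [dy_sum hU (fun s _ => (hL.smooth_gLow i s).mul (hL.smooth_spray s)) h,
    dy_const_mul hU ((SmoothOff.sum fun k _ => (SmoothOff.coord k).mul (h2 k)).sub
      (hL.smooth_sqr.dx hU i)) _ h,
    dy_sub hU (SmoothOff.sum fun k _ => (SmoothOff.coord k).mul (h2 k)) (hL.smooth_sqr.dx hU i) h,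
    dy_contract hU h2 h, dy_dx_comm hU hL.smooth_sqr h] at h1
  simp only [dy_mul hU (hL.smooth_gLow _ _) (hL.smooth_spray _) h, hL.dx_dy_dy_sqr h,
    hL.dy_spray, Finset.sum_add_distrib] at h1
  exact h1

/-- `Nⁱ_m yᵐ = Γⁱ_kl yᵏ yˡ`. -/
theorem contract_nonlinConn (h : (x, y) ∈ slit U) (i : Fin n) :
    ∑ m, y m * nonlinConn L i m x y = spray L i x y := by
  refine hL.eq_of_sum_gLow h (v := fun i => ∑ m, y m * nonlinConn L i m x y)
    (w := fun i => spray L i x y) (fun i => ?_) i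
  -- `dy_sum_gLow_spray` is contracted with yᵐ. The term with the Cartan tensor disappears, and both
  -- sides become twice a lowered vector.
  have h1 : ∑ m, y m * (∑ s, dy (gLow L i s) m x y * spray L s x y
      + ∑ s, gLow L i s x y * (2 * nonlinConn L s m x y)) =
      2 * ∑ s, gLow L i s x y * ∑ m, y m * nonlinConn L s m x y := by
    have h2 : ∑ m, y m * ∑ s, dy (gLow L i s) m x y * spray L s x y =
        ∑ s, spray L s x y * ∑ m, y m * dy (gLow L i s) m x y := by
      simp only [Finset.mul_sum]
      rw [Finset.sum_comm]
      exact Finset.sum_congr rfl fun s _ => Finset.sum_congr rfl fun m _ => by ring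
    simp only [mul_add, Finset.sum_add_distrib]
    rw [h2]
    simp only [hL.contract_dy_gLow_deriv h, mul_zero, Finset.sum_const_zero, zero_add,
      Finset.mul_sum]
    rw [Finset.sum_comm]
    exact Finset.sum_congr rfl fun s _ => Finset.sum_congr rfl fun m _ => by ring
  have h3 : ∑ m, y m * ((1 / 2) * (dx (dy (sqr L) i) m x y +
      ∑ k, y k * (2 * dx (gLow L m i) k x y) - dx (dy (sqr L) m) i x y)) =
      2 * ∑ s, gLow L i s x y * spray L s x y := by
    have h4 : ∑ m, y m * ∑ k, y k * (2 * dx (gLow L m i) k x y) =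
        ∑ k, y k * dx (dy (sqr L) i) k x y := by
      have h5 : ∑ m, y m * ∑ k, y k * (2 * dx (gLow L m i) k x y) =
          ∑ k, y k * (2 * ∑ m, y m * dx (gLow L m i) k x y) := by
        simp only [Finset.mul_sum]
        rw [Finset.sum_comm]
        exact Finset.sum_congr rfl fun s _ => Finset.sum_congr rfl fun m _ => by ring
      rw [h5]
      refine Finset.sum_congr rfl fun k _ => ?_
      rw [hL.contract_dx_gLow_fst h]; ring
    have h6 : ∑ m, y m * ((1 / 2) * (dx (dy (sqr L) i) m x y +
      ∑ k, y k * (2 * dx (gLow L m i) k x y) - dx (dy (sqr L) m) i x y)) =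
      (1 / 2) * (∑ m, y m * dx (dy (sqr L) i) m x y
        + ∑ m, y m * ∑ k, y k * (2 * dx (gLow L m i) k x y)
        - ∑ m, y m * dx (dy (sqr L) m) i x y) := by
      rw [← Finset.sum_add_distrib, ← Finset.sum_sub_distrib, Finset.mul_sum]
      exact Finset.sum_congr rfl fun s _ => by ring
    rw [h6, h4, hL.contract_dx_dy_sqr h, hL.sum_gLow_spray h]
    ring
  have h7 := Finset.sum_congr (rfl : (Finset.univ : Finset (Fin n)) = Finset.univ)
    fun m _ => congrArg (y m * ·) (hL.dy_sum_gLow_spray h i m)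
  simp only [] at h7
  rw [h1, h3] at h7
  linarith

/-- `Lⁱ_mk yᵏ = Nⁱ_m`. -/
theorem contract_cartanH (h : (x, y) ∈ slit U) (i m : Fin n) :
    ∑ k, cartanH L i m k x y * y k = nonlinConn L i m x y := by
  refine hL.eq_of_sum_gLow h (v := fun i => ∑ k, cartanH L i m k x y * y k)
    (w := fun i => nonlinConn L i m x y) (fun i => ?_) i
  have h1 : ∑ s, gLow L i s x y * ∑ k, cartanH L s m k x y * y k =
      ∑ k, y k * ((1 / 2) * (horiz L (gLow L i k) m x y + horiz L (gLow L m i) k x y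
        - horiz L (gLow L m k) i x y)) := by
    simp only [Finset.mul_sum]
    rw [Finset.sum_comm]
    refine Finset.sum_congr rfl fun k _ => ?_
    rw [← hL.lower_half_raise h i fun s => horiz L (gLow L s k) m x y + horiz L (gLow L m s) k x y
        - horiz L (gLow L m k) s x y, Finset.mul_sum]
    exact Finset.sum_congr rfl fun s _ => by rw [cartanH]; ring
  have h2 : ∀ i m, ∑ k, y k * horiz L (gLow L i k) m x y = (1 / 2) * dx (dy (sqr L) i) m x y := by
    intro i m
    simp only [horiz, mul_sub, Finset.sum_sub_distrib, hL.contract_dx_gLow h]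
    have : ∑ k, y k * ∑ j, nonlinConn L j m x y * dy (gLow L i k) j x y =
        ∑ j, nonlinConn L j m x y * ∑ k, y k * dy (gLow L i k) j x y := by
      simp only [Finset.mul_sum]
      rw [Finset.sum_comm]
      exact Finset.sum_congr rfl fun s _ => Finset.sum_congr rfl fun m _ => by ring
    rw [this]
    simp [hL.contract_dy_gLow h]
  -- Contracting N with y gives the spray, and the total symmetry of ∂g/∂y then produces exactly the
  -- correction term of `dy_sum_gLow_spray`.
  have h3 : ∑ k, y k * horiz L (gLow L m i) k x y =
      ∑ k, y k * dx (gLow L m i) k x y - ∑ s, dy (gLow L i s) m x y * spray L s x y := by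
    simp only [horiz, mul_sub, Finset.sum_sub_distrib]
    congr 1
    simp only [Finset.mul_sum, ← hL.contract_nonlinConn h]
    rw [Finset.sum_comm]
    refine Finset.sum_congr rfl fun s _ => Finset.sum_congr rfl fun k _ => ?_
    rw [hL.dy_gLow_swap h m i s, hL.dy_gLow_comm h s i m]; ring
  have h4 : ∑ k, y k * ((1 / 2) * (horiz L (gLow L i k) m x y + horiz L (gLow L m i) k x y
        - horiz L (gLow L m k) i x y)) = (1 / 2) * (∑ k, y k * horiz L (gLow L i k) m x y
        + ∑ k, y k * horiz L (gLow L m i) k x y - ∑ k, y k * horiz L (gLow L m k) i x y) := by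
    rw [← Finset.sum_add_distrib, ← Finset.sum_sub_distrib, Finset.mul_sum]
    exact Finset.sum_congr rfl fun s _ => by ring
  have h5 := hL.dy_sum_gLow_spray h i m
  have h6 : ∑ s, gLow L i s x y * (2 * nonlinConn L s m x y) =
      2 * ∑ s, gLow L i s x y * nonlinConn L s m x y := by
    rw [Finset.mul_sum]; exact Finset.sum_congr rfl fun s _ => by ring
  have h7 : ∑ k, y k * (2 * dx (gLow L m i) k x y) = 2 * ∑ k, y k * dx (gLow L m i) k x y := by
    rw [Finset.mul_sum]; exact Finset.sum_congr rfl fun s _ => by ring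
  rw [h6, h7] at h5
  rw [h1, h4, h2, h2, h3]
  linarith

/-- `yᵐ Cⁱ_mk = 0`. -/
theorem contract_cartanV (h : (x, y) ∈ slit U) (i k : Fin n) :
    ∑ m, y m * cartanV L i m k x y = 0 := by
  refine hL.eq_of_sum_gLow h (v := fun i => ∑ m, y m * cartanV L i m k x y)
    (w := fun i => 0) (fun i => ?_) i
  have h1 : ∑ s, gLow L i s x y * ∑ m, y m * cartanV L s m k x y =
      ∑ m, y m * ((1 / 2) * (dy (gLow L i k) m x y + dy (gLow L m i) k x y
        - dy (gLow L m k) i x y)) := by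
    simp only [Finset.mul_sum]
    rw [Finset.sum_comm]
    refine Finset.sum_congr rfl fun m _ => ?_
    rw [← hL.lower_half_raise h i fun s => dy (gLow L s k) m x y + dy (gLow L m s) k x y
        - dy (gLow L m k) s x y, Finset.mul_sum]
    exact Finset.sum_congr rfl fun s _ => by rw [cartanV]; ring
  have h4 : ∑ m, y m * ((1 / 2) * (dy (gLow L i k) m x y + dy (gLow L m i) k x y
        - dy (gLow L m k) i x y)) = (1 / 2) * (∑ m, y m * dy (gLow L i k) m x y
        + ∑ m, y m * dy (gLow L m i) k x y - ∑ m, y m * dy (gLow L m k) i x y) := by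
    rw [← Finset.sum_add_distrib, ← Finset.sum_sub_distrib, Finset.mul_sum]
    exact Finset.sum_congr rfl fun s _ => by ring
  rw [h1, h4, hL.contract_dy_gLow_deriv h, hL.contract_dy_gLow_fst h, hL.contract_dy_gLow_fst h]
  simp

/-- `yʲ Rⁱ_jk` in terms of the spray and the nonlinear connection. -/
theorem contract_curv (h : (x, y) ∈ slit U) (i k : Fin n) :
    ∑ j, y j * curv L i j k x y = dx (spray L i) k x y
      - ∑ l, nonlinConn L l k x y * nonlinConn L i l x y
      - ∑ j, y j * dx (nonlinConn L i k) j x y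
      + ∑ l, spray L l x y * dy (nonlinConn L i k) l x y := by
  have hU := hL.isOpen
  have h1 : ∑ j, y j * dx (nonlinConn L i j) k x y = dx (spray L i) k x y := by
    rw [← dx_contract hU (hL.smooth_nonlinConn i) h]
    exact dx_congr hU (fun x y h => hL.contract_nonlinConn h i) h k
  -- Differentiate Nⁱ_j yʲ = sprayⁱ in yˡ: the right side gives 2Nⁱ_l, and one Nⁱ_l on the left
  -- comes from the factor yʲ.
  have h2 : ∀ l, ∑ j, y j * dy (nonlinConn L i j) l x y = nonlinConn L i l x y := by
    intro l
    have h3 := dy_congr hU (fun x y h => hL.contract_nonlinConn h i) h l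
    rw [dy_contract hU (hL.smooth_nonlinConn i) h, hL.dy_spray] at h3
    linarith
  have h3 : ∑ j, y j * ∑ l, nonlinConn L l k x y * dy (nonlinConn L i j) l x y =
      ∑ l, nonlinConn L l k x y * ∑ j, y j * dy (nonlinConn L i j) l x y := by
    simp only [Finset.mul_sum]
    rw [Finset.sum_comm]
    exact Finset.sum_congr rfl fun s _ => Finset.sum_congr rfl fun m _ => by ring
  have h4 : ∑ j, y j * ∑ l, nonlinConn L l j x y * dy (nonlinConn L i k) l x y =
      ∑ l, spray L l x y * dy (nonlinConn L i k) l x y := by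
    simp only [← hL.contract_nonlinConn h, Finset.mul_sum, Finset.sum_mul]
    rw [Finset.sum_comm]
    exact Finset.sum_congr rfl fun s _ => Finset.sum_congr rfl fun m _ => by ring
  simp only [curv, horiz, mul_sub, Finset.sum_sub_distrib]
  rw [h1, h3, h4]
  simp only [h2]
  ring

/-- The Euler–Lagrange expression of `L²` along a curve with velocity `y` and acceleration `a`. -/
theorem eulerLagrange_eq (h : (x, y) ∈ slit U) (a η : EuclideanSpace ℝ (Fin n)) :
    fderiv ℝ (fderiv ℝ (Function.uncurry (sqr L))) (x, y) (y, a) (0, η)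
      - fderiv ℝ (Function.uncurry (sqr L)) (x, y) (η, 0) =
    2 * ∑ i, η i * ∑ k, gLow L i k x y * (a k + spray L k x y) := by
  rw [hL.fderiv_fderiv_sqr h, hL.smooth_sqr.fderiv_apply hL.isOpen h]
  simp only [PiLp.zero_apply, zero_mul, Finset.sum_const_zero, add_zero]
  rw [← Finset.sum_sub_distrib, Finset.mul_sum]
  refine Finset.sum_congr rfl fun i _ => ?_
  have h1 : ∑ k, gLow L i k x y * (a k + spray L k x y) =
      ∑ k, gLow L i k x y * a k + ∑ k, gLow L i k x y * spray L k x y := by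
    simp only [mul_add, Finset.sum_add_distrib]
  have h2 : ∑ k, a k * (2 * gLow L k i x y) = 2 * ∑ k, gLow L i k x y * a k := by
    rw [Finset.mul_sum]
    exact Finset.sum_congr rfl fun k _ => by rw [hL.gLow_comm h i k]; ring
  rw [h1, h2, hL.sum_gLow_spray h]
  ring

end IsLocalFinsler
end LocalFinsler

/-! ### Geodesics and Jacobi fields in a chart. -/

section LocalCurves

variable {n : ℕ} {L : EuclideanSpace ℝ (Fin n) → EuclideanSpace ℝ (Fin n) → ℝ}
  {U : Set (EuclideanSpace ℝ (Fin n))} {x ξ : ℝ → EuclideanSpace ℝ (Fin n)} {t : ℝ}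

theorem uniqueDiffWithinAt_unitInterval (ht : t ∈ Icc (0 : ℝ) 1) :
    UniqueDiffWithinAt ℝ (Icc (0 : ℝ) 1) t := uniqueDiffOn_Icc one_pos t ht

theorem contDiffWithinAt_derivWithin {E : Type*} [NormedAddCommGroup E] [NormedSpace ℝ E]
    {f : ℝ → E} {s : Set ℝ} {t : ℝ} (hf : ContDiffWithinAt ℝ ∞ f s t) (hs : UniqueDiffOn ℝ s)
    (ht : t ∈ s) : ContDiffWithinAt ℝ ∞ (derivWithin f s) s t := by
  have := (hf.fderivWithin_right hs (m := ∞) (by simp) ht).clm_apply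
    (contDiffWithinAt_const (c := (1 : ℝ)))
  exact this.congr (fun y _ => (fderivWithin_derivWithin).symm)
    (fderivWithin_derivWithin).symm

theorem contDiffWithinAt_timeDeriv (hx : ContDiffWithinAt ℝ ∞ x (Icc 0 1) t)
    (ht : t ∈ Icc (0 : ℝ) 1) : ContDiffWithinAt ℝ ∞ (timeDeriv x) (Icc 0 1) t :=
  contDiffWithinAt_derivWithin hx (uniqueDiffOn_Icc one_pos) ht

theorem hasDerivWithinAt_timeDeriv (hx : ContDiffWithinAt ℝ ∞ x (Icc 0 1) t) :
    HasDerivWithinAt x (timeDeriv x t) (Icc 0 1) t :=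
  (hx.differentiableWithinAt (by simp)).hasDerivWithinAt

theorem hasDerivWithinAt_jet (hx : ContDiffWithinAt ℝ ∞ x (Icc 0 1) t)
    (ht : t ∈ Icc (0 : ℝ) 1) :
    HasDerivWithinAt (fun s => (x s, timeDeriv x s)) (timeDeriv x t, timeDeriv (timeDeriv x) t)
      (Icc 0 1) t :=
  (hasDerivWithinAt_timeDeriv hx).prodMk
    (hasDerivWithinAt_timeDeriv (contDiffWithinAt_timeDeriv hx ht))

theorem hasDerivWithinAt_component {f : ℝ → EuclideanSpace ℝ (Fin n)}
    {f' : EuclideanSpace ℝ (Fin n)} {s : Set ℝ} (hf : HasDerivWithinAt f f' s t) (m : Fin n) :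
    HasDerivWithinAt (fun s => f s m) (f' m) s t :=
  HasFDerivAt.comp_hasDerivWithinAt (l := fun v : EuclideanSpace ℝ (Fin n) => v m)
    (l' := EuclideanSpace.proj (𝕜 := ℝ) m) t (EuclideanSpace.proj (𝕜 := ℝ) m).hasFDerivAt hf

theorem hasDerivWithinAt_fderiv_apply {E F : Type*} [NormedAddCommGroup E] [NormedSpace ℝ E]
    [NormedAddCommGroup F] [NormedSpace ℝ F] {f : E → F} {z w : ℝ → E} {z' w' : E} {s : Set ℝ}
    (hf : DifferentiableAt ℝ (fderiv ℝ f) (z t)) (hz : HasDerivWithinAt z z' s t)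
    (hw : HasDerivWithinAt w w' s t) :
    HasDerivWithinAt (fun r => fderiv ℝ f (z r) (w r))
      (fderiv ℝ (fderiv ℝ f) (z t) z' (w t) + fderiv ℝ f (z t) w') s t :=
  HasDerivWithinAt.clm_apply (c := fun r => fderiv ℝ f (z r))
    (hf.hasFDerivAt.comp_hasDerivWithinAt t hz) hw

theorem hasDerivWithinAt_fderiv_fderiv_apply {E F : Type*} [NormedAddCommGroup E]
    [NormedSpace ℝ E] [NormedAddCommGroup F] [NormedSpace ℝ F] {f : E → F} {z v w : ℝ → E}
    {z' v' w' : E} {s : Set ℝ}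
    (hf : DifferentiableAt ℝ (fderiv ℝ (fderiv ℝ f)) (z t)) (hz : HasDerivWithinAt z z' s t)
    (hv : HasDerivWithinAt v v' s t) (hw : HasDerivWithinAt w w' s t) :
    HasDerivWithinAt (fun r => fderiv ℝ (fderiv ℝ f) (z r) (v r) (w r))
      (fderiv ℝ (fderiv ℝ (fderiv ℝ f)) (z t) z' (v t) (w t)
        + fderiv ℝ (fderiv ℝ f) (z t) v' (w t) + fderiv ℝ (fderiv ℝ f) (z t) (v t) w') s t :=
  HasDerivWithinAt.clm_apply (c := fun r => fderiv ℝ (fderiv ℝ f) (z r) (v r))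
    (hasDerivWithinAt_fderiv_apply hf hz hv) hw

namespace IsLocalFinsler

variable (hL : IsLocalFinsler L U)
include hL

/-- Contraction with the velocity turns L into N, and N into the spray. The vertical coefficients
are then multiplied by acceleration plus spray, which vanishes along geodesics
(`covDeriv_of_geodesic`). -/
theorem covDeriv_apply (h : (x t, timeDeriv x t) ∈ slit U) (i : Fin n) :
    covDeriv L x ξ t i = timeDeriv ξ t i + ∑ m, ξ t m *
      (nonlinConn L i m (x t) (timeDeriv x t) + ∑ k, cartanV L i m k (x t) (timeDeriv x t) *
        (timeDeriv (timeDeriv x) t k + spray L k (x t) (timeDeriv x t))) := by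
  simp only [covDeriv]
  congr 1
  refine Finset.sum_congr rfl fun m _ => ?_
  rw [Finset.sum_add_distrib, hL.contract_cartanH h]
  simp only [← hL.contract_nonlinConn h, mul_comm (timeDeriv x t _)]

/-- The vertical coefficients annihilate the velocity, so ∇ċ/dt = 0 is the spray equation. -/
theorem covDeriv_timeDeriv (h : (x t, timeDeriv x t) ∈ slit U) (i : Fin n) :
    covDeriv L x (timeDeriv x) t i =
      timeDeriv (timeDeriv x) t i + spray L i (x t) (timeDeriv x t) := by
  rw [hL.covDeriv_apply h]
  congr 1
  generalize hw : (fun k => timeDeriv (timeDeriv x) t k + spray L k (x t) (timeDeriv x t)) = w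
  have h1 : ∀ k, timeDeriv (timeDeriv x) t k + spray L k (x t) (timeDeriv x t) = w k :=
    congrFun hw
  simp only [h1, mul_add (timeDeriv x t _), Finset.sum_add_distrib, hL.contract_nonlinConn h]
  rw [add_eq_left]
  simp only [Finset.mul_sum]
  rw [Finset.sum_comm]
  refine Finset.sum_eq_zero fun k _ => ?_
  have h2 := hL.contract_cartanV h i k
  simp only [← mul_assoc, ← Finset.sum_mul, h2, zero_mul]

theorem covDeriv_of_geodesic (h : (x t, timeDeriv x t) ∈ slit U)
    (hgeo : ∀ k, timeDeriv (timeDeriv x) t k + spray L k (x t) (timeDeriv x t) = 0) (i : Fin n) :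
    covDeriv L x ξ t i =
      timeDeriv ξ t i + ∑ m, ξ t m * nonlinConn L i m (x t) (timeDeriv x t) := by
  rw [hL.covDeriv_apply h]
  simp [hgeo]

theorem hasDerivWithinAt_along {f : EuclideanSpace ℝ (Fin n) → EuclideanSpace ℝ (Fin n) → ℝ}
    (hf : SmoothOff U f) (h : (x t, timeDeriv x t) ∈ slit U)
    (hx : ContDiffWithinAt ℝ ∞ x (Icc 0 1) t) (ht : t ∈ Icc (0 : ℝ) 1) :
    HasDerivWithinAt (fun s => f (x s) (timeDeriv x s))
      (fderiv ℝ (Function.uncurry f) (x t, timeDeriv x t)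
        (timeDeriv x t, timeDeriv (timeDeriv x) t)) (Icc 0 1) t :=
  HasFDerivAt.comp_hasDerivWithinAt (l := Function.uncurry f)
    (f := fun s => (x s, timeDeriv x s)) t (hf.differentiableAt hL.isOpen h).hasFDerivAt
    (hasDerivWithinAt_jet hx ht)

/-- Along a geodesic the Jacobi operator is the linearization of the geodesic equation. -/
theorem jacobi_operator_apply
    (hgeo : ∀ᶠ s in 𝓝[Icc 0 1] t, (x s, timeDeriv x s) ∈ slit U ∧
      ∀ k, timeDeriv (timeDeriv x) s k + spray L k (x s) (timeDeriv x s) = 0)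
    (hx : ContDiffWithinAt ℝ ∞ x (Icc 0 1) t) (hξ : ContDiffWithinAt ℝ ∞ ξ (Icc 0 1) t)
    (ht : t ∈ Icc (0 : ℝ) 1) (i : Fin n) :
    covDeriv L x (covDeriv L x ξ) t i + curvTerm L x ξ t i = timeDeriv (timeDeriv ξ) t i +
      fderiv ℝ (Function.uncurry (spray L i)) (x t, timeDeriv x t) (ξ t, timeDeriv ξ t) := by
  have hU := hL.isOpen
  obtain ⟨h, hg⟩ := hgeo.self_of_nhdsWithin ht
  -- The derivative of N along the curve contains the acceleration, which the geodesic equation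
  -- replaces by minus the spray.
  have h1 : ∀ i, HasDerivWithinAt (fun s => covDeriv L x ξ s i)
      (timeDeriv (timeDeriv ξ) t i + ∑ m, (timeDeriv ξ t m * nonlinConn L i m (x t) (timeDeriv x t)
        + ξ t m * (∑ j, timeDeriv x t j * dx (nonlinConn L i m) j (x t) (timeDeriv x t)
        - ∑ l, spray L l (x t) (timeDeriv x t) *
          dy (nonlinConn L i m) l (x t) (timeDeriv x t)))) (Icc 0 1) t := by
    intro i
    have h2 := (hasDerivWithinAt_component
      (hasDerivWithinAt_timeDeriv (contDiffWithinAt_timeDeriv hξ ht)) i).fun_add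
      (HasDerivWithinAt.fun_sum (u := Finset.univ) fun m _ =>
        (hasDerivWithinAt_component (hasDerivWithinAt_timeDeriv hξ) m).fun_mul
        (hL.hasDerivWithinAt_along (hL.smooth_nonlinConn i m) h hx ht))
    refine (h2.congr_of_eventuallyEq ?_ ?_).congr_deriv ?_
    · filter_upwards [hgeo] with s hs
      exact hL.covDeriv_of_geodesic hs.1 hs.2 i
    · exact hL.covDeriv_of_geodesic h hg i
    · congr 1
      refine Finset.sum_congr rfl fun m _ => ?_
      congr 2
      rw [(hL.smooth_nonlinConn i m).fderiv_apply hU h, sub_eq_add_neg, ← Finset.sum_neg_distrib]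
      congr 1
      refine Finset.sum_congr rfl fun l _ => ?_
      rw [eq_neg_of_add_eq_zero_left (hg l), neg_mul]
  have hu := uniqueDiffWithinAt_unitInterval ht
  have h2 : timeDeriv (covDeriv L x ξ) t i = derivWithin (fun s => covDeriv L x ξ s i)
      (Icc 0 1) t :=
    ((hasDerivWithinAt_component (differentiableWithinAt_euclidean.2 fun i =>
      (h1 i).differentiableWithinAt).hasDerivWithinAt i).derivWithin hu).symm
  rw [hL.covDeriv_of_geodesic h hg, h2, (h1 i).derivWithin hu, (hL.smooth_spray i).fderiv_apply hU h]
  simp only [hL.covDeriv_of_geodesic h hg, hL.dy_spray]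
  have h4 : curvTerm L x ξ t i = ∑ k, ξ t k * ∑ j, timeDeriv x t j *
      curv L i j k (x t) (timeDeriv x t) := by
    simp only [curvTerm, Finset.mul_sum]
    rw [Finset.sum_comm]
    exact Finset.sum_congr rfl fun k _ => Finset.sum_congr rfl fun j _ => by ring
  rw [h4]
  simp only [hL.contract_curv h]
  have h5 : ∑ m, (timeDeriv ξ t m + ∑ l, ξ t l * nonlinConn L m l (x t) (timeDeriv x t)) *
      nonlinConn L i m (x t) (timeDeriv x t) =
      ∑ m, timeDeriv ξ t m * nonlinConn L i m (x t) (timeDeriv x t) +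
      ∑ m, ξ t m * ∑ l, nonlinConn L l m (x t) (timeDeriv x t) *
        nonlinConn L i l (x t) (timeDeriv x t) := by
    simp only [add_mul, Finset.sum_add_distrib, Finset.mul_sum, Finset.sum_mul]
    congr 1
    rw [Finset.sum_comm]
    exact Finset.sum_congr rfl fun k _ => Finset.sum_congr rfl fun j _ => by ring
  rw [h5]
  simp only [mul_add, mul_sub, Finset.sum_add_distrib, Finset.sum_sub_distrib]
  have h6 : ∑ m, timeDeriv ξ t m * (2 * nonlinConn L i m (x t) (timeDeriv x t)) =
      2 * ∑ m, timeDeriv ξ t m * nonlinConn L i m (x t) (timeDeriv x t) := by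
    rw [Finset.mul_sum]; exact Finset.sum_congr rfl fun m _ => by ring
  rw [h6]
  ring

/-- The Euler–Lagrange equation of `L²` along a geodesic. -/
theorem hasDerivWithinAt_momentum_within {S : Set ℝ} {ξ' : EuclideanSpace ℝ (Fin n)}
    (h : (x t, timeDeriv x t) ∈ slit U)
    (hgeo : ∀ k, timeDeriv (timeDeriv x) t k + spray L k (x t) (timeDeriv x t) = 0)
    (hx : ContDiffWithinAt ℝ ∞ x (Icc 0 1) t) (ht : t ∈ Icc (0 : ℝ) 1) (hS : S ⊆ Icc 0 1)
    (hξ : HasDerivWithinAt ξ ξ' S t) :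
    HasDerivWithinAt (fun s => fderiv ℝ (Function.uncurry (sqr L)) (x s, timeDeriv x s) (0, ξ s))
      (fderiv ℝ (Function.uncurry (sqr L)) (x t, timeDeriv x t) (ξ t, ξ')) S t := by
  have h2 := hasDerivWithinAt_fderiv_apply (hL.smooth_sqr.differentiableAt_fderiv hL.isOpen h)
    ((hasDerivWithinAt_jet hx ht).mono hS) ((hasDerivWithinAt_const t S
    (0 : EuclideanSpace ℝ (Fin n))).prodMk hξ)
  refine h2.congr_deriv ?_
  have h3 := hL.eulerLagrange_eq h (timeDeriv (timeDeriv x) t) (ξ t)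
  simp only [hgeo, mul_zero, Finset.sum_const_zero] at h3
  have h4 : fderiv ℝ (Function.uncurry (sqr L)) (x t, timeDeriv x t) (ξ t, ξ') =
      fderiv ℝ (Function.uncurry (sqr L)) (x t, timeDeriv x t) (ξ t, 0) +
      fderiv ℝ (Function.uncurry (sqr L)) (x t, timeDeriv x t) (0, ξ') := by
    rw [← map_add]; simp
  rw [h4]
  linarith

theorem hasDerivWithinAt_momentum (h : (x t, timeDeriv x t) ∈ slit U)
    (hgeo : ∀ k, timeDeriv (timeDeriv x) t k + spray L k (x t) (timeDeriv x t) = 0)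
    (hx : ContDiffWithinAt ℝ ∞ x (Icc 0 1) t) (ht : t ∈ Icc (0 : ℝ) 1)
    (hξ : ContDiffWithinAt ℝ ∞ ξ (Icc 0 1) t) :
    HasDerivWithinAt (fun s => fderiv ℝ (Function.uncurry (sqr L)) (x s, timeDeriv x s) (0, ξ s))
      (fderiv ℝ (Function.uncurry (sqr L)) (x t, timeDeriv x t) (ξ t, timeDeriv ξ t))
      (Icc 0 1) t :=
  hL.hasDerivWithinAt_momentum_within h hgeo hx ht Subset.rfl (hasDerivWithinAt_timeDeriv hξ)

theorem contDiffAt_fderiv_sqr (h : (x t, timeDeriv x t) ∈ slit U) :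
    ContDiffAt ℝ ∞ (fderiv ℝ (Function.uncurry (sqr L))) (x t, timeDeriv x t) :=
  (hL.smooth_sqr.contDiffAt hL.isOpen h).fderiv_right (by simp)

theorem differentiableAt_fderiv_fderiv_sqr (h : (x t, timeDeriv x t) ∈ slit U) :
    DifferentiableAt ℝ (fderiv ℝ (fderiv ℝ (Function.uncurry (sqr L)))) (x t, timeDeriv x t) :=
  ((hL.contDiffAt_fderiv_sqr h).fderiv_right (m := ∞) (by simp)).differentiableAt (by simp)

/-- The linearized Euler–Lagrange expression along a geodesic. -/
theorem hasDerivWithinAt_linearized_momentum (h : (x t, timeDeriv x t) ∈ slit U)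
    (hgeo : ∀ k, timeDeriv (timeDeriv x) t k + spray L k (x t) (timeDeriv x t) = 0)
    (hx : ContDiffWithinAt ℝ ∞ x (Icc 0 1) t) (ht : t ∈ Icc (0 : ℝ) 1)
    (hξ : ContDiffWithinAt ℝ ∞ ξ (Icc 0 1) t) (η : EuclideanSpace ℝ (Fin n)) :
    HasDerivWithinAt (fun s => fderiv ℝ (fderiv ℝ (Function.uncurry (sqr L))) (x s, timeDeriv x s)
        (ξ s, timeDeriv ξ s) (0, η))
      (fderiv ℝ (fderiv ℝ (Function.uncurry (sqr L))) (x t, timeDeriv x t)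
        (ξ t, timeDeriv ξ t) (η, 0) +
        2 * ∑ i, η i * ∑ k, gLow L i k (x t) (timeDeriv x t) * (timeDeriv (timeDeriv ξ) t k +
        fderiv ℝ (Function.uncurry (spray L k)) (x t, timeDeriv x t) (ξ t, timeDeriv ξ t)))
      (Icc 0 1) t := by
  have hU := hL.isOpen
  have hd1 := hL.smooth_sqr.differentiableAt_fderiv hU h
  have hd2 := hL.differentiableAt_fderiv_fderiv_sqr h
  have h1 := hasDerivWithinAt_fderiv_fderiv_apply hd2 (hasDerivWithinAt_jet hx ht)
    (hasDerivWithinAt_jet hξ ht) (hasDerivWithinAt_const t (Icc (0 : ℝ) 1)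
    ((0 : EuclideanSpace ℝ (Fin n)), η))
  refine h1.congr_deriv ?_
  set X := x t
  set Y := timeDeriv x t
  set A := timeDeriv (timeDeriv x) t
  set u := ξ t
  set v := timeDeriv ξ t
  set w := timeDeriv (timeDeriv ξ) t
  -- The identity `eulerLagrange_eq` holds for all points, velocities and accelerations. It is
  -- differentiated at r = 0 along (X + ru, Y + rv, A + rw), that is, linearized in the direction of
  -- ξ and its derivatives.
  have hline : ∀ a b : EuclideanSpace ℝ (Fin n), HasDerivWithinAt (fun r : ℝ => a + r • b) b
      univ 0 := fun a b => by
    simpa using (((hasDerivAt_id (0 : ℝ)).smul_const b).const_add a).hasDerivWithinAt (s := univ)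
  have hz := (hline X u).prodMk (hline Y v)
  have hz0 : (X + (0 : ℝ) • u, Y + (0 : ℝ) • v) = (X, Y) := by simp
  have h2 := (hasDerivWithinAt_fderiv_fderiv_apply (t := (0 : ℝ))
    (z := fun r : ℝ => (X + r • u, Y + r • v)) (by rw [hz0]; exact hd2) hz
    ((hline Y v).prodMk (hline A w)) (hasDerivWithinAt_const _ _
      ((0 : EuclideanSpace ℝ (Fin n)), η))).fun_sub
    (hasDerivWithinAt_fderiv_apply (z := fun r : ℝ => (X + r • u, Y + r • v))
      (by rw [hz0]; exact hd1) hz (hasDerivWithinAt_const _ _ (η, (0 : EuclideanSpace ℝ (Fin n)))))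
  have hsm : ∀ {f : EuclideanSpace ℝ (Fin n) → EuclideanSpace ℝ (Fin n) → ℝ}, SmoothOff U f →
      HasDerivWithinAt (fun r : ℝ => f (X + r • u) (Y + r • v))
        (fderiv ℝ (Function.uncurry f) (X, Y) (u, v)) univ 0 := fun {f} hf =>
    HasFDerivAt.comp_hasDerivWithinAt (l := Function.uncurry f) (0 : ℝ)
      (by rw [hz0]; exact (hf.differentiableAt hU h).hasFDerivAt) hz
  have h3 : HasDerivWithinAt (fun r : ℝ => 2 * ∑ i, η i * ∑ k,
      gLow L i k (X + r • u) (Y + r • v) * ((A + r • w) k + spray L k (X + r • u) (Y + r • v)))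
      _ univ 0 :=
    (HasDerivWithinAt.fun_sum (u := Finset.univ) fun i _ =>
      (HasDerivWithinAt.fun_sum (u := Finset.univ) fun k _ =>
        (hsm (hL.smooth_gLow i k)).fun_mul ((hasDerivWithinAt_component (hline A w) k).fun_add
          (hsm (hL.smooth_spray k)))).const_mul (η i)).const_mul 2
  have h4 : (fun r : ℝ => fderiv ℝ (fderiv ℝ (Function.uncurry (sqr L))) (X + r • u, Y + r • v)
      (Y + r • v, A + r • w) (0, η)
      - fderiv ℝ (Function.uncurry (sqr L)) (X + r • u, Y + r • v) (η, 0)) =ᶠ[𝓝 0]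
      fun r : ℝ => 2 * ∑ i, η i * ∑ k,
      gLow L i k (X + r • u) (Y + r • v) * ((A + r • w) k + spray L k (X + r • u) (Y + r • v)) := by
    have hc : ContinuousAt (fun r : ℝ => (X + r • u, Y + r • v)) 0 := by fun_prop
    have := hc.eventually (p := fun q => q ∈ slit U)
      (by
        simp only [zero_smul, add_zero]; exact (isOpen_slit hU).mem_nhds h)
    filter_upwards [this] with r hr
    exact hL.eulerLagrange_eq hr _ η
  rw [hasDerivWithinAt_univ] at h2 h3
  have h5 := h2.unique (h3.congr_of_eventuallyEq h4)
  simp only [zero_smul, add_zero, map_zero] at h5 ⊢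
  -- Differentiation in time and linearization feed (Y, A) and (u, v) into the third derivative in
  -- opposite order.
  have hs : IsSymmSndFDerivAt ℝ (fderiv ℝ (Function.uncurry (sqr L))) (X, Y) :=
    (hL.contDiffAt_fderiv_sqr h).isSymmSndFDerivAt
      (by simp; exact WithTop.coe_le_coe.2 (le_top (a := (2 : ℕ∞))))
  rw [hs (Y, A) (u, v)]
  -- The derivative of g_ik is multiplied by acceleration plus spray, which is zero on the geodesic.
  simp only [hgeo, mul_zero, zero_add] at h5
  linarith

/-- The Jacobi equation as the linearized Euler–Lagrange equation of `L²`. -/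
theorem jacobi_iff
    (hgeo : ∀ᶠ s in 𝓝[Icc 0 1] t, (x s, timeDeriv x s) ∈ slit U ∧
      ∀ k, timeDeriv (timeDeriv x) s k + spray L k (x s) (timeDeriv x s) = 0)
    (hx : ContDiffWithinAt ℝ ∞ x (Icc 0 1) t) (hξ : ContDiffWithinAt ℝ ∞ ξ (Icc 0 1) t)
    (ht : t ∈ Icc (0 : ℝ) 1) :
    covDeriv L x (covDeriv L x ξ) t + curvTerm L x ξ t = 0 ↔ ∀ η : EuclideanSpace ℝ (Fin n),
      HasDerivWithinAt (fun s => fderiv ℝ (fderiv ℝ (Function.uncurry (sqr L)))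
        (x s, timeDeriv x s) (ξ s, timeDeriv ξ s) (0, η))
      (fderiv ℝ (fderiv ℝ (Function.uncurry (sqr L))) (x t, timeDeriv x t)
        (ξ t, timeDeriv ξ t) (η, 0)) (Icc 0 1) t := by
  obtain ⟨h, hg⟩ := hgeo.self_of_nhdsWithin ht
  have h1 := hL.hasDerivWithinAt_linearized_momentum h hg hx ht hξ
  have hu := uniqueDiffWithinAt_unitInterval ht
  have h2 : covDeriv L x (covDeriv L x ξ) t + curvTerm L x ξ t = 0 ↔
      ∀ k, timeDeriv (timeDeriv ξ) t k +
        fderiv ℝ (Function.uncurry (spray L k)) (x t, timeDeriv x t) (ξ t, timeDeriv ξ t) = 0 := by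
    simp only [← hL.jacobi_operator_apply hgeo hx hξ ht]
    exact ⟨fun h k => by rw [← PiLp.add_apply, h]; rfl, fun h => by ext k; exact h k⟩
  rw [h2]
  constructor
  · intro h3 η
    refine (h1 η).congr_deriv ?_
    simp [h3]
  · intro h3 k
    refine hL.eq_of_sum_gLow h (v := fun k => timeDeriv (timeDeriv ξ) t k +
        fderiv ℝ (Function.uncurry (spray L k)) (x t, timeDeriv x t) (ξ t, timeDeriv ξ t))
      (w := fun _ => 0) (fun i => ?_) k
    have h4 := ((h1 (EuclideanSpace.single i 1)).derivWithin hu).symm.trans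
      ((h3 (EuclideanSpace.single i 1)).derivWithin hu)
    have h5 : ∀ B : Fin n → ℝ, ∑ j, (EuclideanSpace.single i (1 : ℝ) :
        EuclideanSpace ℝ (Fin n)) j * B j = B i := fun B => by simp
    rw [h5] at h4
    simp only [mul_zero, Finset.sum_const_zero]
    linarith

/-- Euler's relation, differentiated once. -/
theorem fderiv_fderiv_sqr_vertical {x y : EuclideanSpace ℝ (Fin n)} (h : (x, y) ∈ slit U)
    (v w : EuclideanSpace ℝ (Fin n)) :
    fderiv ℝ (fderiv ℝ (Function.uncurry (sqr L))) (x, y) (v, w) (0, y) =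
      2 * fderiv ℝ (Function.uncurry (sqr L)) (x, y) (v, w)
      - fderiv ℝ (Function.uncurry (sqr L)) (x, y) (0, w) := by
  have hU := hL.isOpen
  have hline : ∀ a b : EuclideanSpace ℝ (Fin n), HasDerivWithinAt (fun r : ℝ => a + r • b) b
      univ 0 := fun a b => by
    simpa using (((hasDerivAt_id (0 : ℝ)).smul_const b).const_add a).hasDerivWithinAt (s := univ)
  have hz := (hline x v).prodMk (hline y w)
  have hz0 : (x + (0 : ℝ) • v, y + (0 : ℝ) • w) = (x, y) := by simp
  have h1 := hasDerivWithinAt_fderiv_apply (z := fun r : ℝ => (x + r • v, y + r • w))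
    (by rw [hz0]; exact hL.smooth_sqr.differentiableAt_fderiv hU h) hz
    ((hasDerivWithinAt_const (0 : ℝ) univ (0 : EuclideanSpace ℝ (Fin n))).prodMk (hline y w))
  have h2 := (HasFDerivAt.comp_hasDerivWithinAt (l := Function.uncurry (sqr L)) (0 : ℝ)
    (f := fun r : ℝ => (x + r • v, y + r • w))
      (by rw [hz0]; exact (hL.smooth_sqr.differentiableAt hU h).hasFDerivAt) hz).const_mul 2
  have h4 : (fun r : ℝ => fderiv ℝ (Function.uncurry (sqr L)) (x + r • v, y + r • w)
      (0, y + r • w)) =ᶠ[𝓝 0]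
      fun r : ℝ => 2 * (Function.uncurry (sqr L) ∘ fun r : ℝ => (x + r • v, y + r • w)) r := by
    have hc : ContinuousAt (fun r : ℝ => (x + r • v, y + r • w)) 0 := by fun_prop
    have := hc.eventually (p := fun q => q ∈ slit U)
      (by
        simp only [zero_smul, add_zero]; exact (isOpen_slit hU).mem_nhds h)
    filter_upwards [this] with r hr
    exact hL.fderiv_sqr_vertical hr
  rw [hasDerivWithinAt_univ] at h1 h2
  have h5 := h1.unique (h2.congr_of_eventuallyEq h4)
  simp only [zero_smul, add_zero] at h5
  linarith

/-- For a solution of the linearized Euler–Lagrange equation the derivative of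
`t ↦ ∂L²/∂y (ξ)` is constant. -/
theorem hasDerivWithinAt_fderiv_sqr_of_jacobi (h : (x t, timeDeriv x t) ∈ slit U)
    (hgeo : ∀ k, timeDeriv (timeDeriv x) t k + spray L k (x t) (timeDeriv x t) = 0)
    (hev : ∀ᶠ s in 𝓝[Icc 0 1] t, (x s, timeDeriv x s) ∈ slit U)
    (hx : ContDiffWithinAt ℝ ∞ x (Icc 0 1) t) (ht : t ∈ Icc (0 : ℝ) 1)
    (hξ : ContDiffWithinAt ℝ ∞ ξ (Icc 0 1) t)
    (hjac : ∀ η : EuclideanSpace ℝ (Fin n),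
      HasDerivWithinAt (fun s => fderiv ℝ (fderiv ℝ (Function.uncurry (sqr L)))
        (x s, timeDeriv x s) (ξ s, timeDeriv ξ s) (0, η))
      (fderiv ℝ (fderiv ℝ (Function.uncurry (sqr L))) (x t, timeDeriv x t)
        (ξ t, timeDeriv ξ t) (η, 0)) (Icc 0 1) t) :
    HasDerivWithinAt (fun s => fderiv ℝ (Function.uncurry (sqr L)) (x s, timeDeriv x s)
      (ξ s, timeDeriv ξ s)) 0 (Icc 0 1) t := by
  have hU := hL.isOpen
  have hu := uniqueDiffWithinAt_unitInterval ht
  have hd1 := hL.smooth_sqr.differentiableAt_fderiv hU h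
  have hd2 := hL.differentiableAt_fderiv_fderiv_sqr h
  have hxd := contDiffWithinAt_timeDeriv hx ht
  have hξd := contDiffWithinAt_timeDeriv hξ ht
  -- The linearized momentum paired with the velocity is differentiated in two ways: with the Jacobi
  -- equation for the frozen velocity and a correction from the acceleration, and through Euler's
  -- relation. The comparison isolates the derivative of the first variation of L².
  have h1 := hasDerivWithinAt_fderiv_fderiv_apply hd2 (hasDerivWithinAt_jet hx ht)
    (hasDerivWithinAt_jet hξ ht) ((hasDerivWithinAt_const t (Icc (0 : ℝ) 1)
    (0 : EuclideanSpace ℝ (Fin n))).prodMk (hasDerivWithinAt_timeDeriv hxd))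
  have h2 := hasDerivWithinAt_fderiv_fderiv_apply hd2 (hasDerivWithinAt_jet hx ht)
    (hasDerivWithinAt_jet hξ ht) (hasDerivWithinAt_const t (Icc (0 : ℝ) 1)
    ((0 : EuclideanSpace ℝ (Fin n)), timeDeriv x t))
  have h3 := (h2.derivWithin hu).symm.trans ((hjac (timeDeriv x t)).derivWithin hu)
  have h4 := hasDerivWithinAt_fderiv_apply hd1 (hasDerivWithinAt_jet hx ht)
    (hasDerivWithinAt_jet hξ ht)
  have h5 := hL.hasDerivWithinAt_momentum h hgeo hx ht hξd
  have h6 : (fun s => fderiv ℝ (fderiv ℝ (Function.uncurry (sqr L))) (x s, timeDeriv x s)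
      (ξ s, timeDeriv ξ s) (0, timeDeriv x s)) =ᶠ[𝓝[Icc 0 1] t] fun s =>
      2 * fderiv ℝ (Function.uncurry (sqr L)) (x s, timeDeriv x s) (ξ s, timeDeriv ξ s)
      - fderiv ℝ (Function.uncurry (sqr L)) (x s, timeDeriv x s) (0, timeDeriv ξ s) := by
    filter_upwards [hev] with s hs
    exact hL.fderiv_fderiv_sqr_vertical hs _ _
  have h7 := (((h4.const_mul 2).fun_sub h5).congr_of_eventuallyEq h6
    (hL.fderiv_fderiv_sqr_vertical h _ _)).derivWithin hu
  rw [h1.derivWithin hu] at h7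
  have hsymm : IsSymmSndFDerivAt ℝ (Function.uncurry (sqr L)) (x t, timeDeriv x t) :=
    hL.smooth_sqr.isSymm hU h
  have h8 := hsymm (ξ t, timeDeriv ξ t) (timeDeriv x t, timeDeriv (timeDeriv x) t)
  have h9 : fderiv ℝ (fderiv ℝ (Function.uncurry (sqr L))) (x t, timeDeriv x t)
      (ξ t, timeDeriv ξ t) (timeDeriv x t, timeDeriv (timeDeriv x) t) =
      fderiv ℝ (fderiv ℝ (Function.uncurry (sqr L))) (x t, timeDeriv x t)
      (ξ t, timeDeriv ξ t) (timeDeriv x t, 0) +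
      fderiv ℝ (fderiv ℝ (Function.uncurry (sqr L))) (x t, timeDeriv x t)
      (ξ t, timeDeriv ξ t) (0, timeDeriv (timeDeriv x) t) := by
    rw [← map_add]; simp
  refine h4.congr_deriv ?_
  simp only [map_zero, add_zero] at h3
  linarith

end IsLocalFinsler
end LocalCurves

/-! ### Second-order chain rules. -/

section ChainRule

variable {K E F : Type*} [NormedAddCommGroup K] [NormedSpace ℝ K]
  [NormedAddCommGroup E] [NormedSpace ℝ E] [NormedAddCommGroup F] [NormedSpace ℝ F]

theorem two_le_infty : (2 : WithTop ℕ∞) ≤ ∞ := WithTop.coe_le_coe.2 (le_top (a := (2 : ℕ∞)))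

theorem ContDiffAt.differentiableAt_fderiv {f : K → E} {k : K} (hf : ContDiffAt ℝ ∞ f k) :
    DifferentiableAt ℝ (fderiv ℝ f) k :=
  (hf.fderiv_right (m := ∞) (by simp)).differentiableAt (by simp)

theorem eventually_contDiffAt_of_infty {f : K → E} {k : K} (hf : ContDiffAt ℝ ∞ f k) :
    ∀ᶠ v in 𝓝 k, ContDiffAt ℝ 2 f v :=
  (hf.of_le two_le_infty).eventually (by simp)

/-- The term with the second derivative of the inner map is what makes second derivatives of F²
depend on the chosen family of curves; it is carried along and later recognized as a total time
derivative. -/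
theorem fderiv_fderiv_comp {g : E → F} {f : K → E} {k : K} (hg : ContDiffAt ℝ ∞ g (f k))
    (hf : ContDiffAt ℝ ∞ f k) (v w : K) :
    fderiv ℝ (fderiv ℝ (fun q => g (f q))) k v w =
      fderiv ℝ (fderiv ℝ g) (f k) (fderiv ℝ f k v) (fderiv ℝ f k w)
        + fderiv ℝ g (f k) (fderiv ℝ (fderiv ℝ f) k v w) := by
  have hc : ContDiffAt ℝ ∞ (fun q => g (f q)) k := hg.comp k hf
  rw [← fderiv_clm_apply_const (ContDiffAt.differentiableAt_fderiv hc)]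
  have h1 : (fun q => fderiv ℝ (fun q => g (f q)) q w) =ᶠ[𝓝 k]
      fun q => fderiv ℝ g (f q) (fderiv ℝ f q w) := by
    filter_upwards [eventually_contDiffAt_of_infty hf,
      hf.continuousAt.eventually (eventually_contDiffAt_of_infty hg)] with q hq1 hq2
    have := fderiv_comp q (hq2.differentiableAt (by simp)) (hq1.differentiableAt (by simp))
    rw [show (fun q => g (f q)) = g ∘ f from rfl, this]; rfl
  rw [h1.fderiv_eq]
  have h2 : DifferentiableAt ℝ (fun q => fderiv ℝ g (f q)) k :=
    (ContDiffAt.differentiableAt_fderiv hg).comp k (hf.differentiableAt (by simp))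
  have h3 : DifferentiableAt ℝ (fun q => fderiv ℝ f q w) k :=
    (ContDiffAt.differentiableAt_fderiv hf).clm_apply (differentiableAt_const w)
  rw [fderiv_clm_apply h2 h3]
  have h4 : fderiv ℝ (fun q => fderiv ℝ g (f q)) k = _ :=
    fderiv_comp k (ContDiffAt.differentiableAt_fderiv hg) (hf.differentiableAt (by simp))
  simp only [add_apply, ContinuousLinearMap.comp_apply,
    ContinuousLinearMap.flip_apply, h4,
    fderiv_clm_apply_const (ContDiffAt.differentiableAt_fderiv hf)]
  rw [add_comm]

theorem hasDerivWithinAt_smul_line (a b : K) :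
    HasDerivWithinAt (fun r : ℝ => a + r • b) b univ 0 := by
  simpa using (((hasDerivAt_id (0 : ℝ)).smul_const b).const_add a).hasDerivWithinAt (s := univ)

/-- The map `(v, w) ↦ (X v, Y v + DX v w)`. -/
def velocityMap (X Y : K → E) (q : K × K) : E × E := (X q.1, Y q.1 + fderiv ℝ X q.1 q.2)

theorem ContDiffAt.velocityMap {X Y : K → E} {q : K × K} (hX : ContDiffAt ℝ ∞ X q.1)
    (hY : ContDiffAt ℝ ∞ Y q.1) : ContDiffAt ℝ ∞ (velocityMap X Y) q := by
  have h1 : ContDiffAt ℝ ∞ (fun q : K × K => X q.1) q := hX.comp q contDiffAt_fst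
  have h2 : ContDiffAt ℝ ∞ (fun q : K × K => Y q.1) q := hY.comp q contDiffAt_fst
  have h3 : ContDiffAt ℝ ∞ (fun q : K × K => fderiv ℝ X q.1) q :=
    (hX.fderiv_right (m := ∞) (by simp)).comp q contDiffAt_fst
  exact h1.prodMk (h2.add (h3.clm_apply contDiffAt_snd))

theorem fderiv_velocityMap {X Y : K → E} {v w : K} (hX : ContDiffAt ℝ 2 X v)
    (hY : ContDiffAt ℝ 2 Y v) (ξ ζ : K) :
    fderiv ℝ (velocityMap X Y) (v, w) (ξ, ζ) = (fderiv ℝ X v ξ,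
      fderiv ℝ Y v ξ + (fderiv ℝ (fderiv ℝ X) v ξ w + fderiv ℝ X v ζ)) := by
  have hX1 := hX.differentiableAt (by simp)
  have hY1 := hY.differentiableAt (by simp)
  have hX2 : DifferentiableAt ℝ (fderiv ℝ X) v :=
    (hX.fderiv_right (m := 1) (by norm_num)).differentiableAt (by simp)
  have h1 : HasFDerivAt (fun q : K × K => X q.1) (fderiv ℝ X v ∘L ContinuousLinearMap.fst ℝ K K)
      (v, w) := HasFDerivAt.comp (g := X) (v, w) hX1.hasFDerivAt hasFDerivAt_fst
  have h2 : HasFDerivAt (fun q : K × K => Y q.1) (fderiv ℝ Y v ∘L ContinuousLinearMap.fst ℝ K K)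
      (v, w) := HasFDerivAt.comp (g := Y) (v, w) hY1.hasFDerivAt hasFDerivAt_fst
  have h3 : HasFDerivAt (fun q : K × K => fderiv ℝ X q.1)
      (fderiv ℝ (fderiv ℝ X) v ∘L ContinuousLinearMap.fst ℝ K K) (v, w) :=
    HasFDerivAt.comp (g := fderiv ℝ X) (v, w) hX2.hasFDerivAt hasFDerivAt_fst
  have h4 : HasFDerivAt (velocityMap X Y) _ (v, w) :=
    h1.prodMk (h2.add (h3.clm_apply hasFDerivAt_snd))
  rw [h4.fderiv]
  simp [add_comm]

/-- At second component 0 the third derivative of `X` does not contribute, and this is the only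
place where the formula is needed. -/
theorem fderiv_fderiv_velocityMap {X Y : K → E} {v : K} (hX : ContDiffAt ℝ ∞ X v)
    (hY : ContDiffAt ℝ ∞ Y v) (ξ ζ η θ : K) :
    fderiv ℝ (fderiv ℝ (velocityMap X Y)) (v, 0) (ξ, ζ) (η, θ) =
      (fderiv ℝ (fderiv ℝ X) v ξ η, fderiv ℝ (fderiv ℝ Y) v ξ η
        + (fderiv ℝ (fderiv ℝ X) v η ζ + fderiv ℝ (fderiv ℝ X) v ξ θ)) := by
  have hc : ContDiffAt ℝ ∞ (velocityMap X Y) (v, 0) := ContDiffAt.velocityMap hX hY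
  have hd := ContDiffAt.differentiableAt_fderiv hc
  have hl := (hasDerivWithinAt_smul_line (v, (0 : K)) (ξ, ζ))
  have hl1 := hasDerivWithinAt_smul_line v ξ
  have hl2 := hasDerivWithinAt_smul_line (0 : K) ζ
  have h1 := hasDerivWithinAt_fderiv_apply (f := velocityMap X Y) (t := (0 : ℝ)) (by simpa using hd)
    hl (hasDerivWithinAt_const (0 : ℝ) univ (η, θ))
  have hX1 := hX.fderiv_right (m := ∞) (by simp)
  have hX2 := ContDiffAt.differentiableAt_fderiv hX
  have hX3 := ContDiffAt.differentiableAt_fderiv hX1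
  have hY2 := ContDiffAt.differentiableAt_fderiv hY
  have e1 := hasDerivWithinAt_fderiv_apply (f := X) (t := (0 : ℝ)) (by simpa using hX2)
    hl1 (hasDerivWithinAt_const (0 : ℝ) univ η)
  have e2 := hasDerivWithinAt_fderiv_apply (f := Y) (t := (0 : ℝ)) (by simpa using hY2)
    hl1 (hasDerivWithinAt_const (0 : ℝ) univ η)
  have e3 := hasDerivWithinAt_fderiv_apply (f := X) (t := (0 : ℝ)) (by simpa using hX2)
    hl1 (hasDerivWithinAt_const (0 : ℝ) univ θ)
  have e4 := hasDerivWithinAt_fderiv_fderiv_apply (f := X) (t := (0 : ℝ)) (by simpa using hX3)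
    hl1 (hasDerivWithinAt_const (0 : ℝ) univ η) hl2
  have h2 := e1.prodMk (e2.fun_add (e4.fun_add e3))
  rw [hasDerivWithinAt_univ] at h1 h2
  have hcont : ContinuousAt (fun r : ℝ => v + r • ξ) 0 := by fun_prop
  have h3 := h1.unique (h2.congr_of_eventuallyEq (by
    filter_upwards [hcont.eventually (by simpa using eventually_contDiffAt_of_infty hX),
      hcont.eventually (by simpa using eventually_contDiffAt_of_infty hY)] with r hr1 hr2
    exact fderiv_velocityMap hr1 hr2 η θ))
  simpa using h3

end ChainRule

/-! ### Smooth families of curves: time and parameter derivatives. -/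

section Families

variable {K E F : Type*} [NormedAddCommGroup K] [NormedSpace ℝ K]
  [NormedAddCommGroup E] [NormedSpace ℝ E] [NormedAddCommGroup F] [NormedSpace ℝ F]
  {S : Set ℝ} {x : ℝ × K → E} {t : ℝ} {k : K}

/-- `x` is smooth on `S × K` near `q`. -/
def SmoothGerm (S : Set ℝ) (x : ℝ × K → E) (q : ℝ × K) : Prop :=
  ∀ᶠ p in 𝓝[S ×ˢ univ] q, ContDiffWithinAt ℝ ∞ x (S ×ˢ univ) p

/-- The derivative of the family `x` in the time variable. -/
def tDeriv (S : Set ℝ) (x : ℝ × K → E) (q : ℝ × K) : E := derivWithin (fun s => x (s, q.2)) S q.1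

/-- The derivative of the family `x` in the parameter. -/
def kDeriv (x : ℝ × K → E) (q : ℝ × K) : K →L[ℝ] E := fderiv ℝ (fun v => x (q.1, v)) q.2

theorem SmoothGerm.contDiffWithinAt (h : SmoothGerm S x (t, k)) (ht : t ∈ S) :
    ContDiffWithinAt ℝ ∞ x (S ×ˢ univ) (t, k) :=
  Eventually.self_of_nhdsWithin h ⟨ht, mem_univ _⟩

theorem SmoothGerm.eventually {q : ℝ × K} (h : SmoothGerm S x q) :
    ∀ᶠ p in 𝓝[S ×ˢ univ] q, SmoothGerm S x p := eventually_eventually_nhdsWithin.2 h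

theorem tendsto_slice_time (S : Set ℝ) (t : ℝ) (k : K) :
    Tendsto (fun s : ℝ => (s, k)) (𝓝[S] t) (𝓝[S ×ˢ univ] (t, k)) := by
  refine tendsto_nhdsWithin_iff.2 ⟨?_, ?_⟩
  · exact (Continuous.prodMk_left k).continuousAt.mono_left nhdsWithin_le_nhds
  · filter_upwards [self_mem_nhdsWithin] with s hs using ⟨hs, mem_univ _⟩

theorem tendsto_slice_param (ht : t ∈ S) (k : K) :
    Tendsto (fun v : K => (t, v)) (𝓝 k) (𝓝[S ×ˢ univ] (t, k)) :=
  tendsto_nhdsWithin_iff.2 ⟨(Continuous.prodMk_right t).continuousAt,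
    Eventually.of_forall fun _ => ⟨ht, mem_univ _⟩⟩

theorem SmoothGerm.eventually_param (h : SmoothGerm S x (t, k)) (ht : t ∈ S) :
    ∀ᶠ v in 𝓝 k, SmoothGerm S x (t, v) := (tendsto_slice_param ht k).eventually h.eventually

theorem SmoothGerm.congr {y : ℝ × K → E} (h : SmoothGerm S x (t, k))
    (hxy : y =ᶠ[𝓝[S ×ˢ univ] (t, k)] x) : SmoothGerm S y (t, k) := by
  filter_upwards [h, eventually_eventually_nhdsWithin.2 hxy, self_mem_nhdsWithin]
    with p hp1 hp2 hp3
  exact hp1.congr_of_eventuallyEq hp2 (hp2.self_of_nhdsWithin hp3)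

theorem SmoothGerm.comp {g : E → F} (h : SmoothGerm S x (t, k)) (ht : t ∈ S) {U : Set E}
    (hU : IsOpen U) (hg : ContDiffOn ℝ ∞ g U) (hx : x (t, k) ∈ U) :
    SmoothGerm S (fun q => g (x q)) (t, k) := by
  have h1 := (h.contDiffWithinAt ht).continuousWithinAt.eventually (hU.mem_nhds hx)
  filter_upwards [h, h1] with p hp1 hp2
  exact (hg.contDiffAt (hU.mem_nhds hp2)).comp_contDiffWithinAt p hp1

theorem SmoothGerm.prodMk {y : ℝ × K → F} (hx : SmoothGerm S x (t, k))
    (hy : SmoothGerm S y (t, k)) : SmoothGerm S (fun q => (x q, y q)) (t, k) := by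
  filter_upwards [hx, hy] with p hp1 hp2 using hp1.prodMk hp2

theorem SmoothGerm.add {y : ℝ × K → E} (hx : SmoothGerm S x (t, k))
    (hy : SmoothGerm S y (t, k)) : SmoothGerm S (fun q => x q + y q) (t, k) := by
  filter_upwards [hx, hy] with p hp1 hp2 using hp1.add hp2

theorem SmoothGerm.clm_apply {c : ℝ × K → E →L[ℝ] F} (hc : SmoothGerm S c (t, k))
    (hx : SmoothGerm S x (t, k)) : SmoothGerm S (fun q => c q (x q)) (t, k) := by
  filter_upwards [hc, hx] with p hp1 hp2 using hp1.clm_apply hp2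

theorem SmoothGerm.of_contDiff (hx : ContDiff ℝ ∞ x) : SmoothGerm S x (t, k) :=
  Eventually.of_forall fun _ => hx.contDiffWithinAt

/-- A smooth family stays smooth after a smooth, time dependent change of the parameter. -/
theorem SmoothGerm.comp_param {K' : Type*} [NormedAddCommGroup K'] [NormedSpace ℝ K']
    {φ : ℝ × K' → K} {k' : K'} (hx : SmoothGerm S x (t, φ (t, k')))
    (hφ : SmoothGerm S φ (t, k')) (ht : t ∈ S) :
    SmoothGerm S (fun q => x (q.1, φ q)) (t, k') := by
  have h1 : Tendsto (fun q : ℝ × K' => (q.1, φ q)) (𝓝[S ×ˢ univ] (t, k'))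
      (𝓝[S ×ˢ univ] (t, φ (t, k'))) := by
    refine tendsto_nhdsWithin_iff.2 ⟨?_, ?_⟩
    · exact (continuous_fst.continuousWithinAt (x := (t, k'))).prodMk
        (hφ.contDiffWithinAt ht).continuousWithinAt
    · filter_upwards [self_mem_nhdsWithin] with q hq using ⟨hq.1, mem_univ _⟩
  filter_upwards [h1.eventually hx, hφ] with p hp1 hp2
  exact ContDiffWithinAt.comp (g := x) (t := S ×ˢ univ) p hp1 (contDiffWithinAt_fst.prodMk hp2)
    fun q hq => ⟨hq.1, mem_univ _⟩

theorem SmoothGerm.contDiffWithinAt_time (h : SmoothGerm S x (t, k)) (ht : t ∈ S) :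
    ContDiffWithinAt ℝ ∞ (fun s => x (s, k)) S t :=
  ContDiffWithinAt.comp (g := x) (f := fun s => (s, k)) (t := S ×ˢ univ) t
    (h.contDiffWithinAt ht) (contDiffWithinAt_id.prodMk contDiffWithinAt_const)
    fun _ hs => ⟨hs, mem_univ _⟩

theorem contDiffAt_param (h : ContDiffWithinAt ℝ ∞ x (S ×ˢ univ) (t, k)) (ht : t ∈ S) :
    ContDiffAt ℝ ∞ (fun v => x (t, v)) k :=
  (ContDiffWithinAt.comp (g := x) (f := fun v => (t, v)) (s := univ) (t := S ×ˢ univ) k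
    h (contDiffWithinAt_const.prodMk contDiffWithinAt_id)
    fun _ _ => ⟨ht, mem_univ _⟩).contDiffAt univ_mem

theorem SmoothGerm.contDiffAt_param (h : SmoothGerm S x (t, k)) (ht : t ∈ S) :
    ContDiffAt ℝ ∞ (fun v => x (t, v)) k := Finsler.contDiffAt_param (h.contDiffWithinAt ht) ht

theorem kDeriv_eq (hx : DifferentiableWithinAt ℝ x (S ×ˢ univ) (t, k)) (ht : t ∈ S) (v : K) :
    kDeriv x (t, k) v = fderivWithin ℝ x (S ×ˢ univ) (t, k) (0, v) := by
  have h1 : HasFDerivWithinAt (fun v => x (t, v)) (fderivWithin ℝ x (S ×ˢ univ) (t, k) ∘L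
      ContinuousLinearMap.inr ℝ ℝ K) univ k :=
    HasFDerivWithinAt.comp k hx.hasFDerivWithinAt
      (hasFDerivAt_prodMk_right t k).hasFDerivWithinAt fun _ _ => ⟨ht, mem_univ _⟩
  rw [kDeriv, (hasFDerivWithinAt_univ.1 h1).fderiv]; rfl

theorem tDeriv_eq (hS : UniqueDiffOn ℝ S) (hx : DifferentiableWithinAt ℝ x (S ×ˢ univ) (t, k))
    (ht : t ∈ S) : tDeriv S x (t, k) = fderivWithin ℝ x (S ×ˢ univ) (t, k) (1, 0) := by
  have h1 : HasFDerivWithinAt (fun s => x (s, k)) (fderivWithin ℝ x (S ×ˢ univ) (t, k) ∘L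
      ContinuousLinearMap.inl ℝ ℝ K) S t :=
    HasFDerivWithinAt.comp t hx.hasFDerivWithinAt
      (hasFDerivAt_prodMk_left t k).hasFDerivWithinAt fun _ hs => ⟨hs, mem_univ _⟩
  rw [tDeriv, ← fderivWithin_derivWithin, h1.fderivWithin (hS t ht)]; rfl

theorem SmoothGerm.fderivWithin (h : SmoothGerm S x (t, k)) (hS : UniqueDiffOn ℝ S) :
    SmoothGerm S (_root_.fderivWithin ℝ x (S ×ˢ univ)) (t, k) := by
  filter_upwards [h, self_mem_nhdsWithin] with p hp1 hp2
  exact hp1.fderivWithin_right (hS.prod uniqueDiffOn_univ) (by simp) hp2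

/-- The identification of `tDeriv` with a directional derivative of the whole family is needed at
all nearby points; this is where the neighbourhood in `SmoothGerm` is used. -/
theorem SmoothGerm.tDeriv (h : SmoothGerm S x (t, k)) (hS : UniqueDiffOn ℝ S) :
    SmoothGerm S (tDeriv S x) (t, k) := by
  have h1 := (h.fderivWithin hS).clm_apply
    (SmoothGerm.of_contDiff (contDiff_const (c := ((1 : ℝ), (0 : K)))))
  refine h1.congr ?_
  filter_upwards [h, self_mem_nhdsWithin] with p hp1 hp2
  exact tDeriv_eq hS (hp1.differentiableWithinAt (by simp)) hp2.1

theorem SmoothGerm.kDeriv (h : SmoothGerm S x (t, k)) (hS : UniqueDiffOn ℝ S) :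
    SmoothGerm S (kDeriv x) (t, k) := by
  have h1 : SmoothGerm S (fun p => (ContinuousLinearMap.compL ℝ K (ℝ × K) E).flip
      (ContinuousLinearMap.inr ℝ ℝ K) (_root_.fderivWithin ℝ x (S ×ˢ univ) p)) (t, k) := by
    filter_upwards [h.fderivWithin hS] with p hp
    exact (ContinuousLinearMap.contDiff _).comp_contDiffWithinAt hp
  refine h1.congr ?_
  filter_upwards [h, self_mem_nhdsWithin] with p hp1 hp2
  ext v
  exact kDeriv_eq (hp1.differentiableWithinAt (by simp)) hp2.1 v

/-- Derivatives in the time variable and in the parameter commute. -/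
theorem SmoothGerm.hasDerivWithinAt_kDeriv (h : SmoothGerm S x (t, k)) (hS : UniqueDiffOn ℝ S)
    (hS' : S ⊆ closure (interior S)) (ht : t ∈ S) :
    HasDerivWithinAt (fun s => Finsler.kDeriv x (s, k)) (Finsler.kDeriv (Finsler.tDeriv S x) (t, k))
      S t := by
  have hk := (h.kDeriv hS).contDiffWithinAt_time ht
  refine (hk.differentiableWithinAt (by simp)).hasDerivWithinAt.congr_deriv ?_
  ext v
  have hW : (t, k) ∈ S ×ˢ (univ : Set K) := ⟨ht, mem_univ _⟩
  have hWu : UniqueDiffOn ℝ (S ×ˢ (univ : Set K)) := hS.prod uniqueDiffOn_univ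
  have hD := ((h.fderivWithin hS).contDiffWithinAt ht).differentiableWithinAt (by simp)
  -- the second derivative of `x` in the two directions
  have h1 : derivWithin (fun s => Finsler.kDeriv x (s, k)) S t v =
      _root_.fderivWithin ℝ (_root_.fderivWithin ℝ x (S ×ˢ univ)) (S ×ˢ univ) (t, k) (1, 0)
        (0, v) := by
    have e1 : HasDerivWithinAt (fun s => Finsler.kDeriv x (s, k) v) _ S t :=
      ((hk.differentiableWithinAt (by simp)).hasDerivWithinAt).clm_apply
        (hasDerivWithinAt_const t S v)
    have e2 : HasDerivWithinAt (fun s => _root_.fderivWithin ℝ x (S ×ˢ univ) (s, k)) _ S t :=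
      hD.hasFDerivWithinAt.comp_hasDerivWithinAt (f := fun s => (s, k)) t
        ((hasDerivWithinAt_id t S).prodMk (hasDerivWithinAt_const t S k))
        fun _ hs => ⟨hs, mem_univ _⟩
    have e3 := e2.clm_apply (hasDerivWithinAt_const t S ((0 : ℝ), v))
    have e4 : (fun s => Finsler.kDeriv x (s, k) v) =ᶠ[𝓝[S] t]
        fun s => _root_.fderivWithin ℝ x (S ×ˢ univ) (s, k) (0, v) := by
      filter_upwards [(tendsto_slice_time S t k).eventually h, self_mem_nhdsWithin] with s hs1 hs2
      exact kDeriv_eq (hs1.differentiableWithinAt (by simp)) hs2 v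
    have e5 := (e1.derivWithin (hS t ht)).symm.trans
      ((e3.congr_of_eventuallyEq e4 (e4.self_of_nhdsWithin ht)).derivWithin (hS t ht))
    simpa using e5
  have h2 : Finsler.kDeriv (Finsler.tDeriv S x) (t, k) v =
      _root_.fderivWithin ℝ (_root_.fderivWithin ℝ x (S ×ˢ univ)) (S ×ˢ univ) (t, k) (0, v)
        (1, 0) := by
    rw [kDeriv_eq (((h.tDeriv hS).contDiffWithinAt ht).differentiableWithinAt (by simp)) ht]
    have e4 : Finsler.tDeriv S x =ᶠ[𝓝[S ×ˢ univ] (t, k)]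
        fun p => _root_.fderivWithin ℝ x (S ×ˢ univ) p (1, 0) := by
      filter_upwards [h, self_mem_nhdsWithin] with p hp1 hp2
      exact tDeriv_eq hS (hp1.differentiableWithinAt (by simp)) hp2.1
    rw [e4.fderivWithin_eq (e4.self_of_nhdsWithin hW),
      fderivWithin_clm_apply (hWu _ hW) hD (differentiableWithinAt_const _)]
    simp
  rw [h1, h2]
  -- The domain is not open at the ends of `S`; second derivatives are still symmetric there because
  -- these points lie in the closure of the interior.
  have hsymm : IsSymmSndFDerivWithinAt ℝ x (S ×ˢ univ) (t, k) := by
    refine (h.contDiffWithinAt ht).isSymmSndFDerivWithinAt (by simpa using two_le_infty) hWu ?_ hW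
    rw [interior_prod_eq, closure_prod_eq]
    exact ⟨hS' ht, by simp⟩
  exact hsymm _ _

theorem SmoothGerm.hasDerivWithinAt_kDeriv_kDeriv (h : SmoothGerm S x (t, k))
    (hS : UniqueDiffOn ℝ S) (hS' : S ⊆ closure (interior S)) (ht : t ∈ S) :
    HasDerivWithinAt (fun s => Finsler.kDeriv (Finsler.kDeriv x) (s, k))
      (Finsler.kDeriv (Finsler.kDeriv (Finsler.tDeriv S x)) (t, k)) S t := by
  refine ((h.kDeriv hS).hasDerivWithinAt_kDeriv hS hS' ht).congr_deriv ?_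
  have : (fun v => Finsler.tDeriv S (Finsler.kDeriv x) (t, v)) =ᶠ[𝓝 k]
      fun v => Finsler.kDeriv (Finsler.tDeriv S x) (t, v) := by
    filter_upwards [h.eventually_param ht] with v hv
    exact (hv.hasDerivWithinAt_kDeriv hS hS' ht).derivWithin (hS t ht)
  exact this.fderiv_eq

theorem uniqueDiffOn_of_lt {a b : ℝ} (hab : a < b) : UniqueDiffOn ℝ (Icc a b) :=
  uniqueDiffOn_Icc hab

theorem Icc_subset_closure_interior {a b : ℝ} (hab : a < b) :
    Icc a b ⊆ closure (interior (Icc a b)) := by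
  rw [interior_Icc, closure_Ioo hab.ne]

end Families

/-! ### From the manifold to charts. -/

section Charts

variable {n : ℕ} {M : Type*} [TopologicalSpace M] [ChartedSpace (EuclideanSpace ℝ (Fin n)) M]
  [IsManifold (𝓡 n) ∞ M]

/-- The derivative at `p` of the chart at `a`. -/
def chartDeriv (a p : M) : EuclideanSpace ℝ (Fin n) →L[ℝ] EuclideanSpace ℝ (Fin n) :=
  mfderiv (𝓡 n) (𝓡 n) (chartAt (EuclideanSpace ℝ (Fin n)) a) p

variable {a p : M}

theorem mdifferentiable_chart_infty (a : M) :
    (chartAt (EuclideanSpace ℝ (Fin n)) a).MDifferentiable (𝓡 n) (𝓡 n) := mdifferentiable_chart a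

theorem chartDeriv_bijective (hp : p ∈ (chartAt (EuclideanSpace ℝ (Fin n)) a).source) :
    Function.Bijective (chartDeriv (n := n) a p) := (mdifferentiable_chart_infty a).mfderiv_bijective hp

theorem chartDeriv_eq_zero (hp : p ∈ (chartAt (EuclideanSpace ℝ (Fin n)) a).source)
    {u : EuclideanSpace ℝ (Fin n)} : chartDeriv a p u = 0 ↔ u = 0 :=
  map_eq_zero_iff _ (chartDeriv_bijective hp).1

theorem mfderiv_chart_symm_chartDeriv (hp : p ∈ (chartAt (EuclideanSpace ℝ (Fin n)) a).source)
    (u : EuclideanSpace ℝ (Fin n)) :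
    mfderiv (𝓡 n) (𝓡 n) (chartAt (EuclideanSpace ℝ (Fin n)) a).symm
      (chartAt (EuclideanSpace ℝ (Fin n)) a p) (chartDeriv a p u) = u :=
  DFunLike.congr_fun ((mdifferentiable_chart_infty a).symm_comp_deriv hp) u

/-- All tangent spaces are the model space by definition, so the same vector can be read at two
equal base points without a transport map. -/
theorem apply_mk_congr (F : TangentBundle (𝓡 n) M → ℝ) {p q : M} (h : p = q)
    (u : EuclideanSpace ℝ (Fin n)) :
    F (⟨p, u⟩ : TangentBundle (𝓡 n) M) = F (⟨q, u⟩ : TangentBundle (𝓡 n) M) := by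
  subst h; rfl

theorem eq_localF (F : TangentBundle (𝓡 n) M → ℝ)
    (hp : p ∈ (chartAt (EuclideanSpace ℝ (Fin n)) a).source) (u : EuclideanSpace ℝ (Fin n)) :
    F (⟨p, u⟩ : TangentBundle (𝓡 n) M) =
      localF F a (chartAt (EuclideanSpace ℝ (Fin n)) a p) (chartDeriv a p u) := by
  have h1 := mfderiv_chart_symm_chartDeriv hp u
  have h2 : localF F a (chartAt (EuclideanSpace ℝ (Fin n)) a p) (chartDeriv a p u) =
      F (⟨(chartAt (EuclideanSpace ℝ (Fin n)) a).symm (chartAt (EuclideanSpace ℝ (Fin n)) a p),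
        mfderiv (𝓡 n) (𝓡 n) (chartAt (EuclideanSpace ℝ (Fin n)) a).symm
      (chartAt (EuclideanSpace ℝ (Fin n)) a p) (chartDeriv a p u)⟩ : TangentBundle (𝓡 n) M) := rfl
  rw [h2]
  refine Eq.trans ?_ (apply_mk_congr F
    ((chartAt (EuclideanSpace ℝ (Fin n)) a).left_inv hp).symm _)
  exact congrArg (fun v : EuclideanSpace ℝ (Fin n) => F (⟨p, v⟩ : TangentBundle (𝓡 n) M)) h1.symm

/-- Links the smooth structure of the tangent bundle, defined by trivializations, to the derivative
of a chart, which is what `localField` and `localF` use. -/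
theorem trivializationAt_snd (hp : p ∈ (chartAt (EuclideanSpace ℝ (Fin n)) a).source)
    (u : TangentSpace (𝓡 n) p) :
    (trivializationAt (EuclideanSpace ℝ (Fin n)) (TangentSpace (𝓡 n)) a
      (⟨p, u⟩ : TangentBundle (𝓡 n) M)).2 = chartDeriv a p u := by
  have h1 := TangentBundle.continuousLinearMapAt_trivializationAt (I := 𝓡 n) hp
  have h2 : mfderiv (𝓡 n) 𝓘(ℝ, EuclideanSpace ℝ (Fin n)) (extChartAt (𝓡 n) a) p =
      chartDeriv a p := by
    rw [chartDeriv]; congr 1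
  have h3 := DFunLike.congr_fun (h1.trans h2) u
  refine Eq.trans ?_ h3
  rw [Bundle.Trivialization.continuousLinearMapAt_apply,
    Bundle.Trivialization.coe_linearMapAt_of_mem]
  simpa using hp

variable {E : Type*} [NormedAddCommGroup E] [NormedSpace ℝ E] {f : E → M} {s : Set E} {q : E}

/-- Smoothness of a map into `M` in terms of a chart. -/
theorem contMDiffWithinAt_iff_chart (hq : f q ∈ (chartAt (EuclideanSpace ℝ (Fin n)) a).source) :
    ContMDiffWithinAt 𝓘(ℝ, E) (𝓡 n) ∞ f s q ↔ ContinuousWithinAt f s q ∧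
      ContDiffWithinAt ℝ ∞ (fun v => chartAt (EuclideanSpace ℝ (Fin n)) a (f v)) s q := by
  rw [contMDiffWithinAt_iff_target_of_mem_source hq, contMDiffWithinAt_iff_contDiffWithinAt]
  rfl

theorem contDiffWithinAt_chart (hq : f q ∈ (chartAt (EuclideanSpace ℝ (Fin n)) a).source)
    (hf : ContMDiffWithinAt 𝓘(ℝ, E) (𝓡 n) ∞ f s q) :
    ContDiffWithinAt ℝ ∞ (fun v => chartAt (EuclideanSpace ℝ (Fin n)) a (f v)) s q :=
  ((contMDiffWithinAt_iff_chart hq).1 hf).2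

/-- Smoothness of a map into `TM` in terms of a chart of `M`. -/
theorem contMDiffWithinAt_tangent_iff {u : E → EuclideanSpace ℝ (Fin n)}
    (hq : f q ∈ (chartAt (EuclideanSpace ℝ (Fin n)) a).source) :
    ContMDiffWithinAt 𝓘(ℝ, E) (𝓡 n).tangent ∞ (fun v => (⟨f v, u v⟩ : TangentBundle (𝓡 n) M)) s q ↔
      ContMDiffWithinAt 𝓘(ℝ, E) (𝓡 n) ∞ f s q ∧
      ContDiffWithinAt ℝ ∞ (fun v => chartDeriv a (f v) (u v)) s q := by
  have he : (⟨f q, u q⟩ : TangentBundle (𝓡 n) M) ∈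
      (trivializationAt (EuclideanSpace ℝ (Fin n)) (TangentSpace (𝓡 n)) a).source := by
    simpa [Bundle.Trivialization.mem_source] using hq
  rw [show (𝓡 n).tangent = (𝓡 n).prod 𝓘(ℝ, EuclideanSpace ℝ (Fin n)) from rfl,
    Bundle.Trivialization.contMDiffWithinAt_iff (f := fun v => (⟨f v, u v⟩ : TangentBundle (𝓡 n) M))
      he]
  refine and_congr_right fun hf => ?_
  rw [← contMDiffWithinAt_iff_contDiffWithinAt]
  have hev : (fun v => (trivializationAt (EuclideanSpace ℝ (Fin n)) (TangentSpace (𝓡 n)) a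
      (⟨f v, u v⟩ : TangentBundle (𝓡 n) M)).2) =ᶠ[𝓝[s] q] fun v => chartDeriv a (f v) (u v) := by
    filter_upwards [hf.continuousWithinAt.eventually
      ((chartAt (EuclideanSpace ℝ (Fin n)) a).open_source.mem_nhds hq)] with v hv
    exact trivializationAt_snd hv _
  exact hev.contMDiffWithinAt_iff (trivializationAt_snd hq _)

theorem fderivWithin_chart (hq : f q ∈ (chartAt (EuclideanSpace ℝ (Fin n)) a).source)
    (hf : MDifferentiableWithinAt 𝓘(ℝ, E) (𝓡 n) f s q) (hs : UniqueDiffWithinAt ℝ s q) (v : E) :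
    fderivWithin ℝ (fun v => chartAt (EuclideanSpace ℝ (Fin n)) a (f v)) s q v =
      chartDeriv a (f q) (mfderivWithin 𝓘(ℝ, E) (𝓡 n) f s q v) := by
  have h1 := mfderiv_comp_mfderivWithin q ((mdifferentiable_chart_infty a).mdifferentiableAt hq) hf
    hs.uniqueMDiffWithinAt
  rw [← mfderivWithin_eq_fderivWithin]
  exact DFunLike.congr_fun h1 v

theorem fderiv_chart (hq : f q ∈ (chartAt (EuclideanSpace ℝ (Fin n)) a).source)
    (hf : MDifferentiableAt 𝓘(ℝ, E) (𝓡 n) f q) (v : E) :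
    fderiv ℝ (fun v => chartAt (EuclideanSpace ℝ (Fin n)) a (f v)) q v =
      chartDeriv a (f q) (mfderiv 𝓘(ℝ, E) (𝓡 n) f q v) := by
  have h := fderivWithin_chart (s := univ) hq hf.mdifferentiableWithinAt uniqueDiffWithinAt_univ v
  rwa [fderivWithin_univ, mfderivWithin_univ] at h

theorem derivWithin_chart {c : ℝ → M} {S : Set ℝ} {t : ℝ}
    (ht : c t ∈ (chartAt (EuclideanSpace ℝ (Fin n)) a).source)
    (hc : MDifferentiableWithinAt 𝓘(ℝ, ℝ) (𝓡 n) c S t) (hS : UniqueDiffWithinAt ℝ S t) :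
    derivWithin (localCurve a c) S t =
      chartDeriv a (c t) (mfderivWithin 𝓘(ℝ, ℝ) (𝓡 n) c S t (1 : ℝ)) := by
  rw [← fderivWithin_derivWithin]
  exact fderivWithin_chart ht hc hS 1

theorem contMDiffAt_chart_symm {x : EuclideanSpace ℝ (Fin n)}
    (hx : x ∈ (chartAt (EuclideanSpace ℝ (Fin n)) a).target) :
    ContMDiffAt (𝓡 n) (𝓡 n) ∞ (chartAt (EuclideanSpace ℝ (Fin n)) a).symm x :=
  (contMDiffOn_chart_symm (x := a)).contMDiffAt
    ((chartAt (EuclideanSpace ℝ (Fin n)) a).open_target.mem_nhds hx)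

theorem chartDeriv_mfderiv_symm {x : EuclideanSpace ℝ (Fin n)}
    (hx : x ∈ (chartAt (EuclideanSpace ℝ (Fin n)) a).target) (y : EuclideanSpace ℝ (Fin n)) :
    chartDeriv a ((chartAt (EuclideanSpace ℝ (Fin n)) a).symm x)
      (mfderiv (𝓡 n) (𝓡 n) (chartAt (EuclideanSpace ℝ (Fin n)) a).symm x y) = y :=
  DFunLike.congr_fun ((mdifferentiable_chart_infty a).comp_symm_deriv hx) y

variable {F : TangentBundle (𝓡 n) M → ℝ}

/-- The local expression is F composed with the tangent map of the inverse chart. In the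
trivialization the fibre component of that map is just y, so the map is smooth, and it keeps y ≠ 0
off the zero section. -/
theorem IsFinsler.smoothOff_localF (hF : IsFinsler F) (a : M) :
    SmoothOff (chartAt (EuclideanSpace ℝ (Fin n)) a).target (localF F a) := by
  set φ := chartAt (EuclideanSpace ℝ (Fin n)) a
  intro q hq
  have hx : q.1 ∈ φ.target := hq.1
  have hsrc : φ.symm q.1 ∈ φ.source := φ.map_target hx
  have h1 : ContMDiffAt 𝓘(ℝ, EuclideanSpace ℝ (Fin n) × EuclideanSpace ℝ (Fin n)) (𝓡 n) ∞
      (fun q : EuclideanSpace ℝ (Fin n) × EuclideanSpace ℝ (Fin n) => φ.symm q.1) q :=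
    (contMDiffAt_chart_symm hx).comp q contDiff_fst.contMDiff.contMDiffAt
  have h2 : ContMDiffAt 𝓘(ℝ, EuclideanSpace ℝ (Fin n) × EuclideanSpace ℝ (Fin n)) (𝓡 n).tangent ∞
      (fun q : EuclideanSpace ℝ (Fin n) × EuclideanSpace ℝ (Fin n) =>
        (⟨φ.symm q.1, mfderiv (𝓡 n) (𝓡 n) φ.symm q.1 q.2⟩ : TangentBundle (𝓡 n) M)) q := by
    rw [← contMDiffWithinAt_univ]
    refine (contMDiffWithinAt_tangent_iff (a := a)
      (f := fun q : EuclideanSpace ℝ (Fin n) × EuclideanSpace ℝ (Fin n) => φ.symm q.1)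
      (u := fun q => mfderiv (𝓡 n) (𝓡 n) φ.symm q.1 q.2) hsrc).2 ⟨h1, ?_⟩
    refine (contDiffWithinAt_snd (𝕜 := ℝ)).congr_of_eventuallyEq ?_ ?_
    · filter_upwards [nhdsWithin_le_nhds (continuous_fst.continuousAt.eventually
        (φ.open_target.mem_nhds hx))] with r hr
      exact chartDeriv_mfderiv_symm hr r.2
    · exact chartDeriv_mfderiv_symm hx q.2
  have hne : (mfderiv (𝓡 n) (𝓡 n) φ.symm q.1 q.2 : EuclideanSpace ℝ (Fin n)) ≠ 0 := fun h0 => by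
    have := chartDeriv_mfderiv_symm hx q.2
    rw [show mfderiv (𝓡 n) (𝓡 n) φ.symm q.1 q.2 = 0 from h0] at this
    exact hq.2 (by rw [mem_singleton_iff, ← this]; exact map_zero _)
  have h3 : ContMDiffWithinAt 𝓘(ℝ, EuclideanSpace ℝ (Fin n) × EuclideanSpace ℝ (Fin n)) 𝓘(ℝ, ℝ) ∞
      (Function.uncurry (localF F a))
      ((fun q : EuclideanSpace ℝ (Fin n) × EuclideanSpace ℝ (Fin n) =>
        (⟨φ.symm q.1, mfderiv (𝓡 n) (𝓡 n) φ.symm q.1 q.2⟩ : TangentBundle (𝓡 n) M)) ⁻¹'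
        {v | v.snd ≠ 0} ∩ slit φ.target) q :=
    ContMDiffWithinAt.comp_of_eq (x := q) (hF.smooth _ hne) (h2.contMDiffWithinAt)
      (fun r hr => hr.1) rfl
  have h4 : slit φ.target ⊆ ((fun q : EuclideanSpace ℝ (Fin n) × EuclideanSpace ℝ (Fin n) =>
        (⟨φ.symm q.1, mfderiv (𝓡 n) (𝓡 n) φ.symm q.1 q.2⟩ : TangentBundle (𝓡 n) M)) ⁻¹'
        {v | v.snd ≠ 0} ∩ slit φ.target) := fun r hr => ⟨fun h0 => by
    have := chartDeriv_mfderiv_symm (a := a) hr.1 r.2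
    rw [show mfderiv (𝓡 n) (𝓡 n) φ.symm r.1 r.2 = 0 from h0] at this
    exact hr.2 (by rw [mem_singleton_iff, ← this]; exact map_zero _), hr⟩
  exact contMDiffWithinAt_iff_contDiffWithinAt.1 (h3.mono h4)

/-- `F²` in a chart is the function `sqr (localF F a)`. -/
theorem sq_eq_sqr (F : TangentBundle (𝓡 n) M → ℝ)
    (hp : p ∈ (chartAt (EuclideanSpace ℝ (Fin n)) a).source) (u : EuclideanSpace ℝ (Fin n)) :
    F (⟨p, u⟩ : TangentBundle (𝓡 n) M) ^ 2 =
      sqr (localF F a) (chartAt (EuclideanSpace ℝ (Fin n)) a p) (chartDeriv a p u) := by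
  rw [eq_localF F hp]; rfl

/-- On a fibre, F² is `sqr` composed with the affine map `j`, whose second derivative vanishes; so
the Hessian simply pulls back. -/
theorem fundTensor_eq_of_smooth
    (hs : SmoothOff (chartAt (EuclideanSpace ℝ (Fin n)) a).target (localF F a))
    (hp : p ∈ (chartAt (EuclideanSpace ℝ (Fin n)) a).source) {y : EuclideanSpace ℝ (Fin n)}
    (hy : y ≠ 0) (u v : EuclideanSpace ℝ (Fin n)) :
    fundTensor F p y u v = (1 / 2) * fderiv ℝ (fderiv ℝ (Function.uncurry (sqr (localF F a))))
      (chartAt (EuclideanSpace ℝ (Fin n)) a p, chartDeriv a p y)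
      (0, chartDeriv a p u) (0, chartDeriv a p v) := by
  set φ := chartAt (EuclideanSpace ℝ (Fin n)) a
  have hsq : SmoothOff φ.target (sqr (localF F a)) :=
    (hs.mul hs).congr fun x y _ => by simp [sqr, sq]
  have hsl : (φ p, chartDeriv a p y) ∈ slit φ.target :=
    ⟨φ.map_source hp, fun h => hy ((chartDeriv_eq_zero hp).1 h)⟩
  have hc := hsq.contDiffAt φ.open_target hsl
  let j : EuclideanSpace ℝ (Fin n) → EuclideanSpace ℝ (Fin n) × EuclideanSpace ℝ (Fin n) :=
    fun z => (φ p, chartDeriv a p z)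
  have hj : ContDiff ℝ ∞ j := contDiff_const.prodMk (chartDeriv a p).contDiff
  have hj1 : ∀ z, fderiv ℝ j z = (0 : EuclideanSpace ℝ (Fin n) →L[ℝ] EuclideanSpace ℝ (Fin n)).prod
      (chartDeriv a p) := fun z =>
    ((hasFDerivAt_const (φ p) z).prodMk (chartDeriv a p).hasFDerivAt).fderiv
  have hj2 : fderiv ℝ (fderiv ℝ j) y = 0 := by
    rw [show fderiv ℝ j = fun _ => _ from funext hj1, fderiv_fun_const]; rfl
  have h1 : (fun z : EuclideanSpace ℝ (Fin n) => F (⟨p, z⟩ : TangentBundle (𝓡 n) M) ^ 2) =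
      fun z => Function.uncurry (sqr (localF F a)) (j z) := funext fun z => sq_eq_sqr F hp z
  have hcj : ContDiffAt ℝ ∞ (fun z => Function.uncurry (sqr (localF F a)) (j z)) y :=
    ContDiffAt.comp (g := Function.uncurry (sqr (localF F a))) y hc hj.contDiffAt
  have h2 : fundTensor F p y u v = (1 / 2) * fderiv ℝ (fun w : EuclideanSpace ℝ (Fin n) =>
      fderiv ℝ (fun z : EuclideanSpace ℝ (Fin n) =>
        F (⟨p, z⟩ : TangentBundle (𝓡 n) M) ^ 2) w v) y u := rfl
  rw [h2, h1, fderiv_clm_apply_const (ContDiffAt.differentiableAt_fderiv hcj),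
    fderiv_fderiv_comp (f := j) hc hj.contDiffAt, hj2, hj1]
  simp [j]

theorem IsFinsler.isLocalFinsler (hF : IsFinsler F) (a : M) :
    IsLocalFinsler (localF F a) (chartAt (EuclideanSpace ℝ (Fin n)) a).target where
  isOpen := (chartAt (EuclideanSpace ℝ (Fin n)) a).open_target
  smooth := hF.smoothOff_localF a
  homogeneous x _ y r := by
    have h : mfderiv (𝓡 n) (𝓡 n) (chartAt (EuclideanSpace ℝ (Fin n)) a).symm x (r • y) =
      r • mfderiv (𝓡 n) (𝓡 n) (chartAt (EuclideanSpace ℝ (Fin n)) a).symm x y := map_smul _ _ _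
    rw [localF, tangentMap]
    refine Eq.trans ?_ (hF.homogeneous _ _ r)
    congr 2
  posDef x hx y u hy hu := by
    set φ := chartAt (EuclideanSpace ℝ (Fin n)) a
    have hp : φ.symm x ∈ φ.source := φ.map_target hx
    obtain ⟨y', rfl⟩ := (chartDeriv_bijective hp).2 y
    obtain ⟨u', rfl⟩ := (chartDeriv_bijective hp).2 u
    have hy' : y' ≠ 0 := fun h => hy (by rw [h, map_zero])
    have hu' : u' ≠ 0 := fun h => hu (by rw [h, map_zero])
    have h1 := hF.posDef (φ.symm x) y' u' hy' hu'
    rw [fundTensor_eq_of_smooth (hF.smoothOff_localF a) hp hy', φ.right_inv hx] at h1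
    linarith

theorem IsFinsler.fundTensor_eq (hF : IsFinsler F)
    (hp : p ∈ (chartAt (EuclideanSpace ℝ (Fin n)) a).source) {y : EuclideanSpace ℝ (Fin n)}
    (hy : y ≠ 0) (u v : EuclideanSpace ℝ (Fin n)) :
    fundTensor F p y u v = (1 / 2) * fderiv ℝ (fderiv ℝ (Function.uncurry (sqr (localF F a))))
      (chartAt (EuclideanSpace ℝ (Fin n)) a p, chartDeriv a p y)
      (0, chartDeriv a p u) (0, chartDeriv a p v) :=
  fundTensor_eq_of_smooth (hF.smoothOff_localF a) hp hy u v

theorem IsFinsler.mem_slit (_hF : IsFinsler F)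
    (hp : p ∈ (chartAt (EuclideanSpace ℝ (Fin n)) a).source) {y : EuclideanSpace ℝ (Fin n)}
    (hy : y ≠ 0) : (chartAt (EuclideanSpace ℝ (Fin n)) a p, chartDeriv a p y) ∈
      slit (chartAt (EuclideanSpace ℝ (Fin n)) a).target :=
  ⟨(chartAt (EuclideanSpace ℝ (Fin n)) a).map_source hp,
    fun h => hy ((chartDeriv_eq_zero hp).1 h)⟩

/-- `g(u, y) = ½ ∂F²/∂y (u)`. -/
theorem IsFinsler.fundTensor_right (hF : IsFinsler F)
    (hp : p ∈ (chartAt (EuclideanSpace ℝ (Fin n)) a).source) {y : EuclideanSpace ℝ (Fin n)}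
    (hy : y ≠ 0) (u : EuclideanSpace ℝ (Fin n)) :
    fundTensor F p y u y = (1 / 2) * fderiv ℝ (Function.uncurry (sqr (localF F a)))
      (chartAt (EuclideanSpace ℝ (Fin n)) a p, chartDeriv a p y) (0, chartDeriv a p u) := by
  rw [hF.fundTensor_eq hp hy,
    (hF.isLocalFinsler a).fderiv_fderiv_sqr_vertical (hF.mem_slit hp hy)]
  ring

/-- Two uses of Euler's relation; it turns the integrand of `energy` into a power of F². -/
theorem IsFinsler.fundTensor_self (hF : IsFinsler F) {y : EuclideanSpace ℝ (Fin n)}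
    (hy : y ≠ 0) : fundTensor F p y y y = F (⟨p, y⟩ : TangentBundle (𝓡 n) M) ^ 2 := by
  have hp := mem_chart_source (EuclideanSpace ℝ (Fin n)) p
  rw [hF.fundTensor_right hp hy, (hF.isLocalFinsler p).fderiv_sqr_vertical (hF.mem_slit hp hy),
    sq_eq_sqr F hp]
  ring

end Charts

/-! ### Tubes: smooth families of parametrizations along a curve. -/

section Tubes

variable {n : ℕ} {M : Type*} [TopologicalSpace M] [ChartedSpace (EuclideanSpace ℝ (Fin n)) M]
  [IsManifold (𝓡 n) ∞ M]
variable {K : Type*} [NormedAddCommGroup K] [NormedSpace ℝ K] {S : Set ℝ} {t : ℝ} {k : K} {a : M}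

/-- `f` is a smooth map into `M` on `S × K` near `q`. -/
def MSmoothGerm (n : ℕ) {M : Type*} [TopologicalSpace M]
    [ChartedSpace (EuclideanSpace ℝ (Fin n)) M] (S : Set ℝ) (f : ℝ × K → M) (q : ℝ × K) : Prop :=
  ∀ᶠ p in 𝓝[S ×ˢ univ] q, ContMDiffWithinAt 𝓘(ℝ, ℝ × K) (𝓡 n) ∞ f (S ×ˢ univ) p

variable {f g : ℝ × K → M}

theorem MSmoothGerm.contMDiffWithinAt (h : MSmoothGerm n S f (t, k)) (ht : t ∈ S) :
    ContMDiffWithinAt 𝓘(ℝ, ℝ × K) (𝓡 n) ∞ f (S ×ˢ univ) (t, k) :=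
  Eventually.self_of_nhdsWithin h ⟨ht, mem_univ _⟩

theorem MSmoothGerm.congr (h : MSmoothGerm n S f (t, k)) (hfg : g =ᶠ[𝓝[S ×ˢ univ] (t, k)] f) :
    MSmoothGerm n S g (t, k) := by
  filter_upwards [h, eventually_eventually_nhdsWithin.2 hfg, self_mem_nhdsWithin]
    with p hp1 hp2 hp3
  exact hp1.congr_of_eventuallyEq hp2 (hp2.self_of_nhdsWithin hp3)

theorem MSmoothGerm.eventually_mem_source (h : MSmoothGerm n S f (t, k)) (ht : t ∈ S)
    (ha : f (t, k) ∈ (chartAt (EuclideanSpace ℝ (Fin n)) a).source) :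
    ∀ᶠ p in 𝓝[S ×ˢ univ] (t, k), f p ∈ (chartAt (EuclideanSpace ℝ (Fin n)) a).source :=
  (h.contMDiffWithinAt ht).continuousWithinAt.eventually
    ((chartAt (EuclideanSpace ℝ (Fin n)) a).open_source.mem_nhds ha)

theorem MSmoothGerm.smoothGerm (h : MSmoothGerm n S f (t, k)) (ht : t ∈ S)
    (ha : f (t, k) ∈ (chartAt (EuclideanSpace ℝ (Fin n)) a).source) :
    SmoothGerm S (fun q => chartAt (EuclideanSpace ℝ (Fin n)) a (f q)) (t, k) := by
  filter_upwards [h, h.eventually_mem_source ht ha] with p hp1 hp2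
  exact contDiffWithinAt_chart hp2 hp1

theorem SmoothGerm.mSmoothGerm {x : ℝ × K → EuclideanSpace ℝ (Fin n)}
    (h : SmoothGerm S x (t, k)) (ht : t ∈ S)
    (ha : x (t, k) ∈ (chartAt (EuclideanSpace ℝ (Fin n)) a).target) :
    MSmoothGerm n S (fun q => (chartAt (EuclideanSpace ℝ (Fin n)) a).symm (x q)) (t, k) := by
  filter_upwards [h, (h.contDiffWithinAt ht).continuousWithinAt.eventually
    ((chartAt (EuclideanSpace ℝ (Fin n)) a).open_target.mem_nhds ha)] with p hp1 hp2
  exact (contMDiffAt_chart_symm hp2).comp_contMDiffWithinAt p hp1.contMDiffWithinAt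

theorem contMDiffAt_slice (h : ContMDiffWithinAt 𝓘(ℝ, ℝ × K) (𝓡 n) ∞ f (S ×ˢ univ) (t, k))
    (ht : t ∈ S) : ContMDiffAt 𝓘(ℝ, K) (𝓡 n) ∞ (fun v => f (t, v)) k := by
  rw [← contMDiffWithinAt_univ]
  exact ContMDiffWithinAt.comp (g := f) (t := S ×ˢ univ) k h
    (contDiff_prodMk_right (𝕜 := ℝ) (n := ∞) t).contMDiff.contMDiffAt.contMDiffWithinAt
    fun _ _ => ⟨ht, mem_univ _⟩

/-- Near `t` the map `Φ` is a smooth family of parametrizations of neighbourhoods of the points of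
the curve `c`. -/
structure IsTubeAt (c : ℝ → M) (Φ : ℝ × EuclideanSpace ℝ (Fin n) → M) (t : ℝ) : Prop where
  base : Φ (t, 0) = c t
  smooth : MSmoothGerm n (Icc 0 1) Φ (t, 0)
  injective : Function.Injective
    (mfderiv 𝓘(ℝ, EuclideanSpace ℝ (Fin n)) (𝓡 n) (fun v => Φ (t, v)) 0)

theorem kDeriv_chart (h : MSmoothGerm n S f (t, k)) (ht : t ∈ S)
    (ha : f (t, k) ∈ (chartAt (EuclideanSpace ℝ (Fin n)) a).source) (v : K) :
    kDeriv (fun q => chartAt (EuclideanSpace ℝ (Fin n)) a (f q)) (t, k) v =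
      chartDeriv a (f (t, k)) (mfderiv 𝓘(ℝ, K) (𝓡 n) (fun v => f (t, v)) k v) :=
  fderiv_chart (f := fun v => f (t, v)) ha
    ((contMDiffAt_slice (h.contMDiffWithinAt ht) ht).mdifferentiableAt (by simp)) v

theorem mfderiv_injective_iff_chart (h : MSmoothGerm n S f (t, k)) (ht : t ∈ S)
    (ha : f (t, k) ∈ (chartAt (EuclideanSpace ℝ (Fin n)) a).source) :
    Function.Injective (mfderiv 𝓘(ℝ, K) (𝓡 n) (fun v => f (t, v)) k) ↔
    Function.Injective
      (kDeriv (fun q => chartAt (EuclideanSpace ℝ (Fin n)) a (f q)) (t, k)) := by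
  have h1 : ⇑(kDeriv (fun q => chartAt (EuclideanSpace ℝ (Fin n)) a (f q)) (t, k)) =
      chartDeriv (n := n) a (f (t, k)) ∘ mfderiv 𝓘(ℝ, K) (𝓡 n) (fun v => f (t, v)) k :=
    funext fun v => kDeriv_chart h ht ha v
  rw [h1]
  exact ((chartDeriv_bijective ha).1.of_comp_iff _).symm

/-- The map with chart expression `x` is a tube at `t`. -/
theorem isTubeAt_of_chart {c : ℝ → M} {x : ℝ × EuclideanSpace ℝ (Fin n) → EuclideanSpace ℝ (Fin n)}
    (ht : t ∈ Icc (0 : ℝ) 1) (hc : c t ∈ (chartAt (EuclideanSpace ℝ (Fin n)) a).source)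
    (hx : SmoothGerm (Icc 0 1) x (t, 0)) (hx0 : x (t, 0) = localCurve a c t)
    (hinj : Function.Injective (kDeriv x (t, 0))) :
    IsTubeAt c (fun q => (chartAt (EuclideanSpace ℝ (Fin n)) a).symm (x q)) t := by
  set φ := chartAt (EuclideanSpace ℝ (Fin n)) a
  have htar : x (t, 0) ∈ φ.target := by rw [hx0]; exact φ.map_source hc
  have hg := hx.mSmoothGerm ht htar
  refine ⟨by rw [hx0]; exact φ.left_inv hc, hg, ?_⟩
  rw [mfderiv_injective_iff_chart (a := a) hg ht (φ.map_target htar)]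
  have h1 : (fun v => φ (φ.symm (x (t, v)))) =ᶠ[𝓝 0] fun v => x (t, v) := by
    filter_upwards [(hx.contDiffAt_param ht).continuousAt.eventually
      (φ.open_target.mem_nhds htar)] with v hv using φ.right_inv hv
  rw [kDeriv, h1.fderiv_eq]
  exact hinj

theorem IsTubeAt.congr {c : ℝ → M} {Φ Ψ : ℝ × EuclideanSpace ℝ (Fin n) → M}
    (h : IsTubeAt c Φ t) (ht : t ∈ Icc (0 : ℝ) 1) (hΨ : Ψ =ᶠ[𝓝[Icc 0 1 ×ˢ univ] (t, 0)] Φ) :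
    IsTubeAt c Ψ t := by
  have h1 : (fun v => Ψ (t, v)) =ᶠ[𝓝 0] fun v => Φ (t, v) :=
    (tendsto_slice_param ht 0).eventually hΨ
  refine ⟨h1.self_of_nhds.trans h.base, h.smooth.congr hΨ, ?_⟩
  rw [h1.mfderiv_eq]
  exact h.injective

/-- A smooth change of time that is the identity up to `p` and afterwards stays in [p, p + δ]. It
lets a tube known only before some time supply parametrizations for later times. -/
theorem exists_smooth_clamp {p δ : ℝ} (hδ : 0 < δ) : ∃ τ : ℝ → ℝ, ContDiff ℝ ∞ τ ∧
    (∀ t ≤ p, τ t = t) ∧ (∀ t, p ≤ t → p ≤ τ t ∧ τ t ≤ t ∧ τ t ≤ p + δ) := by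
  refine ⟨fun t => p + (t - p) * (1 - Real.smoothTransition ((t - p) / δ)), ?_, ?_, ?_⟩
  · have : ContDiff ℝ ∞ fun t : ℝ => Real.smoothTransition ((t - p) / δ) :=
      Real.smoothTransition.contDiff.comp ((contDiff_id.sub contDiff_const).div_const δ)
    exact contDiff_const.add ((contDiff_id.sub contDiff_const).mul (contDiff_const.sub this))
  · intro t ht
    simp only [Real.smoothTransition.zero_of_nonpos
      (div_nonpos_of_nonpos_of_nonneg (sub_nonpos.2 ht) hδ.le)]
    ring
  · intro t ht
    have h0 := Real.smoothTransition.nonneg ((t - p) / δ)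
    have h1 := Real.smoothTransition.le_one ((t - p) / δ)
    have h2 : 0 ≤ t - p := sub_nonneg.2 ht
    refine ⟨by nlinarith, by nlinarith, ?_⟩
    by_cases h3 : t - p ≤ δ
    · nlinarith
    · simp only []
      rw [Real.smoothTransition.one_of_one_le ((one_le_div hδ).2 (not_le.1 h3).le)]
      linarith

theorem smoothGerm_localCurve {c : ℝ → M} (hc : ContMDiffOn 𝓘(ℝ, ℝ) (𝓡 n) ∞ c (Icc 0 1))
    (ht : t ∈ Icc (0 : ℝ) 1) (ha : c t ∈ (chartAt (EuclideanSpace ℝ (Fin n)) a).source) (k : K) :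
    SmoothGerm (Icc 0 1) (fun q : ℝ × K => localCurve (n := n) a c q.1) (t, k) := by
  have h1 : Tendsto (Prod.fst : ℝ × K → ℝ) (𝓝[Icc 0 1 ×ˢ univ] (t, k)) (𝓝[Icc 0 1] t) :=
    tendsto_nhdsWithin_iff.2 ⟨continuous_fst.continuousWithinAt, by
      filter_upwards [self_mem_nhdsWithin] with q hq using hq.1⟩
  filter_upwards [h1.eventually ((hc t ht).continuousWithinAt.eventually
    ((chartAt (EuclideanSpace ℝ (Fin n)) a).open_source.mem_nhds ha)), self_mem_nhdsWithin]
    with q hq1 hq2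
  exact ContDiffWithinAt.comp (g := localCurve a c) (t := Icc 0 1) q
    (contDiffWithinAt_chart hq1 (hc q.1 hq2.1)) contDiffWithinAt_fst fun r hr => hr.1

/-- A tube along `c` on `[0, T)` extends to `[0, T + δ)` if `c` stays in a chart. -/
theorem exists_tube_extension {c : ℝ → M} (hc : ContMDiffOn 𝓘(ℝ, ℝ) (𝓡 n) ∞ c (Icc 0 1))
    {Φ : ℝ × EuclideanSpace ℝ (Fin n) → M} {T δ : ℝ} (hT : 0 < T) (hδ : 0 < δ)
    (hΦ : ∀ t ∈ Icc (0 : ℝ) 1, t < T → IsTubeAt c Φ t)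
    (ha : ∀ t ∈ Icc (0 : ℝ) 1, |t - T| < δ →
      c t ∈ (chartAt (EuclideanSpace ℝ (Fin n)) a).source) :
    ∃ Ψ : ℝ × EuclideanSpace ℝ (Fin n) → M,
      ∀ t ∈ Icc (0 : ℝ) 1, t < T + δ → IsTubeAt c Ψ t := by
  set φ := chartAt (EuclideanSpace ℝ (Fin n)) a
  -- `p` is the gluing time: close enough to `T` for the curve to be in the chart, and before `T` so
  -- that the old tube exists there.
  obtain ⟨p, hp0, hpT, hpδ⟩ : ∃ p, 0 < p ∧ p < T ∧ T - δ < p :=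
    ⟨max (T / 2) (T - δ / 2), lt_max_of_lt_left (by linarith), max_lt (by linarith) (by linarith),
      lt_max_of_lt_right (by linarith)⟩
  obtain ⟨τ, hτ, hτ1, hτ2⟩ := exists_smooth_clamp (p := p) (δ := (T - p) / 2) (by linarith)
  let x : ℝ × EuclideanSpace ℝ (Fin n) → EuclideanSpace ℝ (Fin n) := fun q => φ (Φ q)
  -- In the chart, the old tube at the clamped time is translated so that its centre is c(t). Up to
  -- time `p` the clamp is the identity and nothing changes, so the two definitions agree smoothly.
  let y : ℝ × EuclideanSpace ℝ (Fin n) → EuclideanSpace ℝ (Fin n) := fun q =>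
    localCurve a c q.1 + (x (τ q.1, q.2) - x (τ q.1, 0))
  have hτmem : ∀ t ∈ Icc (0 : ℝ) 1, τ t ∈ Icc (0 : ℝ) 1 := by
    intro t ht
    rcases le_total t p with h | h
    · rw [hτ1 t h]; exact ht
    · obtain ⟨h1, h2, -⟩ := hτ2 t h
      exact ⟨hp0.le.trans h1, h2.trans ht.2⟩
  have hxg : ∀ t ∈ Icc (0 : ℝ) 1, t < T → T - δ < t → SmoothGerm (Icc 0 1) x (t, 0) := by
    intro t ht htT htδ
    refine (hΦ t ht htT).smooth.smoothGerm ht ?_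
    rw [(hΦ t ht htT).base]
    exact ha t ht (abs_lt.2 ⟨by linarith, by linarith⟩)
  have hy : ∀ t ∈ Icc (0 : ℝ) 1, p ≤ t → t < T + δ →
      IsTubeAt c (fun q => φ.symm (y q)) t := by
    intro t ht hpt htT
    obtain ⟨h1, h2, h3⟩ := hτ2 t hpt
    have hct : c t ∈ φ.source := ha t ht (abs_lt.2 ⟨by linarith, by linarith⟩)
    have hxτ := hxg (τ t) (hτmem t ht) (by linarith) (by linarith)
    have hW : ∀ ψ : ℝ × EuclideanSpace ℝ (Fin n) → EuclideanSpace ℝ (Fin n), ContDiff ℝ ∞ ψ →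
        ψ (t, 0) = 0 → SmoothGerm (Icc 0 1) (fun q => x (τ q.1, ψ q)) (t, 0) := by
      intro ψ hψ hψ0
      have hm : ContDiff ℝ ∞ fun q : ℝ × EuclideanSpace ℝ (Fin n) => (τ q.1, ψ q) :=
        (hτ.comp contDiff_fst).prodMk hψ
      have htend : Tendsto (fun q : ℝ × EuclideanSpace ℝ (Fin n) => (τ q.1, ψ q))
          (𝓝[Icc 0 1 ×ˢ univ] (t, 0)) (𝓝[Icc 0 1 ×ˢ univ] (τ t, 0)) := by
        refine tendsto_nhdsWithin_iff.2 ⟨?_, ?_⟩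
        · have := hm.continuous.continuousWithinAt (s := Icc 0 1 ×ˢ univ)
            (x := (t, (0 : EuclideanSpace ℝ (Fin n))))
          simpa only [ContinuousWithinAt, hψ0] using this
        · filter_upwards [self_mem_nhdsWithin] with q hq using ⟨hτmem _ hq.1, mem_univ _⟩
      filter_upwards [htend.eventually hxτ] with q hq
      exact ContDiffWithinAt.comp (g := x) (t := Icc 0 1 ×ˢ univ) q hq hm.contDiffWithinAt
        fun r hr => ⟨hτmem _ hr.1, mem_univ _⟩
    have hneg : SmoothGerm (Icc 0 1) (fun q : ℝ × EuclideanSpace ℝ (Fin n) => -x (τ q.1, 0))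
        (t, (0 : EuclideanSpace ℝ (Fin n))) := by
      filter_upwards [hW (fun _ => 0) contDiff_const rfl] with q hq using hq.neg
    have hyg : SmoothGerm (Icc 0 1) y (t, 0) := by
      refine (((smoothGerm_localCurve hc ht hct 0).add
        ((hW Prod.snd contDiff_snd rfl).add hneg))).congr (Eventually.of_forall fun q => ?_)
      simp [y, sub_eq_add_neg]
    refine isTubeAt_of_chart ht hct hyg (by simp [y]) ?_
    have h4 : kDeriv y (t, 0) = kDeriv x (τ t, 0) := by
      simp only [kDeriv, y, fderiv_const_add, fderiv_sub_const]
    rw [h4]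
    have ht' := hΦ (τ t) (hτmem t ht) (by linarith)
    refine (mfderiv_injective_iff_chart ht'.smooth (hτmem t ht) ?_).1 ht'.injective
    rw [ht'.base]
    exact ha _ (hτmem t ht) (abs_lt.2 ⟨by linarith, by linarith⟩)
  refine ⟨fun q => if q.1 ≤ p then Φ q else φ.symm (y q), fun t ht htT => ?_⟩
  rcases lt_or_ge t p with htp | htp
  · refine (hΦ t ht (by linarith)).congr ht ?_
    filter_upwards [nhdsWithin_le_nhds (continuous_fst.continuousAt.eventually
      (gt_mem_nhds htp))] with q hq
    simp only [hq.le, if_true]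
  · refine (hy t ht htp htT).congr ht ?_
    -- At the gluing time itself the old branch must be shown to equal the new formula on its side,
    -- so that near `p` the tube is given by the new formula alone.
    rcases htp.eq_or_lt with rfl | htp
    · have htp' := hΦ p ht hpT
      filter_upwards [htp'.smooth.eventually_mem_source (a := a) ht (by
          rw [htp'.base]; exact ha p ht (abs_lt.2 ⟨by linarith, by linarith⟩)),
        nhdsWithin_le_nhds (continuous_fst.continuousAt.eventually (lt_mem_nhds hpδ)),
        self_mem_nhdsWithin] with q hq1 hq2 hq3
      by_cases hq : q.1 ≤ p
      · have hb := (hΦ q.1 hq3.1 (by linarith)).base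
        have : y q = φ (Φ q) := by
          simp only [y, x, hτ1 q.1 hq, hb, localCurve]
          abel
        simp only [hq, if_true, this]
        exact (φ.left_inv hq1).symm
      · simp only [hq, if_false]
    · filter_upwards [nhdsWithin_le_nhds (continuous_fst.continuousAt.eventually
        (lt_mem_nhds htp))] with q hq
      simp only [not_le.2 hq, if_false]

/-- Every smooth curve has a tube. -/
theorem exists_tube {c : ℝ → M} (hc : ContMDiffOn 𝓘(ℝ, ℝ) (𝓡 n) ∞ c (Icc 0 1)) :
    ∃ Φ : ℝ × EuclideanSpace ℝ (Fin n) → M, ∀ t ∈ Icc (0 : ℝ) 1, IsTubeAt c Φ t := by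
  -- A Lebesgue number of the cover of [0,1] by chart domains: each extension gains the same length
  -- δ, so finitely many suffice.
  obtain ⟨δ, hδ, hcover⟩ : ∃ δ > 0, ∀ T ∈ Icc (0 : ℝ) 1, ∃ a : M, ∀ t ∈ Icc (0 : ℝ) 1,
      |t - T| < δ → c t ∈ (chartAt (EuclideanSpace ℝ (Fin n)) a).source := by
    have hopen : ∀ a : M, ∃ O : Set ℝ, IsOpen O ∧
        c ⁻¹' (chartAt (EuclideanSpace ℝ (Fin n)) a).source ∩ Icc 0 1 = O ∩ Icc 0 1 := fun a =>
      continuousOn_iff'.1 hc.continuousOn _ (chartAt (EuclideanSpace ℝ (Fin n)) a).open_source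
    choose O hO1 hO2 using hopen
    obtain ⟨δ, hδ, h⟩ := lebesgue_number_lemma_of_metric (c := O) (isCompact_Icc (a := (0 : ℝ))
      (b := 1)) hO1 fun t ht => mem_iUnion.2 ⟨c t, ((hO2 (c t)).subset
        ⟨mem_chart_source (EuclideanSpace ℝ (Fin n)) (c t), ht⟩).1⟩
    refine ⟨δ, hδ, fun T hT => ?_⟩
    obtain ⟨a, ha⟩ := h T hT
    exact ⟨a, fun t ht htT => ((hO2 a).symm.subset
      ⟨ha (by rwa [Metric.mem_ball, Real.dist_eq]), ht⟩).1⟩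
  have hstep : ∀ k : ℕ, ∃ Φ : ℝ × EuclideanSpace ℝ (Fin n) → M,
      ∀ t ∈ Icc (0 : ℝ) 1, t < ((k : ℝ) + 1) * δ → IsTubeAt c Φ t := by
    intro k
    induction k with
    | zero =>
      obtain ⟨a, ha⟩ := hcover 0 (by simp)
      refine ⟨fun q => (chartAt (EuclideanSpace ℝ (Fin n)) a).symm
        (localCurve a c q.1 + q.2), fun t ht htδ => ?_⟩
      have hct := ha t ht (by
        rw [sub_zero, abs_of_nonneg ht.1]; simpa using htδ)
      refine isTubeAt_of_chart ht hct ((smoothGerm_localCurve hc ht hct 0).add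
        (SmoothGerm.of_contDiff contDiff_snd)) (by simp) ?_
      have : kDeriv (fun q : ℝ × EuclideanSpace ℝ (Fin n) => localCurve a c q.1 + q.2) (t, 0) =
          ContinuousLinearMap.id ℝ _ := by
        exact ((hasFDerivAt_id _).const_add (localCurve a c t)).fderiv
      rw [this]
      exact fun _ _ h => h
    | succ k ih =>
      obtain ⟨Φ, hΦ⟩ := ih
      by_cases hk : ((k : ℝ) + 1) * δ ≤ 1
      · obtain ⟨a, ha⟩ := hcover _ ⟨by positivity, hk⟩
        obtain ⟨Ψ, hΨ⟩ := exists_tube_extension hc (by positivity) hδ hΦ ha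
        exact ⟨Ψ, fun t ht htT => hΨ t ht (by push_cast at htT; linarith)⟩
      · exact ⟨Φ, fun t ht _ => hΦ t ht (ht.2.trans_lt (not_le.1 hk))⟩
  obtain ⟨k, hk⟩ := exists_nat_gt (1 / δ)
  obtain ⟨Φ, hΦ⟩ := hstep k
  refine ⟨Φ, fun t ht => hΦ t ht (ht.2.trans_lt ?_)⟩
  rw [div_lt_iff₀ hδ] at hk
  linarith

end Tubes

/-! ### F² along a family of curves and its derivatives. -/

section FamilyLagrangian

variable {n : ℕ} {M : Type*} [TopologicalSpace M] [ChartedSpace (EuclideanSpace ℝ (Fin n)) M]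
  [IsManifold (𝓡 n) ∞ M]
variable {K : Type*} [NormedAddCommGroup K] [NormedSpace ℝ K] {S : Set ℝ} {t : ℝ} {k : K} {a : M}
  {f : ℝ × K → M}

/-- The velocity of the curve `s ↦ f (s, v)`, for a family `f`. -/
def famVelocity (n : ℕ) {M : Type*} [TopologicalSpace M]
    [ChartedSpace (EuclideanSpace ℝ (Fin n)) M] (S : Set ℝ) (f : ℝ × K → M) (q : ℝ × K) :
    EuclideanSpace ℝ (Fin n) :=
  mfderivWithin 𝓘(ℝ, ℝ) (𝓡 n) (fun s => f (s, q.2)) S q.1 (1 : ℝ)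

/-- The derivative of `v ↦ f (t, v)`, for a family `f`. -/
def famDeriv (n : ℕ) {M : Type*} [TopologicalSpace M]
    [ChartedSpace (EuclideanSpace ℝ (Fin n)) M] (f : ℝ × K → M) (q : ℝ × K) :
    K →L[ℝ] EuclideanSpace ℝ (Fin n) :=
  mfderiv 𝓘(ℝ, K) (𝓡 n) (fun v => f (q.1, v)) q.2

/-- `F²` at the velocity of the curve `s ↦ f (s, v s)`, as a function of `s`, `v s` and the
velocity `w` of `v`. -/
def famLagrangian (F : TangentBundle (𝓡 n) M → ℝ) (S : Set ℝ) (f : ℝ × K → M)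
    (q : ℝ × (K × K)) : ℝ :=
  F (⟨f (q.1, q.2.1), famVelocity n S f (q.1, q.2.1) + famDeriv n f (q.1, q.2.1) q.2.2⟩ :
    TangentBundle (𝓡 n) M) ^ 2

/-- The family `f` in the chart at `a`. -/
def localFam (n : ℕ) {M : Type*} [TopologicalSpace M]
    [ChartedSpace (EuclideanSpace ℝ (Fin n)) M] (a : M) (f : ℝ × K → M) (q : ℝ × K) :
    EuclideanSpace ℝ (Fin n) :=
  chartAt (EuclideanSpace ℝ (Fin n)) a (f q)

variable {F : TangentBundle (𝓡 n) M → ℝ}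

theorem tDeriv_localFam (hS : UniqueDiffOn ℝ S)
    (h : ContMDiffWithinAt 𝓘(ℝ, ℝ × K) (𝓡 n) ∞ f (S ×ˢ univ) (t, k)) (ht : t ∈ S)
    (ha : f (t, k) ∈ (chartAt (EuclideanSpace ℝ (Fin n)) a).source) :
    tDeriv S (localFam n a f) (t, k) = chartDeriv a (f (t, k)) (famVelocity n S f (t, k)) := by
  refine derivWithin_chart (c := fun s => f (s, k)) ha ?_ (hS t ht)
  have : ContMDiffWithinAt 𝓘(ℝ, ℝ) (𝓡 n) ∞ (fun s => f (s, k)) S t :=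
    ContMDiffWithinAt.comp (g := f) (t := S ×ˢ univ) t h
      (contDiff_prodMk_left (𝕜 := ℝ) (n := ∞) k).contMDiff.contMDiffAt.contMDiffWithinAt
      fun _ hs => ⟨hs, mem_univ _⟩
  exact this.mdifferentiableWithinAt (by simp)

theorem kDeriv_localFam
    (h : ContMDiffWithinAt 𝓘(ℝ, ℝ × K) (𝓡 n) ∞ f (S ×ˢ univ) (t, k)) (ht : t ∈ S)
    (ha : f (t, k) ∈ (chartAt (EuclideanSpace ℝ (Fin n)) a).source) (v : K) :
    kDeriv (localFam n a f) (t, k) v = chartDeriv a (f (t, k)) (famDeriv n f (t, k) v) :=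
  fderiv_chart (f := fun v => f (t, v)) ha
    ((contMDiffAt_slice h ht).mdifferentiableAt (by simp)) v

theorem famLagrangian_eq (hS : UniqueDiffOn ℝ S)
    (h : ContMDiffWithinAt 𝓘(ℝ, ℝ × K) (𝓡 n) ∞ f (S ×ˢ univ) (t, k)) (ht : t ∈ S)
    (ha : f (t, k) ∈ (chartAt (EuclideanSpace ℝ (Fin n)) a).source) (w : K) :
    famLagrangian F S f (t, (k, w)) = Function.uncurry (sqr (localF F a))
      (localFam n a f (t, k), tDeriv S (localFam n a f) (t, k)
        + kDeriv (localFam n a f) (t, k) w) := by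
  rw [tDeriv_localFam hS h ht ha, kDeriv_localFam h ht ha, famLagrangian, sq_eq_sqr F ha, map_add]
  rfl

theorem tendsto_fst_param (S : Set ℝ) (t : ℝ) (v w : K) :
    Tendsto (fun q : ℝ × (K × K) => (q.1, q.2.1)) (𝓝[S ×ˢ univ] (t, (v, w)))
      (𝓝[S ×ˢ univ] (t, v)) := by
  refine tendsto_nhdsWithin_iff.2 ⟨?_, ?_⟩
  · have : Continuous fun q : ℝ × (K × K) => (q.1, q.2.1) := by fun_prop
    exact this.continuousWithinAt
  · filter_upwards [self_mem_nhdsWithin] with q hq using ⟨hq.1, mem_univ _⟩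

theorem famLagrangian_eventuallyEq (hS : UniqueDiffOn ℝ S) (h : MSmoothGerm n S f (t, k))
    (ht : t ∈ S) (ha : f (t, k) ∈ (chartAt (EuclideanSpace ℝ (Fin n)) a).source) (w : K) :
    famLagrangian F S f =ᶠ[𝓝[S ×ˢ univ] (t, (k, w))] fun q => Function.uncurry (sqr (localF F a))
      (localFam n a f (q.1, q.2.1), tDeriv S (localFam n a f) (q.1, q.2.1)
        + kDeriv (localFam n a f) (q.1, q.2.1) q.2.2) := by
  have h1 := tendsto_fst_param S t k w
  filter_upwards [h1.eventually h, h1.eventually (h.eventually_mem_source ht ha),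
    self_mem_nhdsWithin] with q hq1 hq2 hq3
  exact famLagrangian_eq hS hq1 hq3.1 hq2 _

theorem slit_of_famVelocity_ne_zero (hF : IsFinsler F) (hS : UniqueDiffOn ℝ S)
    (h : MSmoothGerm n S f (t, k)) (ht : t ∈ S)
    (ha : f (t, k) ∈ (chartAt (EuclideanSpace ℝ (Fin n)) a).source)
    (hv : famVelocity n S f (t, k) ≠ 0) :
    (localFam n a f (t, k), tDeriv S (localFam n a f) (t, k)) ∈
      slit (chartAt (EuclideanSpace ℝ (Fin n)) a).target := by
  rw [tDeriv_localFam hS (h.contMDiffWithinAt ht) ht ha]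
  exact hF.mem_slit ha hv

/-- F is smooth only off the zero section; the nonzero velocity keeps the composition in that open
set. -/
theorem smoothGerm_famLagrangian (hF : IsFinsler F) (hS : UniqueDiffOn ℝ S)
    (h : MSmoothGerm n S f (t, k)) (ht : t ∈ S) (hv : famVelocity n S f (t, k) ≠ 0) :
    SmoothGerm S (famLagrangian F S f) (t, (k, (0 : K))) := by
  have ha := mem_chart_source (EuclideanSpace ℝ (Fin n)) (f (t, k))
  refine SmoothGerm.congr ?_ (famLagrangian_eventuallyEq hS h ht ha 0)
  have hx : SmoothGerm S (localFam n (f (t, k)) f) (t, k) := h.smoothGerm ht ha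
  have hφ : SmoothGerm S (fun q : ℝ × (K × K) => q.2.1) (t, (k, (0 : K))) :=
    SmoothGerm.of_contDiff (contDiff_fst.comp contDiff_snd)
  have hφ2 : SmoothGerm S (fun q : ℝ × (K × K) => q.2.2) (t, (k, (0 : K))) :=
    SmoothGerm.of_contDiff (contDiff_snd.comp contDiff_snd)
  have h1 := SmoothGerm.comp_param (φ := fun q : ℝ × (K × K) => q.2.1) hx hφ ht
  have h2 := SmoothGerm.comp_param (φ := fun q : ℝ × (K × K) => q.2.1) (hx.tDeriv hS) hφ ht
  have h3 := SmoothGerm.comp_param (φ := fun q : ℝ × (K × K) => q.2.1) (hx.kDeriv hS) hφ ht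
  have h4 := h1.prodMk (h2.add (h3.clm_apply hφ2))
  have hL := hF.isLocalFinsler (f (t, k))
  refine SmoothGerm.comp h4 ht (isOpen_slit hL.isOpen) hL.smooth_sqr ?_
  simp only [map_zero, add_zero]
  exact slit_of_famVelocity_ne_zero hF hS h ht ha hv

theorem famLagrangian_param_eventuallyEq (hS : UniqueDiffOn ℝ S) (h : MSmoothGerm n S f (t, k))
    (ht : t ∈ S) (ha : f (t, k) ∈ (chartAt (EuclideanSpace ℝ (Fin n)) a).source) :
    (fun q => famLagrangian F S f (t, q)) =ᶠ[𝓝 (k, (0 : K))] fun q =>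
      Function.uncurry (sqr (localF F a)) (velocityMap (fun v => localFam n a f (t, v))
        (fun v => tDeriv S (localFam n a f) (t, v)) q) :=
  (tendsto_slice_param ht (k, (0 : K))).eventually (famLagrangian_eventuallyEq hS h ht ha 0)

/-- The first derivative of the Lagrangian of a family. -/
theorem kDeriv_famLagrangian (hF : IsFinsler F) (hS : UniqueDiffOn ℝ S)
    (h : MSmoothGerm n S f (t, k)) (ht : t ∈ S)
    (ha : f (t, k) ∈ (chartAt (EuclideanSpace ℝ (Fin n)) a).source)
    (hv : famVelocity n S f (t, k) ≠ 0) (ξ ζ : K) :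
    kDeriv (famLagrangian F S f) (t, (k, 0)) (ξ, ζ) =
      fderiv ℝ (Function.uncurry (sqr (localF F a)))
        (localFam n a f (t, k), tDeriv S (localFam n a f) (t, k))
        (kDeriv (localFam n a f) (t, k) ξ,
          kDeriv (tDeriv S (localFam n a f)) (t, k) ξ + kDeriv (localFam n a f) (t, k) ζ) := by
  have hL := hF.isLocalFinsler a
  have hsl := slit_of_famVelocity_ne_zero hF hS h ht ha hv
  have hx : SmoothGerm S (localFam n a f) (t, k) := h.smoothGerm ht ha
  have hX := hx.contDiffAt_param ht
  have hY := (hx.tDeriv hS).contDiffAt_param ht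
  have h0 : velocityMap (fun v => localFam n a f (t, v))
        (fun v => tDeriv S (localFam n a f) (t, v)) (k, 0) =
      (localFam n a f (t, k), tDeriv S (localFam n a f) (t, k)) := by simp [velocityMap]
  have hd : DifferentiableAt ℝ (velocityMap (fun v => localFam n a f (t, v))
        (fun v => tDeriv S (localFam n a f) (t, v))) (k, 0) :=
    (ContDiffAt.velocityMap (q := (k, (0 : K))) hX hY).differentiableAt (by simp)
  have h1 := Filter.EventuallyEq.fderiv_eq (𝕜 := ℝ)
    (famLagrangian_param_eventuallyEq (F := F) hS h ht ha)
  have h2 := fderiv_comp (g := Function.uncurry (sqr (localF F a))) (k, (0 : K))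
    (by rw [h0]; exact hL.smooth_sqr.differentiableAt hL.isOpen hsl) hd
  rw [kDeriv, h1]
  refine (DFunLike.congr_fun h2 (ξ, ζ)).trans ?_
  rw [h0, ContinuousLinearMap.comp_apply,
    fderiv_velocityMap (hX.of_le two_le_infty) (hY.of_le two_le_infty)]
  simp [kDeriv]

/-- The second derivative of the Lagrangian of a family. -/
theorem kDeriv_kDeriv_famLagrangian (hF : IsFinsler F) (hS : UniqueDiffOn ℝ S)
    (h : MSmoothGerm n S f (t, k)) (ht : t ∈ S)
    (ha : f (t, k) ∈ (chartAt (EuclideanSpace ℝ (Fin n)) a).source)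
    (hv : famVelocity n S f (t, k) ≠ 0) (ξ ζ η θ : K) :
    kDeriv (kDeriv (famLagrangian F S f)) (t, (k, 0)) (ξ, ζ) (η, θ) =
      fderiv ℝ (fderiv ℝ (Function.uncurry (sqr (localF F a))))
        (localFam n a f (t, k), tDeriv S (localFam n a f) (t, k))
        (kDeriv (localFam n a f) (t, k) ξ,
          kDeriv (tDeriv S (localFam n a f)) (t, k) ξ + kDeriv (localFam n a f) (t, k) ζ)
        (kDeriv (localFam n a f) (t, k) η,
          kDeriv (tDeriv S (localFam n a f)) (t, k) η + kDeriv (localFam n a f) (t, k) θ) +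
      fderiv ℝ (Function.uncurry (sqr (localF F a)))
        (localFam n a f (t, k), tDeriv S (localFam n a f) (t, k))
        (kDeriv (kDeriv (localFam n a f)) (t, k) ξ η,
          kDeriv (kDeriv (tDeriv S (localFam n a f))) (t, k) ξ η
          + (kDeriv (kDeriv (localFam n a f)) (t, k) η ζ
          + kDeriv (kDeriv (localFam n a f)) (t, k) ξ θ)) := by
  have hL := hF.isLocalFinsler a
  have hsl := slit_of_famVelocity_ne_zero hF hS h ht ha hv
  have hx : SmoothGerm S (localFam n a f) (t, k) := h.smoothGerm ht ha
  have hX := hx.contDiffAt_param ht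
  have hY := (hx.tDeriv hS).contDiffAt_param ht
  have h0 : velocityMap (fun v => localFam n a f (t, v))
        (fun v => tDeriv S (localFam n a f) (t, v)) (k, 0) =
      (localFam n a f (t, k), tDeriv S (localFam n a f) (t, k)) := by simp [velocityMap]
  have hd : ContDiffAt ℝ ∞ (velocityMap (fun v => localFam n a f (t, v))
        (fun v => tDeriv S (localFam n a f) (t, v))) (k, 0) :=
    ContDiffAt.velocityMap (q := (k, (0 : K))) hX hY
  have h1 := Filter.EventuallyEq.fderiv_eq (𝕜 := ℝ) (Filter.EventuallyEq.fderiv (𝕜 := ℝ)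
    (famLagrangian_param_eventuallyEq (F := F) hS h ht ha))
  have h2 := fderiv_fderiv_comp (g := Function.uncurry (sqr (localF F a)))
    (by rw [h0]; exact hL.smooth_sqr.contDiffAt hL.isOpen hsl) hd (ξ, ζ) (η, θ)
  have h3 : kDeriv (kDeriv (famLagrangian F S f)) (t, (k, 0)) =
      fderiv ℝ (fderiv ℝ fun q => famLagrangian F S f (t, q)) (k, 0) := rfl
  rw [h3, h1, h2, h0, fderiv_velocityMap (hX.of_le two_le_infty) (hY.of_le two_le_infty),
    fderiv_velocityMap (hX.of_le two_le_infty) (hY.of_le two_le_infty),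
    fderiv_fderiv_velocityMap hX hY]
  simp only [map_zero, zero_add]
  rfl

end FamilyLagrangian

/-! ### The second variation of F² in a tube around a geodesic. -/

section GeodesicTubes

variable {n : ℕ} {M : Type*} [TopologicalSpace M] [ChartedSpace (EuclideanSpace ℝ (Fin n)) M]
  [IsManifold (𝓡 n) ∞ M]
  {F : TangentBundle (𝓡 n) M → ℝ} {c : ℝ → M} {Φ : ℝ × EuclideanSpace ℝ (Fin n) → M}
  {a : M} {t : ℝ} {ξ : ℝ → EuclideanSpace ℝ (Fin n)}

/-- `Φ` is a tube along the regular geodesic `c`. -/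
structure IsGeodesicTube (F : TangentBundle (𝓡 n) M → ℝ) (c : ℝ → M)
    (Φ : ℝ × EuclideanSpace ℝ (Fin n) → M) : Prop where
  finsler : IsFinsler F
  geodesic : IsGeodesic F c
  regular : ∀ t ∈ Icc (0 : ℝ) 1, (velocity (n := n) c t : EuclideanSpace ℝ (Fin n)) ≠ 0
  tube : ∀ t ∈ Icc (0 : ℝ) 1, IsTubeAt c Φ t

/-- The derivative at `0` of the energy density in a tube. -/
def tubeLin (F : TangentBundle (𝓡 n) M → ℝ) (Φ : ℝ × EuclideanSpace ℝ (Fin n) → M) (t : ℝ) :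
    (EuclideanSpace ℝ (Fin n) × EuclideanSpace ℝ (Fin n)) →L[ℝ] ℝ :=
  kDeriv (famLagrangian F (Icc 0 1) Φ) (t, (0, 0))

/-- The second derivative at `0` of the energy density in a tube. -/
def tubeQuad (F : TangentBundle (𝓡 n) M → ℝ) (Φ : ℝ × EuclideanSpace ℝ (Fin n) → M) (t : ℝ) :
    (EuclideanSpace ℝ (Fin n) × EuclideanSpace ℝ (Fin n)) →L[ℝ]
      (EuclideanSpace ℝ (Fin n) × EuclideanSpace ℝ (Fin n)) →L[ℝ] ℝ :=
  kDeriv (kDeriv (famLagrangian F (Icc 0 1) Φ)) (t, (0, 0))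

/-- The components in a chart of the field along `c` with coordinates `ξ` in a tube. -/
def tubeField (a : M) (Φ : ℝ × EuclideanSpace ℝ (Fin n) → M) (ξ : ℝ → EuclideanSpace ℝ (Fin n))
    (t : ℝ) : EuclideanSpace ℝ (Fin n) := kDeriv (localFam n a Φ) (t, 0) (ξ t)

namespace IsGeodesicTube

variable (hT : IsGeodesicTube F c Φ) (ht : t ∈ Icc (0 : ℝ) 1)
  (ha : c t ∈ (chartAt (EuclideanSpace ℝ (Fin n)) a).source)
include hT

theorem contMDiffOn : ContMDiffOn 𝓘(ℝ, ℝ) (𝓡 n) ∞ c (Icc 0 1) := hT.geodesic.1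

include ht

theorem eventually_mem_source (ha : c t ∈ (chartAt (EuclideanSpace ℝ (Fin n)) a).source) :
    ∀ᶠ s in 𝓝[Icc 0 1] t, s ∈ Icc (0 : ℝ) 1 ∧
      c s ∈ (chartAt (EuclideanSpace ℝ (Fin n)) a).source := by
  filter_upwards [self_mem_nhdsWithin, (hT.contMDiffOn t ht).continuousWithinAt.eventually
    ((chartAt (EuclideanSpace ℝ (Fin n)) a).open_source.mem_nhds ha)] with s hs1 hs2
  exact ⟨hs1, hs2⟩

theorem source_base (ha : c t ∈ (chartAt (EuclideanSpace ℝ (Fin n)) a).source) :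
    Φ (t, 0) ∈ (chartAt (EuclideanSpace ℝ (Fin n)) a).source := by
  rwa [(hT.tube t ht).base]

theorem localFam_zero : localFam n a Φ (t, 0) = localCurve a c t := by
  rw [localFam, (hT.tube t ht).base]; rfl

theorem tDeriv_zero : tDeriv (Icc 0 1) (localFam n a Φ) (t, 0) = timeDeriv (localCurve a c) t :=
  derivWithin_congr (fun _ hs => hT.localFam_zero hs) (hT.localFam_zero ht)

include ha

theorem contDiffWithinAt_localCurve : ContDiffWithinAt ℝ ∞ (localCurve (n := n) a c) (Icc 0 1) t :=
  contDiffWithinAt_chart ha (hT.contMDiffOn t ht)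

theorem timeDeriv_localCurve :
    timeDeriv (localCurve a c) t = chartDeriv a (c t) (velocity (n := n) c t) :=
  derivWithin_chart ha ((hT.contMDiffOn t ht).mdifferentiableWithinAt (by simp))
    (uniqueDiffWithinAt_unitInterval ht)

theorem mem_slit : (localCurve a c t, timeDeriv (localCurve a c) t) ∈
    slit (chartAt (EuclideanSpace ℝ (Fin n)) a).target := by
  rw [hT.timeDeriv_localCurve ht ha]
  exact hT.finsler.mem_slit ha (hT.regular t ht)

theorem geodesic_equation (k : Fin n) : timeDeriv (timeDeriv (localCurve a c)) t k +
    spray (localF F a) k (localCurve a c t) (timeDeriv (localCurve a c) t) = 0 := by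
  rw [← (hT.finsler.isLocalFinsler a).covDeriv_timeDeriv (hT.mem_slit ht ha),
    hT.geodesic.2 a t ht ha]
  rfl

theorem famVelocity_ne_zero : famVelocity n (Icc 0 1) Φ (t, 0) ≠ 0 := by
  intro h0
  have h1 := tDeriv_localFam (uniqueDiffOn_Icc one_pos)
    ((hT.tube t ht).smooth.contMDiffWithinAt ht) ht (hT.source_base ht ha)
  rw [h0, map_zero, hT.tDeriv_zero ht] at h1
  exact (hT.mem_slit ht ha).2 h1

theorem smoothGerm_localFam : SmoothGerm (Icc 0 1) (localFam n a Φ) (t, 0) :=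
  (hT.tube t ht).smooth.smoothGerm ht (hT.source_base ht ha)

theorem hasDerivWithinAt_frame :
    HasDerivWithinAt (fun s => kDeriv (localFam n a Φ) (s, 0))
      (kDeriv (tDeriv (Icc 0 1) (localFam n a Φ)) (t, 0)) (Icc 0 1) t :=
  (hT.smoothGerm_localFam ht ha).hasDerivWithinAt_kDeriv (uniqueDiffOn_Icc one_pos)
    (Icc_subset_closure_interior one_pos) ht

theorem contDiffWithinAt_tubeField (hξ : ContDiffWithinAt ℝ ∞ ξ (Icc 0 1) t) :
    ContDiffWithinAt ℝ ∞ (tubeField a Φ ξ) (Icc 0 1) t :=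
  (((hT.smoothGerm_localFam ht ha).kDeriv (uniqueDiffOn_Icc one_pos)).contDiffWithinAt_time
    ht).clm_apply hξ

theorem hasDerivWithinAt_tubeField {ξ' : EuclideanSpace ℝ (Fin n)}
    (hξ : HasDerivWithinAt ξ ξ' (Icc 0 1) t) :
    HasDerivWithinAt (tubeField a Φ ξ) (kDeriv (tDeriv (Icc 0 1) (localFam n a Φ)) (t, 0) (ξ t)
      + kDeriv (localFam n a Φ) (t, 0) ξ') (Icc 0 1) t :=
  HasDerivWithinAt.clm_apply (hT.hasDerivWithinAt_frame ht ha) hξ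

theorem timeDeriv_tubeField (hξ : ContDiffWithinAt ℝ ∞ ξ (Icc 0 1) t) :
    timeDeriv (tubeField a Φ ξ) t = kDeriv (tDeriv (Icc 0 1) (localFam n a Φ)) (t, 0) (ξ t)
      + kDeriv (localFam n a Φ) (t, 0) (timeDeriv ξ t) :=
  (hT.hasDerivWithinAt_tubeField ht ha (hasDerivWithinAt_timeDeriv hξ)).derivWithin
    (uniqueDiffWithinAt_unitInterval ht)

theorem kDeriv_injective : Function.Injective (kDeriv (localFam n a Φ) (t, 0)) :=
  (mfderiv_injective_iff_chart (hT.tube t ht).smooth ht (hT.source_base ht ha)).1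
    (hT.tube t ht).injective

theorem tubeLin_apply (v w : EuclideanSpace ℝ (Fin n)) : tubeLin F Φ t (v, w) =
    fderiv ℝ (Function.uncurry (sqr (localF F a)))
      (localCurve a c t, timeDeriv (localCurve a c) t)
      (kDeriv (localFam n a Φ) (t, 0) v,
        kDeriv (tDeriv (Icc 0 1) (localFam n a Φ)) (t, 0) v
          + kDeriv (localFam n a Φ) (t, 0) w) := by
  rw [tubeLin, kDeriv_famLagrangian hT.finsler (uniqueDiffOn_Icc one_pos) (hT.tube t ht).smooth ht
    (hT.source_base ht ha) (hT.famVelocity_ne_zero ht ha), hT.localFam_zero ht, hT.tDeriv_zero ht]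

theorem tubeLin_zero_apply (w : EuclideanSpace ℝ (Fin n)) : tubeLin F Φ t (0, w) =
    fderiv ℝ (Function.uncurry (sqr (localF F a)))
      (localCurve a c t, timeDeriv (localCurve a c) t)
      (0, kDeriv (localFam n a Φ) (t, 0) w) := by
  rw [hT.tubeLin_apply ht ha]; simp

theorem tubeLin_jet (hξ : ContDiffWithinAt ℝ ∞ ξ (Icc 0 1) t) :
    tubeLin F Φ t (ξ t, timeDeriv ξ t) =
    fderiv ℝ (Function.uncurry (sqr (localF F a)))
      (localCurve a c t, timeDeriv (localCurve a c) t)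
      (tubeField a Φ ξ t, timeDeriv (tubeField a Φ ξ) t) := by
  rw [hT.tubeLin_apply ht ha, hT.timeDeriv_tubeField ht ha hξ]; rfl

theorem tubeQuad_apply (ξ ζ η θ : EuclideanSpace ℝ (Fin n)) : tubeQuad F Φ t (ξ, ζ) (η, θ) =
    fderiv ℝ (fderiv ℝ (Function.uncurry (sqr (localF F a))))
      (localCurve a c t, timeDeriv (localCurve a c) t)
      (kDeriv (localFam n a Φ) (t, 0) ξ,
        kDeriv (tDeriv (Icc 0 1) (localFam n a Φ)) (t, 0) ξ + kDeriv (localFam n a Φ) (t, 0) ζ)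
      (kDeriv (localFam n a Φ) (t, 0) η,
        kDeriv (tDeriv (Icc 0 1) (localFam n a Φ)) (t, 0) η + kDeriv (localFam n a Φ) (t, 0) θ) +
    fderiv ℝ (Function.uncurry (sqr (localF F a)))
      (localCurve a c t, timeDeriv (localCurve a c) t)
      (kDeriv (kDeriv (localFam n a Φ)) (t, 0) ξ η,
        kDeriv (kDeriv (tDeriv (Icc 0 1) (localFam n a Φ))) (t, 0) ξ η
          + (kDeriv (kDeriv (localFam n a Φ)) (t, 0) η ζ
          + kDeriv (kDeriv (localFam n a Φ)) (t, 0) ξ θ)) := by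
  rw [tubeQuad, kDeriv_kDeriv_famLagrangian hT.finsler (uniqueDiffOn_Icc one_pos)
    (hT.tube t ht).smooth ht (hT.source_base ht ha) (hT.famVelocity_ne_zero ht ha),
    hT.localFam_zero ht, hT.tDeriv_zero ht]

omit ha

/-- The Euler–Lagrange equation of the energy in a tube. -/
theorem hasDerivWithinAt_tubeLin (hξ : ContDiffWithinAt ℝ ∞ ξ (Icc 0 1) t) :
    HasDerivWithinAt (fun s => tubeLin F Φ s (0, ξ s)) (tubeLin F Φ t (ξ t, timeDeriv ξ t))
      (Icc 0 1) t := by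
  have ha := mem_chart_source (EuclideanSpace ℝ (Fin n)) (c t)
  have h1 := (hT.finsler.isLocalFinsler (c t)).hasDerivWithinAt_momentum (hT.mem_slit ht ha)
    (hT.geodesic_equation ht ha) (hT.contDiffWithinAt_localCurve ht ha) ht
    (hT.contDiffWithinAt_tubeField ht ha hξ)
  rw [hT.tubeLin_jet ht ha hξ]
  have h2 : (fun s => tubeLin F Φ s (0, ξ s)) =ᶠ[𝓝[Icc 0 1] t] fun s =>
      fderiv ℝ (Function.uncurry (sqr (localF F (c t))))
      (localCurve (c t) c s, timeDeriv (localCurve (c t) c) s) (0, tubeField (c t) Φ ξ s) := by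
    filter_upwards [hT.eventually_mem_source ht ha] with s hs
    exact hT.tubeLin_zero_apply hs.1 hs.2 _
  exact h1.congr_of_eventuallyEq h2 (h2.self_of_nhdsWithin ht)

theorem contDiffWithinAt_tubeQuad : ContDiffWithinAt ℝ ∞ (tubeQuad F Φ) (Icc 0 1) t := by
  have ha := mem_chart_source (EuclideanSpace ℝ (Fin n)) (c t)
  exact (((smoothGerm_famLagrangian hT.finsler (uniqueDiffOn_Icc one_pos) (hT.tube t ht).smooth ht
    (hT.famVelocity_ne_zero ht ha)).kDeriv (uniqueDiffOn_Icc one_pos)).kDeriv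
    (uniqueDiffOn_Icc one_pos)).contDiffWithinAt_time ht

theorem contDiffWithinAt_tubeLin : ContDiffWithinAt ℝ ∞ (tubeLin F Φ) (Icc 0 1) t := by
  have ha := mem_chart_source (EuclideanSpace ℝ (Fin n)) (c t)
  exact ((smoothGerm_famLagrangian hT.finsler (uniqueDiffOn_Icc one_pos) (hT.tube t ht).smooth ht
    (hT.famVelocity_ne_zero ht ha)).kDeriv (uniqueDiffOn_Icc one_pos)).contDiffWithinAt_time ht

-- Symmetry is that of second derivatives. On pairs (0, w) all second derivatives of the tube drop
-- out, and Q becomes twice the fundamental tensor applied to the image of w under the injective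
-- frame.
omit ht in
theorem isQuadLagrangian : IsQuadLagrangian (tubeQuad F Φ) where
  smooth _ ht := hT.contDiffWithinAt_tubeQuad ht
  symm t ht u v := by
    have ha := mem_chart_source (EuclideanSpace ℝ (Fin n)) (c t)
    have h1 := (smoothGerm_famLagrangian hT.finsler (uniqueDiffOn_Icc one_pos)
      (hT.tube t ht).smooth ht (hT.famVelocity_ne_zero ht ha)).contDiffAt_param ht
    exact h1.isSymmSndFDerivAt (by simpa using two_le_infty) u v
  pos t ht w hw := by
    have ha := mem_chart_source (EuclideanSpace ℝ (Fin n)) (c t)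
    rw [hT.tubeQuad_apply ht ha]
    simp only [map_zero, zero_apply, zero_add, Prod.mk_zero_zero, add_zero]
    refine (hT.finsler.isLocalFinsler (c t)).posDef _ (hT.mem_slit ht ha).1 _ _
      (hT.mem_slit ht ha).2 ?_
    rwa [Ne, map_eq_zero_iff _ (hT.kDeriv_injective ht ha)]

include ha

/-- The Jacobi equation in a chart at a point is the Euler–Lagrange equation of the second
variation in a tube. -/
theorem jacobi_iff_tube (hξ : ContDiffOn ℝ ∞ ξ (Icc 0 1)) :
    covDeriv (localF F a) (localCurve a c) (covDeriv (localF F a) (localCurve a c)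
      (tubeField a Φ ξ)) t + curvTerm (localF F a) (localCurve a c) (tubeField a Φ ξ) t = 0 ↔
    ∀ η, HasDerivWithinAt (fun s => tubeQuad F Φ s (ξ s, timeDeriv ξ s) (0, η))
      (tubeQuad F Φ t (ξ t, timeDeriv ξ t) (η, 0)) (Icc 0 1) t := by
  have hL := hT.finsler.isLocalFinsler a
  have hu := uniqueDiffWithinAt_unitInterval ht
  have hx := hT.contDiffWithinAt_localCurve ht ha
  have hsl := hT.mem_slit ht ha
  have hU := hT.contDiffWithinAt_tubeField ht ha (hξ t ht)
  have hev := hT.eventually_mem_source ht ha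
  have hgerm := hT.smoothGerm_localFam ht ha
  rw [hL.jacobi_iff (by
    filter_upwards [hev] with s hs
    exact ⟨hT.mem_slit hs.1 hs.2, hT.geodesic_equation hs.1 hs.2⟩) hx hU ht]
  set e := Function.uncurry (sqr (localF F a))
  set x := localCurve (n := n) a c
  set u := tubeField a Φ ξ
  set X := localFam n a Φ
  have hd2 : DifferentiableAt ℝ (fderiv ℝ (fderiv ℝ e)) (x t, timeDeriv x t) :=
    hL.differentiableAt_fderiv_fderiv_sqr hsl
  -- the derivative of the linearized momentum on constant vectors and on the frame
  have h1 : ∀ χ : EuclideanSpace ℝ (Fin n), HasDerivWithinAt (fun s => fderiv ℝ (fderiv ℝ e)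
      (x s, timeDeriv x s) (u s, timeDeriv u s) (0, χ))
      (fderiv ℝ (fderiv ℝ (fderiv ℝ e)) (x t, timeDeriv x t) (timeDeriv x t,
        timeDeriv (timeDeriv x) t) (u t, timeDeriv u t) (0, χ)
        + fderiv ℝ (fderiv ℝ e) (x t, timeDeriv x t) (timeDeriv u t, timeDeriv (timeDeriv u) t)
          (0, χ)) (Icc 0 1) t := fun χ =>
    (hasDerivWithinAt_fderiv_fderiv_apply hd2 (hasDerivWithinAt_jet hx ht)
      (hasDerivWithinAt_jet hU ht) (hasDerivWithinAt_const t (Icc (0 : ℝ) 1)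
      ((0 : EuclideanSpace ℝ (Fin n)), χ))).congr_deriv (by rw [map_zero, add_zero])
  have h2 : ∀ η : EuclideanSpace ℝ (Fin n), HasDerivWithinAt (fun s => fderiv ℝ (fderiv ℝ e)
      (x s, timeDeriv x s) (u s, timeDeriv u s) (0, kDeriv X (s, 0) η))
      (fderiv ℝ (fderiv ℝ (fderiv ℝ e)) (x t, timeDeriv x t) (timeDeriv x t,
        timeDeriv (timeDeriv x) t) (u t, timeDeriv u t) (0, kDeriv X (t, 0) η)
        + fderiv ℝ (fderiv ℝ e) (x t, timeDeriv x t) (timeDeriv u t, timeDeriv (timeDeriv u) t)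
          (0, kDeriv X (t, 0) η)
        + fderiv ℝ (fderiv ℝ e) (x t, timeDeriv x t) (u t, timeDeriv u t)
          (0, kDeriv (tDeriv (Icc 0 1) X) (t, 0) η)) (Icc 0 1) t := fun η =>
    hasDerivWithinAt_fderiv_fderiv_apply hd2 (hasDerivWithinAt_jet hx ht)
      (hasDerivWithinAt_jet hU ht) ((hasDerivWithinAt_const t (Icc (0 : ℝ) 1)
      (0 : EuclideanSpace ℝ (Fin n))).prodMk
      (hasDerivWithinAt_clm_apply_const (hT.hasDerivWithinAt_frame ht ha) η))
  -- the second order part of the tube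
  have hΓ : ∀ η : EuclideanSpace ℝ (Fin n), ContDiffWithinAt ℝ ∞
      (fun s => kDeriv (kDeriv X) (s, 0) (ξ s) η) (Icc 0 1) t := fun η =>
    (((hgerm.kDeriv (uniqueDiffOn_Icc one_pos)).kDeriv
      (uniqueDiffOn_Icc one_pos)).contDiffWithinAt_time ht).clm_apply (hξ t ht) |>.clm_apply
      contDiffWithinAt_const
  have hΓ' : ∀ η : EuclideanSpace ℝ (Fin n), timeDeriv
      (fun s => kDeriv (kDeriv X) (s, 0) (ξ s) η) t =
      kDeriv (kDeriv (tDeriv (Icc 0 1) X)) (t, 0) (ξ t) η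
        + kDeriv (kDeriv X) (t, 0) (timeDeriv ξ t) η := fun η => by
    have e1 := hgerm.hasDerivWithinAt_kDeriv_kDeriv (uniqueDiffOn_Icc one_pos)
      (Icc_subset_closure_interior one_pos) ht
    have e2 := HasDerivWithinAt.clm_apply e1 (hasDerivWithinAt_timeDeriv (hξ t ht))
    have e3 := hasDerivWithinAt_clm_apply_const e2 η
    rw [timeDeriv, e3.derivWithin hu]; rfl
  -- The second derivatives of the tube enter as a curve paired with the momentum of c. Since c
  -- satisfies the Euler–Lagrange equation, their contributions to the two sides of the equation for
  -- Q are equal and cancel.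
  have h3 := fun η => hL.hasDerivWithinAt_momentum hsl (hT.geodesic_equation ht ha) hx ht (hΓ η)
  have h4 : ∀ η, HasDerivWithinAt (fun s => tubeQuad F Φ s (ξ s, timeDeriv ξ s) (0, η)) _
      (Icc 0 1) t := fun η => by
    refine ((h2 η).fun_add (h3 η)).congr_of_eventuallyEq_of_mem ?_ ht
    filter_upwards [hev] with s hs
    rw [hT.tubeQuad_apply hs.1 hs.2, hT.timeDeriv_tubeField hs.1 hs.2 (hξ s hs.1)]
    simp only [map_zero, zero_add, zero_apply]
    rfl
  have hsymm : ∀ v w, kDeriv (kDeriv X) (t, 0) v w = kDeriv (kDeriv X) (t, 0) w v := fun v w =>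
    (hgerm.contDiffAt_param ht).isSymmSndFDerivAt (by simpa using two_le_infty) v w
  have h5 : ∀ η, tubeQuad F Φ t (ξ t, timeDeriv ξ t) (η, 0) =
      fderiv ℝ (fderiv ℝ e) (x t, timeDeriv x t) (u t, timeDeriv u t) (kDeriv X (t, 0) η, 0)
      + fderiv ℝ (fderiv ℝ e) (x t, timeDeriv x t) (u t, timeDeriv u t)
          (0, kDeriv (tDeriv (Icc 0 1) X) (t, 0) η)
      + fderiv ℝ e (x t, timeDeriv x t) (kDeriv (kDeriv X) (t, 0) (ξ t) η, timeDeriv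
      (fun s => kDeriv (kDeriv X) (s, 0) (ξ s) η) t) := fun η => by
    rw [hT.tubeQuad_apply ht ha, hT.timeDeriv_tubeField ht ha (hξ t ht), hΓ', ← map_add,
      hsymm η]
    simp only [map_zero, add_zero, zero_add, Prod.mk_add_mk]
    rfl
  constructor
  · intro hjac η
    refine (h4 η).congr_deriv ?_
    have := ((h1 (kDeriv X (t, 0) η)).derivWithin hu).symm.trans ((hjac _).derivWithin hu)
    rw [h5, ← this]
  · intro hq χ
    obtain ⟨η, rfl⟩ := (LinearMap.injective_iff_surjective
      (f := (kDeriv X (t, 0) : EuclideanSpace ℝ (Fin n) →ₗ[ℝ] EuclideanSpace ℝ (Fin n)))).1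
      (hT.kDeriv_injective ht ha) χ
    refine (h1 _).congr_deriv ?_
    have := ((h4 η).derivWithin hu).symm.trans ((hq η).derivWithin hu)
    rw [h5] at this
    have h6 := add_right_cancel this
    exact add_right_cancel h6

end IsGeodesicTube
end GeodesicTubes

/-! ### Fields along the geodesic in tube coordinates. -/

section TubeCoordinates

variable {n : ℕ} {M : Type*} [TopologicalSpace M] [ChartedSpace (EuclideanSpace ℝ (Fin n)) M]
  [IsManifold (𝓡 n) ∞ M]
  {F : TangentBundle (𝓡 n) M → ℝ} {c : ℝ → M} {Φ : ℝ × EuclideanSpace ℝ (Fin n) → M}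
  {a : M} {t : ℝ} {ξ : ℝ → EuclideanSpace ℝ (Fin n)}

theorem inverse_apply_self {E E' : Type*} [NormedAddCommGroup E] [NormedSpace ℝ E]
    [NormedAddCommGroup E'] [NormedSpace ℝ E'] [FiniteDimensional ℝ E] [FiniteDimensional ℝ E']
    {f : E →L[ℝ] E'} (hf : Function.Injective f)
    (hn : Module.finrank ℝ E = Module.finrank ℝ E') (v : E) : f.inverse (f v) = v := by
  obtain ⟨e, rfl⟩ := exists_equiv_of_injective f hf hn
  simp

theorem apply_inverse_self {E E' : Type*} [NormedAddCommGroup E] [NormedSpace ℝ E]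
    [NormedAddCommGroup E'] [NormedSpace ℝ E'] [FiniteDimensional ℝ E] [FiniteDimensional ℝ E']
    {f : E →L[ℝ] E'} (hf : Function.Injective f)
    (hn : Module.finrank ℝ E = Module.finrank ℝ E') (v : E') : f (f.inverse v) = v := by
  obtain ⟨e, rfl⟩ := exists_equiv_of_injective f hf hn
  simp

theorem _root_.ContDiffWithinAt.clm_inverse {E E' : Type*} [NormedAddCommGroup E] [NormedSpace ℝ E]
    [NormedAddCommGroup E'] [NormedSpace ℝ E'] [FiniteDimensional ℝ E] [FiniteDimensional ℝ E']
    {f : ℝ → E →L[ℝ] E'} {s : Set ℝ} (hf : ContDiffWithinAt ℝ ∞ f s t)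
    (hi : Function.Injective (f t)) (hn : Module.finrank ℝ E = Module.finrank ℝ E') :
    ContDiffWithinAt ℝ ∞ (fun s => (f s).inverse) s t := by
  have : CompleteSpace E := FiniteDimensional.complete ℝ E
  obtain ⟨e, he⟩ := exists_equiv_of_injective (f t) hi hn
  have h1 : ContDiffAt ℝ ∞ ContinuousLinearMap.inverse (f t) := by
    rw [← he]; exact contDiffAt_map_inverse e
  exact h1.comp_contDiffWithinAt t hf

/-- The field with coordinates `ξ` in a tube. -/
def tubeFrame (n : ℕ) {M : Type*} [TopologicalSpace M]
    [ChartedSpace (EuclideanSpace ℝ (Fin n)) M] (Φ : ℝ × EuclideanSpace ℝ (Fin n) → M)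
    (ξ : ℝ → EuclideanSpace ℝ (Fin n)) (t : ℝ) : EuclideanSpace ℝ (Fin n) :=
  famDeriv n Φ (t, 0) (ξ t)

/-- The coordinates in a tube of a field. -/
def tubeCoord (n : ℕ) {M : Type*} [TopologicalSpace M]
    [ChartedSpace (EuclideanSpace ℝ (Fin n)) M] (Φ : ℝ × EuclideanSpace ℝ (Fin n) → M)
    (X : ℝ → EuclideanSpace ℝ (Fin n)) (t : ℝ) : EuclideanSpace ℝ (Fin n) :=
  (famDeriv n Φ (t, 0)).inverse (X t)

namespace IsGeodesicTube

variable (hT : IsGeodesicTube F c Φ) {X : ℝ → EuclideanSpace ℝ (Fin n)}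
include hT

theorem famDeriv_injective (ht : t ∈ Icc (0 : ℝ) 1) :
    Function.Injective (famDeriv n Φ (t, 0)) := (hT.tube t ht).injective

theorem famDeriv_tubeCoord (ht : t ∈ Icc (0 : ℝ) 1) :
    famDeriv n Φ (t, 0) (tubeCoord n Φ X t) = X t :=
  apply_inverse_self (hT.famDeriv_injective ht) rfl _

theorem tubeCoord_tubeFrame (ht : t ∈ Icc (0 : ℝ) 1) : tubeCoord n Φ (tubeFrame n Φ ξ) t = ξ t :=
  inverse_apply_self (hT.famDeriv_injective ht) rfl _

theorem tubeCoord_eq_zero (ht : t ∈ Icc (0 : ℝ) 1) : tubeCoord n Φ X t = 0 ↔ X t = 0 := by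
  rw [← hT.famDeriv_tubeCoord (X := X) ht, map_eq_zero_iff _ (hT.famDeriv_injective ht)]

theorem tubeField_eq (ht : t ∈ Icc (0 : ℝ) 1)
    (ha : c t ∈ (chartAt (EuclideanSpace ℝ (Fin n)) a).source) :
    tubeField a Φ ξ t = chartDeriv a (c t) (tubeFrame n Φ ξ t) := by
  rw [tubeField, kDeriv_localFam ((hT.tube t ht).smooth.contMDiffWithinAt ht) ht
    (hT.source_base ht ha), (hT.tube t ht).base]
  rfl

theorem tubeField_tubeCoord (ht : t ∈ Icc (0 : ℝ) 1)
    (ha : c t ∈ (chartAt (EuclideanSpace ℝ (Fin n)) a).source) :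
    tubeField a Φ (tubeCoord n Φ X) t = chartDeriv a (c t) (X t) := by
  rw [hT.tubeField_eq ht ha, tubeFrame, hT.famDeriv_tubeCoord ht]

/-- Chart components and tube coordinates differ by the frame, which is smooth and invertible in
time. A general `s` is allowed because fields are smooth only on the pieces of a partition. -/
theorem contMDiffWithinAt_iff_tubeCoord {s : Set ℝ} (hs : s ⊆ Icc 0 1) (ht : t ∈ s) :
    ContMDiffWithinAt 𝓘(ℝ, ℝ) (𝓡 n).tangent ∞
      (fun t => (⟨c t, X t⟩ : TangentBundle (𝓡 n) M)) s t ↔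
    ContDiffWithinAt ℝ ∞ (tubeCoord n Φ X) s t := by
  have ht' := hs ht
  have ha := mem_chart_source (EuclideanSpace ℝ (Fin n)) (c t)
  rw [contMDiffWithinAt_tangent_iff ha, and_iff_right ((hT.contMDiffOn t ht').mono hs)]
  have hev : ∀ᶠ r in 𝓝[s] t, r ∈ Icc (0 : ℝ) 1 ∧
      c r ∈ (chartAt (EuclideanSpace ℝ (Fin n)) (c t)).source :=
    nhdsWithin_mono t hs (hT.eventually_mem_source ht' ha)
  have hfr : ContDiffWithinAt ℝ ∞ (fun r => kDeriv (localFam n (c t) Φ) (r, 0)) s t :=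
    (((hT.smoothGerm_localFam ht' ha).kDeriv (uniqueDiffOn_Icc one_pos)).contDiffWithinAt_time
      ht').mono hs
  constructor
  · intro h
    refine ((hfr.clm_inverse (hT.kDeriv_injective ht' ha) rfl).clm_apply
      h).congr_of_eventuallyEq ?_ ?_
    · filter_upwards [hev] with r hr
      rw [← hT.tubeField_tubeCoord hr.1 hr.2, tubeField,
        inverse_apply_self (hT.kDeriv_injective hr.1 hr.2) rfl]
    · rw [← hT.tubeField_tubeCoord ht' ha, tubeField,
        inverse_apply_self (hT.kDeriv_injective ht' ha) rfl]
  · intro h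
    refine (hfr.clm_apply h).congr_of_eventuallyEq ?_ ?_
    · filter_upwards [hev] with r hr
      exact (hT.tubeField_tubeCoord hr.1 hr.2).symm
    · exact (hT.tubeField_tubeCoord ht' ha).symm

theorem contMDiffOn_iff_tubeCoord {s : Set ℝ} (hs : s ⊆ Icc 0 1) :
    ContMDiffOn 𝓘(ℝ, ℝ) (𝓡 n).tangent ∞ (fun t => (⟨c t, X t⟩ : TangentBundle (𝓡 n) M)) s ↔
    ContDiffOn ℝ ∞ (tubeCoord n Φ X) s :=
  forall₂_congr fun _ ht => hT.contMDiffWithinAt_iff_tubeCoord hs ht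

end IsGeodesicTube

theorem timeDeriv_congr {ξ ζ : ℝ → EuclideanSpace ℝ (Fin n)} (h : ξ =ᶠ[𝓝[Icc 0 1] t] ζ)
    (ht : t ∈ Icc (0 : ℝ) 1) : timeDeriv ξ t = timeDeriv ζ t :=
  h.derivWithin_eq (h.self_of_nhdsWithin ht)

theorem covDeriv_congr {L : EuclideanSpace ℝ (Fin n) → EuclideanSpace ℝ (Fin n) → ℝ}
    {x ξ ζ : ℝ → EuclideanSpace ℝ (Fin n)} (h : ξ =ᶠ[𝓝[Icc 0 1] t] ζ)
    (ht : t ∈ Icc (0 : ℝ) 1) : covDeriv L x ξ t = covDeriv L x ζ t := by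
  simp only [covDeriv, timeDeriv_congr h ht, h.self_of_nhdsWithin ht]

theorem covDeriv_eventuallyEq {L : EuclideanSpace ℝ (Fin n) → EuclideanSpace ℝ (Fin n) → ℝ}
    {x ξ ζ : ℝ → EuclideanSpace ℝ (Fin n)} (h : ξ =ᶠ[𝓝[Icc 0 1] t] ζ) :
    covDeriv L x ξ =ᶠ[𝓝[Icc 0 1] t] covDeriv L x ζ := by
  filter_upwards [eventually_eventually_nhdsWithin.2 h, self_mem_nhdsWithin] with s hs ht
  exact covDeriv_congr hs ht

theorem IsQJacobi.congr {H : Type*} [NormedAddCommGroup H] [NormedSpace ℝ H]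
    {Q : ℝ → (H × H) →L[ℝ] (H × H) →L[ℝ] ℝ} {ξ ζ : ℝ → H} (h : IsQJacobi Q ξ)
    (hξ : ∀ t ∈ Icc (0 : ℝ) 1, ζ t = ξ t) : IsQJacobi Q ζ := by
  have hd : ∀ t ∈ Icc (0 : ℝ) 1, derivWithin ζ (Icc 0 1) t = derivWithin ξ (Icc 0 1) t :=
    fun t ht => derivWithin_congr hξ (hξ t ht)
  refine ⟨h.smooth.congr hξ, fun t ht η => ?_⟩
  rw [hξ t ht, hd t ht]
  exact (h.eqn t ht η).congr (fun s hs => by rw [hξ s hs, hd s hs]) (by rw [hξ t ht, hd t ht])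

namespace IsGeodesicTube

variable (hT : IsGeodesicTube F c Φ) {X : ℝ → EuclideanSpace ℝ (Fin n)}
include hT

/-- The equation in the tube does not mention charts, so the Jacobi equations in all charts reduce
to one. Chart components equal those of the tube field only near t, whence the local congruence of
`covDeriv`. -/
theorem isJacobi_iff : IsJacobi F c X ↔ IsQJacobi (tubeQuad F Φ) (tubeCoord n Φ X) := by
  have hsm := hT.contMDiffOn_iff_tubeCoord (X := X) (Subset.refl _)
  have key : ∀ (hξ : ContDiffOn ℝ ∞ (tubeCoord n Φ X) (Icc 0 1)) (a : M) (t : ℝ)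
      (ht : t ∈ Icc (0 : ℝ) 1) (ha : c t ∈ (chartAt (EuclideanSpace ℝ (Fin n)) a).source),
      covDeriv (localF F a) (localCurve a c)
        (covDeriv (localF F a) (localCurve a c) (localField a c X)) t
      + curvTerm (localF F a) (localCurve a c) (localField a c X) t = 0 ↔
      ∀ η, HasDerivWithinAt (fun s => tubeQuad F Φ s (tubeCoord n Φ X s,
        timeDeriv (tubeCoord n Φ X) s) (0, η)) (tubeQuad F Φ t (tubeCoord n Φ X t,
        timeDeriv (tubeCoord n Φ X) t) (η, 0)) (Icc 0 1) t := by
    intro hξ a t ht ha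
    have h1 : localField a c X =ᶠ[𝓝[Icc 0 1] t] tubeField a Φ (tubeCoord n Φ X) := by
      filter_upwards [hT.eventually_mem_source ht ha] with s hs
      exact (hT.tubeField_tubeCoord hs.1 hs.2).symm
    rw [← hT.jacobi_iff_tube ht ha hξ, covDeriv_congr (covDeriv_eventuallyEq h1) ht]
    simp only [curvTerm, h1.self_of_nhdsWithin ht]
  constructor
  · rintro ⟨h1, h2⟩
    have hξ := hsm.1 h1
    refine ⟨hξ, fun t ht => ?_⟩
    exact (key hξ (c t) t ht (mem_chart_source _ _)).1 (h2 _ t ht (mem_chart_source _ _))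
  · rintro ⟨h1, h2⟩
    exact ⟨hsm.2 h1, fun a t ht ha => (key h1 a t ht ha).2 (h2 t ht)⟩

theorem isConjugate_iff (ht : t ∈ Icc (0 : ℝ) 1) : IsConjugate F c 0 t ↔
    ∃ ξ, IsQJacobi (tubeQuad F Φ) ξ ∧ (∃ s ∈ Icc (0 : ℝ) 1, ξ s ≠ 0) ∧ ξ 0 = 0 ∧ ξ t = 0 := by
  have h0 : (0 : ℝ) ∈ Icc (0 : ℝ) 1 := ⟨le_rfl, zero_le_one⟩
  constructor
  · rintro ⟨J, hJ, ⟨s, hs, hJs⟩, hJ0, hJt⟩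
    exact ⟨tubeCoord n Φ J, hT.isJacobi_iff.1 hJ,
      ⟨s, hs, (hT.tubeCoord_eq_zero hs).not.2 hJs⟩, (hT.tubeCoord_eq_zero h0).2 hJ0,
      (hT.tubeCoord_eq_zero ht).2 hJt⟩
  · rintro ⟨ξ, hξ, ⟨s, hs, hξs⟩, hξ0, hξt⟩
    refine ⟨tubeFrame n Φ ξ, hT.isJacobi_iff.2
      (hξ.congr fun r hr => hT.tubeCoord_tubeFrame hr), ⟨s, hs, ?_⟩, ?_, ?_⟩
    · exact (map_eq_zero_iff _ (hT.famDeriv_injective hs)).not.2 hξs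
    · change famDeriv n Φ (0, 0) (ξ 0) = 0
      rw [hξ0, map_zero]
    · change famDeriv n Φ (t, 0) (ξ t) = 0
      rw [hξt, map_zero]

theorem hasDerivWithinAt_tubeLin_of_isQJacobi (hξ : IsQJacobi (tubeQuad F Φ) ξ)
    (ht : t ∈ Icc (0 : ℝ) 1) :
    HasDerivWithinAt (fun s => tubeLin F Φ s (ξ s, timeDeriv ξ s)) 0 (Icc 0 1) t := by
  have ha := mem_chart_source (EuclideanSpace ℝ (Fin n)) (c t)
  have hL := hT.finsler.isLocalFinsler (c t)
  have hsl := hT.mem_slit ht ha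
  have hx := hT.contDiffWithinAt_localCurve ht ha
  have hU := hT.contDiffWithinAt_tubeField ht ha (hξ.smooth t ht)
  have hev := hT.eventually_mem_source ht ha
  have hj := (hT.jacobi_iff_tube ht ha hξ.smooth).2 (hξ.eqn t ht)
  rw [hL.jacobi_iff (by
    filter_upwards [hev] with s hs
    exact ⟨hT.mem_slit hs.1 hs.2, hT.geodesic_equation hs.1 hs.2⟩) hx hU ht] at hj
  have h1 := hL.hasDerivWithinAt_fderiv_sqr_of_jacobi hsl (hT.geodesic_equation ht ha) (by
    filter_upwards [hev] with s hs using hT.mem_slit hs.1 hs.2) hx ht hU hj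
  refine h1.congr_of_eventuallyEq_of_mem ?_ ht
  filter_upwards [hev] with s hs
  exact hT.tubeLin_jet hs.1 hs.2 (hξ.smooth s hs.1)

/-- A Jacobi field that vanishes twice is orthogonal to the velocity. -/
theorem tubeLin_eq_zero_of_isQJacobi (hξ : IsQJacobi (tubeQuad F Φ) ξ) {t₀ : ℝ}
    (ht₀ : t₀ ∈ Ioc (0 : ℝ) 1) (h0 : ξ 0 = 0) (h1 : ξ t₀ = 0) (ht : t ∈ Icc (0 : ℝ) 1) :
    tubeLin F Φ t (0, ξ t) = 0 ∧ tubeLin F Φ t (ξ t, timeDeriv ξ t) = 0 := by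
  have hz : (0 : ℝ) ∈ Icc (0 : ℝ) 1 := ⟨le_rfl, zero_le_one⟩
  set κ := tubeLin F Φ 0 (ξ 0, timeDeriv ξ 0)
  have hconst : ∀ s ∈ Icc (0 : ℝ) 1, tubeLin F Φ s (ξ s, timeDeriv ξ s) = κ := by
    refine constant_of_derivWithin_zero (fun s hs =>
      (hT.hasDerivWithinAt_tubeLin_of_isQJacobi hξ hs).differentiableWithinAt) fun s hs => ?_
    have hs' : s ∈ Icc (0 : ℝ) 1 := ⟨hs.1, hs.2.le⟩
    exact (hT.hasDerivWithinAt_tubeLin_of_isQJacobi hξ hs').derivWithin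
      (uniqueDiffWithinAt_unitInterval hs')
  -- The pairing of the momentum of c with ξ has derivative `tubeLin` on (ξ, ξ'), which is the
  -- constant κ. So it is affine in s, and vanishing at 0 and at `t₀` forces κ = 0.
  have haff : ∀ s ∈ Icc (0 : ℝ) 1, HasDerivWithinAt
      (fun s => tubeLin F Φ s (0, ξ s) - s * κ) 0 (Icc 0 1) s := fun s hs =>
    ((hT.hasDerivWithinAt_tubeLin hs (hξ.smooth s hs)).fun_sub
      ((hasDerivWithinAt_id s _).mul_const κ)).congr_deriv (by rw [hconst s hs]; simp)
  have haff' : ∀ s ∈ Icc (0 : ℝ) 1, tubeLin F Φ s (0, ξ s) - s * κ = 0 := by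
    intro s hs
    rw [constant_of_derivWithin_zero (fun s hs => (haff s hs).differentiableWithinAt)
      (fun r hr => (haff r ⟨hr.1, hr.2.le⟩).derivWithin
        (uniqueDiffWithinAt_unitInterval ⟨hr.1, hr.2.le⟩)) s hs, h0, Prod.mk_zero_zero, map_zero,
      zero_mul, sub_zero]
  have hκ : κ = 0 := by
    have := haff' t₀ ⟨ht₀.1.le, ht₀.2⟩
    rw [h1, Prod.mk_zero_zero, map_zero, zero_sub, neg_eq_zero, mul_eq_zero] at this
    exact this.resolve_left ht₀.1.ne'
  refine ⟨?_, (hconst t ht).trans hκ⟩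
  have := haff' t ht
  rwa [hκ, mul_zero, sub_zero] at this

/-- By Euler's relation g(X,ċ) is half of the fibre derivative of F² on X, so orthogonality becomes
the vanishing of `tubeLin` on (0, ξ). -/
theorem fundTensor_velocity (ht : t ∈ Icc (0 : ℝ) 1) :
    fundTensor F (c t) (velocity c t) (X t) (velocity c t) =
      (1 / 2) * tubeLin F Φ t (0, tubeCoord n Φ X t) := by
  have ha := mem_chart_source (EuclideanSpace ℝ (Fin n)) (c t)
  rw [hT.finsler.fundTensor_right ha (hT.regular t ht), hT.tubeLin_zero_apply ht ha,
    ← hT.timeDeriv_localCurve ht ha]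
  have := hT.tubeField_tubeCoord (X := X) ht ha
  rw [tubeField] at this
  rw [this]
  rfl

theorem tubeLin_velocity (ht : t ∈ Icc (0 : ℝ) 1) :
    tubeLin F Φ t (0, tubeCoord n Φ (fun t => velocity (n := n) c t) t) =
      2 * F (⟨c t, velocity c t⟩ : TangentBundle (𝓡 n) M) ^ 2 := by
  have := hT.fundTensor_velocity (X := fun t => velocity (n := n) c t) ht
  rw [hT.finsler.fundTensor_self (hT.regular t ht)] at this
  linarith

end IsGeodesicTube
end TubeCoordinates

/-! ### Differentiation under the integral sign. -/

section ParametricIntegrals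

variable {K E : Type*} [NormedAddCommGroup K] [NormedSpace ℝ K] [NormedAddCommGroup E]
  [NormedSpace ℝ E] {k₀ : K} {a b : ℝ}

/-- Compactness of `S`: local properties along the slice hold on one common neighbourhood of the
parameter. -/
theorem eventually_forall_of_nhdsWithin {S : Set ℝ} (hS : IsCompact S) {P : ℝ × K → Prop}
    (h : ∀ t ∈ S, ∀ᶠ p in 𝓝[S ×ˢ univ] (t, k₀), P p) : ∀ᶠ k in 𝓝 k₀, ∀ t ∈ S, P (t, k) := by
  have h1 : ∀ᶠ k in 𝓝 k₀, ∀ t ∈ S, t ∈ S → P (t, k) := by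
    refine hS.eventually_forall_of_forall_eventually (P := fun k t => t ∈ S → P (t, k))
      fun t ht => ?_
    have h2 := eventually_nhdsWithin_iff.1 (h t ht)
    have h3 : Tendsto (fun z : K × ℝ => (z.2, z.1)) (𝓝 (k₀, t)) (𝓝 (t, k₀)) :=
      continuous_swap.continuousAt
    filter_upwards [h3.eventually h2] with z hz hz2 using hz ⟨hz2, mem_univ _⟩
  filter_upwards [h1] with k hk t ht using hk t ht ht

/-- Near `k₀` the parameter derivative is bounded by `C + 1` uniformly in time, a constant that
serves as the dominating function. Values in a general `E` allow a second application, to the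
derivative itself. -/
theorem SmoothGerm.eventually_hasFDerivAt_integral (hab : a < b) {g : ℝ × K → E}
    (hg : ∀ t ∈ Icc a b, SmoothGerm (Icc a b) g (t, k₀)) :
    ∀ᶠ k in 𝓝 k₀, HasFDerivAt (fun k => ∫ t in a..b, g (t, k))
      (∫ t in a..b, Finsler.kDeriv g (t, k)) k := by
  have hS := uniqueDiffOn_of_lt hab
  obtain ⟨C, hC⟩ := isCompact_Icc.exists_bound_of_continuousOn
    (f := fun t => Finsler.kDeriv g (t, k₀))
    fun t ht => (((hg t ht).kDeriv hS).contDiffWithinAt_time ht).continuousWithinAt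
  have h1 : ∀ᶠ k in 𝓝 k₀, ∀ t ∈ Icc a b, SmoothGerm (Icc a b) g (t, k) ∧
      ‖Finsler.kDeriv g (t, k)‖ < C + 1 := by
    refine eventually_forall_of_nhdsWithin isCompact_Icc (P := fun p =>
      SmoothGerm (Icc a b) g p ∧ ‖Finsler.kDeriv g p‖ < C + 1) fun t ht => ?_
    refine (hg t ht).eventually.and ?_
    have h2 := (((hg t ht).kDeriv hS).contDiffWithinAt ht).continuousWithinAt.norm
    exact h2.eventually (gt_mem_nhds (by linarith [hC t ht]))
  have hI : uIoc a b ⊆ Icc a b := by rw [uIoc_of_le hab.le]; exact Ioc_subset_Icc_self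
  have hcont : ∀ k, (∀ t ∈ Icc a b, SmoothGerm (Icc a b) g (t, k)) →
      ContinuousOn (fun t => g (t, k)) (Icc a b) := fun k hk t ht =>
    ((hk t ht).contDiffWithinAt_time ht).continuousWithinAt
  have hcont' : ∀ k, (∀ t ∈ Icc a b, SmoothGerm (Icc a b) g (t, k)) →
      ContinuousOn (fun t => Finsler.kDeriv g (t, k)) (Icc a b) := fun k hk t ht =>
    (((hk t ht).kDeriv hS).contDiffWithinAt_time ht).continuousWithinAt
  filter_upwards [eventually_eventually_nhds.2 h1] with k hk
  have hk0 := fun t ht => (hk.self_of_nhds t ht).1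
  refine (intervalIntegral.hasFDerivAt_integral_of_dominated_of_fderiv_le
    (F := fun k t => g (t, k)) (F' := fun k t => Finsler.kDeriv g (t, k)) (bound := fun _ => C + 1)
    hk ?_ ?_ ?_ ?_ ?_ ?_)
  · filter_upwards [hk] with k' hk'
    exact ((hcont k' fun t ht => (hk' t ht).1).mono hI).aestronglyMeasurable measurableSet_uIoc
  · exact ContinuousOn.intervalIntegrable (by rw [uIcc_of_le hab.le]; exact hcont k hk0)
  · exact ((hcont' k hk0).mono hI).aestronglyMeasurable measurableSet_uIoc
  · exact Eventually.of_forall fun t ht k' hk' => (hk' t (hI ht)).2.le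
  · exact intervalIntegrable_const
  · refine Eventually.of_forall fun t ht k' hk' => ?_
    exact (((hk' t (hI ht)).1.contDiffAt_param (hI ht)).differentiableAt (by simp)).hasFDerivAt

theorem SmoothGerm.hasFDerivAt_integral_kDeriv (hab : a < b) {g : ℝ × K → ℝ}
    (hg : ∀ t ∈ Icc a b, SmoothGerm (Icc a b) g (t, k₀)) :
    HasFDerivAt (fun k => ∫ t in a..b, Finsler.kDeriv g (t, k))
      (∫ t in a..b, Finsler.kDeriv (Finsler.kDeriv g) (t, k₀)) k₀ :=
  (SmoothGerm.eventually_hasFDerivAt_integral hab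
    fun t ht => (hg t ht).kDeriv (uniqueDiffOn_of_lt hab)).self_of_nhds

theorem SmoothGerm.integral_kDeriv_kDeriv_apply (hab : a < b) {g : ℝ × K → ℝ}
    (hg : ∀ t ∈ Icc a b, SmoothGerm (Icc a b) g (t, k₀)) (u v : K) :
    (∫ t in a..b, Finsler.kDeriv (Finsler.kDeriv g) (t, k₀)) u v =
      ∫ t in a..b, Finsler.kDeriv (Finsler.kDeriv g) (t, k₀) u v := by
  have hS := uniqueDiffOn_of_lt hab
  have h1 : ContinuousOn (fun t => Finsler.kDeriv (Finsler.kDeriv g) (t, k₀)) (Icc a b) :=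
    fun t ht => ((((hg t ht).kDeriv hS).kDeriv hS).contDiffWithinAt_time ht).continuousWithinAt
  rw [ContinuousLinearMap.intervalIntegral_apply
    (ContinuousOn.intervalIntegrable (by rwa [uIcc_of_le hab.le])),
    ContinuousLinearMap.intervalIntegral_apply (ContinuousOn.intervalIntegrable
      (by rw [uIcc_of_le hab.le]; exact h1.clm_apply continuousOn_const))]

/-- The source of the two coefficients of `hessQuad`. Since the base is nonzero, every real exponent
is allowed. -/
theorem fderiv_fderiv_rpow {f : K → ℝ} (q : ℝ) (hf : ContDiffAt ℝ ∞ f k₀) (h0 : f k₀ ≠ 0)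
    (u v : K) : fderiv ℝ (fderiv ℝ fun k => f k ^ q) k₀ u v =
      q * f k₀ ^ (q - 1) * fderiv ℝ (fderiv ℝ f) k₀ u v +
      q * (q - 1) * f k₀ ^ (q - 2) * (fderiv ℝ f k₀ u * fderiv ℝ f k₀ v) := by
  have h1 : ContDiffAt ℝ ∞ (fun x : ℝ => x ^ q) (f k₀) := Real.contDiffAt_rpow_const_of_ne h0
  have h2 : ∀ (q : ℝ) {x : ℝ}, x ≠ 0 → fderiv ℝ (fun x : ℝ => x ^ q) x =
      ContinuousLinearMap.toSpanSingleton ℝ (q * x ^ (q - 1)) := fun q x hx => by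
    rw [(Real.hasDerivAt_rpow_const (Or.inl hx)).hasFDerivAt.fderiv]
  have h3 : fderiv ℝ (fun x : ℝ => x ^ q) =ᶠ[𝓝 (f k₀)] fun x =>
      ContinuousLinearMap.toSpanSingleton ℝ (q * x ^ (q - 1)) := by
    filter_upwards [isOpen_ne.mem_nhds h0] with x hx using h2 q hx
  have h4 : ∀ x y : ℝ, fderiv ℝ (fderiv ℝ fun x : ℝ => x ^ q) (f k₀) x y =
      x * (y * (q * (q - 1) * f k₀ ^ (q - 2))) := fun x y => by
    have hd : DifferentiableAt ℝ (fderiv ℝ fun x : ℝ => x ^ q) (f k₀) :=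
      ContDiffAt.differentiableAt_fderiv h1
    rw [← fderiv_clm_apply_const hd]
    have h5 : (fun z => fderiv ℝ (fun x : ℝ => x ^ q) z y) =ᶠ[𝓝 (f k₀)] fun x =>
        y * (q * x ^ (q - 1)) := by
      filter_upwards [h3] with z hz
      rw [hz]; simp
    rw [h5.fderiv_eq (𝕜 := ℝ), (((Real.hasDerivAt_rpow_const (p := q - 1)
      (Or.inl h0)).const_mul q).const_mul y).hasFDerivAt.fderiv]
    simp only [ContinuousLinearMap.toSpanSingleton_apply, smul_eq_mul]
    rw [show q - 1 - 1 = q - 2 by ring]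
    ring
  rw [fderiv_fderiv_comp (g := fun x : ℝ => x ^ q) h1 hf, h4, h2 q h0]
  simp only [ContinuousLinearMap.toSpanSingleton_apply, smul_eq_mul]
  ring

end ParametricIntegrals

/-! ### Partitions of [0,1] and their refinements. -/

section Partitions

theorem IsPartition.mem_Icc {k : ℕ} {τ : ℕ → ℝ} (h : IsPartition k τ) {i : ℕ} (hi : i ≤ k) :
    τ i ∈ Icc (0 : ℝ) 1 := by
  have hmono : ∀ j ≤ k, ∀ i ≤ j, τ i ≤ τ j := by
    intro j
    induction j with
    | zero => intro _ i hi; rw [Nat.le_zero.1 hi]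
    | succ j ih =>
      intro hj i hij
      rcases Nat.le_succ_iff.1 hij with h1 | h1
      · exact (ih (by omega) i h1).trans (h.lt j (by omega)).le
      · rw [h1]
  exact ⟨h.zero ▸ hmono i hi 0 (Nat.zero_le _), h.last ▸ hmono k le_rfl i hi⟩

theorem IsPartition.subset {k : ℕ} {τ : ℕ → ℝ} (h : IsPartition k τ) {i : ℕ} (hi : i < k) :
    Icc (τ i) (τ (i + 1)) ⊆ Icc 0 1 :=
  Icc_subset_Icc (h.mem_Icc hi.le).1 (h.mem_Icc (Nat.succ_le_of_lt hi)).2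

/-- An interval that contains no partition point in its interior lies in a piece. -/
theorem IsPartition.exists_piece {k : ℕ} {τ : ℕ → ℝ} (h : IsPartition k τ) {a b : ℝ}
    (ha : 0 ≤ a) (hab : a < b) (hb : b ≤ 1) (hτ : ∀ i ≤ k, τ i ∉ Ioo a b) :
    ∃ i < k, Icc a b ⊆ Icc (τ i) (τ (i + 1)) := by
  have hex : ∃ i, i ≤ k ∧ a < τ i := ⟨k, le_rfl, by rw [h.last]; linarith⟩
  classical
  obtain ⟨h1, h2⟩ := Nat.find_spec hex
  have h3 : Nat.find hex ≠ 0 := fun h0 => by rw [h0, h.zero] at h2; linarith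
  obtain ⟨i, hi⟩ := Nat.exists_eq_succ_of_ne_zero h3
  have h4 : τ i ≤ a := by
    by_contra hlt
    have := Nat.find_min' hex (m := i) ⟨by omega, not_le.1 hlt⟩
    omega
  rw [hi] at h1 h2
  refine ⟨i, by omega, Icc_subset_Icc h4 ?_⟩
  by_contra hlt
  exact hτ (i + 1) h1 ⟨h2, not_le.1 hlt⟩

/-- Every finite set is avoided by the interiors of the pieces of some partition. -/
theorem exists_partition (s : Finset ℝ) : ∃ (k : ℕ) (τ : ℕ → ℝ), IsPartition k τ ∧
    ∀ i < k, ∀ x ∈ s, x ∉ Ioo (τ i) (τ (i + 1)) := by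
  classical
  set r : Finset ℝ := insert 0 (insert 1 (s.filter fun x => x ∈ Ioo (0 : ℝ) 1)) with hr
  have hr01 : ∀ x ∈ r, x ∈ Icc (0 : ℝ) 1 := by
    intro x hx
    simp only [hr, Finset.mem_insert, Finset.mem_filter] at hx
    rcases hx with rfl | rfl | ⟨-, hx⟩
    · exact ⟨le_rfl, zero_le_one⟩
    · exact ⟨zero_le_one, le_rfl⟩
    · exact ⟨hx.1.le, hx.2.le⟩
  have h0 : (0 : ℝ) ∈ r := by simp [hr]
  have h1 : (1 : ℝ) ∈ r := by simp [hr]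
  have hpos : 0 < r.card := Finset.card_pos.2 ⟨0, h0⟩
  let e := r.orderEmbOfFin rfl
  -- The points of `r` in increasing order; the value 1 beyond the last index is a default that is
  -- never used.
  let τ : ℕ → ℝ := fun i => if h : i < r.card then e ⟨i, h⟩ else 1
  have hτ : ∀ i (h : i < r.card), τ i = e ⟨i, h⟩ := fun i h => dif_pos h
  refine ⟨r.card - 1, τ, ⟨?_, ?_, ?_⟩, ?_⟩
  · rw [hτ 0 hpos]
    obtain ⟨j, hj⟩ : (0 : ℝ) ∈ Set.range e := by
      rw [Finset.range_orderEmbOfFin]; exact h0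
    refine le_antisymm ?_ (hr01 _ (Finset.orderEmbOfFin_mem r rfl _)).1
    rw [← hj]
    exact e.monotone (Fin.mk_le_of_le_val (Nat.zero_le _))
  · rw [hτ _ (by omega)]
    obtain ⟨j, hj⟩ : (1 : ℝ) ∈ Set.range e := by
      rw [Finset.range_orderEmbOfFin]; exact h1
    refine le_antisymm (hr01 _ (Finset.orderEmbOfFin_mem r rfl _)).2 ?_
    rw [← hj]
    exact e.monotone (Fin.le_def.2 (by have := j.2; simp only; omega))
  · intro i hi
    rw [hτ i (by omega), hτ (i + 1) (by omega)]
    exact e.strictMono (Fin.mk_lt_mk.2 (Nat.lt_succ_self i))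
  · intro i hi x hx hxI
    rw [hτ i (by omega), hτ (i + 1) (by omega)] at hxI
    have hxr : x ∈ r := by
      have h2 := hr01 _ (Finset.orderEmbOfFin_mem r rfl ⟨i, by omega⟩)
      have h3 := hr01 _ (Finset.orderEmbOfFin_mem r rfl ⟨i + 1, by omega⟩)
      simp only [hr, Finset.mem_insert, Finset.mem_filter]
      exact Or.inr (Or.inr ⟨hx, lt_of_le_of_lt h2.1 hxI.1, lt_of_lt_of_le hxI.2 h3.2⟩)
    -- A point of `r` strictly inside a piece would have an index strictly between i and i + 1.
    obtain ⟨j, hj⟩ : x ∈ Set.range e := by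
      rw [Finset.range_orderEmbOfFin]; exact hxr
    rw [← hj] at hxI
    have h4 := Fin.lt_def.1 (e.lt_iff_lt.1 hxI.1)
    have h5 := Fin.lt_def.1 (e.lt_iff_lt.1 hxI.2)
    simp only at h4 h5
    omega

/-- Two partitions have a common refinement. -/
theorem IsPartition.exists_refinement {k l : ℕ} {τ σ : ℕ → ℝ} (h : IsPartition k τ)
    (h' : IsPartition l σ) : ∃ (m : ℕ) (ρ : ℕ → ℝ), IsPartition m ρ ∧ ∀ i < m,
      (∃ j < k, Icc (ρ i) (ρ (i + 1)) ⊆ Icc (τ j) (τ (j + 1))) ∧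
      ∃ j < l, Icc (ρ i) (ρ (i + 1)) ⊆ Icc (σ j) (σ (j + 1)) := by
  classical
  obtain ⟨m, ρ, hρ, hs⟩ := exists_partition
    ((Finset.range (k + 1)).image τ ∪ (Finset.range (l + 1)).image σ)
  refine ⟨m, ρ, hρ, fun i hi => ?_⟩
  have h1 := (hρ.mem_Icc hi.le).1
  have h2 := (hρ.mem_Icc (Nat.succ_le_of_lt hi)).2
  refine ⟨h.exists_piece h1 (hρ.lt i hi) h2 fun j hj => hs i hi _ ?_,
    h'.exists_piece h1 (hρ.lt i hi) h2 fun j hj => hs i hi _ ?_⟩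
  · exact Finset.mem_union_left _ (Finset.mem_image_of_mem _ (Finset.mem_range.2 (by omega)))
  · exact Finset.mem_union_right _ (Finset.mem_image_of_mem _ (Finset.mem_range.2 (by omega)))

theorem IsPartition.exists_mem {k : ℕ} {τ : ℕ → ℝ} (h : IsPartition k τ) {t : ℝ}
    (ht : t ∈ Icc (0 : ℝ) 1) : ∃ i < k, t ∈ Icc (τ i) (τ (i + 1)) := by
  have hk : 0 < k := Nat.pos_of_ne_zero fun h0 => by
    have := h.last; rw [h0, h.zero] at this; norm_num at this
  classical
  rcases eq_or_lt_of_le ht.2 with rfl | h1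
  · refine ⟨k - 1, by omega, ?_⟩
    have h2 := h.lt (k - 1) (by omega)
    rw [Nat.sub_add_cancel hk, h.last] at h2 ⊢
    exact ⟨h2.le, le_rfl⟩
  · have hex : ∃ i, i ≤ k ∧ t < τ i := ⟨k, le_rfl, by rw [h.last]; exact h1⟩
    obtain ⟨h2, h3⟩ := Nat.find_spec hex
    have h4 : Nat.find hex ≠ 0 := fun h0 => by
      rw [h0, h.zero] at h3; linarith [ht.1]
    obtain ⟨i, hi⟩ := Nat.exists_eq_succ_of_ne_zero h4
    rw [hi] at h2 h3
    refine ⟨i, by omega, ?_, h3.le⟩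
    by_contra hlt
    have := Nat.find_min' hex (m := i) ⟨by omega, not_le.1 hlt⟩
    omega

theorem IsPartition.sum_integral {k : ℕ} {τ : ℕ → ℝ} (h : IsPartition k τ) {f : ℝ → ℝ}
    (hf : ∀ i < k, IntervalIntegrable f volume (τ i) (τ (i + 1))) :
    ∑ i ∈ Finset.range k, ∫ t in τ i..τ (i + 1), f t = ∫ t in (0 : ℝ)..1, f t := by
  rw [intervalIntegral.sum_integral_adjacent_intervals hf, h.zero, h.last]

theorem IsPartition.finite_points {k : ℕ} {τ : ℕ → ℝ} (_h : IsPartition k τ) :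
    (τ '' Iic k).Finite := (finite_Iic k).image τ

theorem IsPartition.exists_mem_Ioo {k : ℕ} {τ : ℕ → ℝ} (h : IsPartition k τ) {t : ℝ}
    (ht : t ∈ Ioo (0 : ℝ) 1 \ τ '' Iic k) : ∃ i < k, t ∈ Ioo (τ i) (τ (i + 1)) := by
  obtain ⟨i, hi, h1⟩ := h.exists_mem (Ioo_subset_Icc_self ht.1)
  refine ⟨i, hi, lt_of_le_of_ne h1.1 fun h0 => ht.2 ⟨i, hi.le, h0⟩,
    lt_of_le_of_ne h1.2 fun h0 => ht.2 ⟨i + 1, Nat.succ_le_of_lt hi, h0.symm⟩⟩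

theorem IsPartition.isPiecewiseDiff {H : Type*} [NormedAddCommGroup H] [NormedSpace ℝ H]
    {k : ℕ} {τ : ℕ → ℝ} (h : IsPartition k τ) {ξ : ℝ → H}
    (hξ : ∀ i < k, ContDiffOn ℝ ∞ ξ (Icc (τ i) (τ (i + 1)))) : IsPiecewiseDiff ξ where
  cont := by
    have h1 : ∀ j ≤ k, ContinuousOn ξ (Icc 0 (τ j)) := by
      intro j
      induction j with
      | zero => intro _; rw [h.zero, Icc_self]; exact continuousOn_singleton _ _
      | succ j ih =>
        intro hj
        have h2 := (ih (by omega)).union_of_isClosed (hξ j hj).continuousOn isClosed_Icc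
          isClosed_Icc
        rwa [Icc_union_Icc_eq_Icc (h.mem_Icc (by omega)).1 (h.lt j hj).le] at h2
    have := h1 k le_rfl
    rwa [h.last] at this
  diff := by
    have h1 : ∀ i < k, ∃ C, ∀ t ∈ Icc (τ i) (τ (i + 1)),
        ‖derivWithin ξ (Icc (τ i) (τ (i + 1))) t‖ ≤ C := fun i hi =>
      isCompact_Icc.exists_bound_of_continuousOn ((hξ i hi).continuousOn_derivWithin
        (uniqueDiffOn_of_lt (h.lt i hi)) (by simp))
    choose! C hC using h1
    refine ⟨τ '' Iic k, h.finite_points, ∑ i ∈ Finset.range k, |C i|, fun t ht => ?_⟩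
    obtain ⟨i, hi, hti⟩ := h.exists_mem_Ioo ht
    have hn := Icc_mem_nhds hti.1 hti.2
    have hti' := Ioo_subset_Icc_self hti
    refine ⟨((hξ i hi).contDiffAt hn).differentiableAt (by simp), ?_⟩
    rw [← derivWithin_of_mem_nhds hn]
    refine (hC i hi t hti').trans ((le_abs_self _).trans ?_)
    exact Finset.single_le_sum (f := fun i => |C i|) (fun _ _ => abs_nonneg _)
      (Finset.mem_range.2 hi)

end Partitions

/-! ### Second derivatives of maps into the manifold under change of chart. -/

section SecondOrder

variable {n : ℕ} {M : Type*} [TopologicalSpace M] [ChartedSpace (EuclideanSpace ℝ (Fin n)) M]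
  [IsManifold (𝓡 n) ∞ M]
variable {K K' : Type*} [NormedAddCommGroup K] [NormedSpace ℝ K] [NormedAddCommGroup K']
  [NormedSpace ℝ K']

theorem fderiv_fderiv_inl {g : K × K' → ℝ} {k : K} (hg : ContDiffAt ℝ ∞ g (k, 0)) (u v : K) :
    fderiv ℝ (fderiv ℝ fun k => g (k, 0)) k u v = fderiv ℝ (fderiv ℝ g) (k, 0) (u, 0) (v, 0) := by
  have h1 : ContDiffAt ℝ ∞ (fun k : K => (k, (0 : K'))) k := by fun_prop
  have h2 : fderiv ℝ (fun k : K => (k, (0 : K'))) = fun _ => ContinuousLinearMap.inl ℝ K K' := by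
    funext k
    exact (ContinuousLinearMap.inl ℝ K K').fderiv
  rw [fderiv_fderiv_comp (g := g) (f := fun k : K => (k, (0 : K'))) hg h1, h2]
  simp

theorem fderiv_inl {g : K × K' → ℝ} {k : K} (hg : ContDiffAt ℝ ∞ g (k, 0)) (u : K) :
    fderiv ℝ (fun k => g (k, 0)) k u = fderiv ℝ g (k, 0) (u, 0) := by
  have h1 := (hg.differentiableAt (by simp)).hasFDerivAt.comp k
    (ContinuousLinearMap.inl ℝ K K').hasFDerivAt
  exact DFunLike.congr_fun h1.fderiv u

variable {g : K → M} {g' : K' → M} {k : K} {k' : K'} {p : M}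

/-- Under a change of chart the second derivative acquires a term that depends only on first
derivatives; for two maps with equal first derivatives this term cancels in the difference. -/
theorem fderiv_fderiv_chart (hg : ContMDiffAt 𝓘(ℝ, K) (𝓡 n) ∞ g k) (hp : g k = p) {a : M}
    (ha : p ∈ (chartAt (EuclideanSpace ℝ (Fin n)) a).source) (u v : K) :
    fderiv ℝ (fderiv ℝ fun v => chartAt (EuclideanSpace ℝ (Fin n)) a (g v)) k u v =
      fderiv ℝ (fderiv ℝ fun x => chartAt (EuclideanSpace ℝ (Fin n)) a
        ((chartAt (EuclideanSpace ℝ (Fin n)) p).symm x)) (chartAt (EuclideanSpace ℝ (Fin n)) p p)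
        (chartDeriv p p (mfderiv 𝓘(ℝ, K) (𝓡 n) g k u))
        (chartDeriv p p (mfderiv 𝓘(ℝ, K) (𝓡 n) g k v)) +
      fderiv ℝ (fun x => chartAt (EuclideanSpace ℝ (Fin n)) a
        ((chartAt (EuclideanSpace ℝ (Fin n)) p).symm x)) (chartAt (EuclideanSpace ℝ (Fin n)) p p)
        (fderiv ℝ (fderiv ℝ fun v => chartAt (EuclideanSpace ℝ (Fin n)) p (g v)) k u v) := by
  subst hp
  have hs := mem_chart_source (EuclideanSpace ℝ (Fin n)) (g k)
  have hc : ∀ {b : M}, g k ∈ (chartAt (EuclideanSpace ℝ (Fin n)) b).source →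
      ContDiffAt ℝ ∞ (fun v => chartAt (EuclideanSpace ℝ (Fin n)) b (g v)) k := fun hb =>
    contDiffWithinAt_univ.1 (contDiffWithinAt_chart hb hg.contMDiffWithinAt)
  have hx : chartAt (EuclideanSpace ℝ (Fin n)) (g k) (g k) ∈
      (chartAt (EuclideanSpace ℝ (Fin n)) (g k)).target := OpenPartialHomeomorph.map_source _ hs
  have hsymm : (chartAt (EuclideanSpace ℝ (Fin n)) (g k)).symm
      (chartAt (EuclideanSpace ℝ (Fin n)) (g k) (g k)) = g k :=
    OpenPartialHomeomorph.left_inv _ hs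
  have hh : ContDiffAt ℝ ∞ (fun x => chartAt (EuclideanSpace ℝ (Fin n)) a
      ((chartAt (EuclideanSpace ℝ (Fin n)) (g k)).symm x))
      (chartAt (EuclideanSpace ℝ (Fin n)) (g k) (g k)) :=
    contDiffWithinAt_univ.1 (contDiffWithinAt_chart (by rwa [hsymm])
      (contMDiffAt_chart_symm hx).contMDiffWithinAt)
  have hev : (fun v => chartAt (EuclideanSpace ℝ (Fin n)) a (g v)) =ᶠ[𝓝 k]
      fun v => chartAt (EuclideanSpace ℝ (Fin n)) a
        ((chartAt (EuclideanSpace ℝ (Fin n)) (g k)).symm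
          (chartAt (EuclideanSpace ℝ (Fin n)) (g k) (g v))) := by
    filter_upwards [hg.continuousAt.preimage_mem_nhds
      ((chartAt (EuclideanSpace ℝ (Fin n)) (g k)).open_source.mem_nhds hs)] with v hv
    rw [OpenPartialHomeomorph.left_inv _ hv]
  rw [(hev.fderiv (𝕜 := ℝ)).fderiv_eq (𝕜 := ℝ), fderiv_fderiv_comp (g := fun x =>
    chartAt (EuclideanSpace ℝ (Fin n)) a ((chartAt (EuclideanSpace ℝ (Fin n)) (g k)).symm x))
    (f := fun v => chartAt (EuclideanSpace ℝ (Fin n)) (g k) (g v)) hh (hc hs), fderiv_chart hs (hg.mdifferentiableAt (by simp)),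
    fderiv_chart hs (hg.mdifferentiableAt (by simp))]

/-- The difference of the second derivatives in directions with the same first derivatives is a
tangent vector. -/
theorem exists_secondOrder_difference (hg : ContMDiffAt 𝓘(ℝ, K) (𝓡 n) ∞ g k) (hp : g k = p)
    (hg' : ContMDiffAt 𝓘(ℝ, K') (𝓡 n) ∞ g' k') (hp' : g' k' = p) {u v : K} {u' v' : K'}
    (hu : (mfderiv 𝓘(ℝ, K) (𝓡 n) g k u : EuclideanSpace ℝ (Fin n)) =
      mfderiv 𝓘(ℝ, K') (𝓡 n) g' k' u')
    (hv : (mfderiv 𝓘(ℝ, K) (𝓡 n) g k v : EuclideanSpace ℝ (Fin n)) =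
      mfderiv 𝓘(ℝ, K') (𝓡 n) g' k' v') :
    ∃ D : EuclideanSpace ℝ (Fin n), ∀ a, p ∈ (chartAt (EuclideanSpace ℝ (Fin n)) a).source →
      fderiv ℝ (fderiv ℝ fun v => chartAt (EuclideanSpace ℝ (Fin n)) a (g v)) k u v -
        fderiv ℝ (fderiv ℝ fun v => chartAt (EuclideanSpace ℝ (Fin n)) a (g' v)) k' u' v' =
      chartDeriv a p D := by
  have hs := mem_chart_source (EuclideanSpace ℝ (Fin n)) p
  obtain ⟨D, hD⟩ := (chartDeriv_bijective (n := n) hs).2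
    (fderiv ℝ (fderiv ℝ fun v => chartAt (EuclideanSpace ℝ (Fin n)) p (g v)) k u v -
        fderiv ℝ (fderiv ℝ fun v => chartAt (EuclideanSpace ℝ (Fin n)) p (g' v)) k' u' v')
  refine ⟨D, fun a ha => ?_⟩
  have hx : chartAt (EuclideanSpace ℝ (Fin n)) p p ∈
      (chartAt (EuclideanSpace ℝ (Fin n)) p).target := OpenPartialHomeomorph.map_source _ hs
  have hsymm : (chartAt (EuclideanSpace ℝ (Fin n)) p).symm
      (chartAt (EuclideanSpace ℝ (Fin n)) p p) = p := OpenPartialHomeomorph.left_inv _ hs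
  have h1 := fderiv_chart (a := a) (f := (chartAt (EuclideanSpace ℝ (Fin n)) p).symm)
    (by rwa [hsymm]) ((contMDiffAt_chart_symm hx).mdifferentiableAt (by simp)) (chartDeriv p p D)
  rw [mfderiv_chart_symm_chartDeriv hs, hsymm] at h1
  rw [fderiv_fderiv_chart hg hp ha, fderiv_fderiv_chart hg' hp' ha, ← h1, hD, map_sub, hu, hv]
  abel

end SecondOrder

/-! ### Comparing an arbitrary family of curves with the tube. -/

section Families

variable {n : ℕ} {M : Type*} [TopologicalSpace M] [ChartedSpace (EuclideanSpace ℝ (Fin n)) M]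
  [IsManifold (𝓡 n) ∞ M]
variable {K : Type*} [NormedAddCommGroup K] [NormedSpace ℝ K]
  {F : TangentBundle (𝓡 n) M → ℝ} {c : ℝ → M} {Φ : ℝ × EuclideanSpace ℝ (Fin n) → M}
  {f : ℝ × K → M} {a : M} {α β t : ℝ} {ξ η : ℝ → EuclideanSpace ℝ (Fin n)} {u v : K}

/-- `f` is a smooth family of curves on `[α, β]` that contains `c`. -/
structure IsFamilyOn (n : ℕ) {M : Type*} [TopologicalSpace M]
    [ChartedSpace (EuclideanSpace ℝ (Fin n)) M] (α β : ℝ) (c : ℝ → M) (f : ℝ × K → M) : Prop where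
  lt : α < β
  subset : Icc α β ⊆ Icc 0 1
  base : ∀ t ∈ Icc α β, f (t, 0) = c t
  smooth : ∀ t ∈ Icc α β, MSmoothGerm n (Icc α β) f (t, 0)

/-- The square of the speed of the curves of a family. -/
def famDensity (F : TangentBundle (𝓡 n) M → ℝ) (S : Set ℝ) (f : ℝ × K → M) (q : ℝ × K) : ℝ :=
  famLagrangian F S f (q.1, (q.2, 0))

namespace IsFamilyOn

variable (hf : IsFamilyOn n α β c f) (hT : IsGeodesicTube F c Φ) (ht : t ∈ Icc α β)
  (ha : c t ∈ (chartAt (EuclideanSpace ℝ (Fin n)) a).source)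
include hf

theorem uniqueDiffOn : UniqueDiffOn ℝ (Icc α β) := uniqueDiffOn_of_lt hf.lt

include ht

theorem source_base (ha : c t ∈ (chartAt (EuclideanSpace ℝ (Fin n)) a).source) :
    f (t, 0) ∈ (chartAt (EuclideanSpace ℝ (Fin n)) a).source := by
  rwa [hf.base t ht]

theorem localFam_zero : localFam n a f (t, 0) = localCurve a c t := by
  rw [localFam, hf.base t ht]; rfl

include hT

theorem eventually_mem_source (ha : c t ∈ (chartAt (EuclideanSpace ℝ (Fin n)) a).source) :
    ∀ᶠ s in 𝓝[Icc α β] t, s ∈ Icc α β ∧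
      c s ∈ (chartAt (EuclideanSpace ℝ (Fin n)) a).source := by
  filter_upwards [self_mem_nhdsWithin, nhdsWithin_mono t hf.subset
    (hT.eventually_mem_source (hf.subset ht) ha)] with s h1 h2 using ⟨h1, h2.2⟩

include ha

theorem tDeriv_zero :
    tDeriv (Icc α β) (localFam n a f) (t, 0) = timeDeriv (localCurve a c) t := by
  rw [tDeriv, derivWithin_congr (f := localCurve (n := n) a c)
    (fun s hs => hf.localFam_zero hs) (hf.localFam_zero ht)]
  exact derivWithin_subset hf.subset (hf.uniqueDiffOn t ht)
    ((hT.contDiffWithinAt_localCurve (hf.subset ht) ha).differentiableWithinAt (by simp))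

theorem famVelocity_ne_zero : famVelocity n (Icc α β) f (t, 0) ≠ 0 := by
  intro h0
  have h1 := tDeriv_localFam hf.uniqueDiffOn
    ((hf.smooth t ht).contMDiffWithinAt ht) ht (hf.source_base ht ha)
  rw [h0, map_zero, hf.tDeriv_zero hT ht ha] at h1
  exact (hT.mem_slit (hf.subset ht) ha).2 h1

theorem smoothGerm_localFam : SmoothGerm (Icc α β) (localFam n a f) (t, 0) :=
  (hf.smooth t ht).smoothGerm ht (hf.source_base ht ha)

theorem hasDerivWithinAt_frame :
    HasDerivWithinAt (fun s => kDeriv (localFam n a f) (s, 0))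
      (kDeriv (tDeriv (Icc α β) (localFam n a f)) (t, 0)) (Icc α β) t :=
  (hf.smoothGerm_localFam hT ht ha).hasDerivWithinAt_kDeriv hf.uniqueDiffOn
    (Icc_subset_closure_interior hf.lt) ht

omit ha

theorem smoothGerm_famLagrangian :
    SmoothGerm (Icc α β) (famLagrangian F (Icc α β) f) (t, ((0 : K), (0 : K))) :=
  Finsler.smoothGerm_famLagrangian hT.finsler hf.uniqueDiffOn (hf.smooth t ht) ht
    (hf.famVelocity_ne_zero hT ht (mem_chart_source _ (c t)))

theorem smoothGerm_famDensity : SmoothGerm (Icc α β) (famDensity F (Icc α β) f) (t, 0) :=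
  SmoothGerm.comp_param (x := famLagrangian F (Icc α β) f) (φ := fun q : ℝ × K => (q.2, (0 : K)))
    (hf.smoothGerm_famLagrangian hT ht)
    (SmoothGerm.of_contDiff (contDiff_snd.prodMk contDiff_const)) ht

theorem famDensity_zero : famDensity F (Icc α β) f (t, 0) =
    F (⟨c t, velocity c t⟩ : TangentBundle (𝓡 n) M) ^ 2 := by
  have ha := mem_chart_source (EuclideanSpace ℝ (Fin n)) (c t)
  rw [famDensity, famLagrangian_eq hf.uniqueDiffOn ((hf.smooth t ht).contMDiffWithinAt ht) ht
    (hf.source_base ht ha), map_zero, add_zero, hf.localFam_zero ht, hf.tDeriv_zero hT ht ha,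
    hT.timeDeriv_localCurve (hf.subset ht) ha]
  exact (sq_eq_sqr F ha _).symm

variable (hξ : ∀ t ∈ Icc α β, famDeriv n f (t, 0) u = famDeriv n Φ (t, 0) (ξ t))
  (hη : ∀ t ∈ Icc α β, famDeriv n f (t, 0) v = famDeriv n Φ (t, 0) (η t))
include hξ

include ha in
theorem kDeriv_localFam_eq :
    kDeriv (localFam n a f) (t, 0) u = kDeriv (localFam n a Φ) (t, 0) (ξ t) := by
  rw [kDeriv_localFam ((hf.smooth t ht).contMDiffWithinAt ht) ht (hf.source_base ht ha),
    kDeriv_localFam ((hT.tube t (hf.subset ht)).smooth.contMDiffWithinAt (hf.subset ht))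
    (hf.subset ht) (hT.source_base (hf.subset ht) ha), hξ t ht, hf.base t ht,
    (hT.tube t (hf.subset ht)).base]

theorem contDiffWithinAt_coord : ContDiffWithinAt ℝ ∞ ξ (Icc α β) t := by
  have ha := mem_chart_source (EuclideanSpace ℝ (Fin n)) (c t)
  have ht' := hf.subset ht
  have hfr : ContDiffWithinAt ℝ ∞ (fun r => kDeriv (localFam n (c t) Φ) (r, 0)) (Icc α β) t :=
    (((hT.smoothGerm_localFam ht' ha).kDeriv (uniqueDiffOn_Icc one_pos)).contDiffWithinAt_time
      ht').mono hf.subset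
  have hfr' : ContDiffWithinAt ℝ ∞ (fun r => kDeriv (localFam n (c t) f) (r, 0) u) (Icc α β) t :=
    (((hf.smoothGerm_localFam hT ht ha).kDeriv hf.uniqueDiffOn).contDiffWithinAt_time
      ht).clm_apply contDiffWithinAt_const
  refine ((hfr.clm_inverse (hT.kDeriv_injective ht' ha) rfl).clm_apply
    hfr').congr_of_eventuallyEq_of_mem ?_ ht
  filter_upwards [hf.eventually_mem_source hT ht ha] with r hr
  rw [hf.kDeriv_localFam_eq hT hr.1 hr.2 hξ,
    inverse_apply_self (hT.kDeriv_injective (hf.subset hr.1) hr.2) rfl]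

include ha in
theorem kDeriv_tDeriv_localFam_eq : kDeriv (tDeriv (Icc α β) (localFam n a f)) (t, 0) u =
    kDeriv (tDeriv (Icc 0 1) (localFam n a Φ)) (t, 0) (ξ t)
      + kDeriv (localFam n a Φ) (t, 0) (derivWithin ξ (Icc α β) t) := by
  have h1 := hasDerivWithinAt_clm_apply_const (hf.hasDerivWithinAt_frame hT ht ha) u
  have h2 := HasDerivWithinAt.clm_apply
    ((hT.hasDerivWithinAt_frame (hf.subset ht) ha).mono hf.subset)
    ((hf.contDiffWithinAt_coord hT ht hξ).differentiableWithinAt (by simp)).hasDerivWithinAt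
  refine (hf.uniqueDiffOn t ht).eq_deriv _ h1 (h2.congr_of_eventuallyEq_of_mem ?_ ht)
  filter_upwards [hf.eventually_mem_source hT ht ha] with r hr
  exact hf.kDeriv_localFam_eq hT hr.1 hr.2 hξ

theorem kDeriv_famDensity : kDeriv (famDensity F (Icc α β) f) (t, 0) u =
    tubeLin F Φ t (ξ t, derivWithin ξ (Icc α β) t) := by
  have ha := mem_chart_source (EuclideanSpace ℝ (Fin n)) (c t)
  have h1 : kDeriv (famDensity F (Icc α β) f) (t, 0) u =
      kDeriv (famLagrangian F (Icc α β) f) (t, (0, 0)) (u, 0) :=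
    fderiv_inl ((hf.smoothGerm_famLagrangian hT ht).contDiffAt_param ht) u
  rw [h1, kDeriv_famLagrangian hT.finsler hf.uniqueDiffOn (hf.smooth t ht) ht
    (hf.source_base ht ha) (hf.famVelocity_ne_zero hT ht ha), hT.tubeLin_apply (hf.subset ht) ha,
    hf.localFam_zero ht, hf.tDeriv_zero hT ht ha, hf.kDeriv_localFam_eq hT ht ha hξ,
    hf.kDeriv_tDeriv_localFam_eq hT ht ha hξ, map_zero, add_zero]

include hη

-- Both second derivatives have the same D²F² part, as the variation fields agree. The rest is
-- linear: the fibre derivative and base derivative of F² on the difference of second derivatives of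
-- the two families and on the expression that is its time derivative.
include ha in
theorem kDeriv_kDeriv_famDensity : kDeriv (kDeriv (famDensity F (Icc α β) f)) (t, 0) u v =
    tubeQuad F Φ t (ξ t, derivWithin ξ (Icc α β) t) (η t, derivWithin η (Icc α β) t) +
    fderiv ℝ (Function.uncurry (sqr (localF F a)))
      (localCurve a c t, timeDeriv (localCurve a c) t)
      (kDeriv (kDeriv (localFam n a f)) (t, 0) u v
        - kDeriv (kDeriv (localFam n a Φ)) (t, 0) (ξ t) (η t),
        kDeriv (kDeriv (tDeriv (Icc α β) (localFam n a f))) (t, 0) u v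
        - (kDeriv (kDeriv (tDeriv (Icc 0 1) (localFam n a Φ))) (t, 0) (ξ t) (η t)
          + kDeriv (kDeriv (localFam n a Φ)) (t, 0) (derivWithin ξ (Icc α β) t) (η t)
          + kDeriv (kDeriv (localFam n a Φ)) (t, 0) (ξ t) (derivWithin η (Icc α β) t))) := by
  have h1 : kDeriv (kDeriv (famDensity F (Icc α β) f)) (t, 0) u v =
      kDeriv (kDeriv (famLagrangian F (Icc α β) f)) (t, (0, 0)) (u, 0) (v, 0) :=
    fderiv_fderiv_inl ((hf.smoothGerm_famLagrangian hT ht).contDiffAt_param ht) u v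
  have hsymm : ∀ v w, kDeriv (kDeriv (localFam n a Φ)) (t, 0) v w =
      kDeriv (kDeriv (localFam n a Φ)) (t, 0) w v := fun v w =>
    ((hT.smoothGerm_localFam (hf.subset ht) ha).contDiffAt_param
      (hf.subset ht)).isSymmSndFDerivAt (by simpa using two_le_infty) v w
  rw [h1, kDeriv_kDeriv_famLagrangian hT.finsler hf.uniqueDiffOn (hf.smooth t ht) ht
    (hf.source_base ht ha) (hf.famVelocity_ne_zero hT ht ha), hT.tubeQuad_apply (hf.subset ht) ha,
    hf.localFam_zero ht, hf.tDeriv_zero hT ht ha, hf.kDeriv_localFam_eq hT ht ha hξ,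
    hf.kDeriv_tDeriv_localFam_eq hT ht ha hξ, hf.kDeriv_localFam_eq hT ht ha hη,
    hf.kDeriv_tDeriv_localFam_eq hT ht ha hη, hsymm (derivWithin ξ (Icc α β) t)]
  simp only [map_zero, add_zero]
  rw [add_assoc, ← map_add]
  refine congrArg₂ (· + ·) rfl (congrArg _ ?_)
  rw [Prod.mk_add_mk]
  refine Prod.ext ?_ ?_ <;> dsimp only <;> abel

/-- The second variations along `f` and along the tube differ by the derivative of the momentum
of the difference `D` of the second derivatives. -/
theorem hasDerivWithinAt_defect {D : ℝ → EuclideanSpace ℝ (Fin n)}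
    (hD : ∀ t ∈ Icc α β, ∀ a, c t ∈ (chartAt (EuclideanSpace ℝ (Fin n)) a).source →
      kDeriv (kDeriv (localFam n a f)) (t, 0) u v
        - kDeriv (kDeriv (localFam n a Φ)) (t, 0) (ξ t) (η t) = chartDeriv a (c t) (D t)) :
    HasDerivWithinAt (fun t => 2 * fundTensor F (c t) (velocity c t) (D t) (velocity c t))
      (kDeriv (kDeriv (famDensity F (Icc α β) f)) (t, 0) u v -
        tubeQuad F Φ t (ξ t, derivWithin ξ (Icc α β) t) (η t, derivWithin η (Icc α β) t))
      (Icc α β) t := by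
  have ha := mem_chart_source (EuclideanSpace ℝ (Fin n)) (c t)
  have ht' := hf.subset ht
  have h1 := hasDerivWithinAt_clm_apply_const (hasDerivWithinAt_clm_apply_const
    ((hf.smoothGerm_localFam hT ht ha).hasDerivWithinAt_kDeriv_kDeriv hf.uniqueDiffOn
    (Icc_subset_closure_interior hf.lt) ht) u) v
  have h2 := HasDerivWithinAt.clm_apply (HasDerivWithinAt.clm_apply
    (((hT.smoothGerm_localFam ht' ha).hasDerivWithinAt_kDeriv_kDeriv (uniqueDiffOn_Icc one_pos)
    (Icc_subset_closure_interior one_pos) ht').mono hf.subset)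
    ((hf.contDiffWithinAt_coord hT ht hξ).differentiableWithinAt (by simp)).hasDerivWithinAt)
    ((hf.contDiffWithinAt_coord hT ht hη).differentiableWithinAt (by simp)).hasDerivWithinAt
  -- The Euler–Lagrange equation of the geodesic, applied to the difference of the second
  -- derivatives in the chart, turns the linear remainder into a time derivative.
  have h3 := (hT.finsler.isLocalFinsler (c t)).hasDerivWithinAt_momentum_within
    (hT.mem_slit ht' ha) (hT.geodesic_equation ht' ha) (hT.contDiffWithinAt_localCurve ht' ha) ht'
    hf.subset (h1.fun_sub h2)
  rw [hf.kDeriv_kDeriv_famDensity hT ht ha hξ hη, add_sub_cancel_left]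
  refine h3.congr_of_eventuallyEq_of_mem ?_ ht
  filter_upwards [hf.eventually_mem_source hT ht ha] with s hs
  rw [hT.finsler.fundTensor_right hs.2 (hT.regular s (hf.subset hs.1)), hD s hs.1 _ hs.2,
    hT.timeDeriv_localCurve (hf.subset hs.1) hs.2]
  rw [← mul_assoc, mul_one_div_cancel two_ne_zero, one_mul]
  rfl

end IsFamilyOn
end Families

/-! ### The second variation of the p-energy. -/

section SecondVariation

variable {n : ℕ} {M : Type*} [TopologicalSpace M] [ChartedSpace (EuclideanSpace ℝ (Fin n)) M]
  [IsManifold (𝓡 n) ∞ M]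
variable {K : Type*} [NormedAddCommGroup K] [NormedSpace ℝ K]
  {F : TangentBundle (𝓡 n) M → ℝ} {c : ℝ → M} {Φ : ℝ × EuclideanSpace ℝ (Fin n) → M}
  {f : ℝ × K → M} {a : M} {α β t : ℝ} {ξ η : ℝ → EuclideanSpace ℝ (Fin n)} {u v : K}

/-- The square of the initial speed. -/
def speedSq (F : TangentBundle (𝓡 n) M → ℝ) (c : ℝ → M) : ℝ :=
  F (⟨c 0, velocity c 0⟩ : TangentBundle (𝓡 n) M) ^ 2

/-- Geodesics have constant speed. -/
theorem IsGeodesicTube.speedSq_eq (hT : IsGeodesicTube F c Φ) (ht : t ∈ Icc (0 : ℝ) 1) :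
    F (⟨c t, velocity c t⟩ : TangentBundle (𝓡 n) M) ^ 2 = speedSq F c := by
  have key : ∀ t ∈ Icc (0 : ℝ) 1, HasDerivWithinAt
      (fun s => F (⟨c s, velocity c s⟩ : TangentBundle (𝓡 n) M) ^ 2) 0 (Icc 0 1) t := by
    intro t ht
    have ha := mem_chart_source (EuclideanSpace ℝ (Fin n)) (c t)
    have hL := hT.finsler.isLocalFinsler (c t)
    have hsl := hT.mem_slit ht ha
    have hx := hT.contDiffWithinAt_localCurve ht ha
    have hev := hT.eventually_mem_source ht ha
    set x := localCurve (n := n) (c t) c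
    set e := Function.uncurry (sqr (localF F (c t)))
    have h1 : HasDerivWithinAt (fun s => e (x s, timeDeriv x s))
        (fderiv ℝ e (x t, timeDeriv x t) (timeDeriv x t, timeDeriv (timeDeriv x) t))
        (Icc 0 1) t :=
      HasFDerivAt.comp_hasDerivWithinAt (l := e) t
        (hL.smooth_sqr.differentiableAt hL.isOpen hsl).hasFDerivAt (hasDerivWithinAt_jet hx ht)
    have h2 := hL.hasDerivWithinAt_momentum hsl (hT.geodesic_equation ht ha) hx ht
      (contDiffWithinAt_timeDeriv hx ht)
    have h3 : HasDerivWithinAt (fun s => 2 * e (x s, timeDeriv x s))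
        (fderiv ℝ e (x t, timeDeriv x t) (timeDeriv x t, timeDeriv (timeDeriv x) t))
        (Icc 0 1) t := by
      refine h2.congr_of_eventuallyEq_of_mem ?_ ht
      filter_upwards [hev] with s hs
      exact (hL.fderiv_sqr_vertical (hT.mem_slit hs.1 hs.2)).symm
    -- By Euler's relation the momentum paired with the velocity is 2F², and by the Euler–Lagrange
    -- equation its derivative equals that of F²; hence the latter is zero.
    have h4 := (uniqueDiffWithinAt_unitInterval ht).eq_deriv _ h3 (h1.const_mul 2)
    have h5 : fderiv ℝ e (x t, timeDeriv x t) (timeDeriv x t, timeDeriv (timeDeriv x) t) = 0 := by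
      linarith
    rw [h5] at h1
    refine h1.congr_of_eventuallyEq_of_mem ?_ ht
    filter_upwards [hev] with s hs
    have := sq_eq_sqr F hs.2 (velocity c s)
    rw [this, ← hT.timeDeriv_localCurve hs.1 hs.2]
    rfl
  exact constant_of_derivWithin_zero (fun s hs => (key s hs).differentiableWithinAt)
    (fun s hs => (key s ⟨hs.1, hs.2.le⟩).derivWithin
      (uniqueDiffWithinAt_unitInterval ⟨hs.1, hs.2.le⟩)) t ht

theorem IsGeodesicTube.speedSq_pos (hT : IsGeodesicTube F c Φ) : 0 < speedSq F c :=
  pow_pos (hT.finsler.pos _ _ (hT.regular 0 ⟨le_rfl, zero_le_one⟩)) 2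

/-- The quadratic Lagrangian of the second variation of the `p`-energy. -/
def hessQuad (F : TangentBundle (𝓡 n) M → ℝ) (c : ℝ → M)
    (Φ : ℝ × EuclideanSpace ℝ (Fin n) → M) (p t : ℝ) :
    (EuclideanSpace ℝ (Fin n) × EuclideanSpace ℝ (Fin n)) →L[ℝ]
      (EuclideanSpace ℝ (Fin n) × EuclideanSpace ℝ (Fin n)) →L[ℝ] ℝ :=
  (p / 2 * speedSq F c ^ (p / 2 - 1)) • tubeQuad F Φ t +
    (p / 2 * (p / 2 - 1) * speedSq F c ^ (p / 2 - 2)) •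
      (tubeLin F Φ t).smulRight (tubeLin F Φ t)

theorem hessQuad_apply (p t : ℝ) (x y : EuclideanSpace ℝ (Fin n) × EuclideanSpace ℝ (Fin n)) :
    hessQuad F c Φ p t x y = p / 2 * speedSq F c ^ (p / 2 - 1) * tubeQuad F Φ t x y +
      p / 2 * (p / 2 - 1) * speedSq F c ^ (p / 2 - 2) * (tubeLin F Φ t x * tubeLin F Φ t y) := by
  simp [hessQuad]

theorem continuousOn_clm_add {E G : Type*} [NormedAddCommGroup E] [NormedSpace ℝ E]
    [NormedAddCommGroup G] [NormedSpace ℝ G] {Q R : ℝ → E →L[ℝ] G} {S : Set ℝ}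
    (hQ : ContinuousOn Q S) (hR : ContinuousOn R S) : ContinuousOn (fun t => Q t + R t) S :=
  hQ.add hR

theorem continuousOn_smul_add_smulRight {E : Type*} [NormedAddCommGroup E] [NormedSpace ℝ E]
    {Q : ℝ → E →L[ℝ] E →L[ℝ] ℝ} {l : ℝ → E →L[ℝ] ℝ} {S : Set ℝ} (hQ : ContinuousOn Q S)
    (hl : ContinuousOn l S) (A B : ℝ) :
    ContinuousOn (fun t => A • Q t + B • (l t).smulRight (l t)) S := by
  have h1 : ContinuousOn (fun t => (l t).smulRight (l t)) S :=
    (ContinuousLinearMap.smulRightL ℝ E (E →L[ℝ] ℝ)).continuous₂.comp_continuousOn (hl.prodMk hl)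
  have h2 : ContinuousOn (fun t => A • Q t) S := hQ.const_smul A
  have h3 : ContinuousOn (fun t => B • (l t).smulRight (l t)) S := h1.const_smul B
  exact continuousOn_clm_add h2 h3

theorem IsGeodesicTube.continuousOn_hessQuad (hT : IsGeodesicTube F c Φ) (p : ℝ) :
    ContinuousOn (hessQuad F c Φ p) (Icc 0 1) := by
  exact continuousOn_smul_add_smulRight
    (fun t ht => (hT.contDiffWithinAt_tubeQuad ht).continuousWithinAt)
    (fun t ht => (hT.contDiffWithinAt_tubeLin ht).continuousWithinAt) _ _

theorem IsGeodesicTube.intervalIntegrable_hessQuad (hT : IsGeodesicTube F c Φ) (p : ℝ)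
    (hξ : IsPiecewiseDiff ξ) (hη : IsPiecewiseDiff η) (hαβ : α ≤ β) (hα : 0 ≤ α) (hβ : β ≤ 1) :
    IntervalIntegrable (quadIntegrand (hessQuad F c Φ p) ξ η) volume α β := by
  have := hξ.integrable_bilin hη 1 1 (hT.continuousOn_hessQuad p) hαβ hα hβ
  simp only [one_smul] at this
  exact this

namespace IsFamilyOn

variable (hf : IsFamilyOn n α β c f) (hT : IsGeodesicTube F c Φ)
include hf hT

theorem smoothGerm_famDensity_rpow (ht : t ∈ Icc α β) (q : ℝ) :
    SmoothGerm (Icc α β) (fun r => famDensity F (Icc α β) f r ^ q) (t, 0) := by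
  refine SmoothGerm.comp (g := fun x : ℝ => x ^ q) (hf.smoothGerm_famDensity hT ht) ht
    (U := {x | x ≠ 0}) isOpen_ne
    (fun x hx => (Real.contDiffAt_rpow_const_of_ne hx).contDiffWithinAt) ?_
  change famDensity F (Icc α β) f (t, 0) ≠ 0
  rw [hf.famDensity_zero hT ht, hT.speedSq_eq (hf.subset ht)]
  exact hT.speedSq_pos.ne'

/-- A nonzero velocity is an open condition, made uniform in time by compactness; so nearby curves
of the family are again regular. -/
theorem eventually_regular : ∀ᶠ k in 𝓝 (0 : K), ∀ t ∈ Icc α β,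
    MSmoothGerm n (Icc α β) f (t, k) ∧ famVelocity n (Icc α β) f (t, k) ≠ 0 := by
  refine eventually_forall_of_nhdsWithin isCompact_Icc (P := fun q =>
    MSmoothGerm n (Icc α β) f q ∧ famVelocity n (Icc α β) f q ≠ 0) fun t ht => ?_
  have ha := mem_chart_source (EuclideanSpace ℝ (Fin n)) (c t)
  have h1 := (((hf.smoothGerm_localFam hT ht ha).tDeriv hf.uniqueDiffOn).contDiffWithinAt
    ht).continuousWithinAt
  have h0 : tDeriv (Icc α β) (localFam n (c t) f) (t, 0) ≠ 0 := by
    rw [hf.tDeriv_zero hT ht ha]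
    exact (hT.mem_slit (hf.subset ht) ha).2
  filter_upwards [eventually_eventually_nhdsWithin.2 (hf.smooth t ht), self_mem_nhdsWithin,
    h1.eventually (isOpen_ne.mem_nhds h0),
    (hf.smooth t ht).eventually_mem_source ht (hf.source_base ht ha)] with q hq1 hq2 hq3 hq4
  refine ⟨hq1, fun hv => hq3 ?_⟩
  rw [tDeriv_localFam (t := q.1) (k := q.2) hf.uniqueDiffOn
    (MSmoothGerm.contMDiffWithinAt (t := q.1) (k := q.2) hq1 hq2.1) hq2.1 hq4]
  erw [hv]
  exact map_zero _

variable (hξ : ∀ t ∈ Icc α β, famDeriv n f (t, 0) u = famDeriv n Φ (t, 0) (ξ t))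
  (hη : ∀ t ∈ Icc α β, famDeriv n f (t, 0) v = famDeriv n Φ (t, 0) (η t))
include hξ hη

/-- On a single piece the integrand for the family and that for the tube differ by a constant times
the time derivative of 2g(D,ċ). The factor can be taken out because the speed is constant. -/
theorem integral_kDeriv_kDeriv (p : ℝ) (hξp : IsPiecewiseDiff ξ) (hηp : IsPiecewiseDiff η)
    {D : ℝ → EuclideanSpace ℝ (Fin n)}
    (hD : ∀ t ∈ Icc α β, ∀ a, c t ∈ (chartAt (EuclideanSpace ℝ (Fin n)) a).source →
      kDeriv (kDeriv (localFam n a f)) (t, 0) u v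
        - kDeriv (kDeriv (localFam n a Φ)) (t, 0) (ξ t) (η t) = chartDeriv a (c t) (D t)) :
    ∫ t in α..β, kDeriv (kDeriv fun r => famDensity F (Icc α β) f r ^ (p / 2)) (t, 0) u v =
      (∫ t in α..β, quadIntegrand (hessQuad F c Φ p) ξ η t) +
      p / 2 * speedSq F c ^ (p / 2 - 1) *
        (2 * fundTensor F (c β) (velocity c β) (D β) (velocity c β) -
          2 * fundTensor F (c α) (velocity c α) (D α) (velocity c α)) := by
  have hI := hT.intervalIntegrable_hessQuad p hξp hηp hf.lt.le
    (hf.subset (left_mem_Icc.2 hf.lt.le)).1 (hf.subset (right_mem_Icc.2 hf.lt.le)).2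
  have hJ : IntervalIntegrable (fun t => kDeriv (kDeriv fun r =>
      famDensity F (Icc α β) f r ^ (p / 2)) (t, 0) u v) volume α β := by
    refine ContinuousOn.intervalIntegrable ?_
    rw [uIcc_of_le hf.lt.le]
    intro t ht
    exact ((((((hf.smoothGerm_famDensity_rpow hT ht (p / 2)).kDeriv hf.uniqueDiffOn).kDeriv
      hf.uniqueDiffOn).contDiffWithinAt_time ht).clm_apply
      contDiffWithinAt_const).clm_apply contDiffWithinAt_const).continuousWithinAt
  rw [← sub_eq_iff_eq_add', ← intervalIntegral.integral_sub hJ hI, mul_sub]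
  refine intervalIntegral.integral_eq_sub_of_hasDerivAt_of_le hf.lt.le
    (f := fun t => p / 2 * speedSq F c ^ (p / 2 - 1) *
      (2 * fundTensor F (c t) (velocity c t) (D t) (velocity c t)))
    (fun t ht => ((hf.hasDerivWithinAt_defect hT ht hξ hη hD).const_mul _).continuousWithinAt)
    (fun t ht => ?_) (hJ.sub hI)
  have ht' := Ioo_subset_Icc_self ht
  have hn := Icc_mem_nhds ht.1 ht.2
  refine (((hf.hasDerivWithinAt_defect hT ht' hξ hη hD).const_mul _).hasDerivAt hn).congr_deriv ?_
  have h0 : famDensity F (Icc α β) f (t, 0) = speedSq F c := by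
    rw [hf.famDensity_zero hT ht', hT.speedSq_eq (hf.subset ht')]
  have h1 : kDeriv (kDeriv fun r => famDensity F (Icc α β) f r ^ (p / 2)) (t, 0) u v = _ :=
    fderiv_fderiv_rpow (p / 2) ((hf.smoothGerm_famDensity hT ht').contDiffAt_param ht')
      (by rw [h0]; exact hT.speedSq_pos.ne') u v
  have h2 := hf.kDeriv_famDensity hT ht' hξ
  have h3 := hf.kDeriv_famDensity hT ht' hη
  rw [derivWithin_of_mem_nhds hn] at h2 h3
  rw [h1, h0, quadIntegrand, hessQuad_apply, derivWithin_of_mem_nhds hn,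
    derivWithin_of_mem_nhds hn, ← h2, ← h3]
  simp only [kDeriv]
  ring

end IsFamilyOn

/-- `f` is a family with fixed end points that is smooth on the pieces of a partition. -/
structure IsPiecewiseFamily (n : ℕ) {M : Type*} [TopologicalSpace M]
    [ChartedSpace (EuclideanSpace ℝ (Fin n)) M] (k : ℕ) (τ : ℕ → ℝ) (c : ℝ → M)
    (f : ℝ × K → M) : Prop where
  partition : IsPartition k τ
  family : ∀ i < k, IsFamilyOn n (τ i) (τ (i + 1)) c f
  fixed_zero : ∀ᶠ v in 𝓝 (0 : K), f (0, v) = c 0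
  fixed_one : ∀ᶠ v in 𝓝 (0 : K), f (1, v) = c 1

namespace IsPiecewiseFamily

variable {k : ℕ} {τ : ℕ → ℝ} (hf : IsPiecewiseFamily n k τ c f) (hT : IsGeodesicTube F c Φ)
include hf hT

/-- `energy` uses velocities within [0,1] and `famDensity` those within a piece. They agree inside
the pieces, and the finitely many break points have measure zero. Regularity is needed for g(ċ,ċ) =
F². -/
theorem eventually_energy_eq (p : ℝ) : ∀ᶠ v in 𝓝 (0 : K), energy (n := n) F p (fun t => f (t, v)) =
    ∑ i ∈ Finset.range k, ∫ t in τ i..τ (i + 1),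
      famDensity F (Icc (τ i) (τ (i + 1))) f (t, v) ^ (p / 2) := by
  have h1 : ∀ᶠ v in 𝓝 (0 : K), ∀ i ∈ Finset.range k, ∀ t ∈ Icc (τ i) (τ (i + 1)),
      MSmoothGerm n (Icc (τ i) (τ (i + 1))) f (t, v) ∧
      famVelocity n (Icc (τ i) (τ (i + 1))) f (t, v) ≠ 0 ∧ ContinuousWithinAt
        (fun t => famDensity F (Icc (τ i) (τ (i + 1))) f (t, v) ^ (p / 2))
        (Icc (τ i) (τ (i + 1))) t := by
    refine (Finset.eventually_all _).2 fun i hi => ?_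
    have hfi := hf.family i (Finset.mem_range.1 hi)
    have h2 := eventually_forall_of_nhdsWithin (isCompact_Icc (a := τ i) (b := τ (i + 1)))
      (k₀ := (0 : K)) (fun t ht => (hfi.smoothGerm_famDensity_rpow hT ht (p / 2)).eventually)
    filter_upwards [hfi.eventually_regular hT, h2] with v hv hv2 t ht
    exact ⟨(hv t ht).1, (hv t ht).2, ((hv2 t ht).contDiffWithinAt_time ht).continuousWithinAt⟩
  filter_upwards [h1] with v hv
  have h3 : ∀ i < k, EqOn (fun t => famDensity F (Icc (τ i) (τ (i + 1))) f (t, v) ^ (p / 2))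
      (fun t => fundTensor F (f (t, v)) (velocity (fun t => f (t, v)) t)
        (velocity (fun t => f (t, v)) t) (velocity (fun t => f (t, v)) t) ^ (p / 2))
      (Ioo (τ i) (τ (i + 1))) := by
    intro i hi t ht
    obtain ⟨-, h4, -⟩ := hv i (Finset.mem_range.2 hi) t (Ioo_subset_Icc_self ht)
    have h5 : famVelocity n (Icc (τ i) (τ (i + 1))) f (t, v) =
        velocity (n := n) (fun t => f (t, v)) t := by
      have ht1 : t ∈ Ioo (0 : ℝ) 1 :=
        ⟨lt_of_le_of_lt (hf.partition.mem_Icc hi.le).1 ht.1,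
          lt_of_lt_of_le ht.2 (hf.partition.mem_Icc (Nat.succ_le_of_lt hi)).2⟩
      have h6 := mfderivWithin_of_mem_nhds (I := 𝓘(ℝ, ℝ)) (I' := 𝓡 n) (f := fun t => f (t, v))
        (Icc_mem_nhds ht.1 ht.2)
      have h7 := mfderivWithin_of_mem_nhds (I := 𝓘(ℝ, ℝ)) (I' := 𝓡 n) (f := fun t => f (t, v))
        (Icc_mem_nhds ht1.1 ht1.2)
      exact DFunLike.congr_fun (h6.trans h7.symm) (1 : ℝ)
    have h8 := hT.finsler.fundTensor_self (p := f (t, v)) (h5 ▸ h4)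
    simp only
    rw [h8, famDensity, famLagrangian, map_zero, add_zero, h5]
  have h9 : ∀ i < k, IntervalIntegrable (fun t => famDensity F (Icc (τ i) (τ (i + 1))) f (t, v)
      ^ (p / 2)) volume (τ i) (τ (i + 1)) := fun i hi => by
    refine ContinuousOn.intervalIntegrable ?_
    rw [uIcc_of_le (hf.partition.lt i hi).le]
    exact fun t ht => (hv i (Finset.mem_range.2 hi) t ht).2.2
  rw [energy, ← hf.partition.sum_integral fun i hi => (h9 i hi).congr_uIoo (by
    rw [uIoo_of_le (hf.partition.lt i hi).le]; exact h3 i hi)]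
  exact Finset.sum_congr rfl fun i hi => (intervalIntegral.integral_congr_Ioo_of_le
    (hf.partition.lt i (Finset.mem_range.1 hi)).le (h3 i (Finset.mem_range.1 hi))).symm

omit hT in
theorem base (t : ℝ) (ht : t ∈ Icc (0 : ℝ) 1) : f (t, 0) = c t := by
  obtain ⟨i, hi, hti⟩ := hf.partition.exists_mem ht
  exact (hf.family i hi).base t hti

variable (hξ : ∀ t ∈ Icc (0 : ℝ) 1, famDeriv n f (t, 0) u = famDeriv n Φ (t, 0) (ξ t))
  (hη : ∀ t ∈ Icc (0 : ℝ) 1, famDeriv n f (t, 0) v = famDeriv n Φ (t, 0) (η t))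
include hξ hη

/-- `D` is chosen pointwise and depends only on the time slices of the families, not on the piece.
The same value therefore serves on both sides of a break point, and the boundary terms telescope. -/
theorem exists_defect : ∃ D : ℝ → EuclideanSpace ℝ (Fin n), ∀ t ∈ Icc (0 : ℝ) 1,
    ∀ a, c t ∈ (chartAt (EuclideanSpace ℝ (Fin n)) a).source →
      kDeriv (kDeriv (localFam n a f)) (t, 0) u v
        - kDeriv (kDeriv (localFam n a Φ)) (t, 0) (ξ t) (η t) = chartDeriv a (c t) (D t) := by
  have h1 : ∀ t ∈ Icc (0 : ℝ) 1, ∃ D : EuclideanSpace ℝ (Fin n),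
      ∀ a, c t ∈ (chartAt (EuclideanSpace ℝ (Fin n)) a).source →
      kDeriv (kDeriv (localFam n a f)) (t, 0) u v
        - kDeriv (kDeriv (localFam n a Φ)) (t, 0) (ξ t) (η t) = chartDeriv a (c t) D := by
    intro t ht
    obtain ⟨i, hi, hti⟩ := hf.partition.exists_mem ht
    exact exists_secondOrder_difference (g := fun v => f (t, v)) (g' := fun v => Φ (t, v))
      (contMDiffAt_slice (((hf.family i hi).smooth t hti).contMDiffWithinAt hti) hti)
      (hf.base t ht) (contMDiffAt_slice ((hT.tube t ht).smooth.contMDiffWithinAt ht) ht)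
      (hT.tube t ht).base (hξ t ht) (hη t ht)
  choose! D hD using h1
  exact ⟨D, hD⟩

omit hT hf hξ hη in
-- At a fixed end point the family is constant in the parameter, and the second derivative of the
-- tube is evaluated on a zero vector.
theorem defect_eq_zero {D : EuclideanSpace ℝ (Fin n)} (h : ∀ᶠ v in 𝓝 (0 : K), f (t, v) = c t)
    (h0 : ξ t = 0)
    (hD : ∀ a, c t ∈ (chartAt (EuclideanSpace ℝ (Fin n)) a).source →
      kDeriv (kDeriv (localFam n a f)) (t, 0) u v
        - kDeriv (kDeriv (localFam n a Φ)) (t, 0) (ξ t) (η t) = chartDeriv a (c t) D) :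
    D = 0 := by
  have ha := mem_chart_source (EuclideanSpace ℝ (Fin n)) (c t)
  have h1 : (fun v => localFam n (c t) f (t, v)) =ᶠ[𝓝 0] fun _ => localCurve (c t) c t := by
    filter_upwards [h] with v hv
    rw [localFam, hv]; rfl
  have h2 : kDeriv (kDeriv (localFam n (c t) f)) (t, 0) = 0 := by
    have := (h1.fderiv (𝕜 := ℝ)).fderiv_eq (𝕜 := ℝ)
    refine this.trans ?_
    simp
  have h3 := hD (c t) ha
  rw [h2, h0, map_zero, zero_apply, zero_apply, zero_apply, sub_zero] at h3
  exact (chartDeriv_eq_zero ha).1 h3.symm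

/-- The second variation formula. -/
theorem exists_hasFDerivAt_energy (p : ℝ) (hξp : IsPiecewiseDiff ξ) (hηp : IsPiecewiseDiff η)
    (h0 : ξ 0 = 0) (h1 : ξ 1 = 0) : ∃ (G : K → K →L[ℝ] ℝ) (G' : K →L[ℝ] K →L[ℝ] ℝ),
    (∀ᶠ v in 𝓝 (0 : K), HasFDerivAt (fun v => energy (n := n) F p (fun t => f (t, v))) (G v) v) ∧
    HasFDerivAt G G' 0 ∧
    G' u v = ∫ t in (0 : ℝ)..1, quadIntegrand (hessQuad F c Φ p) ξ η t := by
  obtain ⟨D, hD⟩ := hf.exists_defect hT hξ hη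
  have hg : ∀ i ∈ Finset.range k, ∀ t ∈ Icc (τ i) (τ (i + 1)), SmoothGerm (Icc (τ i) (τ (i + 1)))
      (fun r => famDensity F (Icc (τ i) (τ (i + 1))) f r ^ (p / 2)) (t, 0) := fun i hi t ht =>
    (hf.family i (Finset.mem_range.1 hi)).smoothGerm_famDensity_rpow hT ht (p / 2)
  have hlt : ∀ i ∈ Finset.range k, τ i < τ (i + 1) := fun i hi =>
    hf.partition.lt i (Finset.mem_range.1 hi)
  refine ⟨fun v => ∑ i ∈ Finset.range k, ∫ t in τ i..τ (i + 1),
      kDeriv (fun r => famDensity F (Icc (τ i) (τ (i + 1))) f r ^ (p / 2)) (t, v),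
    ∑ i ∈ Finset.range k, ∫ t in τ i..τ (i + 1),
      kDeriv (kDeriv fun r => famDensity F (Icc (τ i) (τ (i + 1))) f r ^ (p / 2)) (t, 0),
    ?_, ?_, ?_⟩
  · have h2 := (Finset.eventually_all (Finset.range k)).2 fun i hi =>
      SmoothGerm.eventually_hasFDerivAt_integral (hlt i hi) (hg i hi)
    filter_upwards [h2, eventually_eventually_nhds.2 (hf.eventually_energy_eq hT p)] with v hv hv2
    exact (HasFDerivAt.fun_sum hv).congr_of_eventuallyEq hv2
  · exact HasFDerivAt.fun_sum fun i hi =>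
      SmoothGerm.hasFDerivAt_integral_kDeriv (hlt i hi) (hg i hi)
  · have hz : (0 : ℝ) ∈ Icc (0 : ℝ) 1 := ⟨le_rfl, zero_le_one⟩
    have ho : (1 : ℝ) ∈ Icc (0 : ℝ) 1 := ⟨zero_le_one, le_rfl⟩
    have hθ : ∀ t, D t = 0 → fundTensor F (c t) (velocity c t) (D t) (velocity c t) = 0 :=
      fun t ht => by rw [ht]; exact (by simp [fundTensor] : fundTensor F (c t) (velocity c t)
        (0 : EuclideanSpace ℝ (Fin n)) (velocity c t) = 0)
    have hI : ∀ i < k, IntervalIntegrable (quadIntegrand (hessQuad F c Φ p) ξ η) volume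
        (τ i) (τ (i + 1)) := fun i hi =>
      hT.intervalIntegrable_hessQuad p hξp hηp (hf.partition.lt i hi).le
        (hf.partition.mem_Icc hi.le).1 (hf.partition.mem_Icc (Nat.succ_le_of_lt hi)).2
    rw [← hf.partition.sum_integral hI]
    simp only [sum_apply]
    have h3 : ∀ i ∈ Finset.range k, _ := fun i hi =>
      (SmoothGerm.integral_kDeriv_kDeriv_apply (hlt i hi) (hg i hi) u v).trans
      ((hf.family i (Finset.mem_range.1 hi)).integral_kDeriv_kDeriv hT
        (fun t ht => hξ t (hf.partition.subset (Finset.mem_range.1 hi) ht))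
        (fun t ht => hη t (hf.partition.subset (Finset.mem_range.1 hi) ht)) p hξp hηp
        fun t ht => hD t (hf.partition.subset (Finset.mem_range.1 hi) ht))
    -- The boundary terms at interior break points telescope; those at 0 and 1 vanish.
    rw [Finset.sum_congr rfl h3, Finset.sum_add_distrib, ← Finset.mul_sum,
      Finset.sum_range_sub fun i =>
        2 * fundTensor F (c (τ i)) (velocity c (τ i)) (D (τ i)) (velocity c (τ i)),
      hf.partition.zero, hf.partition.last,
      hθ 0 (defect_eq_zero hf.fixed_zero h0 (hD 0 hz)),
      hθ 1 (defect_eq_zero hf.fixed_one h1 (hD 1 ho))]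
    simp

end IsPiecewiseFamily
end SecondVariation

/-! ### Two-parameter variations and the Hessian. -/

section Variations

variable {n : ℕ} {M : Type*} [TopologicalSpace M] [ChartedSpace (EuclideanSpace ℝ (Fin n)) M]
  [IsManifold (𝓡 n) ∞ M]
  {F : TangentBundle (𝓡 n) M → ℝ} {c : ℝ → M} {Φ : ℝ × EuclideanSpace ℝ (Fin n) → M}
  {a : M} {α β t : ℝ} {ξ η : ℝ → EuclideanSpace ℝ (Fin n)}

theorem tangentBundle_mk_eq {p q : M} (h : p = q) {u v : EuclideanSpace ℝ (Fin n)} (huv : u = v) :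
    (⟨p, u⟩ : TangentBundle (𝓡 n) M) = ⟨q, v⟩ := by
  subst h; subst huv; rfl

theorem snd_eq_of_tangentBundle_mk_eq {p q : M} {u v : EuclideanSpace ℝ (Fin n)}
    (h : (⟨p, u⟩ : TangentBundle (𝓡 n) M) = ⟨q, v⟩) : u = v :=
  congrArg (fun z : TangentBundle (𝓡 n) M => (show EuclideanSpace ℝ (Fin n) from z.snd)) h

/-- The family of curves of a two-parameter variation. -/
def variationFamily (V : ℝ → ℝ → ℝ → M) (q : ℝ × (ℝ × ℝ)) : M := V q.2.1 q.2.2 q.1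

theorem famDeriv_fst {f : ℝ × (ℝ × ℝ) → M} (hf : MDifferentiableAt 𝓘(ℝ, ℝ × ℝ) (𝓡 n)
    (fun v => f (t, v)) 0) : famDeriv n f (t, 0) (1, 0) =
      mfderiv 𝓘(ℝ, ℝ) (𝓡 n) (fun s => f (t, (s, 0))) 0 (1 : ℝ) := by
  have h1 : HasFDerivAt (fun s : ℝ => (s, (0 : ℝ))) (ContinuousLinearMap.inl ℝ ℝ ℝ) 0 :=
    (ContinuousLinearMap.inl ℝ ℝ ℝ).hasFDerivAt
  have h2 := mfderiv_comp_of_eq (I := 𝓘(ℝ, ℝ)) (I' := 𝓘(ℝ, ℝ × ℝ)) (I'' := 𝓡 n)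
    (g := fun v => f (t, v)) (f := fun s : ℝ => (s, (0 : ℝ))) (x := 0) hf
    h1.differentiableAt.mdifferentiableAt rfl
  have h3 := DFunLike.congr_fun h2 (1 : ℝ)
  refine Eq.trans ?_ h3.symm
  rw [mfderiv_eq_fderiv, h1.fderiv]
  rfl

theorem famDeriv_snd {f : ℝ × (ℝ × ℝ) → M} (hf : MDifferentiableAt 𝓘(ℝ, ℝ × ℝ) (𝓡 n)
    (fun v => f (t, v)) 0) : famDeriv n f (t, 0) (0, 1) =
      mfderiv 𝓘(ℝ, ℝ) (𝓡 n) (fun s => f (t, (0, s))) 0 (1 : ℝ) := by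
  have h1 : HasFDerivAt (fun s : ℝ => ((0 : ℝ), s)) (ContinuousLinearMap.inr ℝ ℝ ℝ) 0 :=
    (ContinuousLinearMap.inr ℝ ℝ ℝ).hasFDerivAt
  have h2 := mfderiv_comp_of_eq (I := 𝓘(ℝ, ℝ)) (I' := 𝓘(ℝ, ℝ × ℝ)) (I'' := 𝓡 n)
    (g := fun v => f (t, v)) (f := fun s : ℝ => ((0 : ℝ), s)) (x := 0) hf
    h1.differentiableAt.mdifferentiableAt rfl
  have h3 := DFunLike.congr_fun h2 (1 : ℝ)
  refine Eq.trans ?_ h3.symm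
  rw [mfderiv_eq_fderiv, h1.fderiv]
  rfl

theorem IsPiecewiseFamily.mdifferentiableAt {K : Type*} [NormedAddCommGroup K] [NormedSpace ℝ K]
    {f : ℝ × K → M} {k : ℕ} {τ : ℕ → ℝ} (hf : IsPiecewiseFamily n k τ c f)
    (ht : t ∈ Icc (0 : ℝ) 1) : MDifferentiableAt 𝓘(ℝ, K) (𝓡 n) (fun v => f (t, v)) 0 := by
  obtain ⟨i, hi, hti⟩ := hf.partition.exists_mem ht
  exact (contMDiffAt_slice (((hf.family i hi).smooth t hti).contMDiffWithinAt hti)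
    hti).mdifferentiableAt (by simp)

theorem box_mem_nhds {ε : ℝ} (hε : 0 < ε) :
    Ioo (-ε) ε ×ˢ Ioo (-ε) ε ∈ 𝓝 (0 : ℝ × ℝ) :=
  prod_mem_nhds (Ioo_mem_nhds (neg_lt_zero.2 hε) hε) (Ioo_mem_nhds (neg_lt_zero.2 hε) hε)

theorem IsVariation.exists_isPiecewiseFamily {X Y : (t : ℝ) → TangentSpace (𝓡 n) (c t)} {ε : ℝ}
    {V : ℝ → ℝ → ℝ → M} (hV : IsVariation c X Y ε V) :
    ∃ k τ, IsPiecewiseFamily n k τ c (variationFamily V) := by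
  obtain ⟨k, τ, hτ, hsm⟩ := hV.smooth
  have hend : ∀ᶠ v in 𝓝 (0 : ℝ × ℝ), V v.1 v.2 ∈ pathSpace n (c 0) (c 1) := by
    filter_upwards [box_mem_nhds hV.eps_pos] with v hv using hV.mem _ hv.1 _ hv.2
  refine ⟨k, τ, hτ, fun i hi => ⟨hτ.lt i hi, hτ.subset hi,
    fun t ht => hV.base t (hτ.subset hi ht), fun t ht => ?_⟩, ?_, ?_⟩
  · set B : Set (ℝ × (ℝ × ℝ)) := Icc (τ i) (τ (i + 1)) ×ˢ (Ioo (-ε) ε ×ˢ Ioo (-ε) ε)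
    have hB : ∀ p ∈ B, ContMDiffWithinAt 𝓘(ℝ, ℝ × (ℝ × ℝ)) (𝓡 n) ∞ (variationFamily V)
        (Icc (τ i) (τ (i + 1)) ×ˢ univ) p := by
      intro p hp
      have h1 : ContMDiffWithinAt 𝓘(ℝ, ℝ × (ℝ × ℝ)) (𝓡 n) ∞ (variationFamily V) B p := by
        refine ContMDiffWithinAt.comp (I' := 𝓘(ℝ, ℝ × ℝ × ℝ))
          (g := fun q : ℝ × ℝ × ℝ => V q.1 q.2.1 q.2.2)
          (f := fun p : ℝ × (ℝ × ℝ) => (p.2.1, p.2.2, p.1))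
          (t := Ioo (-ε) ε ×ˢ Ioo (-ε) ε ×ˢ Icc (τ i) (τ (i + 1))) p
          (hsm i hi _ ⟨hp.2.1, hp.2.2, hp.1⟩) ?_ fun q hq => ⟨hq.2.1, hq.2.2, hq.1⟩
        have h2 : ContDiff ℝ ∞ (fun p : ℝ × (ℝ × ℝ) => (p.2.1, p.2.2, p.1)) := by fun_prop
        exact h2.contMDiff.contMDiffAt.contMDiffWithinAt
      refine h1.mono_of_mem_nhdsWithin ?_
      refine mem_nhdsWithin.2 ⟨univ ×ˢ (Ioo (-ε) ε ×ˢ Ioo (-ε) ε),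
        isOpen_univ.prod (isOpen_Ioo.prod isOpen_Ioo), ⟨mem_univ _, hp.2⟩, ?_⟩
      rintro q ⟨hq1, hq2⟩
      exact ⟨hq2.1, hq1.2⟩
    have hmem : B ∈ 𝓝[Icc (τ i) (τ (i + 1)) ×ˢ univ] (t, (0 : ℝ × ℝ)) := by
      refine mem_nhdsWithin.2 ⟨univ ×ˢ (Ioo (-ε) ε ×ˢ Ioo (-ε) ε),
        isOpen_univ.prod (isOpen_Ioo.prod isOpen_Ioo),
        ⟨mem_univ _, mem_of_mem_nhds (box_mem_nhds hV.eps_pos)⟩, ?_⟩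
      rintro q ⟨hq1, hq2⟩
      exact ⟨hq2.1, hq1.2⟩
    exact mem_of_superset hmem hB
  · filter_upwards [hend] with v hv using hv.1
  · filter_upwards [hend] with v hv using hv.2.1

theorem IsVariation.famDeriv_fst {X Y : (t : ℝ) → TangentSpace (𝓡 n) (c t)} {ε : ℝ}
    {V : ℝ → ℝ → ℝ → M} (hV : IsVariation c X Y ε V) (ht : t ∈ Icc (0 : ℝ) 1) :
    famDeriv n (variationFamily V) (t, 0) (1, 0) = X t := by
  obtain ⟨k, τ, hf⟩ := hV.exists_isPiecewiseFamily
  rw [Finsler.famDeriv_fst (hf.mdifferentiableAt ht)]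
  exact snd_eq_of_tangentBundle_mk_eq (hV.field_fst t ht)

theorem IsVariation.famDeriv_snd {X Y : (t : ℝ) → TangentSpace (𝓡 n) (c t)} {ε : ℝ}
    {V : ℝ → ℝ → ℝ → M} (hV : IsVariation c X Y ε V) (ht : t ∈ Icc (0 : ℝ) 1) :
    famDeriv n (variationFamily V) (t, 0) (0, 1) = Y t := by
  obtain ⟨k, τ, hf⟩ := hV.exists_isPiecewiseFamily
  rw [Finsler.famDeriv_snd (hf.mdifferentiableAt ht)]
  exact snd_eq_of_tangentBundle_mk_eq (hV.field_snd t ht)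

/-- The variation of `c` in a tube with prescribed coordinates. -/
def tubeVariation (Φ : ℝ × EuclideanSpace ℝ (Fin n) → M) (ξ η : ℝ → EuclideanSpace ℝ (Fin n))
    (q : ℝ × (ℝ × ℝ)) : M := Φ (q.1, q.2.1 • ξ q.1 + q.2.2 • η q.1)

/-- The Hessian of the `p`-energy in the coordinates of a tube. -/
def tubeHessian (F : TangentBundle (𝓡 n) M → ℝ) (c : ℝ → M)
    (Φ : ℝ × EuclideanSpace ℝ (Fin n) → M) (p : ℝ) (X Y : (t : ℝ) → TangentSpace (𝓡 n) (c t)) : ℝ :=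
  ∫ t in (0 : ℝ)..1, quadIntegrand (hessQuad F c Φ p) (tubeCoord n Φ X) (tubeCoord n Φ Y) t

/-- A derivative of E near 0 that is itself differentiable at 0 provides the iterated partial
derivatives in the order required by `IsHessian`. -/
theorem second_partial_of_hasFDerivAt {E : ℝ × ℝ → ℝ} {G : ℝ × ℝ → ℝ × ℝ →L[ℝ] ℝ}
    {G' : ℝ × ℝ →L[ℝ] ℝ × ℝ →L[ℝ] ℝ} (hG : ∀ᶠ v in 𝓝 0, HasFDerivAt E (G v) v)
    (hG' : HasFDerivAt G G' 0) :
    (∀ᶠ s₁ in 𝓝 (0 : ℝ), DifferentiableAt ℝ (fun s₂ => E (s₁, s₂)) 0) ∧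
      HasDerivAt (fun s₁ => deriv (fun s₂ => E (s₁, s₂)) 0) (G' (1, 0) (0, 1)) 0 := by
  have hfst : HasFDerivAt (fun s : ℝ => (s, (0 : ℝ))) (ContinuousLinearMap.inl ℝ ℝ ℝ) 0 :=
    (ContinuousLinearMap.inl ℝ ℝ ℝ).hasFDerivAt
  have h1 : ∀ᶠ s₁ in 𝓝 (0 : ℝ), HasDerivAt (fun s₂ => E (s₁, s₂)) (G (s₁, 0) (0, 1)) 0 := by
    filter_upwards [hfst.continuousAt.eventually hG] with s₁ hs
    have h2 : HasDerivAt (fun s₂ : ℝ => (s₁, s₂)) ((0 : ℝ), (1 : ℝ)) 0 :=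
      (hasDerivAt_const _ _).prodMk (hasDerivAt_id _)
    exact HasFDerivAt.comp_hasDerivAt (l := E) (0 : ℝ) hs h2
  refine ⟨h1.mono fun s hs => hs.differentiableAt, ?_⟩
  have h3 : HasDerivAt (fun s₁ : ℝ => G (s₁, 0)) (G' (1, 0)) 0 := by
    have h2 : HasDerivAt (fun s : ℝ => (s, (0 : ℝ))) ((1 : ℝ), (0 : ℝ)) 0 :=
      (hasDerivAt_id _).prodMk (hasDerivAt_const _ _)
    exact HasFDerivAt.comp_hasDerivAt (l := G) (0 : ℝ) hG' h2
  have h4 : HasDerivAt (fun s₁ : ℝ => G (s₁, 0) (0, 1)) (G' (1, 0) (0, 1)) 0 := by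
    simpa using h3.clm_apply (hasDerivAt_const (0 : ℝ) ((0 : ℝ), (1 : ℝ)))
  exact h4.congr_of_eventuallyEq (h1.mono fun s hs => hs.deriv)

namespace IsGeodesicTube

variable (hT : IsGeodesicTube F c Φ)
include hT

theorem isFamilyOn_tubeVariation (hαβ : α < β) (hS : Icc α β ⊆ Icc 0 1)
    (hξ : ContDiffOn ℝ ∞ ξ (Icc α β)) (hη : ContDiffOn ℝ ∞ η (Icc α β)) :
    IsFamilyOn n α β c (tubeVariation Φ ξ η) := by
  refine ⟨hαβ, hS, fun t ht => ?_, fun t ht => ?_⟩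
  · simp only [tubeVariation, Prod.fst_zero, Prod.snd_zero, zero_smul, add_zero]
    exact (hT.tube t (hS ht)).base
  · set g : ℝ × (ℝ × ℝ) → ℝ × EuclideanSpace ℝ (Fin n) :=
      fun q => (q.1, q.2.1 • ξ q.1 + q.2.2 • η q.1)
    have hg : ∀ q ∈ Icc α β ×ˢ (univ : Set (ℝ × ℝ)),
        ContDiffWithinAt ℝ ∞ g (Icc α β ×ˢ univ) q := by
      intro q hq
      have h1 : ContDiffWithinAt ℝ ∞ (fun q : ℝ × (ℝ × ℝ) => ξ q.1) (Icc α β ×ˢ univ) q :=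
        ContDiffWithinAt.comp (g := ξ) (t := Icc α β) q (hξ q.1 hq.1) contDiffWithinAt_fst
          fun r hr => hr.1
      have h2 : ContDiffWithinAt ℝ ∞ (fun q : ℝ × (ℝ × ℝ) => η q.1) (Icc α β ×ˢ univ) q :=
        ContDiffWithinAt.comp (g := η) (t := Icc α β) q (hη q.1 hq.1) contDiffWithinAt_fst
          fun r hr => hr.1
      have h3 : ContDiff ℝ ∞ (fun q : ℝ × (ℝ × ℝ) => q.2.1) := by fun_prop
      have h4 : ContDiff ℝ ∞ (fun q : ℝ × (ℝ × ℝ) => q.2.2) := by fun_prop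
      exact contDiffWithinAt_fst.prodMk ((h3.contDiffWithinAt.smul h1).add
        (h4.contDiffWithinAt.smul h2))
    have hmaps : ∀ q ∈ Icc α β ×ˢ (univ : Set (ℝ × ℝ)),
        g q ∈ Icc (0 : ℝ) 1 ×ˢ (univ : Set (EuclideanSpace ℝ (Fin n))) :=
      fun q hq => ⟨hS hq.1, mem_univ _⟩
    have hg0 : g (t, 0) = (t, 0) := by simp [g]
    have htend : Tendsto g (𝓝[Icc α β ×ˢ univ] (t, 0)) (𝓝[Icc 0 1 ×ˢ univ] (t, 0)) := by
      refine tendsto_nhdsWithin_iff.2 ⟨?_, ?_⟩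
      · have := (hg (t, 0) ⟨ht, mem_univ _⟩).continuousWithinAt.tendsto
        rwa [hg0] at this
      · filter_upwards [self_mem_nhdsWithin] with q hq using hmaps q hq
    have hΦ := (hT.tube t (hS ht)).smooth
    filter_upwards [htend.eventually hΦ, self_mem_nhdsWithin] with q hq hq2
    exact ContMDiffWithinAt.comp (g := Φ) (f := g) q hq (hg q hq2).contMDiffWithinAt hmaps

theorem mfderiv_line (ht : t ∈ Icc (0 : ℝ) 1) (w : EuclideanSpace ℝ (Fin n)) :
    mfderiv 𝓘(ℝ, ℝ) (𝓡 n) (fun s : ℝ => Φ (t, s • w)) 0 (1 : ℝ) = famDeriv n Φ (t, 0) w := by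
  have h1 : HasFDerivAt (fun s : ℝ => s • w) (ContinuousLinearMap.toSpanSingleton ℝ w) 0 :=
    (ContinuousLinearMap.toSpanSingleton ℝ w).hasFDerivAt
  have h2 := mfderiv_comp_of_eq (I := 𝓘(ℝ, ℝ)) (I' := 𝓘(ℝ, EuclideanSpace ℝ (Fin n)))
    (I'' := 𝓡 n) (g := fun v => Φ (t, v)) (f := fun s : ℝ => s • w) (x := 0)
    ((contMDiffAt_slice ((hT.tube t ht).smooth.contMDiffWithinAt ht) ht).mdifferentiableAt
      (by simp)) h1.differentiableAt.mdifferentiableAt (zero_smul ℝ w)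
  refine (DFunLike.congr_fun h2 (1 : ℝ)).trans ?_
  rw [mfderiv_eq_fderiv, h1.fderiv]
  change famDeriv n Φ (t, (0 : ℝ) • w) ((1 : ℝ) • w) = _
  rw [zero_smul, one_smul]

/-- The variation is Φ(t, s₁ξ(t) + s₂η(t)): linear in tube coordinates, smooth on a common
refinement of the two partitions, with fixed ends since ξ and η vanish there. For small parameters
all of its curves are regular. -/
theorem exists_isVariation {X Y : (t : ℝ) → TangentSpace (𝓡 n) (c t)}
    (hX : X ∈ tangentOmega c) (hY : Y ∈ tangentOmega c) : ∃ ε V, IsVariation c X Y ε V := by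
  obtain ⟨hX0, hX1, k, τ, hτ, hXs⟩ := hX
  obtain ⟨hY0, hY1, l, σ, hσ, hYs⟩ := hY
  obtain ⟨m, ρ, hρ, href⟩ := hτ.exists_refinement hσ
  have hz : (0 : ℝ) ∈ Icc (0 : ℝ) 1 := ⟨le_rfl, zero_le_one⟩
  have ho : (1 : ℝ) ∈ Icc (0 : ℝ) 1 := ⟨zero_le_one, le_rfl⟩
  set ξ := tubeCoord n Φ X
  set η := tubeCoord n Φ Y
  have hξ0 : ξ 0 = 0 := (hT.tubeCoord_eq_zero hz).2 hX0
  have hξ1 : ξ 1 = 0 := (hT.tubeCoord_eq_zero ho).2 hX1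
  have hη0 : η 0 = 0 := (hT.tubeCoord_eq_zero hz).2 hY0
  have hη1 : η 1 = 0 := (hT.tubeCoord_eq_zero ho).2 hY1
  set f := tubeVariation Φ ξ η
  have hfam : ∀ i ∈ Finset.range m, IsFamilyOn n (ρ i) (ρ (i + 1)) c f := by
    intro i hi
    obtain ⟨⟨j, hj, hj'⟩, ⟨r, hr, hr'⟩⟩ := href i (Finset.mem_range.1 hi)
    refine hT.isFamilyOn_tubeVariation (hρ.lt i (Finset.mem_range.1 hi))
      (hρ.subset (Finset.mem_range.1 hi)) ?_ ?_
    · exact ((hT.contMDiffOn_iff_tubeCoord (hτ.subset hj)).1 (hXs j hj)).mono hj'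
    · exact ((hT.contMDiffOn_iff_tubeCoord (hσ.subset hr)).1 (hYs r hr)).mono hr'
  have hreg := (Finset.eventually_all (Finset.range m)).2 fun i hi =>
    (hfam i hi).eventually_regular hT
  obtain ⟨ε, hε, hball⟩ := Metric.eventually_nhds_iff.1 hreg
  -- The product carries the supremum norm, so the open box is contained in the ball of the same
  -- size.
  have hbox : ∀ s₁ ∈ Ioo (-ε) ε, ∀ s₂ ∈ Ioo (-ε) ε, dist (s₁, s₂) (0 : ℝ × ℝ) < ε := by
    intro s₁ h₁ s₂ h₂
    rw [dist_zero_right, Prod.norm_mk, max_lt_iff, Real.norm_eq_abs, Real.norm_eq_abs, abs_lt,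
      abs_lt]
    exact ⟨h₁, h₂⟩
  have hbase : ∀ t ∈ Icc (0 : ℝ) 1, f (t, (0, 0)) = c t := by
    intro t ht
    simp only [f, tubeVariation, zero_smul, add_zero]
    exact (hT.tube t ht).base
  refine ⟨ε, fun s₁ s₂ t => f (t, (s₁, s₂)), hε, fun s₁ h₁ s₂ h₂ => ⟨?_, ?_, m, ρ, hρ,
    fun i hi => ⟨fun t ht => ?_, fun t ht => ?_⟩⟩, hbase, ⟨m, ρ, hρ, fun i hi q hq => ?_⟩,
    fun t ht => ?_, fun t ht => ?_⟩
  · simp only [f, tubeVariation, hξ0, hη0, smul_zero, add_zero]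
    exact (hT.tube 0 hz).base
  · simp only [f, tubeVariation, hξ1, hη1, smul_zero, add_zero]
    exact (hT.tube 1 ho).base
  · have h1 := (hball (hbox s₁ h₁ s₂ h₂) i (Finset.mem_range.2 hi) t ht).1.contMDiffWithinAt ht
    exact ContMDiffWithinAt.comp (g := f) (t := Icc (ρ i) (ρ (i + 1)) ×ˢ univ) t h1
      (contDiff_prodMk_left (𝕜 := ℝ) (n := ∞) (s₁, s₂)).contMDiff.contMDiffAt.contMDiffWithinAt
      fun _ hs => ⟨hs, mem_univ _⟩
  · exact (hball (hbox s₁ h₁ s₂ h₂) i (Finset.mem_range.2 hi) t ht).2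
  · have h1 := (hball (hbox q.1 hq.1 q.2.1 hq.2.1) i (Finset.mem_range.2 hi) q.2.2
      hq.2.2).1.contMDiffWithinAt hq.2.2
    have h2 : ContDiff ℝ ∞ (fun q : ℝ × ℝ × ℝ => (q.2.2, (q.1, q.2.1))) := by fun_prop
    exact ContMDiffWithinAt.comp (g := f) (f := fun q : ℝ × ℝ × ℝ => (q.2.2, (q.1, q.2.1)))
      (t := Icc (ρ i) (ρ (i + 1)) ×ˢ univ) q h1 h2.contMDiff.contMDiffAt.contMDiffWithinAt
      fun _ hs => ⟨hs.2.2, mem_univ _⟩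
  · refine tangentBundle_mk_eq (hbase t ht) ?_
    have hfun : (fun s : ℝ => f (t, (s, 0))) = fun s => Φ (t, s • ξ t) := by
      funext s
      simp only [f, tubeVariation, zero_smul, add_zero]
    exact (congrArg (fun g : ℝ → M => (mfderiv 𝓘(ℝ, ℝ) (𝓡 n) g 0 (1 : ℝ) :
      EuclideanSpace ℝ (Fin n))) hfun).trans
      ((hT.mfderiv_line ht (ξ t)).trans (hT.famDeriv_tubeCoord (X := X) ht))
  · refine tangentBundle_mk_eq (hbase t ht) ?_
    have hfun : (fun s : ℝ => f (t, (0, s))) = fun s => Φ (t, s • η t) := by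
      funext s
      simp only [f, tubeVariation, zero_smul, zero_add]
    exact (congrArg (fun g : ℝ → M => (mfderiv 𝓘(ℝ, ℝ) (𝓡 n) g 0 (1 : ℝ) :
      EuclideanSpace ℝ (Fin n))) hfun).trans
      ((hT.mfderiv_line ht (η t)).trans (hT.famDeriv_tubeCoord (X := Y) ht))

theorem isPiecewiseDiff_tubeCoord {X : (t : ℝ) → TangentSpace (𝓡 n) (c t)}
    (hX : X ∈ tangentOmega c) : IsPiecewiseDiff (tubeCoord n Φ X) := by
  obtain ⟨-, -, k, τ, hτ, hXs⟩ := hX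
  exact hτ.isPiecewiseDiff fun i hi =>
    (hT.contMDiffOn_iff_tubeCoord (hτ.subset hi)).1 (hXs i hi)

theorem isHessian (p : ℝ) : IsHessian F p c (tubeHessian F c Φ p) := by
  intro X hX Y hY
  refine ⟨hT.exists_isVariation hX hY, fun ε V hV => ?_⟩
  obtain ⟨k, τ, hf⟩ := hV.exists_isPiecewiseFamily
  have hz : (0 : ℝ) ∈ Icc (0 : ℝ) 1 := ⟨le_rfl, zero_le_one⟩
  have ho : (1 : ℝ) ∈ Icc (0 : ℝ) 1 := ⟨zero_le_one, le_rfl⟩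
  obtain ⟨G, G', hG, hG', hval⟩ := hf.exists_hasFDerivAt_energy hT
    (u := (1, 0)) (v := (0, 1)) (ξ := tubeCoord n Φ X) (η := tubeCoord n Φ Y)
    (fun t ht => (hV.famDeriv_fst ht).trans (hT.famDeriv_tubeCoord ht).symm)
    (fun t ht => (hV.famDeriv_snd ht).trans (hT.famDeriv_tubeCoord ht).symm) p
    (hT.isPiecewiseDiff_tubeCoord hX) (hT.isPiecewiseDiff_tubeCoord hY)
    ((hT.tubeCoord_eq_zero hz).2 hX.1) ((hT.tubeCoord_eq_zero ho).2 hX.2.1)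
  have key := second_partial_of_hasFDerivAt hG hG'
  rw [hval] at key
  exact key

end IsGeodesicTube
end Variations

/-! ### Orthogonal fields and conjugate points. -/

section Index

variable {n : ℕ} {M : Type*} [TopologicalSpace M] [ChartedSpace (EuclideanSpace ℝ (Fin n)) M]
  [IsManifold (𝓡 n) ∞ M]
  {F : TangentBundle (𝓡 n) M → ℝ} {c : ℝ → M} {Φ : ℝ × EuclideanSpace ℝ (Fin n) → M}
  {t : ℝ} {ξ η : ℝ → EuclideanSpace ℝ (Fin n)}

/-- The velocity of a smooth curve in `Ω` vanishes nowhere. -/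
theorem velocity_ne_zero {x₀ x₁ : M} (hc : c ∈ pathSpace n x₀ x₁)
    (hs : ContMDiffOn 𝓘(ℝ, ℝ) (𝓡 n) ∞ c (Icc 0 1)) (ht : t ∈ Icc (0 : ℝ) 1) :
    (velocity (n := n) c t : EuclideanSpace ℝ (Fin n)) ≠ 0 := by
  obtain ⟨-, -, k, τ, hτ, h⟩ := hc
  obtain ⟨i, hi, hti⟩ := hτ.exists_mem ht
  have h1 := (h i hi).2 t hti
  have h2 : mfderivWithin 𝓘(ℝ, ℝ) (𝓡 n) c (Icc (τ i) (τ (i + 1))) t =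
      mfderivWithin 𝓘(ℝ, ℝ) (𝓡 n) c (Icc 0 1) t :=
    mfderivWithin_subset (hτ.subset hi)
      (uniqueDiffOn_of_lt (hτ.lt i hi) t hti).uniqueMDiffWithinAt
      ((hs t ht).mdifferentiableWithinAt (by simp))
  rw [h2] at h1
  exact h1

theorem exists_isGeodesicTube {x₀ x₁ : M} (hF : IsFinsler F) (hc : c ∈ pathSpace n x₀ x₁)
    (hgeo : IsGeodesic F c) : ∃ Φ, IsGeodesicTube F c Φ := by
  obtain ⟨Φ, hΦ⟩ := exists_tube hgeo.1
  exact ⟨Φ, hF, hgeo, fun t ht => velocity_ne_zero hc hgeo.1 ht, hΦ⟩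

theorem quadIntegrand_congr {H : Type*} [NormedAddCommGroup H] [NormedSpace ℝ H]
    {Q : ℝ → (H × H) →L[ℝ] (H × H) →L[ℝ] ℝ} {ξ ζ : ℝ → H}
    (h : ∀ t ∈ Icc (0 : ℝ) 1, ξ t = ζ t) :
    ∫ t in (0 : ℝ)..1, quadIntegrand Q ξ ξ t = ∫ t in (0 : ℝ)..1, quadIntegrand Q ζ ζ t := by
  refine intervalIntegral.integral_congr_Ioo_of_le zero_le_one fun t ht => ?_
  have h1 : ξ =ᶠ[𝓝 t] ζ := by
    filter_upwards [Icc_mem_nhds ht.1 ht.2] with s hs using h s hs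
  simp only [quadIntegrand, h1.deriv_eq, h1.self_of_nhds]

namespace IsGeodesicTube

variable (hT : IsGeodesicTube F c Φ)
include hT

/-- On fields orthogonal to the velocity, the Hessian of the `p`-energy is a multiple of that of
the energy. -/
theorem tubeHessian_of_perp {X : (t : ℝ) → TangentSpace (𝓡 n) (c t)}
    (hX : X ∈ perpOmega F c) (p : ℝ) :
    tubeHessian F c Φ p X X =
      p / 2 * speedSq F c ^ (p / 2 - 1) *
        ∫ t in (0 : ℝ)..1, quadIntegrand (tubeQuad F Φ) (tubeCoord n Φ X) (tubeCoord n Φ X) t := by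
  obtain ⟨⟨-, -, k, τ, hτ, hXs⟩, hperp⟩ := hX
  set ξ := tubeCoord n Φ X
  have hℓ : ∀ t ∈ Icc (0 : ℝ) 1, tubeLin F Φ t (0, ξ t) = 0 := by
    intro t ht
    have := hT.fundTensor_velocity (X := X) ht
    rw [hperp t ht] at this
    linarith
  rw [tubeHessian, ← intervalIntegral.integral_const_mul]
  refine intervalIntegral.integral_congr_ae ?_
  have hfin := hτ.finite_points.insert (1 : ℝ)
  filter_upwards [(measure_eq_zero_iff_ae_notMem (μ := volume)).1 (hfin.measure_zero volume)] with t hns ht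
  rw [uIoc_of_le zero_le_one] at ht
  have ht1 : t ∈ Ioo (0 : ℝ) 1 := ⟨ht.1, lt_of_le_of_ne ht.2 fun h0 => hns (mem_insert_iff.2 (Or.inl h0))⟩
  obtain ⟨i, hi, hti⟩ := hτ.exists_mem_Ioo ⟨ht1, fun h0 => hns (mem_insert_iff.2 (Or.inr h0))⟩
  have ht' := Ioo_subset_Icc_self ht1
  have h1 : ContDiffAt ℝ ∞ ξ t := ((hT.contMDiffOn_iff_tubeCoord (hτ.subset hi)).1
    (hXs i hi)).contDiffAt (Icc_mem_nhds hti.1 hti.2)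
  -- `tubeLin` on (ξ, ξ') is the derivative of `tubeLin` on (0, ξ), which is identically zero by
  -- orthogonality. This removes the second summand of `hessQuad`.
  have h2 := hT.hasDerivWithinAt_tubeLin ht' h1.contDiffWithinAt
  have h3 := (uniqueDiffWithinAt_unitInterval ht').eq_deriv _ h2
    ((hasDerivWithinAt_const t (Icc (0 : ℝ) 1) (0 : ℝ)).congr_of_eventuallyEq_of_mem
    (by filter_upwards [self_mem_nhdsWithin] with s hs using hℓ s hs) ht')
  rw [timeDeriv, derivWithin_of_mem_nhds (Icc_mem_nhds ht1.1 ht1.2)] at h3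
  rw [quadIntegrand, hessQuad_apply, h3, zero_mul, mul_zero, add_zero]
  rfl

theorem eq_zero_of_not_isConjugate (ht : t ∈ Icc (0 : ℝ) 1) (h : ¬ IsConjugate F c 0 t)
    {J : ℝ → EuclideanSpace ℝ (Fin n)} (hJ : IsQJacobi (tubeQuad F Φ) J) (h0 : J 0 = 0)
    (h1 : J t = 0) : ∀ s ∈ Icc (0 : ℝ) 1, J s = 0 := by
  intro s hs
  by_contra hne
  exact h ((hT.isConjugate_iff ht).2 ⟨J, hJ, ⟨s, hs, hne⟩, h0, h1⟩)

theorem coord_zero_one {X : (t : ℝ) → TangentSpace (𝓡 n) (c t)} (hX : X ∈ tangentOmega c) :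
    tubeCoord n Φ X 0 = 0 ∧ tubeCoord n Φ X 1 = 0 :=
  ⟨(hT.tubeCoord_eq_zero ⟨le_rfl, zero_le_one⟩).2 hX.1,
    (hT.tubeCoord_eq_zero ⟨zero_le_one, le_rfl⟩).2 hX.2.1⟩

theorem tubeFrame_mem_perpOmega {k : ℕ} {τ : ℕ → ℝ} (hτ : IsPartition k τ)
    (hξ : ∀ i < k, ContDiffOn ℝ ∞ ξ (Icc (τ i) (τ (i + 1)))) (h0 : ξ 0 = 0) (h1 : ξ 1 = 0)
    (hperp : ∀ t ∈ Icc (0 : ℝ) 1, tubeLin F Φ t (0, ξ t) = 0) :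
    (tubeFrame n Φ ξ : (t : ℝ) → TangentSpace (𝓡 n) (c t)) ∈ perpOmega F c := by
  refine ⟨⟨?_, ?_, k, τ, hτ, fun i hi => ?_⟩, fun t ht => ?_⟩
  · change famDeriv n Φ (0, 0) (ξ 0) = 0
    rw [h0, map_zero]
  · change famDeriv n Φ (1, 0) (ξ 1) = 0
    rw [h1, map_zero]
  · exact (hT.contMDiffOn_iff_tubeCoord (X := tubeFrame n Φ ξ) (hτ.subset hi)).2
      ((hξ i hi).congr fun t ht => hT.tubeCoord_tubeFrame (hτ.subset hi ht))
  · refine (hT.fundTensor_velocity (X := tubeFrame n Φ ξ) ht).trans ?_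
    rw [hT.tubeCoord_tubeFrame ht, hperp t ht, mul_zero]

/-- Past a conjugate point some orthogonal field has negative second variation. -/
theorem exists_integral_neg_of_isConjugate {t₀ : ℝ} (ht₀ : t₀ ∈ Ioo (0 : ℝ) 1)
    (h : IsConjugate F c 0 t₀) : ∃ X ∈ perpOmega F c,
      ∫ t in (0 : ℝ)..1, quadIntegrand (tubeQuad F Φ) (tubeCoord n Φ X) (tubeCoord n Φ X) t < 0 := by
  have ht₀' := Ioo_subset_Icc_self ht₀
  obtain ⟨ξ, hξ, ⟨s, hs, hne⟩, h0, h1⟩ := (hT.isConjugate_iff ht₀').1 h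
  have hQ := hT.isQuadLagrangian
  have hlin : ∀ t ∈ Icc (0 : ℝ) 1, _ := fun t ht =>
    hT.tubeLin_eq_zero_of_isQJacobi hξ ⟨ht₀.1, ht₀.2.le⟩ h0 h1 ht
  set u := derivWithin ξ (Icc 0 1) t₀
  -- Otherwise ξ and its derivative would both vanish at `t₀`, and ξ would be zero.
  have hu : u ≠ 0 := fun hu => hne (hξ.eq_zero hQ ht₀' h1 hu s hs)
  have hℓu : tubeLin F Φ t₀ (0, u) = 0 := by
    have := (hlin t₀ ht₀').2
    rwa [h1] at this
  set w := tubeCoord n Φ (fun t => velocity (n := n) c t) t₀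
  have hw : 0 < tubeLin F Φ t₀ (0, w) := by
    rw [hT.tubeLin_velocity ht₀', hT.speedSq_eq ht₀']
    linarith [hT.speedSq_pos]
  -- The constant vector u is projected along w into the kernel of v ↦ `tubeLin F Φ t (0, v)`, with
  -- denominators cleared. The factor t(1 - t) makes ζ vanish at both ends, and u already lies in
  -- the kernel at `t₀`, so ζ(t₀) is a positive multiple of u.
  set ζ : ℝ → EuclideanSpace ℝ (Fin n) := fun t =>
    (t * (1 - t)) • (tubeLin F Φ t (0, w) • u - tubeLin F Φ t (0, u) • w)
  have hζs : ContDiffOn ℝ ∞ ζ (Icc 0 1) := by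
    have hl : ∀ v, ContDiffOn ℝ ∞ (fun t => tubeLin F Φ t (0, v)) (Icc 0 1) := fun v t ht =>
      (hT.contDiffWithinAt_tubeLin ht).clm_apply contDiffWithinAt_const
    have hp : ContDiff ℝ ∞ (fun t : ℝ => t * (1 - t)) := by fun_prop
    exact hp.contDiffOn.smul (((hl w).smul contDiffOn_const).sub ((hl u).smul contDiffOn_const))
  have hζℓ : ∀ t, tubeLin F Φ t (0, ζ t) = 0 := by
    intro t
    have h2 : ((0 : EuclideanSpace ℝ (Fin n)), ζ t) = (t * (1 - t)) •
        (tubeLin F Φ t (0, w) • ((0 : EuclideanSpace ℝ (Fin n)), u)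
          - tubeLin F Φ t (0, u) • ((0 : EuclideanSpace ℝ (Fin n)), w)) := by
      simp [ζ]
    rw [h2, map_smul, map_sub, map_smul, map_smul, smul_eq_mul, smul_eq_mul, smul_eq_mul]
    ring
  have hζ0 : ζ 0 = 0 := by simp [ζ]
  have hζ1 : ζ 1 = 0 := by simp [ζ]
  have hζt : ζ t₀ = (t₀ * (1 - t₀) * tubeLin F Φ t₀ (0, w)) • u := by
    simp only [ζ, hℓu, zero_smul, sub_zero, smul_smul]
  have hpos : 0 < tubeQuad F Φ t₀ (0, u) (0, ζ t₀) := by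
    have h2 : ((0 : EuclideanSpace ℝ (Fin n)), ζ t₀) =
        (t₀ * (1 - t₀) * tubeLin F Φ t₀ (0, w)) • ((0 : EuclideanSpace ℝ (Fin n)), u) := by
      rw [hζt]; simp
    rw [h2, map_smul, smul_eq_mul]
    exact mul_pos (mul_pos (mul_pos ht₀.1 (sub_pos.2 ht₀.2)) hw) (hQ.pos t₀ ht₀' u hu)
  obtain ⟨ε, hε⟩ := exists_integral_neg hQ hξ (IsPiecewiseDiff.of_contDiffOn hζs) hζ0 ht₀ h0 h1 hpos
  set χ : ℝ → EuclideanSpace ℝ (Fin n) := fun t => ξ (min t t₀) + ε • ζ t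
  -- The corner of χ can only be at `t₀`, which is kept out of the interior of every piece.
  obtain ⟨k, τ, hτ, hav⟩ := exists_partition {t₀}
  have hχs : ∀ i < k, ContDiffOn ℝ ∞ χ (Icc (τ i) (τ (i + 1))) := by
    intro i hi
    have h2 := hav i hi t₀ (Finset.mem_singleton_self _)
    have hlt := hτ.lt i hi
    have hζi : ContDiffOn ℝ ∞ (fun t => ε • ζ t) (Icc (τ i) (τ (i + 1))) :=
      (hζs.mono (hτ.subset hi)).const_smul ε
    rcases le_or_gt t₀ (τ i) with h3 | h3
    · refine (contDiffOn_const (c := ξ t₀)).add hζi |>.congr fun t ht => ?_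
      simp only [χ, min_eq_right (h3.trans ht.1)]
    · have h4 : τ (i + 1) ≤ t₀ := not_lt.1 fun h5 => h2 ⟨h3, h5⟩
      refine (hξ.smooth.mono (hτ.subset hi)).add hζi |>.congr fun t ht => ?_
      simp only [χ, min_eq_left (ht.2.trans h4)]
  have hχℓ : ∀ t ∈ Icc (0 : ℝ) 1, tubeLin F Φ t (0, χ t) = 0 := by
    intro t ht
    have h2 : ((0 : EuclideanSpace ℝ (Fin n)), χ t) =
        (0, ξ (min t t₀)) + ε • ((0 : EuclideanSpace ℝ (Fin n)), ζ t) := by simp [χ]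
    rw [h2, map_add, map_smul, hζℓ, smul_zero, add_zero]
    rcases le_total t t₀ with h3 | h3
    · rw [min_eq_left h3]; exact (hlin t ht).1
    · rw [min_eq_right h3, h1, Prod.mk_zero_zero, map_zero]
  refine ⟨tubeFrame n Φ χ, hT.tubeFrame_mem_perpOmega hτ hχs ?_ ?_ hχℓ, ?_⟩
  · simp only [χ, min_eq_left ht₀.1.le, h0, hζ0, smul_zero, add_zero]
  · simp only [χ, min_eq_right ht₀.2.le, h1, hζ1, smul_zero, add_zero]
  · rwa [quadIntegrand_congr fun t ht => hT.tubeCoord_tubeFrame ht]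

theorem tubeHessian_self_eq_zero {p : ℝ}
    {X : (t : ℝ) → TangentSpace (𝓡 n) (c t)} (h : ∀ t ∈ Icc (0 : ℝ) 1, X t = 0) :
    tubeHessian F c Φ p X X = 0 := by
  rw [tubeHessian, quadIntegrand_congr (ζ := fun _ => 0)
    fun t ht => (hT.tubeCoord_eq_zero ht).2 (h t ht)]
  simp only [quadIntegrand, deriv_const, Prod.mk_zero_zero, map_zero,
    intervalIntegral.integral_zero]

end IsGeodesicTube

theorem mul_rpow_pos {p r : ℝ} (hp : 0 < p) (hr : 0 < r) : 0 < p / 2 * r ^ (p / 2 - 1) :=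
  mul_pos (half_pos hp) (Real.rpow_pos_of_pos hr _)

theorem mul_rpow_neg {p r : ℝ} (hp : p < 0) (hr : 0 < r) : p / 2 * r ^ (p / 2 - 1) < 0 :=
  mul_neg_of_neg_of_pos (by linarith) (Real.rpow_pos_of_pos hr _)

end Index

end Finsler

end

/-! ### The index theorem for the p-energy. -/

theorem proposition2 {n : ℕ} {M : Type*} [TopologicalSpace M] [T2Space M]
    [SecondCountableTopology M] [ConnectedSpace M]
    [ChartedSpace (EuclideanSpace ℝ (Fin n)) M] [IsManifold (𝓡 n) ∞ M]
    (F : TangentBundle (𝓡 n) M → ℝ) (hF : Finsler.IsFinsler F)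
    (x₀ x₁ : M) (c : ℝ → M) (hc : c ∈ Finsler.pathSpace n x₀ x₁)
    (hgeo : Finsler.IsGeodesic F c) (p : ℝ) (hp0 : p ≠ 0) (hp1 : p ≠ 1) :
    ∃ I : ((t : ℝ) → TangentSpace (𝓡 n) (c t)) → ((t : ℝ) → TangentSpace (𝓡 n) (c t)) → ℝ,
      Finsler.IsHessian F p c I ∧
      ((∀ t ∈ Set.Ioo (0 : ℝ) 1, ¬ Finsler.IsConjugate F c 0 t) →
        (0 < p → ∀ X ∈ Finsler.perpOmega F c, 0 ≤ I X X) ∧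
        (p < 0 → ∀ X ∈ Finsler.perpOmega F c, I X X ≤ 0) ∧
        (¬ Finsler.IsConjugate F c 0 1 →
          ∀ X ∈ Finsler.perpOmega F c, (I X X = 0 ↔ ∀ t ∈ Set.Icc (0 : ℝ) 1, X t = 0))) ∧
      ((∃ t ∈ Set.Ioo (0 : ℝ) 1, Finsler.IsConjugate F c 0 t) →
        (0 < p → ∃ X ∈ Finsler.perpOmega F c, I X X < 0) ∧
        (p < 0 → ∃ X ∈ Finsler.perpOmega F c, 0 < I X X)) := by
  obtain ⟨Φ, hT⟩ := Finsler.exists_isGeodesicTube hF hc hgeo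
  have hr := hT.speedSq_pos
  have hQ := hT.isQuadLagrangian
  refine ⟨Finsler.tubeHessian F c Φ p, hT.isHessian p, fun hconj => ?_, ?_⟩
  · have hnn : ∀ X ∈ Finsler.perpOmega F c, 0 ≤ ∫ t in (0 : ℝ)..1, Finsler.quadIntegrand
        (Finsler.tubeQuad F Φ) (Finsler.tubeCoord n Φ X) (Finsler.tubeCoord n Φ X) t :=
      fun X hX => hQ.integral_nonneg (fun t ht J hJ h0 h1 =>
        hT.eq_zero_of_not_isConjugate (Set.Ioo_subset_Icc_self ht) (hconj t ht) hJ h0 h1)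
        (hT.isPiecewiseDiff_tubeCoord hX.1) (hT.coord_zero_one hX.1).1 (hT.coord_zero_one hX.1).2
    refine ⟨fun hp X hX => ?_, fun hp X hX => ?_, fun hconj1 X hX => ⟨fun h => ?_, fun h => ?_⟩⟩
    · rw [hT.tubeHessian_of_perp hX]
      exact mul_nonneg (Finsler.mul_rpow_pos hp hr).le (hnn X hX)
    · rw [hT.tubeHessian_of_perp hX]
      exact mul_nonpos_of_nonpos_of_nonneg (Finsler.mul_rpow_neg hp hr).le (hnn X hX)
    · rw [hT.tubeHessian_of_perp hX] at h
      have hne : p / 2 * Finsler.speedSq F c ^ (p / 2 - 1) ≠ 0 := by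
        rcases lt_or_gt_of_ne hp0 with hp | hp
        · exact (Finsler.mul_rpow_neg hp hr).ne
        · exact (Finsler.mul_rpow_pos hp hr).ne'
      have hz := hQ.eq_zero_of_integral (fun t ht J hJ h0 h1 => by
        refine hT.eq_zero_of_not_isConjugate (Set.Ioc_subset_Icc_self ht) ?_ hJ h0 h1
        rcases eq_or_lt_of_le ht.2 with rfl | ht1
        · exact hconj1
        · exact hconj t ⟨ht.1, ht1⟩) (hT.isPiecewiseDiff_tubeCoord hX.1)
        (hT.coord_zero_one hX.1).1 (hT.coord_zero_one hX.1).2 ((mul_eq_zero.1 h).resolve_left hne)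
      exact fun t ht => (hT.tubeCoord_eq_zero ht).1 (hz t ht)
    · exact hT.tubeHessian_self_eq_zero h
  · rintro ⟨t₀, ht₀, hconj⟩
    obtain ⟨X, hX, hneg⟩ := hT.exists_integral_neg_of_isConjugate ht₀ hconj
    refine ⟨fun hp => ⟨X, hX, ?_⟩, fun hp => ⟨X, hX, ?_⟩⟩
    · rw [hT.tubeHessian_of_perp hX]
      exact mul_neg_of_pos_of_neg (Finsler.mul_rpow_pos hp hr) hneg
    · rw [hT.tubeHessian_of_perp hX]
      exact mul_pos_of_neg_of_neg (Finsler.mul_rpow_neg hp hr) hneg
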